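/- Let $p$ be an odd prime, $\Bbbk$ a field of characteristic $p$, and $R_n=\Bbbk[x_1,\dots,x_n]$ with $\deg x_i=2$ ($q$-degree). Let $H_q=\Bbbk[\partial_q]/(\partial_q^p)$ act on $R_n$ by the derivation with $\partial_q(x_i)=x_i^2$. An $(R_n,R_n)\#H_q$-module is a $q$-graded $R_n$-bimodule with an operator $\partial_q$, $\partial_q^p=0$, satisfying the Leibniz rule for both actions; for a linear form $f$ with integer coefficients, the twist $V^f$ is $V$ with $\partial_q$ replaced by $\partial_q+f$ (in a bimodule $f$ acts by right multiplication). $q^a$ raises $q$-degrees by $a$. All tensor products carry $\partial\otimes1+1\otimes\partial$ for every $p$-differential $\partial$. *Braid complexes.* For $1\le i<n$ put $B_i=R_n\otimes_{R_n^{s_i}}R_n$, where $s_i$ exchanges $x_i,x_{i+1}$, let $br_i:B_i\to R_n$ be multiplication, and let $rb_i:R_n\to q^{-2}B_i^{-(x_i+x_{i+1})}$ be the bimodule map with $rb_i(1)=x_{i+1}\otimes1-1\otimes x_i$. Define $p$-complexes (boundary maps $\partial_0$ of $t$-degree $-1$, $\partial_0^p=0$) $$pT_i=q^{-3}\bigl(B_i\xrightarrow{br_i}R_n=\cdots=R_n\bigr),\qquad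 pT_i'=q^{3}\bigl(R_n=\cdots=R_n\xrightarrow{rb_i}q^{-2}B_i^{-(x_i+x_{i+1})}\bigr),$$ each with $p-1$ copies of $R_n$ joined by identity maps and with the term containing $B_i$ in $t$-degree $0$. To a word $\beta$ in the generators $\sigma_i$ and their inverses of the braid group on $n\ge1$ strands assign $pT_\beta$, the tensor product over $R_n$ of the $pT_i$ (for $\sigma_i$) and $pT_i'$ (for $\sigma_i^{-1}$) in the order of the word; $pT_\emptyset=R_n$. *Slash homology.* For a vector space $V$ with an operator $D$, $\mathrm H^/(V,D)=\bigoplus_{j=0}^{p-2}\ker D^{j+1}/(\operatorname{im}D^{p-j-1}+\ker D^j)$; operators commuting with $D$ act on it, and $D$ induces the residual $p$-differential, mapping the summand with index $j+1$ to the one with index $j$ and the summand with index $0$ to $0$. *$p$-Hochschild homology.* Let $pC_1$ be the $p$-complex of $(\Bbbk[x],\Bbbk[x])\# H_q$-modules that is free on $e_0,\dots,e_{p-1}$, where $e_s$ has Hochschild degree $s$, the differential is $e_1\mapsto(x\otimes1-1\otimes x)e_0$, $e_{s+1}\mapsto e_s$ for $s\ge1$, $e_0\mapsto0$, $\partial_q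 e_s=(x\otimes1+1\otimes x)e_s$ for $s\ge1$, $\partial_qe_0=0$, and $e_s$ has $q$-degree $2$ for $s\ge1$ and $0$ for $s=0$. Let $pC_n=pC_1^{\otimes n}$ (one factor for each variable), and for a $p$-complex $M$ of $(R_n,R_n)\#H_q$-modules let $p\mathrm{HH}_\bullet(M)$ be the slash homology of $pC_n\otimes_{(R_n,R_n)}M$ for the Koszul differential. It carries $\partial_q$, the $R_n$-action, the map $\partial_t$ induced by $\partial_0$, and the residual Hochschild $p$-differential $\partial_a$. Collapse the Hochschild grading into the others by $a=q^2t$ with $t$ specialized to the $p$-complex shift: the new $t$-degree is $t$-degree plus Hochschild degree $d$, and the new $q$-degree is $q$-degree $+\,2N(d)$, where $N(d)=2r-1$ for $(r-1)p+1\le d\le rp-1$ and $N(d)=2r$ for $d=rp$ is the Hochschild degree before $p$-extension. Put $$p\widehat{\mathrm{HHH}}^{\partial_q}(M)=q^{-n}\,\mathrm H^/\bigl(p\mathrm{HH}_\bullet(M),\ \partial_t+\partial_a\bigr),$$ a $(t,q)$-bigraded $H_q$-module with $R_n$-action and residual $p$-differential in the topological direction. **Claim.** Let $n\ge1$, let $\beta$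 be a braid word on $n$ strands and $M=pT_\beta$. Then there are isomorphisms of $(t,q)$-bigraded $H_q$-modules, compatible with the residual $p$-differentials, 1. $p\widehat{\mathrm{HHH}}^{\partial_q}\bigl((M\otimes\Bbbk[x_{n+1}])\otimes_{R_{n+1}}pT_n\bigr)\cong p\widehat{\mathrm{HHH}}^{\partial_q}(M)^{2x_n}$, 2. $p\widehat{\mathrm{HHH}}^{\partial_q}\bigl((M\otimes\Bbbk[x_{n+1}])\otimes_{R_{n+1}}pT_n'\bigr)\cong p\widehat{\mathrm{HHH}}^{\partial_q}(M)^{-2x_n}$, where $M\otimes\Bbbk[x_{n+1}]$ is the $p$-complex of $(R_{n+1},R_{n+1})\#H_q$-modules obtained from $M$ by adding a strand, and $pT_n,pT_n'$ are formed over $R_{n+1}$. -/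

import Mathlib

open scoped TensorProduct

universe u

set_option linter.unusedSectionVars false

namespace PHHH

open MvPolynomial (X)

section Tensor

variable {k R M N P : Type*} [Field k] [CommRing R] [Algebra k R] [AddCommGroup M]
  [AddCommGroup N] [AddCommGroup P] [Module R M] [Module R N] [Module k M] [Module k N]
  [Module k P] [IsScalarTower k R M] [IsScalarTower k R N]

/-- The `k`-linear map out of `M ⊗[R] N` attached to an `R`-balanced `k`-bilinear map. -/
def liftBal (f : M →ₗ[k] N →ₗ[k] P) (hf : ∀ (r : R) m n, f (r • m) n = f m (r • n)) :
    M ⊗[R] N →ₗ[k] P where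
  toFun := TensorProduct.liftAddHom (R := R)
    (AddMonoidHom.mk' (fun m => (f m).toAddMonoidHom) (fun a b => by ext; simp)) hf
  map_add' := map_add _
  map_smul' c x := by
    induction x using TensorProduct.induction_on with
    | zero => simp
    | tmul m n =>
      change f (c • m) n = c • f m n
      simp
    | add x y hx hy =>
      rw [smul_add, map_add, map_add, hx, hy, smul_add]

lemma liftBal_tmul (f : M →ₗ[k] N →ₗ[k] P)
    (hf : ∀ (r : R) m n, f (r • m) n = f m (r • n)) (m : M) (n : N) :
    liftBal f hf (m ⊗ₜ[R] n) = f m n := rfl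

lemma tensor_ext {F G : M ⊗[R] N →ₗ[k] P}
    (h : ∀ m n, F (m ⊗ₜ n) = G (m ⊗ₜ n)) : F = G := by
  ext x
  induction x using TensorProduct.induction_on with
  | zero => simp
  | tmul m n => exact h m n
  | add x y hx hy => simp [hx, hy]

/-- The operator `D ⊗ 1 + 1 ⊗ E` on `M ⊗[R] N`, where `D` and `E` satisfy the Leibniz rule
with respect to the same map `δ : R → R`. -/
def tensorOp (D : Module.End k M) (E : Module.End k N) (δ : R → R)
    (hD : ∀ r m, D (r • m) = r • D m + δ r • m) (hE : ∀ r n, E (r • n) = r • E n + δ r • n) :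
    Module.End k (M ⊗[R] N) :=
  liftBal (LinearMap.mk₂ k (fun m n => D m ⊗ₜ[R] n + m ⊗ₜ[R] E n)
    (fun a b n => by simp only [map_add, TensorProduct.add_tmul]; abel)
    (fun c a n => by simp only [map_smul, TensorProduct.smul_tmul', smul_add])
    (fun a b n => by simp only [map_add, TensorProduct.tmul_add]; abel)
    (fun c a n => by simp only [map_smul, TensorProduct.tmul_smul, smul_add]))
    (fun r m n => by
      simp only [LinearMap.mk₂_apply, hD, hE, TensorProduct.add_tmul, TensorProduct.tmul_add,
        TensorProduct.smul_tmul]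
      abel)

lemma tensorOp_tmul (D : Module.End k M) (E : Module.End k N) (δ : R → R)
    (hD : ∀ r m, D (r • m) = r • D m + δ r • m) (hE : ∀ r n, E (r • n) = r • E n + δ r • n)
    (m : M) (n : N) :
    tensorOp D E δ hD hE (m ⊗ₜ[R] n) = D m ⊗ₜ[R] n + m ⊗ₜ[R] E n := rfl

lemma natCast_end_eq_zero {V : Type*} [AddCommGroup V] [Module k V] (p : ℕ) [CharP k p] :
    ((p : ℕ) : Module.End k V) = 0 := by
  ext v
  rw [Module.End.natCast_apply, ← Nat.cast_smul_eq_nsmul k, CharP.cast_eq_zero, zero_smul]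
  rfl

lemma tensorOp_pow (p : ℕ) [Fact p.Prime] [CharP k p]
    (D : Module.End k M) (E : Module.End k N) (δ : R → R)
    (hD : ∀ r m, D (r • m) = r • D m + δ r • m) (hE : ∀ r n, E (r • n) = r • E n + δ r • n)
    (hDp : D ^ p = 0) (hEp : E ^ p = 0) : tensorOp D E δ hD hE ^ p = 0 := by
  let π : M ⊗[k] N →ₗ[k] M ⊗[R] N := TensorProduct.lift
    (LinearMap.mk₂ k (fun m n => m ⊗ₜ[R] n) (fun a b n => TensorProduct.add_tmul _ _ _)
      (fun c a n => rfl) (fun a b n => TensorProduct.tmul_add _ _ _)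
      (fun c a n => TensorProduct.tmul_smul _ _ _))
  let T : Module.End k (M ⊗[k] N) := LinearMap.rTensor N D + LinearMap.lTensor M E
  have hT : T ^ p = 0 := by
    have hc : Commute (LinearMap.rTensor N D) (LinearMap.lTensor M E) := by
      change LinearMap.rTensor N D ∘ₗ LinearMap.lTensor M E
        = LinearMap.lTensor M E ∘ₗ LinearMap.rTensor N D
      rw [LinearMap.rTensor_comp_lTensor, LinearMap.lTensor_comp_rTensor]
    have h := hc.add_pow_prime_eq (p := p) Fact.out
    rw [natCast_end_eq_zero p, zero_mul, zero_mul, zero_mul, add_zero] at h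
    change (LinearMap.rTensor N D + LinearMap.lTensor M E) ^ p = 0
    rw [h, LinearMap.rTensor_pow, LinearMap.lTensor_pow, hDp, hEp]
    simp
  have hπ : ∀ x, tensorOp D E δ hD hE (π x) = π (T x) := by
    intro x
    induction x using TensorProduct.induction_on with
    | zero => simp
    | tmul m n =>
      change D m ⊗ₜ[R] n + m ⊗ₜ[R] E n = π (D m ⊗ₜ[k] n + m ⊗ₜ[k] E n)
      rw [map_add]
      rfl
    | add x y hx hy => simp only [map_add, hx, hy]
  have hπr : ∀ r x, (tensorOp D E δ hD hE ^ r) (π x) = π ((T ^ r) x) := by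
    intro r
    induction r with
    | zero => intro x; rfl
    | succ r ih => intro x; rw [pow_succ, pow_succ, Module.End.mul_apply, hπ, ih]; rfl
  refine tensor_ext fun m n => ?_
  have := hπr p (m ⊗ₜ n)
  rw [hT, LinearMap.zero_apply, map_zero] at this
  exact this

/-- The span of the tensors `m ⊗ n` with `deg m + deg n = j`. -/
def tensorGr (F : ℤ → Submodule k M) (G : ℤ → Submodule k N) (j : ℤ) :
    Submodule k (M ⊗[R] N) :=
  Submodule.span k {z | ∃ a b : ℤ, a + b = j ∧ ∃ m ∈ F a, ∃ n ∈ G b, m ⊗ₜ[R] n = z}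

end Tensor

section Pol

variable (k : Type u) [Field k]

/-- The polynomial ring in `n` variables, with strands labelled by `Fin n`. -/
abbrev Pol (n : ℕ) : Type u := MvPolynomial (Fin n) k

/-- The derivation `∂_q` of the polynomial ring with `∂_q (x_i) = x_i ^ 2`. -/
noncomputable def dPol (n : ℕ) : Derivation k (Pol k n) (Pol k n) :=
  MvPolynomial.mkDerivation k fun i => X i ^ 2

/-- The `q`-grading of the polynomial ring: every variable has degree two. -/
noncomputable def polGr (n : ℕ) (j : ℤ) : Submodule k (Pol k n) :=
  ⨆ (d : ℕ) (_ : 2 * (d : ℤ) = j), MvPolynomial.homogeneousSubmodule (Fin n) k d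

/-- The linear form `∑ c_i x_i` with integer coefficients (only their classes mod the
characteristic matter). -/
noncomputable def linForm {n : ℕ} (c : Fin n → ℤ) : Pol k n := ∑ i, c i • X i

variable {k}

lemma leibniz_of_X {n : ℕ} {V : Type*} [AddCommGroup V] [Module k V]
    (ρ : Pol k n →ₐ[k] Module.End k V) (D : Module.End k V)
    (h : ∀ i, D * ρ (X i) = ρ (X i) * D + ρ (X i ^ 2)) (f : Pol k n) :
    D * ρ f = ρ f * D + ρ (dPol k n f) := by
  induction f using MvPolynomial.induction_on with
  | C a =>
    have h1 : ρ (MvPolynomial.C a) = algebraMap k _ a := ρ.commutes a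
    have h2 : dPol k n (MvPolynomial.C a) = 0 := (dPol k n).map_algebraMap a
    rw [h1, h2, map_zero, add_zero]
    exact (Algebra.commutes a D).symm
  | add f g hf hg => rw [map_add, mul_add, hf, hg, map_add, map_add, add_mul]; abel
  | mul_X f i hf =>
    have h2 : dPol k n (X i) = X i ^ 2 := MvPolynomial.mkDerivation_X _ _ _
    rw [map_mul, ← mul_assoc, hf, add_mul, mul_assoc, h i, Derivation.leibniz, h2]
    simp only [smul_eq_mul, map_add, map_mul, mul_add, mul_assoc]
    have : ρ (X i) * ρ (dPol k n f) = ρ (dPol k n f) * ρ (X i) := by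
      rw [← map_mul, ← map_mul, mul_comm]
    rw [this]; abel

lemma pow_add_single {A : Type*} [Ring A] (D x : A) (h : D * x = x * D + x ^ 2) (r : ℕ) :
    (D + x) ^ r = ∑ s ∈ Finset.range (r + 1), (r.descFactorial s : A) * (x ^ s * D ^ (r - s)) := by
  have hx : ∀ s : ℕ, D * x ^ s = x ^ s * D + (s : A) * x ^ (s + 1) := by
    intro s
    induction s with
    | zero => simp
    | succ s ih =>
      rw [pow_succ, ← mul_assoc, ih, add_mul, mul_assoc, h, mul_add, ← mul_assoc, Nat.cast_succ]
      simp only [add_mul, one_mul, pow_succ, mul_assoc, pow_zero]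
      abel
  have hstep : ∀ s t : ℕ, (D + x) * (x ^ s * D ^ t)
      = x ^ s * D ^ (t + 1) + ((s + 1 : ℕ) : A) * (x ^ (s + 1) * D ^ t) := by
    intro s t
    rw [add_mul, ← mul_assoc, hx, ← mul_assoc x, ← pow_succ', pow_succ' D]
    push_cast
    simp only [add_mul, one_mul, mul_assoc]
    abel
  induction r with
  | zero => simp
  | succ r ih =>
    rw [pow_succ', ih, Finset.mul_sum]
    have h1 : ∀ s ∈ Finset.range (r + 1),
        (D + x) * ((r.descFactorial s : A) * (x ^ s * D ^ (r - s)))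
          = (r.descFactorial s : A) * (x ^ s * D ^ (r + 1 - s))
            + ((r.descFactorial s * (s + 1) : ℕ) : A) * (x ^ (s + 1) * D ^ (r - s)) := by
      intro s hs
      have hs' : s ≤ r := Nat.lt_succ_iff.mp (Finset.mem_range.mp hs)
      rw [(Nat.cast_commute (r.descFactorial s) _).symm.left_comm, hstep, mul_add,
        Nat.sub_add_comm hs', Nat.cast_mul, mul_assoc]
    rw [Finset.sum_congr rfl h1, Finset.sum_add_distrib, Finset.sum_range_succ' _ (r + 1),
      Finset.sum_range_succ' _ r]
    have h2 : ∑ s ∈ Finset.range r,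
        (r.descFactorial (s + 1) : A) * (x ^ (s + 1) * D ^ (r + 1 - (s + 1)))
        = ∑ s ∈ Finset.range (r + 1),
        (r.descFactorial (s + 1) : A) * (x ^ (s + 1) * D ^ (r - s)) := by
      rw [Finset.sum_range_succ, Nat.descFactorial_of_lt (Nat.lt_succ_self r)]
      simp
    rw [h2, add_right_comm, ← Finset.sum_add_distrib]
    congr 1
    refine Finset.sum_congr rfl fun s hs => ?_
    have hs' : s ≤ r := Nat.lt_succ_iff.mp (Finset.mem_range.mp hs)
    rw [← add_mul, ← Nat.cast_add, Nat.add_sub_add_right]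
    congr 2
    rw [Nat.succ_descFactorial_succ, Nat.descFactorial_succ]
    obtain ⟨t, rfl⟩ := Nat.exists_eq_add_of_le hs'
    rw [Nat.add_sub_cancel_left]
    ring

lemma pow_add_eq {A : Type*} [Ring A] (p : ℕ) [Fact p.Prime] (hp : (p : A) = 0) (D x : A)
    (h : D * x = x * D + x ^ 2) : (D + x) ^ p = D ^ p := by
  rw [pow_add_single D x h, Finset.sum_range_succ', Finset.sum_eq_zero]
  · simp
  · intro s _
    obtain ⟨q, hq⟩ : ∃ q, p = q + 1 := ⟨p - 1, (Nat.succ_pred_prime Fact.out).symm⟩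
    have : p.descFactorial (s + 1) = p * (p - 1).descFactorial s := by
      rw [hq, Nat.succ_descFactorial_succ, Nat.add_sub_cancel]
    rw [this, Nat.cast_mul, hp, zero_mul, zero_mul]

/-- Twisting a `p`-differential by a linear form with integer coefficients gives a
`p`-differential. -/
lemma twist_pow (p : ℕ) [Fact p.Prime] [CharP k p] {n : ℕ} {V : Type*} [AddCommGroup V]
    [Module k V] (ρ : Pol k n →ₐ[k] Module.End k V) (D : Module.End k V)
    (h : ∀ f, D * ρ f = ρ f * D + ρ (dPol k n f)) (hD : D ^ p = 0) (c : Fin n → ℤ) :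
    (D + ρ (linForm k c)) ^ p = 0 := by
  have hp0 : ((p : ℕ) : Module.End k V) = 0 := natCast_end_eq_zero p
  have hcomm : ∀ f g, ρ f * ρ g = ρ g * ρ f := fun f g => by
    rw [← map_mul, mul_comm, map_mul]
  have hX : ∀ g i, (D + ρ g) * ρ (X i) = ρ (X i) * (D + ρ g) + ρ (X i) ^ 2 := by
    intro g i
    have h2 : dPol k n (X i) = X i ^ 2 := MvPolynomial.mkDerivation_X _ _ _
    rw [add_mul, h, h2, hcomm g, mul_add, map_pow]
    abel
  have hnat : ∀ (m : ℕ) g i, (D + ρ (g + m • X i)) ^ p = (D + ρ g) ^ p := by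
    intro m g i
    induction m with
    | zero => simp
    | succ m ih =>
      rw [← ih, succ_nsmul, ← add_assoc, map_add, ← add_assoc, pow_add_eq p hp0 _ _ (hX _ i)]
  have hint : ∀ (m : ℤ) g i, (D + ρ (g + m • X i)) ^ p = (D + ρ g) ^ p := by
    intro m g i
    have hpp : (p : ℤ) ≠ 0 := by exact_mod_cast (Fact.out : p.Prime).ne_zero
    have h0 : 0 ≤ m % p := Int.emod_nonneg _ hpp
    have h1 : m • (X i : Pol k n) = (m % p).toNat • X i := by
      have : m = m % p + p * (m / p) := (Int.emod_add_mul_ediv m p).symm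
      conv_lhs => rw [this]
      have hz : ∀ v : Pol k n, (p : ℤ) • v = 0 := fun v => by
        rw [natCast_zsmul, ← Nat.cast_smul_eq_nsmul k, CharP.cast_eq_zero k p, zero_smul]
      rw [add_smul, mul_smul, hz, add_zero, ← natCast_zsmul, Int.toNat_of_nonneg h0]
    rw [h1, hnat]
  have hsum : ∀ s : Finset (Fin n), (D + ρ (∑ i ∈ s, c i • X i)) ^ p = 0 := by
    intro s
    induction s using Finset.induction_on with
    | empty => simpa using hD
    | insert i s hi ih => rw [Finset.sum_insert hi, add_comm, add_comm (c i • _), add_comm, hint, ih]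
  exact hsum Finset.univ

lemma dPol_iterate_X (n r : ℕ) (i : Fin n) :
    ((dPol k n : Pol k n →ₗ[k] Pol k n) ^ r) (X i) = r.factorial • X i ^ (r + 1) := by
  induction r with
  | zero => simp
  | succ r ih =>
    have h2 : dPol k n (X i) = X i ^ 2 := MvPolynomial.mkDerivation_X _ _ _
    rw [pow_succ', Module.End.mul_apply, ih, map_nsmul, Derivation.coeFn_coe,
      Derivation.leibniz_pow, h2, smul_smul, Nat.add_sub_cancel, smul_eq_mul, ← pow_add,
      Nat.factorial_succ, mul_comm]

lemma dPol_pow (p : ℕ) [Fact p.Prime] [CharP k p] (n : ℕ) :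
    (dPol k n : Module.End k (Pol k n)) ^ p = 0 := by
  let D : Module.End k (Pol k n) := dPol k n
  let T : Module.End k (Pol k n ⊗[k] Pol k n) := LinearMap.rTensor _ D + LinearMap.lTensor _ D
  have hT : ∀ f g, (T ^ p) (f ⊗ₜ g) = (D ^ p) f ⊗ₜ g + f ⊗ₜ (D ^ p) g := by
    intro f g
    have hc : Commute (LinearMap.rTensor (Pol k n) D) (LinearMap.lTensor (Pol k n) D) := by
      change LinearMap.rTensor _ D ∘ₗ LinearMap.lTensor _ D
        = LinearMap.lTensor _ D ∘ₗ LinearMap.rTensor _ D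
      rw [LinearMap.rTensor_comp_lTensor, LinearMap.lTensor_comp_rTensor]
    have h := hc.add_pow_prime_eq (p := p) Fact.out
    rw [natCast_end_eq_zero p, zero_mul, zero_mul, zero_mul, add_zero] at h
    have hT' : T ^ p = _ := h
    rw [hT', LinearMap.rTensor_pow, LinearMap.lTensor_pow]
    simp
  have hμ : ∀ x, D (LinearMap.mul' k _ x) = LinearMap.mul' k _ (T x) := by
    intro x
    induction x using TensorProduct.induction_on with
    | zero => simp
    | tmul f g => simp [T, D, Derivation.leibniz]; ring
    | add x y hx hy => simp only [map_add, hx, hy]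
  have hμr : ∀ r x, (D ^ r) (LinearMap.mul' k _ x) = LinearMap.mul' k _ ((T ^ r) x) := by
    intro r
    induction r with
    | zero => intro x; rfl
    | succ r ih => intro x; rw [pow_succ, pow_succ, Module.End.mul_apply, hμ, ih]; rfl
  have hmul : ∀ f g, (D ^ p) (f * g) = (D ^ p) f * g + f * (D ^ p) g := by
    intro f g
    have := hμr p (f ⊗ₜ g)
    rw [hT] at this
    simpa using this
  refine LinearMap.ext fun f => ?_
  change (D ^ p) f = 0
  induction f using MvPolynomial.induction_on with
  | C a =>
    have h2 : D (MvPolynomial.C a) = 0 := (dPol k n).map_algebraMap a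
    obtain ⟨q, hq⟩ : ∃ q, p = q + 1 := ⟨p - 1, (Nat.succ_pred_prime Fact.out).symm⟩
    rw [hq, pow_succ, Module.End.mul_apply, h2, map_zero]
  | add f g hf hg => rw [map_add, hf, hg, add_zero]
  | mul_X f i hf =>
    have h3 : (D ^ p) (X i) = 0 := by
      rw [dPol_iterate_X, ← Nat.cast_smul_eq_nsmul k,
        (CharP.cast_eq_zero_iff k p _).2 (Nat.dvd_factorial (Fact.out : p.Prime).pos le_rfl),
        zero_smul]
    rw [hmul, hf, h3, zero_mul, mul_zero, add_zero]

end Pol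
section TensorAct

variable {k R M N A : Type*} [Field k] [CommRing R] [Algebra k R] [AddCommGroup M]
  [AddCommGroup N] [Module R M] [Module R N] [Module k M] [Module k N]
  [IsScalarTower k R M] [IsScalarTower k R N] [Semiring A] [Algebra k A]

/-- The action `ρ ⊗ 1` on `M ⊗[R] N`. -/
noncomputable def actL (ρ : A →ₐ[k] Module.End k M)
    (h : ∀ a (r : R) m, ρ a (r • m) = r • ρ a m) : A →ₐ[k] Module.End k (M ⊗[R] N) :=
  AlgHom.ofLinearMap
    { toFun := fun a => tensorOp (R := R) (ρ a) (0 : Module.End k N) (fun _ => 0)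
        (fun r m => by simp [h]) (fun r n => by simp)
      map_add' := fun a b => tensor_ext fun m n => by
        simp [tensorOp_tmul, TensorProduct.add_tmul]
      map_smul' := fun c a => tensor_ext fun m n => by
        simp [tensorOp_tmul, TensorProduct.smul_tmul'] }
    (tensor_ext fun m n => by simp [tensorOp_tmul])
    (fun a b => tensor_ext fun m n => by simp [tensorOp_tmul])

/-- The action `1 ⊗ ρ` on `M ⊗[R] N`. -/
noncomputable def actR (ρ : A →ₐ[k] Module.End k N)
    (h : ∀ a (r : R) n, ρ a (r • n) = r • ρ a n) : A →ₐ[k] Module.End k (M ⊗[R] N) :=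
  AlgHom.ofLinearMap
    { toFun := fun a => tensorOp (R := R) (0 : Module.End k M) (ρ a) (fun _ => 0)
        (fun r m => by simp) (fun r n => by simp [h])
      map_add' := fun a b => tensor_ext fun m n => by
        simp [tensorOp_tmul, TensorProduct.tmul_add]
      map_smul' := fun c a => tensor_ext fun m n => by
        simp [tensorOp_tmul] }
    (tensor_ext fun m n => by simp [tensorOp_tmul])
    (fun a b => tensor_ext fun m n => by simp [tensorOp_tmul])

lemma actL_tmul (ρ : A →ₐ[k] Module.End k M) (h : ∀ a (r : R) m, ρ a (r • m) = r • ρ a m)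
    (a : A) (m : M) (n : N) : actL ρ h a (m ⊗ₜ[R] n) = ρ a m ⊗ₜ[R] n := by
  change ρ a m ⊗ₜ[R] n + m ⊗ₜ[R] (0 : N) = _
  simp

lemma actR_tmul (ρ : A →ₐ[k] Module.End k N) (h : ∀ a (r : R) n, ρ a (r • n) = r • ρ a n)
    (a : A) (m : M) (n : N) : actR ρ h a (m ⊗ₜ[R] n) = m ⊗ₜ[R] ρ a n := by
  change (0 : M) ⊗ₜ[R] n + m ⊗ₜ[R] ρ a n = _
  simp

end TensorAct

/-- Graded `(R_n, R_n)`-bimodules with a compatible `H_q`-action: a `k`-vector space with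
commuting left and right actions of `R_n = k[x_1, …, x_n]`, a `p`-nilpotent operator `∂_q`
satisfying the Leibniz rule for both actions, and the graded pieces of the `q`-grading. -/
structure HBimod (k : Type u) [Field k] (p n : ℕ) where
  carrier : Type u
  [addCommGroup : AddCommGroup carrier]
  [module : Module k carrier]
  left : Pol k n →ₐ[k] Module.End k carrier
  right : Pol k n →ₐ[k] Module.End k carrier
  left_right : ∀ f g, left f * right g = right g * left f
  dq : Module.End k carrier
  dq_left : ∀ f, dq * left f = left f * dq + left (dPol k n f)
  dq_right : ∀ f, dq * right f = right f * dq + right (dPol k n f)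
  dq_pow : dq ^ p = 0
  grq : ℤ → Submodule k carrier

attribute [instance] HBimod.addCommGroup HBimod.module

/-- `p`-complexes of graded `(R_n, R_n) # H_q`-modules, encoded as one bimodule (the direct sum
of all the terms) with the total boundary map `∂_0` and the graded pieces of the topological
grading, in which `∂_0` has degree `-1`. -/
structure PBimod (k : Type u) [Field k] (p n : ℕ) extends HBimod k p n where
  dt : Module.End k carrier
  dt_left : ∀ f, dt * left f = left f * dt
  dt_right : ∀ f, dt * right f = right f * dt
  dt_dq : dt * dq = dq * dt
  dt_pow : dt ^ p = 0
  grt : ℤ → Submodule k carrier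

section Elementary

variable {k : Type u} [Field k] {p n : ℕ}

/-- The grading shift `q^a`. -/
abbrev HBimod.qshift (a : ℤ) (M : HBimod k p n) : HBimod k p n :=
  { M with grq := fun j => M.grq (j - a) }

/-- The grading shift `q^a`. -/
abbrev PBimod.qshift (a : ℤ) (M : PBimod k p n) : PBimod k p n :=
  { M with grq := fun j => M.grq (j - a) }

/-- Homomorphisms of `(R_n, R_n) # H_q`-modules. -/
structure HBimod.Hom (M N : HBimod k p n) where
  toLin : M.carrier →ₗ[k] N.carrier
  map_left : ∀ f x, toLin (M.left f x) = N.left f (toLin x)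
  map_right : ∀ f x, toLin (M.right f x) = N.right f (toLin x)
  map_dq : ∀ x, toLin (M.dq x) = N.dq (toLin x)

/-- A bimodule regarded as a `p`-complex concentrated in topological degree zero. -/
def HBimod.toPBimod (hp : p ≠ 0) (M : HBimod k p n) : PBimod k p n :=
  { M with
    dt := 0
    dt_left := fun f => by simp
    dt_right := fun f => by simp
    dt_dq := by simp
    dt_pow := zero_pow hp
    grt := fun i => if i = 0 then ⊤ else ⊥ }

/-- The diagonal action on `M × N^q`. -/
noncomputable def actLow (q : ℕ) {V W A : Type*} [AddCommGroup V] [Module k V] [AddCommGroup W]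
    [Module k W] [Semiring A] [Algebra k A] (ρ : A →ₐ[k] Module.End k V)
    (τ : A →ₐ[k] Module.End k W) : A →ₐ[k] Module.End k (V × (Fin q → W)) :=
  AlgHom.ofLinearMap
    { toFun := fun a => (ρ a).prodMap ((τ a).compLeft (Fin q))
      map_add' := fun a b => LinearMap.ext fun x => by
        refine Prod.ext ?_ (funext fun s => ?_) <;> simp
      map_smul' := fun c a => LinearMap.ext fun x => by
        refine Prod.ext ?_ (funext fun s => ?_) <;> simp }
    (LinearMap.ext fun x => by refine Prod.ext ?_ (funext fun s => ?_) <;> simp)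
    (fun a b => LinearMap.ext fun x => by refine Prod.ext ?_ (funext fun s => ?_) <;> simp)

/-- The `p`-complex `M → N[-1]_∂` attached to `f : M → N`: the module `M` sits in topological
degree `0`, and the copies of `N`, connected by identity maps, in degrees `-1, …, -(p-1)`. -/
noncomputable def HBimod.Hom.low [Fact p.Prime] {M N : HBimod k p n} (f : M.Hom N) :
    PBimod k p n where
  carrier := M.carrier × (Fin (p - 1) → N.carrier)
  left := actLow (p - 1) M.left N.left
  right := actLow (p - 1) M.right N.right
  left_right a b := LinearMap.ext fun x => by
    refine Prod.ext ?_ (funext fun s => ?_)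
    · exact LinearMap.congr_fun (M.left_right a b) x.1
    · exact LinearMap.congr_fun (N.left_right a b) (x.2 s)
  dq := M.dq.prodMap (N.dq.compLeft (Fin (p - 1)))
  dq_left a := LinearMap.ext fun x => by
    refine Prod.ext ?_ (funext fun s => ?_)
    · exact LinearMap.congr_fun (M.dq_left a) x.1
    · exact LinearMap.congr_fun (N.dq_left a) (x.2 s)
  dq_right a := LinearMap.ext fun x => by
    refine Prod.ext ?_ (funext fun s => ?_)
    · exact LinearMap.congr_fun (M.dq_right a) x.1
    · exact LinearMap.congr_fun (N.dq_right a) (x.2 s)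
  dq_pow := by
    have h : ∀ r x, ((M.dq.prodMap (N.dq.compLeft (Fin (p - 1))) :
        Module.End k (M.carrier × (Fin (p - 1) → N.carrier))) ^ r) x
        = ((M.dq ^ r) x.1, fun s => (N.dq ^ r) (x.2 s)) := by
      intro r
      induction r with
      | zero => intro x; rfl
      | succ r ih => intro x; rw [pow_succ, Module.End.mul_apply, ih]; rfl
    refine LinearMap.ext fun x => ?_
    rw [h, M.dq_pow, N.dq_pow]
    rfl
  grq j := (M.grq j).prod (Submodule.pi Set.univ fun _ => N.grq j)
  dt :=
    { toFun := fun x => (0, fun s : Fin (p - 1) =>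
        if (s : ℕ) = 0 then f.toLin x.1 else x.2 ⟨(s : ℕ) - 1, by omega⟩)
      map_add' := fun x y => by
        refine Prod.ext ?_ (funext fun s => ?_)
        · simp
        · by_cases h : (s : ℕ) = 0 <;> simp [h]
      map_smul' := fun c x => by
        refine Prod.ext ?_ (funext fun s => ?_)
        · simp
        · by_cases h : (s : ℕ) = 0 <;> simp [h] }
  dt_left a := LinearMap.ext fun x => by
    refine Prod.ext ?_ (funext fun s => ?_)
    · exact (map_zero (M.left a)).symm
    · by_cases h : (s : ℕ) = 0 <;> simp [h, actLow, f.map_left]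
  dt_right a := LinearMap.ext fun x => by
    refine Prod.ext ?_ (funext fun s => ?_)
    · exact (map_zero (M.right a)).symm
    · by_cases h : (s : ℕ) = 0 <;> simp [h, actLow, f.map_right]
  dt_dq := LinearMap.ext fun x => by
    refine Prod.ext ?_ (funext fun s => ?_)
    · exact (map_zero M.dq).symm
    · by_cases h : (s : ℕ) = 0 <;> simp [h, f.map_dq]
  dt_pow := by
    generalize hT : (LinearMap.mk _ _ : Module.End k (M.carrier × (Fin (p - 1) → N.carrier))) = T
    have hT' : ∀ x, T x = (0, fun s : Fin (p - 1) =>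
        if (s : ℕ) = 0 then f.toLin x.1 else x.2 ⟨(s : ℕ) - 1, by omega⟩) := by
      intro x; rw [← hT]; rfl
    have h : ∀ r x, ((T ^ (r + 1)) x).1 = 0 ∧ ∀ s : Fin (p - 1), (s : ℕ) < r →
        ((T ^ (r + 1)) x).2 s = 0 := by
      intro r
      induction r with
      | zero => intro x; rw [zero_add, pow_one, hT']; simp
      | succ r ih =>
        intro x
        obtain ⟨h1, h2⟩ := ih x
        rw [pow_succ', Module.End.mul_apply, hT']
        refine ⟨rfl, fun s hs => ?_⟩
        by_cases h0 : (s : ℕ) = 0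
        · simp [h0, h1]
        · simp only [h0, if_false]
          exact h2 _ (by simp only; omega)
    have hp : T ^ p = T ^ (p - 1 + 1) := by
      rw [Nat.sub_add_cancel (Fact.out : p.Prime).one_le]
    refine LinearMap.ext fun x => ?_
    rw [hp]
    obtain ⟨h1, h2⟩ := h (p - 1) x
    exact Prod.ext h1 (funext fun s => h2 s s.2)
  grt i := (if i = 0 then ⊤ else ⊥ : Submodule k M.carrier).prod
    (Submodule.pi Set.univ fun s : Fin (p - 1) =>
      if i = -((s : ℤ) + 1) then ⊤ else (⊥ : Submodule k N.carrier))

/-- The `p`-complex `M[1]_∂ → N` attached to `f : M → N`: the copies of `M`, connected by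
identity maps, sit in topological degrees `p-1, …, 1`, and `N` in degree `0`. -/
noncomputable def HBimod.Hom.high [Fact p.Prime] {M N : HBimod k p n} (f : M.Hom N) :
    PBimod k p n where
  carrier := N.carrier × (Fin (p - 1) → M.carrier)
  left := actLow (p - 1) N.left M.left
  right := actLow (p - 1) N.right M.right
  left_right a b := LinearMap.ext fun x => by
    refine Prod.ext ?_ (funext fun s => ?_)
    · exact LinearMap.congr_fun (N.left_right a b) x.1
    · exact LinearMap.congr_fun (M.left_right a b) (x.2 s)
  dq := N.dq.prodMap (M.dq.compLeft (Fin (p - 1)))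
  dq_left a := LinearMap.ext fun x => by
    refine Prod.ext ?_ (funext fun s => ?_)
    · exact LinearMap.congr_fun (N.dq_left a) x.1
    · exact LinearMap.congr_fun (M.dq_left a) (x.2 s)
  dq_right a := LinearMap.ext fun x => by
    refine Prod.ext ?_ (funext fun s => ?_)
    · exact LinearMap.congr_fun (N.dq_right a) x.1
    · exact LinearMap.congr_fun (M.dq_right a) (x.2 s)
  dq_pow := by
    have h : ∀ r x, ((N.dq.prodMap (M.dq.compLeft (Fin (p - 1))) :
        Module.End k (N.carrier × (Fin (p - 1) → M.carrier))) ^ r) x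
        = ((N.dq ^ r) x.1, fun s => (M.dq ^ r) (x.2 s)) := by
      intro r
      induction r with
      | zero => intro x; rfl
      | succ r ih => intro x; rw [pow_succ, Module.End.mul_apply, ih]; rfl
    refine LinearMap.ext fun x => ?_
    rw [h, M.dq_pow, N.dq_pow]
    rfl
  grq j := (N.grq j).prod (Submodule.pi Set.univ fun _ => M.grq j)
  dt :=
    { toFun := fun x =>
        (f.toLin (x.2 ⟨0, Nat.sub_pos_of_lt (Fact.out : p.Prime).one_lt⟩), fun s : Fin (p - 1) =>
          if h : (s : ℕ) + 1 < p - 1 then x.2 ⟨(s : ℕ) + 1, h⟩ else 0)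
      map_add' := fun x y => by
        refine Prod.ext ?_ (funext fun s => ?_)
        · simp
        · by_cases h : (s : ℕ) + 1 < p - 1 <;> simp [h]
      map_smul' := fun c x => by
        refine Prod.ext ?_ (funext fun s => ?_)
        · simp
        · by_cases h : (s : ℕ) + 1 < p - 1 <;> simp [h] }
  dt_left a := LinearMap.ext fun x => by
    refine Prod.ext ?_ (funext fun s => ?_)
    · exact f.map_left _ _
    · by_cases h : (s : ℕ) + 1 < p - 1 <;> simp [h, actLow]
  dt_right a := LinearMap.ext fun x => by
    refine Prod.ext ?_ (funext fun s => ?_)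
    · exact f.map_right _ _
    · by_cases h : (s : ℕ) + 1 < p - 1 <;> simp [h, actLow]
  dt_dq := LinearMap.ext fun x => by
    refine Prod.ext ?_ (funext fun s => ?_)
    · exact f.map_dq _
    · by_cases h : (s : ℕ) + 1 < p - 1 <;> simp [h]
  dt_pow := by
    generalize hT : (LinearMap.mk _ _ : Module.End k (N.carrier × (Fin (p - 1) → M.carrier))) = T
    have hT' : ∀ x, T x =
        (f.toLin (x.2 ⟨0, Nat.sub_pos_of_lt (Fact.out : p.Prime).one_lt⟩), fun s : Fin (p - 1) =>
          if h : (s : ℕ) + 1 < p - 1 then x.2 ⟨(s : ℕ) + 1, h⟩ else 0) := by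
      intro x; rw [← hT]; rfl
    have h : ∀ r x, ∀ s : Fin (p - 1), p - 1 ≤ (s : ℕ) + r → ((T ^ r) x).2 s = 0 := by
      intro r
      induction r with
      | zero => intro x s hs; omega
      | succ r ih =>
        intro x s hs
        rw [pow_succ', Module.End.mul_apply, hT']
        by_cases h0 : (s : ℕ) + 1 < p - 1
        · simp only [h0, dif_pos]
          exact ih x _ (by simp only; omega)
        · simp [h0]
    have hp : T ^ p = T * T ^ (p - 1) := by
      rw [← pow_succ', Nat.sub_add_cancel (Fact.out : p.Prime).one_le]
    refine LinearMap.ext fun x => ?_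
    rw [hp, Module.End.mul_apply, hT']
    have h2 : ∀ s : Fin (p - 1), ((T ^ (p - 1)) x).2 s = 0 := fun s => h (p - 1) x s (by omega)
    refine Prod.ext ?_ (funext fun s => ?_)
    · simp [h2]
    · by_cases h0 : (s : ℕ) + 1 < p - 1 <;> simp [h0, h2]
  grt i := (if i = 0 then ⊤ else ⊥ : Submodule k N.carrier).prod
    (Submodule.pi Set.univ fun s : Fin (p - 1) =>
      if i = (s : ℤ) + 1 then ⊤ else (⊥ : Submodule k M.carrier))

end Elementary

section Soergel

variable (k : Type u) [Field k] (p : ℕ) [Fact p.Prime] [CharP k p] {n : ℕ}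

lemma dPol_mul_lmul (f : Pol k n) :
    (dPol k n : Module.End k (Pol k n)) * Algebra.lmul k (Pol k n) f
      = Algebra.lmul k (Pol k n) f * (dPol k n : Module.End k (Pol k n))
        + Algebra.lmul k (Pol k n) (dPol k n f) := by
  refine LinearMap.ext fun g => ?_
  simp [Derivation.leibniz]
  ring

/-- `R_n` as a bimodule over itself. -/
noncomputable def reg (n : ℕ) : HBimod k p n where
  carrier := Pol k n
  left := Algebra.lmul k (Pol k n)
  right := Algebra.lmul k (Pol k n)
  left_right f g := by rw [← map_mul, mul_comm, map_mul]
  dq := (dPol k n : Pol k n →ₗ[k] Pol k n)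
  dq_left := dPol_mul_lmul k
  dq_right := dPol_mul_lmul k
  dq_pow := dPol_pow p n
  grq := polGr k n

/-- The subalgebra of polynomials symmetric in `x_a` and `x_b`. -/
noncomputable def symSub (a b : Fin n) : Subalgebra k (Pol k n) :=
  AlgHom.equalizer (MvPolynomial.rename (Equiv.swap a b)) (AlgHom.id k (Pol k n))

lemma rename_dPol (σ : Equiv.Perm (Fin n)) (f : Pol k n) :
    MvPolynomial.rename σ (dPol k n f) = dPol k n (MvPolynomial.rename σ f) := by
  have hX : ∀ i : Fin n, dPol k n (X i) = X i ^ 2 := fun i => MvPolynomial.mkDerivation_X _ _ _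
  induction f using MvPolynomial.induction_on with
  | C a => simp [dPol]
  | add f g hf hg => simp only [map_add, hf, hg]
  | mul_X f i hf => simp [Derivation.leibniz, hX, hf]

lemma dPol_mem_symSub (a b : Fin n) (f : symSub k a b) : dPol k n f ∈ symSub k a b := by
  have hf : MvPolynomial.rename (Equiv.swap a b) (f : Pol k n) = f := f.2
  change MvPolynomial.rename (Equiv.swap a b) (dPol k n f) = dPol k n f
  rw [rename_dPol, hf]

/-- The vector space `B = R_n ⊗ R_n`, the tensor product being over the polynomials symmetric
in `x_a` and `x_b`. -/
abbrev BS (a b : Fin n) : Type u := Pol k n ⊗[symSub k a b] Pol k n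

/-- The left action of `R_n` on `B`. -/
noncomputable def bsLeft (a b : Fin n) : Pol k n →ₐ[k] Module.End k (BS k a b) :=
  actL (Algebra.lmul k (Pol k n)) (fun f r g => by simp)

/-- The right action of `R_n` on `B`. -/
noncomputable def bsRight (a b : Fin n) : Pol k n →ₐ[k] Module.End k (BS k a b) :=
  actR (Algebra.lmul k (Pol k n)) (fun f r g => by simp)

/-- The operator `∂_q (f ⊗ g) = ∂_q f ⊗ g + f ⊗ ∂_q g` on `B`. -/
noncomputable def bsDq (a b : Fin n) : Module.End k (BS k a b) :=
  tensorOp (dPol k n : Pol k n →ₗ[k] Pol k n) (dPol k n : Pol k n →ₗ[k] Pol k n)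
    (fun r => ⟨dPol k n r, dPol_mem_symSub k a b r⟩)
    (fun r m => by simp [Subalgebra.smul_def, Derivation.leibniz]; ring)
    (fun r m => by simp [Subalgebra.smul_def, Derivation.leibniz]; ring)

lemma bsLeft_tmul (a b : Fin n) (f x y : Pol k n) :
    bsLeft k a b f (x ⊗ₜ[symSub k a b] y) = (f * x) ⊗ₜ[symSub k a b] y :=
  actL_tmul _ _ _ _ _

lemma bsRight_tmul (a b : Fin n) (f x y : Pol k n) :
    bsRight k a b f (x ⊗ₜ[symSub k a b] y) = x ⊗ₜ[symSub k a b] (f * y) :=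
  actR_tmul _ _ _ _ _

lemma bsDq_tmul (a b : Fin n) (x y : Pol k n) :
    bsDq k a b (x ⊗ₜ[symSub k a b] y)
      = dPol k n x ⊗ₜ[symSub k a b] y + x ⊗ₜ[symSub k a b] dPol k n y := rfl

/-- The `(R_n, R_n) # H_q`-module `B`. -/
noncomputable def bs (a b : Fin n) : HBimod k p n where
  carrier := BS k a b
  left := bsLeft k a b
  right := bsRight k a b
  left_right f g := tensor_ext fun x y => by simp [bsLeft_tmul, bsRight_tmul]
  dq := bsDq k a b
  dq_left f := tensor_ext fun x y => by
    simp [bsLeft_tmul, bsDq_tmul, Derivation.leibniz, TensorProduct.add_tmul, mul_comm]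
    abel
  dq_right f := tensor_ext fun x y => by
    simp [bsRight_tmul, bsDq_tmul, Derivation.leibniz, TensorProduct.tmul_add, mul_comm]
    abel
  dq_pow := tensorOp_pow p _ _ _ _ _ (dPol_pow p n) (dPol_pow p n)
  grq := tensorGr (polGr k n) (polGr k n)

variable {k p}

/-- The twist `M^f` by a linear form `f`: the action of `∂_q` is changed by adding the right
multiplication by `f`. -/
noncomputable abbrev HBimod.twistRight (c : Fin n → ℤ) (M : HBimod k p n) : HBimod k p n :=
  { M with
    dq := M.dq + M.right (linForm k c)
    dq_left := fun f => by rw [add_mul, M.dq_left, ← M.left_right, mul_add]; abel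
    dq_right := fun f => by
      rw [add_mul, M.dq_right, ← map_mul, mul_comm (linForm k c), map_mul, mul_add]; abel
    dq_pow := twist_pow p M.right M.dq M.dq_right M.dq_pow c }

variable (k p)

/-- The multiplication map on the underlying vector space of `B`. -/
noncomputable def brLin (a b : Fin n) : Pol k n ⊗[symSub k a b] Pol k n →ₗ[k] Pol k n :=
  liftBal (R := symSub k a b) (LinearMap.mul k (Pol k n))
    (fun r f g => by simp only [Subalgebra.smul_def, smul_eq_mul, LinearMap.mul_apply']; ring)

lemma brLin_tmul (a b : Fin n) (f g : Pol k n) :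
    brLin k a b (f ⊗ₜ[symSub k a b] g) = f * g := rfl

/-- The multiplication map `B → R_n`. -/
noncomputable def br (a b : Fin n) : (bs k p a b).Hom (reg k p n) where
  toLin := brLin k a b
  map_left f := LinearMap.congr_fun (tensor_ext (F := brLin k a b ∘ₗ bsLeft k a b f)
    (G := (Algebra.lmul k (Pol k n) f) ∘ₗ brLin k a b) fun x y => by
      simp [bsLeft_tmul, brLin_tmul, mul_assoc])
  map_right f := LinearMap.congr_fun (tensor_ext (F := brLin k a b ∘ₗ bsRight k a b f)
    (G := (Algebra.lmul k (Pol k n) f) ∘ₗ brLin k a b) fun x y => by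
      simp [bsRight_tmul, brLin_tmul, mul_left_comm])
  map_dq := LinearMap.congr_fun (tensor_ext (F := brLin k a b ∘ₗ bsDq k a b)
    (G := (dPol k n : Pol k n →ₗ[k] Pol k n) ∘ₗ brLin k a b) fun x y => by
      simp [bsDq_tmul, brLin_tmul, Derivation.leibniz]
      ring)

/-- The element `x_b ⊗ 1 - 1 ⊗ x_a` of `B`. -/
noncomputable def rbElt (a b : Fin n) : Pol k n ⊗[symSub k a b] Pol k n :=
  X b ⊗ₜ 1 - 1 ⊗ₜ X a

/-- The integer coefficients of the linear form `-(x_a + x_b)`. -/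
def rbTwist (a b : Fin n) : Fin n → ℤ := -(Pi.single a 1 + Pi.single b 1)

lemma linForm_rbTwist (a b : Fin n) : linForm k (rbTwist a b) = -(X a + X b) := by
  have h : ∀ a : Fin n, ∑ i, (Pi.single a 1 : Fin n → ℤ) i • (X i : Pol k n) = X a := by
    intro a
    rw [Finset.sum_eq_single a]
    · simp
    · intro i _ hi; simp [hi]
    · simp
  simp only [linForm, rbTwist, Pi.neg_apply, Pi.add_apply, neg_smul, add_smul,
    Finset.sum_neg_distrib, Finset.sum_add_distrib, h]

lemma tmul_sym {a b : Fin n} {s : Pol k n} (hs : s ∈ symSub k a b) (f g : Pol k n) :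
    (s * f) ⊗ₜ[symSub k a b] g = f ⊗ₜ[symSub k a b] (s * g) :=
  TensorProduct.smul_tmul (⟨s, hs⟩ : symSub k a b) f g

lemma add_mem_symSub (a b : Fin n) : (X a + X b : Pol k n) ∈ symSub k a b := by
  change MvPolynomial.rename (Equiv.swap a b) (X a + X b) = X a + X b
  simp [add_comm]

lemma mul_mem_symSub (a b : Fin n) : (X a * X b : Pol k n) ∈ symSub k a b := by
  change MvPolynomial.rename (Equiv.swap a b) (X a * X b) = X a * X b
  simp [mul_comm]

lemma X_mem_symSub {a b i : Fin n} (ha : i ≠ a) (hb : i ≠ b) : (X i : Pol k n) ∈ symSub k a b := by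
  change MvPolynomial.rename (Equiv.swap a b) (X i) = X i
  simp [Equiv.swap_apply_of_ne_of_ne ha hb]

lemma bsLeft_bsRight (a b : Fin n) (f g : Pol k n) (z : BS k a b) :
    bsLeft k a b f (bsRight k a b g z) = bsRight k a b g (bsLeft k a b f z) :=
  LinearMap.congr_fun (tensor_ext (F := bsLeft k a b f ∘ₗ bsRight k a b g)
    (G := bsRight k a b g ∘ₗ bsLeft k a b f) fun x y => by
      simp [bsLeft_tmul, bsRight_tmul]) z

lemma bsDq_bsLeft (a b : Fin n) (f : Pol k n) (z : BS k a b) :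
    bsDq k a b (bsLeft k a b f z) = bsLeft k a b f (bsDq k a b z) + bsLeft k a b (dPol k n f) z :=
  LinearMap.congr_fun (tensor_ext (F := bsDq k a b ∘ₗ bsLeft k a b f)
    (G := bsLeft k a b f ∘ₗ bsDq k a b + bsLeft k a b (dPol k n f)) fun x y => by
      simp [bsLeft_tmul, bsDq_tmul, Derivation.leibniz, TensorProduct.add_tmul, mul_comm]
      abel) z

lemma left_rbElt (a b : Fin n) (f : Pol k n) :
    bsLeft k a b f (rbElt k a b) = bsRight k a b f (rbElt k a b) := by
  have hmul : ∀ f g : Pol k n,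
      bsLeft k a b f (rbElt k a b) = bsRight k a b f (rbElt k a b) →
      bsLeft k a b g (rbElt k a b) = bsRight k a b g (rbElt k a b) →
      bsLeft k a b (f * g) (rbElt k a b) = bsRight k a b (f * g) (rbElt k a b) := by
    intro f g hf hg
    rw [map_mul, mul_comm f g, map_mul, Module.End.mul_apply, Module.End.mul_apply, hg,
      bsLeft_bsRight, hf]
  have hL : ∀ f : Pol k n, bsLeft k a b f (rbElt k a b)
      = ((f * X b) ⊗ₜ[symSub k a b] 1 - f ⊗ₜ[symSub k a b] X a :
        BS k a b) := by
    intro f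
    have h := map_sub (bsLeft k a b f)
      (X b ⊗ₜ[symSub k a b] 1 : BS k a b)
      (1 ⊗ₜ[symSub k a b] X a : BS k a b)
    refine h.trans ?_
    rw [bsLeft_tmul, bsLeft_tmul, mul_one]
  have hR : ∀ f : Pol k n, bsRight k a b f (rbElt k a b)
      = (X b ⊗ₜ[symSub k a b] f - 1 ⊗ₜ[symSub k a b] (f * X a) :
        BS k a b) := by
    intro f
    have h := map_sub (bsRight k a b f)
      (X b ⊗ₜ[symSub k a b] 1 : BS k a b)
      (1 ⊗ₜ[symSub k a b] X a : BS k a b)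
    refine h.trans ?_
    rw [bsRight_tmul, bsRight_tmul, mul_one]
  have hs : ∀ s ∈ symSub k a b,
      bsLeft k a b s (rbElt k a b) = bsRight k a b s (rbElt k a b) := by
    intro s hs
    rw [hL, hR, tmul_sym k hs, mul_one, ← tmul_sym k hs, mul_one]
  have hXa : bsLeft k a b (X a) (rbElt k a b) = bsRight k a b (X a) (rbElt k a b) := by
    rw [hL, hR]
    have h1 := tmul_sym k (mul_mem_symSub k a b) 1 1
    have h2 := tmul_sym k (add_mem_symSub k a b) 1 (X a)
    simp only [mul_one, add_mul, TensorProduct.add_tmul, TensorProduct.tmul_add] at h1 h2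
    rw [h1, sub_eq_sub_iff_add_eq_add, mul_comm (X a) (X b), add_comm, ← h2, add_comm]
  have hXb : bsLeft k a b (X b) (rbElt k a b) = bsRight k a b (X b) (rbElt k a b) := by
    have h := hs _ (add_mem_symSub k a b)
    rw [map_add, map_add, LinearMap.add_apply, LinearMap.add_apply, hXa] at h
    exact add_left_cancel h
  induction f using MvPolynomial.induction_on with
  | C c =>
    have h1 := (bsLeft k a b).commutes c
    have h2 := (bsRight k a b).commutes c
    exact LinearMap.congr_fun (h1.trans h2.symm) _
  | add f g hf hg =>
    rw [map_add, map_add, LinearMap.add_apply, LinearMap.add_apply, hf, hg]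
  | mul_X f i hf =>
    refine hmul f (X i) hf ?_
    by_cases ha : i = a
    · rw [ha, hXa]
    · by_cases hb : i = b
      · rw [hb, hXb]
      · exact hs _ (X_mem_symSub k ha hb)

lemma dq_rbElt (a b : Fin n) :
    bsDq k a b (rbElt k a b) + bsRight k a b (linForm k (rbTwist a b)) (rbElt k a b)
      = 0 := by
  have hX : ∀ i : Fin n, dPol k n (X i) = X i ^ 2 := fun i => MvPolynomial.mkDerivation_X _ _ _
  have h1 : bsDq k a b (rbElt k a b)
      = ((X b ^ 2) ⊗ₜ[symSub k a b] 1 - 1 ⊗ₜ[symSub k a b] (X a ^ 2) :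
        BS k a b) := by
    refine (map_sub (bsDq k a b)
      (X b ⊗ₜ[symSub k a b] 1 : BS k a b)
      (1 ⊗ₜ[symSub k a b] X a : BS k a b)).trans ?_
    rw [bsDq_tmul, bsDq_tmul, hX, hX, Derivation.map_one_eq_zero, TensorProduct.zero_tmul,
      TensorProduct.tmul_zero, add_zero, zero_add]
  have h2 : bsRight k a b (linForm k (rbTwist a b)) (rbElt k a b)
      = ((X b) ⊗ₜ[symSub k a b] (-(X a + X b)) - 1 ⊗ₜ[symSub k a b] (-(X a + X b) * X a) :
        BS k a b) := by
    rw [linForm_rbTwist]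
    refine (map_sub (bsRight k a b _)
      (X b ⊗ₜ[symSub k a b] 1 : BS k a b)
      (1 ⊗ₜ[symSub k a b] X a : BS k a b)).trans ?_
    rw [bsRight_tmul, bsRight_tmul, mul_one]
  rw [h1, h2]
  change ((X b ^ 2) ⊗ₜ[symSub k a b] 1 - 1 ⊗ₜ[symSub k a b] (X a ^ 2)
    + (X b ⊗ₜ[symSub k a b] (-(X a + X b)) - 1 ⊗ₜ[symSub k a b] (-(X a + X b) * X a)) :
        BS k a b) = 0
  have h3 := tmul_sym k (mul_mem_symSub k a b) 1 1
  have h4 := tmul_sym k (add_mem_symSub k a b) (X b) 1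
  simp only [mul_one, add_mul, TensorProduct.add_tmul, TensorProduct.tmul_add] at h3 h4
  rw [neg_mul, TensorProduct.tmul_neg, TensorProduct.tmul_neg, TensorProduct.tmul_add, ← h4, h3,
    add_mul, TensorProduct.tmul_add, pow_two, pow_two, mul_comm (X b) (X a)]
  abel

/-- The map `R_n → q^{-2} B^{-(x_a + x_b)}` sending `1` to `x_b ⊗ 1 - 1 ⊗ x_a`. -/
noncomputable def rb (a b : Fin n) :
    (reg k p n).Hom (((bs k p a b).twistRight (rbTwist a b)).qshift (-2)) where
  toLin := (LinearMap.applyₗ (rbElt k a b)).comp (bsLeft k a b).toLinearMap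
  map_left f (x : Pol k n) :=
    LinearMap.congr_fun (map_mul (bsLeft k a b) f x) (rbElt k a b)
  map_right f (x : Pol k n) := by
    have h : bsLeft k a b (f * x) (rbElt k a b)
        = bsRight k a b f (bsLeft k a b x (rbElt k a b)) := by
      rw [mul_comm, map_mul, Module.End.mul_apply, left_rbElt, bsLeft_bsRight]
    exact h
  map_dq (x : Pol k n) := by
    have h : bsLeft k a b (dPol k n x) (rbElt k a b) = bsDq k a b (bsLeft k a b x (rbElt k a b))
        + bsRight k a b (linForm k (rbTwist a b)) (bsLeft k a b x (rbElt k a b)) := by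
      rw [bsDq_bsLeft, ← bsLeft_bsRight, add_right_comm, ← map_add, dq_rbElt, map_zero, zero_add]
    exact h

end Soergel
section Tensor

variable {k : Type u} [Field k] {p n : ℕ}

/-- The underlying space of a bimodule, as an `R_n`-module through the right action. -/
def HBimod.AsRight (M : HBimod k p n) : Type u := M.carrier

/-- The underlying space of a bimodule, as an `R_n`-module through the left action. -/
def HBimod.AsLeft (M : HBimod k p n) : Type u := M.carrier

instance (M : HBimod k p n) : AddCommGroup M.AsRight := inferInstanceAs (AddCommGroup M.carrier)
instance (M : HBimod k p n) : AddCommGroup M.AsLeft := inferInstanceAs (AddCommGroup M.carrier)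
instance (M : HBimod k p n) : Module k M.AsRight := inferInstanceAs (Module k M.carrier)
instance (M : HBimod k p n) : Module k M.AsLeft := inferInstanceAs (Module k M.carrier)

noncomputable instance (M : HBimod k p n) : Module (Pol k n) M.AsRight :=
  Module.compHom M.carrier (M.right : Pol k n →+* Module.End k M.carrier)

noncomputable instance (M : HBimod k p n) : Module (Pol k n) M.AsLeft :=
  Module.compHom M.carrier (M.left : Pol k n →+* Module.End k M.carrier)

lemma HBimod.smul_asRight (M : HBimod k p n) (f : Pol k n) (m : M.AsRight) :
    f • m = (M.right f m : M.carrier) := rfl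

lemma HBimod.smul_asLeft (M : HBimod k p n) (f : Pol k n) (m : M.AsLeft) :
    f • m = (M.left f m : M.carrier) := rfl

instance (M : HBimod k p n) : IsScalarTower k (Pol k n) M.AsRight where
  smul_assoc c f m := LinearMap.congr_fun (map_smul M.right c f) m

instance (M : HBimod k p n) : IsScalarTower k (Pol k n) M.AsLeft where
  smul_assoc c f m := LinearMap.congr_fun (map_smul M.left c f) m

/-- The left action, on the space `AsRight`. -/
def HBimod.leftR (M : HBimod k p n) : Pol k n →ₐ[k] Module.End k M.AsRight := M.left

/-- The right action, on the space `AsLeft`. -/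
def HBimod.rightL (M : HBimod k p n) : Pol k n →ₐ[k] Module.End k M.AsLeft := M.right

/-- The operator `∂_q`, on the space `AsRight`. -/
def HBimod.dqR (M : HBimod k p n) : Module.End k M.AsRight := M.dq

/-- The operator `∂_q`, on the space `AsLeft`. -/
def HBimod.dqL (M : HBimod k p n) : Module.End k M.AsLeft := M.dq

/-- The `q`-grading, on the space `AsRight`. -/
def HBimod.grqR (M : HBimod k p n) : ℤ → Submodule k M.AsRight := M.grq

/-- The `q`-grading, on the space `AsLeft`. -/
def HBimod.grqL (M : HBimod k p n) : ℤ → Submodule k M.AsLeft := M.grq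

/-- The boundary map, on the space `AsRight`. -/
def PBimod.dtR (M : PBimod k p n) : Module.End k M.AsRight := M.dt

/-- The boundary map, on the space `AsLeft`. -/
def PBimod.dtL (M : PBimod k p n) : Module.End k M.AsLeft := M.dt

/-- The topological grading, on the space `AsRight`. -/
def PBimod.grtR (M : PBimod k p n) : ℤ → Submodule k M.AsRight := M.grt

/-- The topological grading, on the space `AsLeft`. -/
def PBimod.grtL (M : PBimod k p n) : ℤ → Submodule k M.AsLeft := M.grt

lemma HBimod.leftR_smul (M : HBimod k p n) (f r : Pol k n) (m : M.AsRight) :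
    M.leftR f (r • m) = r • M.leftR f m := LinearMap.congr_fun (M.left_right f r) m

lemma HBimod.rightL_smul (M : HBimod k p n) (f r : Pol k n) (m : M.AsLeft) :
    M.rightL f (r • m) = r • M.rightL f m := (LinearMap.congr_fun (M.left_right r f) m).symm

lemma HBimod.dqR_smul (M : HBimod k p n) (r : Pol k n) (m : M.AsRight) :
    M.dqR (r • m) = r • M.dqR m + dPol k n r • m := LinearMap.congr_fun (M.dq_right r) m

lemma HBimod.dqL_smul (M : HBimod k p n) (r : Pol k n) (m : M.AsLeft) :
    M.dqL (r • m) = r • M.dqL m + dPol k n r • m := LinearMap.congr_fun (M.dq_left r) m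

lemma HBimod.dqR_leftR (M : HBimod k p n) (f : Pol k n) (m : M.AsRight) :
    M.dqR (M.leftR f m) = M.leftR f (M.dqR m) + M.leftR (dPol k n f) m :=
  LinearMap.congr_fun (M.dq_left f) m

lemma HBimod.dqL_rightL (M : HBimod k p n) (f : Pol k n) (m : M.AsLeft) :
    M.dqL (M.rightL f m) = M.rightL f (M.dqL m) + M.rightL (dPol k n f) m :=
  LinearMap.congr_fun (M.dq_right f) m

lemma PBimod.dtR_smul (M : PBimod k p n) (r : Pol k n) (m : M.AsRight) :
    M.dtR (r • m) = r • M.dtR m + (0 : Pol k n) • m := by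
  rw [zero_smul, add_zero]; exact LinearMap.congr_fun (M.dt_right r) m

lemma PBimod.dtL_smul (M : PBimod k p n) (r : Pol k n) (m : M.AsLeft) :
    M.dtL (r • m) = r • M.dtL m + (0 : Pol k n) • m := by
  rw [zero_smul, add_zero]; exact LinearMap.congr_fun (M.dt_left r) m

lemma PBimod.dtR_leftR (M : PBimod k p n) (f : Pol k n) (m : M.AsRight) :
    M.dtR (M.leftR f m) = M.leftR f (M.dtR m) := LinearMap.congr_fun (M.dt_left f) m

lemma PBimod.dtL_rightL (M : PBimod k p n) (f : Pol k n) (m : M.AsLeft) :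
    M.dtL (M.rightL f m) = M.rightL f (M.dtL m) := LinearMap.congr_fun (M.dt_right f) m

lemma PBimod.dtR_dqR (M : PBimod k p n) (m : M.AsRight) : M.dtR (M.dqR m) = M.dqR (M.dtR m) :=
  LinearMap.congr_fun M.dt_dq m

lemma PBimod.dtL_dqL (M : PBimod k p n) (m : M.AsLeft) : M.dtL (M.dqL m) = M.dqL (M.dtL m) :=
  LinearMap.congr_fun M.dt_dq m

variable [Fact p.Prime] [CharP k p]

namespace PBimod

/-- The tensor product over `R_n` of two `p`-complexes of `(R_n, R_n) # H_q`-modules, with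
`∂_q` and `∂_0` acting by `∂ ⊗ 1 + 1 ⊗ ∂`. -/
noncomputable def tensor (M N : PBimod k p n) : PBimod k p n where
  carrier := M.AsRight ⊗[Pol k n] N.AsLeft
  left := actL M.leftR M.leftR_smul
  right := actR N.rightL N.rightL_smul
  left_right f g := tensor_ext fun x y => by
    simp only [Module.End.mul_apply, actL_tmul, actR_tmul]
  dq := tensorOp M.dqR N.dqL (dPol k n) M.dqR_smul N.dqL_smul
  dq_left f := tensor_ext fun x y => by
    simp only [Module.End.mul_apply, LinearMap.add_apply, actL_tmul,
      tensorOp_tmul, map_add, M.dqR_leftR, TensorProduct.add_tmul]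
    abel
  dq_right f := tensor_ext fun x y => by
    simp only [Module.End.mul_apply, LinearMap.add_apply, actR_tmul,
      tensorOp_tmul, map_add, N.dqL_rightL, TensorProduct.tmul_add]
    abel
  dq_pow := tensorOp_pow p _ _ _ _ _ M.dq_pow N.dq_pow
  grq := tensorGr M.grqR N.grqL
  dt := tensorOp M.dtR N.dtL (fun _ => 0) M.dtR_smul N.dtL_smul
  dt_left f := tensor_ext fun x y => by
    simp only [Module.End.mul_apply, actL_tmul, tensorOp_tmul, map_add, M.dtR_leftR]
  dt_right f := tensor_ext fun x y => by
    simp only [Module.End.mul_apply, actR_tmul, tensorOp_tmul, map_add, N.dtL_rightL]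
  dt_dq := tensor_ext fun x y => by
    simp only [Module.End.mul_apply, tensorOp_tmul, map_add, M.dtR_dqR, N.dtL_dqL]
    abel
  dt_pow := tensorOp_pow p _ _ _ _ _ M.dt_pow N.dt_pow
  grt := tensorGr M.grtR N.grtL

end PBimod

/-- The isomorphism `R_{n+1} ≅ R_n ⊗ k[x_{n+1}]`. -/
noncomputable def splitLast (k : Type u) [Field k] (n : ℕ) :
    Pol k (n + 1) →ₐ[k] Pol k n ⊗[k] Pol k 1 :=
  MvPolynomial.aeval (Fin.lastCases (1 ⊗ₜ X 0) fun i => X i ⊗ₜ 1)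

/-- The action of `R_{n+1}` on `V ⊗ k[x_{n+1}]` extending an action of `R_n` on `V`. -/
noncomputable def actExt {V : Type u} [AddCommGroup V] [Module k V]
    (ρ : Pol k n →ₐ[k] Module.End k V) :
    Pol k (n + 1) →ₐ[k] Module.End k (V ⊗[k] Pol k 1) :=
  ((Module.endTensorEndAlgHom (R := k) (S := k) (A := k) (M := V) (N := Pol k 1)).comp
    (Algebra.TensorProduct.map ρ (Algebra.lmul k (Pol k 1)))).comp (splitLast k n)

lemma actExt_last {V : Type u} [AddCommGroup V] [Module k V]
    (ρ : Pol k n →ₐ[k] Module.End k V) (v : V) (g : Pol k 1) :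
    actExt ρ (X (Fin.last n)) (v ⊗ₜ g) = v ⊗ₜ (X 0 * g) := by
  simp only [actExt, splitLast, AlgHom.comp_apply, MvPolynomial.aeval_X, Fin.lastCases_last,
    Algebra.TensorProduct.map_tmul, map_one]
  rfl

lemma actExt_castSucc {V : Type u} [AddCommGroup V] [Module k V]
    (ρ : Pol k n →ₐ[k] Module.End k V) (i : Fin n) (v : V) (g : Pol k 1) :
    actExt ρ (X i.castSucc) (v ⊗ₜ g) = ρ (X i) v ⊗ₜ g := by
  simp only [actExt, splitLast, AlgHom.comp_apply, MvPolynomial.aeval_X, Fin.lastCases_castSucc,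
    Algebra.TensorProduct.map_tmul, map_one]
  rfl

end Tensor

section Braid

variable {k : Type u} [Field k] {p n : ℕ} [Fact p.Prime] [CharP k p]

lemma actExt_comm {V : Type u} [AddCommGroup V] [Module k V]
    (ρ τ : Pol k n →ₐ[k] Module.End k V) (h : ∀ f g, ρ f * τ g = τ g * ρ f)
    (f g : Pol k (n + 1)) : actExt ρ f * actExt τ g = actExt τ g * actExt ρ f := by
  have key : ∀ z w : Pol k n ⊗[k] Pol k 1,
      Module.endTensorEndAlgHom (R := k) (S := k) (A := k) (M := V) (N := Pol k 1)
        (Algebra.TensorProduct.map ρ (Algebra.lmul k (Pol k 1)) z)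
      * Module.endTensorEndAlgHom (R := k) (S := k) (A := k) (M := V) (N := Pol k 1)
        (Algebra.TensorProduct.map τ (Algebra.lmul k (Pol k 1)) w)
      = Module.endTensorEndAlgHom (R := k) (S := k) (A := k) (M := V) (N := Pol k 1)
        (Algebra.TensorProduct.map τ (Algebra.lmul k (Pol k 1)) w)
      * Module.endTensorEndAlgHom (R := k) (S := k) (A := k) (M := V) (N := Pol k 1)
        (Algebra.TensorProduct.map ρ (Algebra.lmul k (Pol k 1)) z) := by
    intro z w
    induction z using TensorProduct.induction_on with
    | zero => simp
    | add a b ha hb => rw [map_add, map_add, add_mul, mul_add, ha, hb]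
    | tmul a b =>
      induction w using TensorProduct.induction_on with
      | zero => simp
      | add c d hc hd => rw [map_add, map_add, add_mul, mul_add, hc, hd]
      | tmul c d =>
        rw [← map_mul, ← map_mul, Algebra.TensorProduct.map_tmul, Algebra.TensorProduct.map_tmul,
          Algebra.TensorProduct.tmul_mul_tmul, Algebra.TensorProduct.tmul_mul_tmul, h,
          ← map_mul, ← map_mul, mul_comm b d]
  exact key _ _

/-- The operator `D ⊗ 1 + 1 ⊗ ∂_q` on `V ⊗ k[x_{n+1}]`. -/
noncomputable def dqExt {V : Type u} [AddCommGroup V] [Module k V] (D : Module.End k V) :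
    Module.End k (V ⊗[k] Pol k 1) :=
  tensorOp D (dPol k 1 : Pol k 1 →ₗ[k] Pol k 1) (fun _ : k => (0 : k))
    (fun r m => by simp) (fun r m => by simp)

lemma dqExt_tmul {V : Type u} [AddCommGroup V] [Module k V] (D : Module.End k V) (v : V)
    (g : Pol k 1) : dqExt D (v ⊗ₜ g) = D v ⊗ₜ g + v ⊗ₜ dPol k 1 g := rfl

lemma dqExt_actExt {V : Type u} [AddCommGroup V] [Module k V]
    (ρ : Pol k n →ₐ[k] Module.End k V) (D : Module.End k V)
    (h : ∀ f, D * ρ f = ρ f * D + ρ (dPol k n f)) (f : Pol k (n + 1)) :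
    dqExt D * actExt ρ f = actExt ρ f * dqExt D + actExt ρ (dPol k (n + 1) f) := by
  refine leibniz_of_X (actExt ρ) (dqExt D) (fun i => ?_) f
  have hX : ∀ {m : ℕ} (i : Fin m), dPol k m (X i) = X i ^ 2 :=
    fun i => MvPolynomial.mkDerivation_X _ _ _
  refine tensor_ext fun v g => ?_
  rw [map_pow, pow_two]
  induction i using Fin.lastCases with
  | last =>
    simp only [Module.End.mul_apply, LinearMap.add_apply, actExt_last, dqExt_tmul, map_add,
      Derivation.leibniz, hX, TensorProduct.tmul_add, smul_eq_mul, pow_two]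
    rw [add_assoc]
    congr 3
    ring
  | cast i =>
    have h1 : D (ρ (X i) v) = ρ (X i) (D v) + ρ (X i) (ρ (X i) v) := by
      have := LinearMap.congr_fun (h (X i)) v
      rwa [hX, map_pow, pow_two] at this
    simp only [Module.End.mul_apply, LinearMap.add_apply, actExt_castSucc, dqExt_tmul, map_add,
      h1, TensorProduct.add_tmul]
    abel

lemma rTensor_actExt {V : Type u} [AddCommGroup V] [Module k V]
    (ρ : Pol k n →ₐ[k] Module.End k V) (E : Module.End k V) (h : ∀ f, E * ρ f = ρ f * E)
    (f : Pol k (n + 1)) :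
    LinearMap.rTensor (Pol k 1) E * actExt ρ f = actExt ρ f * LinearMap.rTensor (Pol k 1) E := by
  have key : ∀ w : Pol k n ⊗[k] Pol k 1,
      LinearMap.rTensor (Pol k 1) E
        * Module.endTensorEndAlgHom (R := k) (S := k) (A := k) (M := V) (N := Pol k 1)
          (Algebra.TensorProduct.map ρ (Algebra.lmul k (Pol k 1)) w)
      = Module.endTensorEndAlgHom (R := k) (S := k) (A := k) (M := V) (N := Pol k 1)
          (Algebra.TensorProduct.map ρ (Algebra.lmul k (Pol k 1)) w)
        * LinearMap.rTensor (Pol k 1) E := by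
    intro w
    induction w using TensorProduct.induction_on with
    | zero => simp
    | add a b ha hb => rw [map_add, map_add, add_mul, mul_add, ha, hb]
    | tmul a b =>
      refine tensor_ext fun v g => ?_
      have ha : E (ρ a v) = ρ a (E v) := LinearMap.congr_fun (h a) v
      change E (ρ a v) ⊗ₜ[k] (b * g) = ρ a (E v) ⊗ₜ[k] (b * g)
      rw [ha]
  exact key _

/-- The `p`-complex `M ⊗ k[x_{n+1}]` of `(R_{n+1}, R_{n+1}) # H_q`-modules. -/
noncomputable def PBimod.adjoin (M : PBimod k p n) : PBimod k p (n + 1) where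
  carrier := M.carrier ⊗[k] Pol k 1
  left := actExt M.left
  right := actExt M.right
  left_right := actExt_comm M.left M.right M.left_right
  dq := dqExt M.dq
  dq_left := dqExt_actExt M.left M.dq M.dq_left
  dq_right := dqExt_actExt M.right M.dq M.dq_right
  dq_pow := tensorOp_pow p _ _ _ _ _ M.dq_pow (dPol_pow p 1)
  grq := tensorGr M.grq (polGr k 1)
  dt := LinearMap.rTensor (Pol k 1) M.dt
  dt_left := rTensor_actExt M.left M.dt M.dt_left
  dt_right := rTensor_actExt M.right M.dt M.dt_right
  dt_dq := tensor_ext fun v g => by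
    have h : M.dt (M.dq v) = M.dq (M.dt v) := LinearMap.congr_fun M.dt_dq v
    simp only [Module.End.mul_apply, dqExt_tmul, map_add, LinearMap.rTensor_tmul, h]
  dt_pow := by
    rw [LinearMap.rTensor_pow, M.dt_pow, LinearMap.rTensor_zero]
  grt := tensorGr M.grt fun j => if j = 0 then ⊤ else ⊥

/-- The `p`-complex `q^{-3} (B_i → R[-1]_∂)` of a positive crossing of the strands `i` and
`i + 1`. -/
noncomputable def pTpos (k : Type u) [Field k] (p : ℕ) [Fact p.Prime] [CharP k p] {m : ℕ}
    (i : Fin m) : PBimod k p (m + 1) :=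
  (br k p i.castSucc i.succ).low.qshift (-3)

/-- The `p`-complex `q^3 (R[1]_∂ → q^{-2} B_i^{-(x_i + x_{i+1})})` of a negative crossing of the
strands `i` and `i + 1`. -/
noncomputable def pTneg (k : Type u) [Field k] (p : ℕ) [Fact p.Prime] [CharP k p] {m : ℕ}
    (i : Fin m) : PBimod k p (m + 1) :=
  (rb k p i.castSucc i.succ).high.qshift 3

/-- The `p`-complex of a braid on `m + 1` strands, given as a word in the generators (a pair
`(i, true)` stands for the `i`-th generator and `(i, false)` for its inverse). -/
noncomputable def pT (k : Type u) [Field k] (p : ℕ) [Fact p.Prime] [CharP k p] {m : ℕ} :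
    List (Fin m × Bool) → PBimod k p (m + 1)
  | [] => (reg k p (m + 1)).toPBimod (Fact.out : p.Prime).ne_zero
  | (i, true) :: w => (pTpos k p i).tensor (pT k p w)
  | (i, false) :: w => (pTneg k p i).tensor (pT k p w)

end Braid

section Slash

variable {k : Type u} [Field k] {V : Type u} [AddCommGroup V] [Module k V]

/-- The subspace of `ker D^{j+1}` cut out by `im D^{p-j-1} + ker D^j`. -/
def slashDenom (p : ℕ) (D : Module.End k V) (j : ℕ) :
    Submodule k (LinearMap.ker (D ^ (j + 1))) :=
  (LinearMap.range (D ^ (p - j - 1)) ⊔ LinearMap.ker (D ^ j)).comap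
    (LinearMap.ker (D ^ (j + 1))).subtype

/-- The component `ker D^{j+1} / (im D^{p-j-1} + ker D^j)` of slash homology. -/
abbrev SlashPiece (p : ℕ) (D : Module.End k V) (j : ℕ) : Type u :=
  LinearMap.ker (D ^ (j + 1)) ⧸ slashDenom p D j

/-- The slash homology of the `p`-complex `(V, D)`: the direct sum over `0 ≤ j ≤ p - 2` of
`ker D^{j+1} / (im D^{p-j-1} + ker D^j)`. -/
abbrev Slash (p : ℕ) (D : Module.End k V) : Type u := ∀ j : Fin (p - 1), SlashPiece p D j

namespace Slash

lemma pow_apply_comm {D f : Module.End k V} (h : f * D = D * f) (r : ℕ) (v : V) :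
    (D ^ r) (f v) = f ((D ^ r) v) :=
  (LinearMap.congr_fun (Commute.pow_right (show Commute f D from h) r) v).symm

/-- The map induced on `ker D^{j+1} / (im D^{p-j-1} + ker D^j)` by an operator commuting
with `D`. -/
def mapPiece (p : ℕ) (D f : Module.End k V) (h : f * D = D * f) (j : ℕ) :
    Module.End k (SlashPiece p D j) :=
  Submodule.mapQ _ _
    (f.restrict (p := LinearMap.ker (D ^ (j + 1))) (q := LinearMap.ker (D ^ (j + 1)))
      (fun v hv => by rw [LinearMap.mem_ker] at hv ⊢; rw [pow_apply_comm h, hv, map_zero]))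
    (by
      rintro ⟨v, hv⟩ hv'
      obtain ⟨a, ⟨b, rfl⟩, c, hc, hac⟩ := Submodule.mem_sup.mp (show v ∈ _ from hv')
      refine Submodule.mem_sup.mpr ⟨f ((D ^ (p - j - 1)) b), ⟨f b, pow_apply_comm h _ _⟩, f c, ?_, ?_⟩
      · rw [LinearMap.mem_ker] at hc ⊢
        rw [pow_apply_comm h, hc, map_zero]
      · rw [← map_add, hac]; rfl)

/-- The map induced on slash homology by an operator commuting with `D`. -/
def map (p : ℕ) (D f : Module.End k V) (h : f * D = D * f) : Module.End k (Slash p D) :=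
  LinearMap.pi fun j => (mapPiece p D f h j).comp (LinearMap.proj j)

lemma map_apply {p : ℕ} {D f : Module.End k V} (h : f * D = D * f) (x : Slash p D)
    (j : Fin (p - 1)) : map p D f h x j = mapPiece p D f h j (x j) := rfl

lemma map_mul' {p : ℕ} {D f g : Module.End k V} (hf : f * D = D * f) (hg : g * D = D * g)
    (h : f * g * D = D * (f * g)) : map p D (f * g) h = map p D f hf * map p D g hg := by
  refine LinearMap.ext fun x => funext fun j => ?_
  rw [Module.End.mul_apply, map_apply, map_apply, map_apply]
  obtain ⟨v, hv⟩ := Submodule.Quotient.mk_surjective _ (x j)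
  rw [← hv]; rfl

lemma map_add' {p : ℕ} {D f g : Module.End k V} (hf : f * D = D * f) (hg : g * D = D * g)
    (h : (f + g) * D = D * (f + g)) : map p D (f + g) h = map p D f hf + map p D g hg := by
  refine LinearMap.ext fun x => funext fun j => ?_
  rw [LinearMap.add_apply, Pi.add_apply, map_apply, map_apply, map_apply]
  obtain ⟨v, hv⟩ := Submodule.Quotient.mk_surjective _ (x j)
  rw [← hv]; rfl

lemma map_smul' {p : ℕ} {D f : Module.End k V} (c : k) (hf : f * D = D * f)
    (h : (c • f) * D = D * (c • f)) : map p D (c • f) h = c • map p D f hf := by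
  refine LinearMap.ext fun x => funext fun j => ?_
  rw [LinearMap.smul_apply, Pi.smul_apply, map_apply, map_apply]
  obtain ⟨v, hv⟩ := Submodule.Quotient.mk_surjective _ (x j)
  rw [← hv]; rfl

lemma map_one' {p : ℕ} {D : Module.End k V} (h : 1 * D = D * 1) : map p D 1 h = 1 := by
  refine LinearMap.ext fun x => funext fun j => ?_
  rw [map_apply, Module.End.one_apply]
  obtain ⟨v, hv⟩ := Submodule.Quotient.mk_surjective _ (x j)
  rw [← hv]; rfl

lemma map_zero' {p : ℕ} {D f : Module.End k V} (hf : f = 0) (h : f * D = D * f) :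
    map p D f h = 0 := by
  subst hf
  refine LinearMap.ext fun x => funext fun j => ?_
  rw [map_apply]
  obtain ⟨v, hv⟩ := Submodule.Quotient.mk_surjective _ (x j)
  rw [← hv]; rfl

lemma map_congr {p : ℕ} {D f g : Module.End k V} (hfg : f = g) (hf : f * D = D * f)
    (hg : g * D = D * g) : map p D f hf = map p D g hg := by
  subst hfg; rfl

lemma map_comm {p : ℕ} {D f g : Module.End k V} (hf : f * D = D * f) (hg : g * D = D * g)
    (h : f * g = g * f) : map p D f hf * map p D g hg = map p D g hg * map p D f hf := by
  have h1 : f * g * D = D * (f * g) := (show Commute f D from hf).mul_left hg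
  have h2 : g * f * D = D * (g * f) := (show Commute g D from hg).mul_left hf
  rw [← map_mul' hf hg h1, ← map_mul' hg hf h2, map_congr h h1 h2]

lemma map_pow' {p : ℕ} {D f : Module.End k V} (hf : f * D = D * f) (r : ℕ)
    (h : f ^ r * D = D * f ^ r) : map p D (f ^ r) h = map p D f hf ^ r := by
  induction r with
  | zero => exact map_one' _
  | succ r ih =>
    have h1 : f ^ r * D = D * f ^ r := (show Commute f D from hf).pow_left r
    have h2 : f ^ r * f * D = D * (f ^ r * f) := (show Commute _ _ from h1).mul_left hf
    rw [pow_succ (map p D f hf), ← ih h1, ← map_mul' h1 hf h2]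
    exact map_congr (pow_succ f r) _ _

/-- The action induced on slash homology by an action commuting with `D`. -/
def mapAct (p : ℕ) (D : Module.End k V) {A : Type*} [Semiring A] [Algebra k A]
    (ρ : A →ₐ[k] Module.End k V) (h : ∀ a, ρ a * D = D * ρ a) :
    A →ₐ[k] Module.End k (Slash p D) :=
  AlgHom.ofLinearMap
    { toFun := fun a => map p D (ρ a) (h a)
      map_add' := fun a b => by
        rw [← map_add' (h a) (h b) (by rw [← map_add]; exact h _)]
        exact map_congr (map_add ρ a b) _ _
      map_smul' := fun c a => by
        rw [RingHom.id_apply, ← map_smul' c (h a) (by rw [← map_smul]; exact h _)]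
        exact map_congr (map_smul ρ c a) _ _ }
    ((map_congr (map_one ρ) (h 1) ((one_mul D).trans (mul_one D).symm)).trans (map_one' _))
    (fun a b => by
      change map p D (ρ (a * b)) _ = map p D (ρ a) _ * map p D (ρ b) _
      rw [← map_mul' (h a) (h b) (by rw [← map_mul]; exact h _)]
      exact map_congr (map_mul ρ a b) _ _)

lemma mapAct_apply (p : ℕ) (D : Module.End k V) {A : Type*} [Semiring A] [Algebra k A]
    (ρ : A →ₐ[k] Module.End k V) (h : ∀ a, ρ a * D = D * ρ a) (a : A) :
    mapAct p D ρ h a = map p D (ρ a) (h a) := rfl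

/-- The map from the component with index `j + 1` to the one with index `j` induced by `D`. -/
def resPiece (p : ℕ) (D : Module.End k V) (j : ℕ) (hj : j + 1 < p - 1) :
    SlashPiece p D (j + 1) →ₗ[k] SlashPiece p D j :=
  Submodule.mapQ _ _
    (D.restrict (p := LinearMap.ker (D ^ (j + 1 + 1))) (q := LinearMap.ker (D ^ (j + 1)))
      (fun v hv => by
        rw [LinearMap.mem_ker] at hv ⊢; rw [← Module.End.mul_apply, ← pow_succ, hv]))
    (by
      rintro ⟨v, hv⟩ hv'
      obtain ⟨a, ⟨b, rfl⟩, c, hc, hac⟩ := Submodule.mem_sup.mp (show v ∈ _ from hv')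
      refine Submodule.mem_sup.mpr ⟨D ((D ^ (p - (j + 1) - 1)) b), ⟨b, ?_⟩, D c, ?_, ?_⟩
      · rw [← Module.End.mul_apply, ← pow_succ']
        congr 2
        omega
      · rw [LinearMap.mem_ker] at hc ⊢
        rw [← Module.End.mul_apply, ← pow_succ, hc]
      · rw [← map_add, hac]; rfl)

/-- The residual `p`-differential on slash homology, induced by `D`. -/
def res (p : ℕ) (D : Module.End k V) : Module.End k (Slash p D) :=
  LinearMap.pi fun j =>
    if h : (j : ℕ) + 1 < p - 1 then
      (resPiece p D j h).comp (LinearMap.proj (⟨(j : ℕ) + 1, h⟩ : Fin (p - 1)))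
    else 0

lemma res_apply_of_lt {p : ℕ} {D : Module.End k V} (x : Slash p D) (j : Fin (p - 1))
    (h : (j : ℕ) + 1 < p - 1) : res p D x j = resPiece p D j h (x ⟨(j : ℕ) + 1, h⟩) := by
  simp only [res, LinearMap.pi_apply, dif_pos h]; rfl

lemma res_apply_of_not_lt {p : ℕ} {D : Module.End k V} (x : Slash p D) (j : Fin (p - 1))
    (h : ¬ (j : ℕ) + 1 < p - 1) : res p D x j = 0 := by
  simp only [res, LinearMap.pi_apply, dif_neg h]; rfl

lemma map_res {p : ℕ} {D f : Module.End k V} (hf : f * D = D * f) :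
    map p D f hf * res p D = res p D * map p D f hf := by
  refine LinearMap.ext fun x => funext fun j => ?_
  rw [Module.End.mul_apply, Module.End.mul_apply, map_apply]
  by_cases h : (j : ℕ) + 1 < p - 1
  · rw [res_apply_of_lt _ _ h, res_apply_of_lt _ _ h, map_apply]
    obtain ⟨v, hv⟩ := Submodule.Quotient.mk_surjective _ (x ⟨(j : ℕ) + 1, h⟩)
    rw [← hv]
    refine congrArg Submodule.Quotient.mk (Subtype.ext ?_)
    exact LinearMap.congr_fun hf v
  · rw [res_apply_of_not_lt _ _ h, res_apply_of_not_lt _ _ h, map_zero]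

lemma res_pow (p : ℕ) (hp : 1 ≤ p) (D : Module.End k V) : res p D ^ p = 0 := by
  have h : ∀ r x, ∀ j : Fin (p - 1), p - 1 ≤ (j : ℕ) + r → ((res p D ^ r) x) j = 0 := by
    intro r
    induction r with
    | zero => intro x j hj; omega
    | succ r ih =>
      intro x j hj
      rw [pow_succ', Module.End.mul_apply]
      by_cases h0 : (j : ℕ) + 1 < p - 1
      · rw [res_apply_of_lt _ _ h0, ih x _ (by simp only; omega), map_zero]
      · rw [res_apply_of_not_lt _ _ h0]
  exact LinearMap.ext fun x => funext fun j => h p x j (by omega)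

/-- The classes in slash homology of representatives in a given subspace. -/
def gr (p : ℕ) (D : Module.End k V) (S : Submodule k V) : Submodule k (Slash p D) :=
  Submodule.pi Set.univ fun j : Fin (p - 1) =>
    (S.comap (LinearMap.ker (D ^ ((j : ℕ) + 1))).subtype).map (slashDenom p D j).mkQ

end Slash

end Slash

section Koszul

variable {k : Type u} [Field k] {p n : ℕ}

/-- The space underlying the tensor product over `(R_n, R_n)` of the `p`-Koszul complex with a
bimodule. The factor of the `p`-Koszul complex belonging to `x_i` is free over
`k[x_i] ⊗ k[x_i]` on generators `e_0, …, e_{p-1}`, and a coordinate `a` records the generator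
`e_{a_1} ⊗ ⋯ ⊗ e_{a_n}`. -/
abbrev Kos (M : PBimod k p n) : Type u := (Fin n → Fin p) → M.carrier

/-- The sum of the variables `x_i` with `a_i ≠ 0`. -/
noncomputable def kosForm (k : Type u) [Field k] {p n : ℕ} (a : Fin n → Fin p) : Pol k n :=
  linForm k fun i => if (a i : ℕ) = 0 then 0 else 1

/-- The vertical differential in the direction of `x_i`: it sends `e_1` to
`(x_i ⊗ 1 - 1 ⊗ x_i) e_0` and `e_{s+1}` to `e_s` for `s ≥ 1`. -/
noncomputable def kosHi (M : PBimod k p n) (i : Fin n) : Module.End k (Kos M) :=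
  LinearMap.pi fun a =>
    if h : (a i : ℕ) + 1 < p then
      (if (a i : ℕ) = 0 then M.left (X i) - M.right (X i) else 1 : Module.End k M.carrier).comp
        (LinearMap.proj (Function.update a i ⟨(a i : ℕ) + 1, h⟩))
    else 0

/-- The vertical (Hochschild) differential. -/
noncomputable def kosH (M : PBimod k p n) : Module.End k (Kos M) := ∑ i, kosHi M i

/-- The horizontal (topological) differential. -/
noncomputable def kosT (M : PBimod k p n) : Module.End k (Kos M) :=
  M.dt.compLeft (Fin n → Fin p)

/-- The operator `∂_q`: the generators `e_1, …, e_{p-1}` belonging to `x_i` are twisted by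
`x_i ⊗ 1 + 1 ⊗ x_i`. -/
noncomputable def kosQ (M : PBimod k p n) : Module.End k (Kos M) :=
  LinearMap.pi fun a =>
    (M.dq + M.left (kosForm k a) + M.right (kosForm k a)).comp (LinearMap.proj a)

/-- The right action of `R_n`. -/
noncomputable def kosAct (M : PBimod k p n) : Pol k n →ₐ[k] Module.End k (Kos M) :=
  AlgHom.ofLinearMap
    { toFun := fun f => (M.right f).compLeft (Fin n → Fin p)
      map_add' := fun f g => by
        refine LinearMap.ext fun w => funext fun a => ?_
        simp
      map_smul' := fun c f => by
        refine LinearMap.ext fun w => funext fun a => ?_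
        simp }
    (LinearMap.ext fun w => funext fun a => by simp)
    (fun f g => LinearMap.ext fun w => funext fun a => by simp)

/-- The collapsed topological degree: `e_s` has degree `s`. -/
def kosGrT (M : PBimod k p n) (i : ℤ) : Submodule k (Kos M) :=
  Submodule.pi Set.univ fun a : Fin n → Fin p => M.grt (i - ∑ s, ((a s : ℕ) : ℤ))

/-- The Hochschild degree: `e_s` has degree `s`. -/
def kosGrA (M : PBimod k p n) (d : ℕ) : Submodule k (Kos M) :=
  Submodule.pi Set.univ fun a : Fin n → Fin p => if ∑ s, (a s : ℕ) = d then ⊤ else ⊥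

/-- The internal `q`-degree, preserved by all differentials: `e_s` has degree two for `s ≥ 1`,
and `e_0` has degree zero. -/
def kosGrQ (M : PBimod k p n) (j : ℤ) : Submodule k (Kos M) :=
  Submodule.pi Set.univ fun a : Fin n → Fin p =>
    M.grq (j - ∑ s, if (a s : ℕ) = 0 then 0 else 2)

/-- The ordinary Hochschild degree corresponding to the degree `d` of a `p`-extended complex:
the degrees `(r-1) p + 1, …, r p - 1` correspond to `2 r - 1`, and `r p` corresponds to `2 r`. -/
def hochDeg (p d : ℕ) : ℕ := 2 * (d / p) + if d % p = 0 then 0 else 1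

lemma kosHi_apply_of_lt (M : PBimod k p n) (i : Fin n) (w : Kos M) (a : Fin n → Fin p)
    (h : (a i : ℕ) + 1 < p) : kosHi M i w a
      = (if (a i : ℕ) = 0 then M.left (X i) - M.right (X i) else 1 : Module.End k M.carrier)
        (w (Function.update a i ⟨(a i : ℕ) + 1, h⟩)) := by
  simp only [kosHi, LinearMap.pi_apply, dif_pos h]; rfl

lemma kosHi_apply_of_not_lt (M : PBimod k p n) (i : Fin n) (w : Kos M) (a : Fin n → Fin p)
    (h : ¬ (a i : ℕ) + 1 < p) : kosHi M i w a = 0 := by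
  simp only [kosHi, LinearMap.pi_apply, dif_neg h]; rfl

lemma kosT_kosH (M : PBimod k p n) : kosT M * kosH M = kosH M * kosT M := by
  rw [kosH, Finset.mul_sum, Finset.sum_mul]
  refine Finset.sum_congr rfl fun i _ => LinearMap.ext fun w => funext fun a => ?_
  change M.dt (kosHi M i w a) = kosHi M i (kosT M w) a
  by_cases h : (a i : ℕ) + 1 < p
  · rw [kosHi_apply_of_lt _ _ _ _ h, kosHi_apply_of_lt _ _ _ _ h]
    have h1 := fun x => LinearMap.congr_fun (M.dt_left (X i)) x
    have h2 := fun x => LinearMap.congr_fun (M.dt_right (X i)) x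
    simp only [Module.End.mul_apply] at h1 h2
    by_cases h0 : (a i : ℕ) = 0
    · simp [h0, kosT, h1, h2]
    · simp [h0, kosT]
  · rw [kosHi_apply_of_not_lt _ _ _ _ h, kosHi_apply_of_not_lt _ _ _ _ h, map_zero]

lemma kosAct_kosH (M : PBimod k p n) (f : Pol k n) :
    kosAct M f * kosH M = kosH M * kosAct M f := by
  rw [kosH, Finset.mul_sum, Finset.sum_mul]
  refine Finset.sum_congr rfl fun i _ => LinearMap.ext fun w => funext fun a => ?_
  change M.right f (kosHi M i w a) = kosHi M i (kosAct M f w) a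
  by_cases h : (a i : ℕ) + 1 < p
  · rw [kosHi_apply_of_lt _ _ _ _ h, kosHi_apply_of_lt _ _ _ _ h]
    have h1 := fun x => LinearMap.congr_fun (M.left_right (X i) f) x
    have h2 : ∀ x, M.right (X i) (M.right f x) = M.right f (M.right (X i) x) := fun x => by
      rw [← Module.End.mul_apply, ← map_mul, mul_comm, map_mul]; rfl
    simp only [Module.End.mul_apply] at h1
    by_cases h0 : (a i : ℕ) = 0
    · simp [h0, kosAct, h1, h2]
    · simp [h0, kosAct]
  · rw [kosHi_apply_of_not_lt _ _ _ _ h, kosHi_apply_of_not_lt _ _ _ _ h, map_zero]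

lemma kosForm_update (a : Fin n → Fin p) (i : Fin n) (h : (a i : ℕ) + 1 < p) :
    kosForm k (Function.update a i ⟨(a i : ℕ) + 1, h⟩)
      = kosForm k a + if (a i : ℕ) = 0 then X i else 0 := by
  simp only [kosForm, linForm]
  rw [← Finset.add_sum_erase _ _ (Finset.mem_univ i),
    ← Finset.add_sum_erase (a := i) Finset.univ _ (Finset.mem_univ i)]
  have h1 : ∀ s ∈ Finset.univ.erase i,
      (if ((Function.update a i ⟨(a i : ℕ) + 1, h⟩ s : Fin p) : ℕ) = 0 then (0 : ℤ) else 1)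
        • (X s : Pol k n) = (if ((a s : Fin p) : ℕ) = 0 then (0 : ℤ) else 1) • X s := by
    intro s hs
    rw [Function.update_of_ne (Finset.ne_of_mem_erase hs)]
  rw [Finset.sum_congr rfl h1]
  by_cases h0 : (a i : ℕ) = 0
  · simp [h0]; ring
  · simp [h0]

lemma kosQ_kosH (M : PBimod k p n) : kosQ M * kosH M = kosH M * kosQ M := by
  rw [kosH, Finset.mul_sum, Finset.sum_mul]
  refine Finset.sum_congr rfl fun i _ => LinearMap.ext fun w => funext fun a => ?_
  change (M.dq + M.left (kosForm k a) + M.right (kosForm k a)) (kosHi M i w a)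
    = kosHi M i (kosQ M w) a
  have hX : dPol k n (X i) = X i ^ 2 := MvPolynomial.mkDerivation_X _ _ _
  by_cases h : (a i : ℕ) + 1 < p
  · rw [kosHi_apply_of_lt _ _ _ _ h, kosHi_apply_of_lt _ _ _ _ h]
    change _ = (if (a i : ℕ) = 0 then M.left (X i) - M.right (X i) else 1)
      ((M.dq + M.left (kosForm k (Function.update a i ⟨(a i : ℕ) + 1, h⟩))
        + M.right (kosForm k (Function.update a i ⟨(a i : ℕ) + 1, h⟩))) (w _))
    rw [kosForm_update a i h, ← Module.End.mul_apply, ← Module.End.mul_apply]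
    refine LinearMap.congr_fun ?_ _
    by_cases h0 : (a i : ℕ) = 0
    · simp only [h0, if_true, map_add]
      have e1 := M.dq_left (X i)
      have e2 := M.dq_right (X i)
      rw [hX, pow_two, map_mul] at e1 e2
      have e3 : M.left (kosForm k a) * M.left (X i) = M.left (X i) * M.left (kosForm k a) := by
        rw [← map_mul, mul_comm, map_mul]
      have e4 : M.right (kosForm k a) * M.right (X i)
          = M.right (X i) * M.right (kosForm k a) := by
        rw [← map_mul, mul_comm, map_mul]
      have e5 := M.left_right (X i) (kosForm k a)
      have e6 := M.left_right (kosForm k a) (X i)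
      have e7 := M.left_right (X i) (X i)
      simp only [add_mul, mul_add, sub_mul, mul_sub]
      rw [e1, e2, e3, e4, ← e5, ← e6, e7]
      abel
    · simp only [h0, if_false, add_zero, mul_one, one_mul]
  · rw [kosHi_apply_of_not_lt _ _ _ _ h, kosHi_apply_of_not_lt _ _ _ _ h, map_zero]

lemma kosT_kosQ (M : PBimod k p n) : kosT M * kosQ M = kosQ M * kosT M := by
  refine LinearMap.ext fun w => funext fun a => ?_
  change (M.dt * (M.dq + M.left (kosForm k a) + M.right (kosForm k a))) (w a)
    = ((M.dq + M.left (kosForm k a) + M.right (kosForm k a)) * M.dt) (w a)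
  rw [mul_add, mul_add, M.dt_dq, M.dt_left, M.dt_right, add_mul, add_mul]

lemma kosT_kosAct (M : PBimod k p n) (f : Pol k n) :
    kosT M * kosAct M f = kosAct M f * kosT M :=
  LinearMap.ext fun w => funext fun a => LinearMap.congr_fun (M.dt_right f) (w a)

lemma kosQ_kosAct (M : PBimod k p n) (f : Pol k n) :
    kosQ M * kosAct M f = kosAct M f * kosQ M + kosAct M (dPol k n f) := by
  refine LinearMap.ext fun w => funext fun a => ?_
  change ((M.dq + M.left (kosForm k a) + M.right (kosForm k a)) * M.right f) (w a)
    = (M.right f * (M.dq + M.left (kosForm k a) + M.right (kosForm k a))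
      + M.right (dPol k n f)) (w a)
  rw [add_mul, add_mul, M.dq_right, M.left_right, ← map_mul, mul_comm _ f, map_mul, mul_add,
    mul_add]
  refine LinearMap.congr_fun ?_ _
  abel

lemma kosQ_pow [Fact p.Prime] [CharP k p] (M : PBimod k p n) : kosQ M ^ p = 0 := by
  have h : ∀ r w a, (kosQ M ^ r) w a
      = ((M.dq + M.left (kosForm k a) + M.right (kosForm k a)) ^ r) (w a) := by
    intro r
    induction r with
    | zero => intro w a; rfl
    | succ r ih => intro w a; rw [pow_succ, pow_succ, Module.End.mul_apply, ih]; rfl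
  refine LinearMap.ext fun w => funext fun a => ?_
  rw [h]
  have h1 : (M.dq + M.left (kosForm k a)) ^ p = 0 :=
    twist_pow p M.left M.dq M.dq_left M.dq_pow _
  have h2 : (M.dq + M.left (kosForm k a) + M.right (kosForm k a)) ^ p = 0 :=
    twist_pow p M.right (M.dq + M.left (kosForm k a)) (fun f => by
      rw [add_mul, M.dq_right, M.left_right, mul_add]; abel) h1 _
  rw [h2]; rfl

end Koszul

section Homology

variable {k : Type u} [Field k] {p n : ℕ}

/-- `p`-complexes of graded `R_n # H_q`-modules, encoded like `PBimod`. -/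
structure PMod (k : Type u) [Field k] (p n : ℕ) where
  carrier : Type u
  [addCommGroup : AddCommGroup carrier]
  [module : Module k carrier]
  act : Pol k n →ₐ[k] Module.End k carrier
  dq : Module.End k carrier
  dq_act : ∀ f, dq * act f = act f * dq + act (dPol k n f)
  dq_pow : dq ^ p = 0
  dt : Module.End k carrier
  dt_act : ∀ f, dt * act f = act f * dt
  dt_dq : dt * dq = dq * dt
  dt_pow : dt ^ p = 0
  grq : ℤ → Submodule k carrier
  grt : ℤ → Submodule k carrier

attribute [instance] PMod.addCommGroup PMod.module

/-- The twist `V^f` by the linear form `f = ∑ c_i x_i`: the action of `∂_q` is changed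
by adding the multiplication by `f`. -/
noncomputable def PMod.twist [Fact p.Prime] [CharP k p] (V : PMod k p n) (c : Fin n → ℤ) :
    PMod k p n :=
  { V with
    dq := V.dq + V.act (linForm k c)
    dq_act := fun f => by
      rw [add_mul, V.dq_act, ← map_mul, mul_comm (linForm k c), map_mul, mul_add]; abel
    dq_pow := twist_pow p V.act V.dq V.dq_act V.dq_pow c
    dt_dq := by rw [mul_add, add_mul, V.dt_dq, V.dt_act] }

/-- Isomorphisms of bigraded `H_q`-modules compatible with the topological
`p`-differentials. -/
structure HqIso {n' : ℕ} (V : PMod k p n) (W : PMod k p n') where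
  toEquiv : V.carrier ≃ₗ[k] W.carrier
  map_dq : ∀ x, toEquiv (V.dq x) = W.dq (toEquiv x)
  map_dt : ∀ x, toEquiv (V.dt x) = W.dt (toEquiv x)
  map_grq : ∀ j, (V.grq j).map toEquiv.toLinearMap = W.grq j
  map_grt : ∀ i, (V.grt i).map toEquiv.toLinearMap = W.grt i

/-- The total `p`-differential on `p`-Hochschild homology after collapsing the Hochschild and the
topological grading: the sum of the map induced by the boundary maps of the complex of bimodules
and of the residual Hochschild `p`-differential. -/
noncomputable def totalD (M : PBimod k p n) : Module.End k (Slash p (kosH M)) :=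
  Slash.map p (kosH M) (kosT M) (kosT_kosH M) + Slash.res p (kosH M)

lemma map_totalD (M : PBimod k p n) (f : Module.End k (Kos M))
    (h : f * kosH M = kosH M * f) (h' : f * kosT M = kosT M * f) :
    Slash.map p (kosH M) f h * totalD M = totalD M * Slash.map p (kosH M) f h := by
  rw [totalD, mul_add, add_mul, Slash.map_comm h (kosT_kosH M) h', Slash.map_res h]

/-- The collapsed `q`-grading of `p`-Hochschild homology: under `a = q^2 t`, a class of internal
`q`-degree `j` and Hochschild degree `d` has collapsed `q`-degree `j + 2 N`, where `N` is the
ordinary Hochschild degree corresponding to `d`. -/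
noncomputable def pHHGrQ (M : PBimod k p n) (j : ℤ) : Submodule k (Slash p (kosH M)) :=
  ⨆ d : ℕ, Slash.gr p (kosH M) (kosGrA M d ⊓ kosGrQ M (j - 2 * (hochDeg p d : ℤ)))

/-- The collapsed topological grading of `p`-Hochschild homology. -/
noncomputable def pHHGrT (M : PBimod k p n) (i : ℤ) : Submodule k (Slash p (kosH M)) :=
  Slash.gr p (kosH M) (kosGrT M i)

/-- The operator `∂_q` on `p`-Hochschild homology. -/
noncomputable def pHHQ (M : PBimod k p n) : Module.End k (Slash p (kosH M)) :=
  Slash.map p (kosH M) (kosQ M) (kosQ_kosH M)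

/-- The action of `R_n` on `p`-Hochschild homology. -/
noncomputable def pHHAct (M : PBimod k p n) :
    Pol k n →ₐ[k] Module.End k (Slash p (kosH M)) :=
  Slash.mapAct p (kosH M) (kosAct M) (kosAct_kosH M)

lemma pHHQ_totalD (M : PBimod k p n) : pHHQ M * totalD M = totalD M * pHHQ M :=
  map_totalD M _ _ (kosT_kosQ M).symm

lemma pHHAct_totalD (M : PBimod k p n) (f : Pol k n) :
    pHHAct M f * totalD M = totalD M * pHHAct M f :=
  map_totalD M (kosAct M f) (kosAct_kosH M f) (kosT_kosAct M f).symm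

lemma pHHQ_pHHAct (M : PBimod k p n) (f : Pol k n) :
    pHHQ M * pHHAct M f = pHHAct M f * pHHQ M + pHHAct M (dPol k n f) := by
  have c1 : kosQ M * kosAct M f * kosH M = kosH M * (kosQ M * kosAct M f) := by
    rw [mul_assoc, kosAct_kosH, ← mul_assoc, kosQ_kosH, mul_assoc]
  have c2 : kosAct M f * kosQ M * kosH M = kosH M * (kosAct M f * kosQ M) := by
    rw [mul_assoc, kosQ_kosH, ← mul_assoc, kosAct_kosH, mul_assoc]
  have c3 : (kosAct M f * kosQ M + kosAct M (dPol k n f)) * kosH M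
      = kosH M * (kosAct M f * kosQ M + kosAct M (dPol k n f)) := by
    rw [add_mul, mul_add, c2, kosAct_kosH]
  simp only [pHHQ, pHHAct, Slash.mapAct_apply]
  rw [← Slash.map_mul' (kosQ_kosH M) (kosAct_kosH M f) c1,
    ← Slash.map_mul' (kosAct_kosH M f) (kosQ_kosH M) c2,
    ← Slash.map_add' c2 (kosAct_kosH M _) c3]
  exact Slash.map_congr (kosQ_kosAct M f) _ _

lemma pHHQ_pow [Fact p.Prime] [CharP k p] (M : PBimod k p n) : pHHQ M ^ p = 0 := by
  have c1 := (show Commute _ _ from kosQ_kosH M).pow_left p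
  rw [pHHQ, ← Slash.map_pow' (kosQ_kosH M) p c1]
  exact Slash.map_zero' (kosQ_pow M) _

/-- The `p`-homology `q^{-n} H(pHH(M), ∂)` of a `p`-complex of bimodules over `R_n`:
slash homology of the `p`-Hochschild homology with respect to the total `p`-differential. -/
noncomputable def pHHH [Fact p.Prime] [CharP k p] (M : PBimod k p n) : PMod k p n where
  carrier := Slash p (totalD M)
  act := Slash.mapAct p (totalD M) (pHHAct M) (pHHAct_totalD M)
  dq := Slash.map p (totalD M) (pHHQ M) (pHHQ_totalD M)
  dq_act f := by
    have c1 := (show Commute _ _ from pHHQ_totalD M).mul_left (pHHAct_totalD M f)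
    have c2 := (show Commute _ _ from pHHAct_totalD M f).mul_left (pHHQ_totalD M)
    simp only [Slash.mapAct_apply]
    rw [← Slash.map_mul' (pHHQ_totalD M) (pHHAct_totalD M f) c1,
      ← Slash.map_mul' (pHHAct_totalD M f) (pHHQ_totalD M) c2,
      ← Slash.map_add' c2 (pHHAct_totalD M _) (c2.add_left (pHHAct_totalD M _))]
    exact Slash.map_congr (pHHQ_pHHAct M f) _ _
  dq_pow := by
    rw [← Slash.map_pow' (pHHQ_totalD M) p ((show Commute _ _ from pHHQ_totalD M).pow_left p)]
    exact Slash.map_zero' (pHHQ_pow M) _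
  dt := Slash.res p (totalD M)
  dt_act f := (Slash.map_res _).symm
  dt_dq := (Slash.map_res _).symm
  dt_pow := Slash.res_pow p (Fact.out : p.Prime).one_le _
  grq j := Slash.gr p (totalD M) (pHHGrQ M (j + n))
  grt i := Slash.gr p (totalD M) (pHHGrT M i)

end Homology

end PHHH

/-!
Adding a strand to a braid and closing it after one crossing changes the invariant only by a twist.
Classically this is Markov invariance of triply graded homology under stabilization: the bimodule
`M[y] ⊗ B`, with `y` the variable of the new strand, is the sum of two copies of `M[y]`, the partial
Hochschild homology in the direction of `y` is computed by hand, and the crossing leaves one copy of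
`M`. The proof follows this line while keeping track of `p`-complexes, of `∂_q` and of the gradings.

Two facts reduce slash homology to more classical objects. First, an endomorphism of the form
`∑ D ^ i H D ^ (p - 1 - i)` (`adp`) acts by zero on slash homology, so that homotopy equivalences in
this sense induce isomorphisms (`HEquiv.slashIso`); only the forward map has to commute with `∂_q`.
In particular, contractible subs and quotients of short exact sequences split as graded spaces can
be discarded (`HEquiv.ofContractibleQuotient`, `HEquiv.ofContractibleSub`). Secondly, the
`p`-extended Koszul complex is exact away from the Hochschild degrees where a classical Koszul
complex lives (`PExact`, `kosF_exact`). Its slash homology with the differential `∂_t + ∂_a` is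
therefore assembled from the homology `ker D / im D ^ (p - 1)` in degrees `0` modulo `p` and from
a chain of `p - 1` copies of `ker D ^ (p - 1) / im D` in degree `-1` modulo `p` (`L1.ext`,
`L1.extIso`, `KMod.kosExtIso`).

For the complex of a crossing, `1 ⊗ 1` and `η = y ⊗ 1 - 1 ⊗ x` form a basis of `B` over the left
factor. This identifies `M[y] ⊗ pT` with the total of `M[y] ⊕ M[y] → M[y] = ⋯ = M[y]`, respectively of
`M[y] = ⋯ = M[y] → M[y] ⊕ M[y]` (`Cross.equiv`, `Cross.posModel`, `Cross.negModel`). The difference of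
the two actions of `y` is zero on `M[y]`, and on `M[y] ⊗ B` it is the rank one map
`(a, b) ↦ ((y - x) a, -a)`. A map with split kernel and cokernel makes the Koszul complex, in its
direction and up to homotopy, an extension of the cokernel by the suspension of the kernel
(`RankData.split`, `Strand.rankBs`, `Strand.rankR`). On one of the two the crossing becomes the
total of an identity, which is contractible (`L1.loCon`, `L1.hiCon`): on cokernels for a positive
crossing, on kernels for a negative one. On the other it becomes the total of multiplication by
`y - x` on `M[y]`, whose cokernel is `M`, with `x` substituted for `y` (`Strand.ses`). Multiplication
by `y - x` shifts the twists by `x + y`, and collecting the twists of `η` and of the Koszul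
generators leaves `M` twisted by `2 x` and `-2 x` (`Strand.loIso`, `Strand.hiIso`).

For a negative crossing this is all. For a positive one `M` appears suspended in the Hochschild
direction and tensored with the topological chain of length `p - 1`. A suspension exchanges the
even and the odd homology (`L1.suspE`, `L1.suspO`), and the tensor square of the chain is homotopy
equivalent to a single term, because both embed with contractible quotient in one complex
(`L2.glue`). So the two operations cancel up to the translation of the `q`-degree by `4`
(`L1.extUpSusp`); this is where the specialization of `t` in `a = q ^ 2 t` to the shift of
`p`-complexes enters.
-/

set_option linter.unusedSectionVars false
set_option linter.unusedVariables false

/-! ### Null-homotopic endomorphisms, shifts and subquotients -/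

namespace PHHH

section NullHomotopy

/-- In characteristic `p`, the power `(x - y) ^ (p - 1)` of commuting elements is the geometric
sum `∑ x ^ i y ^ (p - 1 - i)`. -/
lemma sub_pow_pred_prime {A : Type*} [Ring A] (p : ℕ) [Fact p.Prime] (hp : (p : A) = 0)
    (hodd : Odd p) {x y : A} (h : Commute x y) :
    (x - y) ^ (p - 1) = ∑ i ∈ Finset.range p, x ^ i * y ^ (p - 1 - i) := by
  have hp1 : p - 1 + 1 = p := Nat.sub_add_cancel (Fact.out : p.Prime).one_le
  have hev : Even (p - 1) := by obtain ⟨q, rfl⟩ := hodd; simp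
  have hc : ∀ i, i ≤ p - 1 → (((p - 1).choose i : ℕ) : A) = (-1) ^ i := by
    intro i
    induction i with
    | zero => simp
    | succ i ih =>
      intro hi
      have h1 : (p.choose (i + 1) : A) = 0 := by
        obtain ⟨c, hc⟩ := (Fact.out : p.Prime).dvd_choose_self (Nat.succ_ne_zero i) (by omega)
        rw [hc, Nat.cast_mul, hp, zero_mul]
      rw [← hp1, Nat.choose_succ_succ, Nat.cast_add, ih (by omega)] at h1
      rw [pow_succ, mul_neg_one]
      exact eq_neg_of_add_eq_zero_right h1
  rw [sub_eq_add_neg, (h.neg_right).add_pow, hp1]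
  refine Finset.sum_congr rfl fun i hi => ?_
  have hi' : i ≤ p - 1 := by have := Finset.mem_range.mp hi; omega
  rw [hc i hi', neg_pow y, mul_assoc, mul_assoc, ((Commute.neg_one_left (y ^ (p - 1 - i))).pow_left i).symm.eq,
    ← mul_assoc ((-1) ^ (p - 1 - i)), ← pow_add, Nat.sub_add_cancel hi', hev.neg_one_pow, one_mul]

variable {k : Type*} [Field k] {V W : Type*} [AddCommGroup V] [Module k V] [AddCommGroup W]
  [Module k W]

/-- The null-homotopic endomorphism `∑ D ^ i H D ^ (p - 1 - i)` of a `p`-complex `(V, D)` attached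
to a linear map `H`. -/
def adp (p : ℕ) (D H : Module.End k V) : Module.End k V :=
  ∑ i ∈ Finset.range p, D ^ i * H * D ^ (p - 1 - i)

lemma adp_apply (p : ℕ) (D H : Module.End k V) (x : V) :
    adp p D H x = ∑ i ∈ Finset.range p, (D ^ i) (H ((D ^ (p - 1 - i)) x)) := by
  simp [adp, LinearMap.sum_apply]

lemma adp_comm (p : ℕ) (D H : Module.End k V) (hD : D ^ p = 0) :
    D * adp p D H = adp p D H * D := by
  rcases p with _ | p
  · simp [adp]
  have h1 : D * adp (p + 1) D H = D ^ (p + 1) * H + ∑ i ∈ Finset.range p, D ^ (i + 1) * H * D ^ (p - i) := by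
    rw [adp, Finset.mul_sum, Finset.sum_range_succ, add_comm]
    congr 1
    · simp [pow_succ', mul_assoc]
    · refine Finset.sum_congr rfl fun i hi => ?_
      simp only [pow_succ', mul_assoc, Nat.add_sub_cancel]
  have h2 : adp (p + 1) D H * D = ∑ i ∈ Finset.range p, D ^ (i + 1) * H * D ^ (p - i) + H * D ^ (p + 1) := by
    rw [adp, Finset.sum_mul, Finset.sum_range_succ']
    congr 1
    · refine Finset.sum_congr rfl fun i hi => ?_
      have := Finset.mem_range.mp hi
      rw [mul_assoc, ← pow_succ]
      congr 2
      omega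
  rw [h1, h2, hD]
  simp

lemma adp_map {D H : Module.End k V} {D' H' : Module.End k W} (p : ℕ) (f : V →ₗ[k] W)
    (hD : ∀ x, f (D x) = D' (f x)) (hH : ∀ x, f (H x) = H' (f x)) (x : V) :
    f (adp p D H x) = adp p D' H' (f x) := by
  have hr : ∀ r x, f ((D ^ r) x) = (D' ^ r) (f x) := by
    intro r
    induction r with
    | zero => intro x; rfl
    | succ r ih => intro x; rw [pow_succ, pow_succ, Module.End.mul_apply, ih, hD]; rfl
  simp only [adp_apply, map_sum, hr, hH]

lemma pow_map {D : Module.End k V} {D' : Module.End k W} (f : V →ₗ[k] W)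
    (hD : ∀ x, f (D x) = D' (f x)) (r : ℕ) (x : V) : f ((D ^ r) x) = (D' ^ r) (f x) := by
  induction r generalizing x with
  | zero => rfl
  | succ r ih => rw [pow_succ, pow_succ, Module.End.mul_apply, ih, hD]; rfl

/-- In characteristic `p` the null-homotopic endomorphism is the iterated commutator
`ad(D) ^ (p - 1) (H)`. -/
lemma adp_eq_ad (p : ℕ) [Fact p.Prime] [CharP k p] (hodd : Odd p) (D H : Module.End k V) :
    adp p D H = ((LinearMap.mulLeft k D - LinearMap.mulRight k D) ^ (p - 1)) H := by
  rw [sub_pow_pred_prime p (natCast_end_eq_zero p) hodd (LinearMap.commute_mulLeft_right D D),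
    LinearMap.sum_apply, adp]
  refine Finset.sum_congr rfl fun i _ => ?_
  rw [LinearMap.pow_mulLeft, LinearMap.pow_mulRight]
  simp [mul_assoc]

/-- Adding to the differential an operator that commutes with it and with the homotopy does not
change the null-homotopic endomorphism: in characteristic `p` the latter is an iterated
commutator. -/
lemma adp_add (p : ℕ) [Fact p.Prime] [CharP k p] (hodd : Odd p) (D S H : Module.End k V)
    (hSD : S * D = D * S) (hSH : S * H = H * S) : adp p (D + S) H = adp p D H := by
  rw [adp_eq_ad p hodd, adp_eq_ad p hodd]
  have key : ∀ r : ℕ, ((LinearMap.mulLeft k (D + S) - LinearMap.mulRight k (D + S)) ^ r) H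
      = ((LinearMap.mulLeft k D - LinearMap.mulRight k D) ^ r) H ∧
      S * ((LinearMap.mulLeft k D - LinearMap.mulRight k D) ^ r) H
        = ((LinearMap.mulLeft k D - LinearMap.mulRight k D) ^ r) H * S := by
    intro r
    induction r with
    | zero => exact ⟨rfl, hSH⟩
    | succ r ih =>
      rw [pow_succ', pow_succ', Module.End.mul_apply, Module.End.mul_apply, ih.1]
      generalize ((LinearMap.mulLeft k D - LinearMap.mulRight k D) ^ r) H = Z at ih
      constructor
      · simp only [LinearMap.sub_apply, LinearMap.mulLeft_apply, LinearMap.mulRight_apply, add_mul,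
          mul_add, ih.2]
        abel
      · simp only [LinearMap.sub_apply, LinearMap.mulLeft_apply, LinearMap.mulRight_apply, sub_mul,
          mul_sub]
        rw [← mul_assoc, hSD, mul_assoc, ih.2, ← mul_assoc, ← mul_assoc, ih.2, mul_assoc Z S D, hSD,
          ← mul_assoc]
  exact (key _).1

/-- A contraction of `(V, D)` exhibits the kernel of `D ^ s` as the image of `D ^ (p - s)`. -/
lemma adp_apply_of_pow_eq_zero (p s : ℕ) (hs : s ≤ p) (D H : Module.End k V) (x : V)
    (hx : (D ^ s) x = 0) : adp p D H x
      = (D ^ (p - s)) (∑ i ∈ Finset.range s, (D ^ i) (H ((D ^ (s - 1 - i)) x))) := by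
  obtain ⟨q, rfl⟩ := Nat.exists_eq_add_of_le' hs
  rw [adp_apply, Finset.sum_range_add, Nat.add_sub_cancel, map_sum]
  have h0 : ∀ i ∈ Finset.range q, (D ^ i) (H ((D ^ (q + s - 1 - i)) x)) = 0 := by
    intro i hi
    have : q + s - 1 - i = q - 1 - i + s := by have := Finset.mem_range.mp hi; omega
    rw [this, pow_add, Module.End.mul_apply, hx, map_zero, map_zero, map_zero]
  rw [Finset.sum_eq_zero h0, zero_add]
  refine Finset.sum_congr rfl fun i hi => ?_
  have : q + s - 1 - (q + i) = s - 1 - i := by omega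
  rw [this, pow_add, Module.End.mul_apply]

/-- Null-homotopic endomorphisms induce zero on slash homology. -/
lemma adp_mem_range (p s : ℕ) (hs : s ≤ p) (D H : Module.End k V) (x : V)
    (hx : (D ^ s) x = 0) : adp p D H x ∈ LinearMap.range (D ^ (p - s)) :=
  ⟨_, (adp_apply_of_pow_eq_zero p s hs D H x hx).symm⟩

/-- If `D` lowers the degree by `t` and `H` raises it by `(p - 1) t`, the null-homotopic
endomorphism attached to `H` is homogeneous of degree zero. -/
lemma adp_mem {p : ℕ} {D H : Module.End k V} {G : ℤ → Submodule k V} (t : ℤ)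
    (hD : ∀ j x, x ∈ G j → D x ∈ G (j - t)) (hH : ∀ j x, x ∈ G j → H x ∈ G (j + (p - 1 : ℕ) * t))
    (j : ℤ) (x : V) (hx : x ∈ G j) : adp p D H x ∈ G j := by
  have hr : ∀ r : ℕ, ∀ j x, x ∈ G j → (D ^ r) x ∈ G (j - r * t) := by
    intro r
    induction r with
    | zero => intro j x hx; simpa using hx
    | succ r ih =>
      intro j x hx
      rw [pow_succ, Module.End.mul_apply]
      have := ih _ _ (hD _ _ hx)
      have e : j - t - r * t = j - ((r + 1 : ℕ) : ℤ) * t := by push_cast; ring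
      rwa [e] at this
  rw [adp_apply]
  refine Submodule.sum_mem _ fun i hi => ?_
  have := hr i _ _ (hH _ _ (hr (p - 1 - i) _ _ hx))
  have hi' := Finset.mem_range.mp hi
  have e : j - ((p - 1 - i : ℕ) : ℤ) * t + ((p - 1 : ℕ) : ℤ) * t - i * t = j := by
    rw [Nat.cast_sub (by omega : i ≤ p - 1)]; ring
  rwa [e] at this

end NullHomotopy

section Shift

variable {k : Type*} [Field k] {Y : Type*} [AddCommGroup Y] [Module k Y]

/-- The shift `x ↦ (x_1, …, x_{q-1}, 0)` on `Y ^ q`. -/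
def shDown (k : Type*) [Field k] (q : ℕ) (Y : Type*) [AddCommGroup Y] [Module k Y] :
    Module.End k (Fin q → Y) :=
  LinearMap.pi fun s => if h : (s : ℕ) + 1 < q then LinearMap.proj ⟨(s : ℕ) + 1, h⟩ else 0

lemma shDown_apply (q : ℕ) (x : Fin q → Y) (s : Fin q) :
    shDown k q Y x s = if h : (s : ℕ) + 1 < q then x ⟨(s : ℕ) + 1, h⟩ else 0 := by
  by_cases h : (s : ℕ) + 1 < q
  · simp only [shDown, LinearMap.pi_apply, dif_pos h]; rfl
  · simp only [shDown, LinearMap.pi_apply, dif_neg h]; rfl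

lemma shDown_pow_apply (q j : ℕ) (x : Fin q → Y) (s : Fin q) :
    (shDown k q Y ^ j) x s = if h : (s : ℕ) + j < q then x ⟨(s : ℕ) + j, h⟩ else 0 := by
  induction j generalizing x with
  | zero => simp
  | succ j ih =>
    rw [pow_succ, Module.End.mul_apply, ih]
    by_cases h : (s : ℕ) + j < q
    · rw [dif_pos h, shDown_apply]; rfl
    · rw [dif_neg h, dif_neg (by omega)]

/-- The map of `Y ^ q` moving the first component to the last place. -/
def topOfBot (k : Type*) [Field k] (q : ℕ) (Y : Type*) [AddCommGroup Y] [Module k Y] :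
    Module.End k (Fin q → Y) :=
  LinearMap.pi fun s => if h : (s : ℕ) + 1 = q then LinearMap.proj ⟨0, by omega⟩ else 0

lemma topOfBot_apply (q : ℕ) (x : Fin q → Y) (s : Fin q) :
    topOfBot k q Y x s = if h : (s : ℕ) + 1 = q then x ⟨0, by omega⟩ else 0 := by
  by_cases h : (s : ℕ) + 1 = q
  · simp only [topOfBot, LinearMap.pi_apply, dif_pos h]; rfl
  · simp only [topOfBot, LinearMap.pi_apply, dif_neg h]; rfl

/-- Exactly one summand `D ^ i H D ^ (p - 1 - i)` contributes to each component: the one that moves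
the component down to the bottom, to the top, and back to its place. -/
lemma adp_shDown (p : ℕ) : adp p (shDown k p Y) (topOfBot k p Y) = 1 := by
  refine LinearMap.ext fun x => funext fun s => ?_
  rw [adp_apply, Finset.sum_apply, Finset.sum_eq_single (p - 1 - (s : ℕ))]
  · rw [shDown_pow_apply, dif_pos (by omega), topOfBot_apply, dif_pos (by simp only; omega),
      shDown_pow_apply, dif_pos (by simp only; omega)]
    simp only [Module.End.one_apply]
    congr 1
    ext
    simp only
    omega
  · intro i hi hne
    have := Finset.mem_range.mp hi
    rw [shDown_pow_apply]
    split_ifs with h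
    · rw [topOfBot_apply, dif_neg (by simp only; omega)]
    · rfl
  · intro h
    exact absurd (Finset.mem_range.mpr (by omega)) h

lemma shDown_compLeft (q : ℕ) (E : Module.End k Y) :
    shDown k q Y * E.compLeft (Fin q) = E.compLeft (Fin q) * shDown k q Y := by
  refine LinearMap.ext fun x => funext fun s => ?_
  simp only [Module.End.mul_apply, shDown_apply, LinearMap.compLeft_apply, Function.comp_apply]
  split_ifs <;> simp

lemma topOfBot_compLeft (q : ℕ) (E : Module.End k Y) :
    topOfBot k q Y * E.compLeft (Fin q) = E.compLeft (Fin q) * topOfBot k q Y := by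
  refine LinearMap.ext fun x => funext fun s => ?_
  simp only [Module.End.mul_apply, topOfBot_apply, LinearMap.compLeft_apply, Function.comp_apply]
  split_ifs <;> simp

/-- The free `p`-complex `Y → Y → ⋯ → Y` with `p` terms is contractible. -/
lemma adp_compLeft_add_shDown (p : ℕ) [Fact p.Prime] [CharP k p] (hodd : Odd p)
    (E : Module.End k Y) :
    adp p (E.compLeft (Fin p) + shDown k p Y) (topOfBot k p Y) = 1 := by
  rw [add_comm, adp_add p hodd _ _ _ (shDown_compLeft p E).symm (topOfBot_compLeft p E).symm,
    adp_shDown]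

end Shift

section Subquotient

variable {k : Type*} [Field k] {V V' V'' : Type*} [AddCommGroup V] [Module k V] [AddCommGroup V']
  [Module k V'] [AddCommGroup V''] [Module k V'']

/-- The subquotient `Z / (Z ∩ B)`. -/
abbrev SQ (Z B : Submodule k V) : Type _ := Z ⧸ B.comap Z.subtype

namespace SQ

variable {Z B : Submodule k V} {Z' B' : Submodule k V'} {Z'' B'' : Submodule k V''}

/-- The class of an element of `Z` in `Z / (Z ∩ B)`. -/
def cls (B : Submodule k V) (v : V) (hv : v ∈ Z) : SQ Z B := Submodule.Quotient.mk ⟨v, hv⟩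

lemma ind {P : SQ Z B → Prop} (h : ∀ v hv, P (cls B v hv)) (x : SQ Z B) : P x := by
  obtain ⟨⟨v, hv⟩, rfl⟩ := Submodule.Quotient.mk_surjective _ x
  exact h v hv

lemma cls_eq {v w : V} {hv : v ∈ Z} {hw : w ∈ Z} : cls B v hv = cls B w hw ↔ v - w ∈ B := by
  rw [cls, cls, Submodule.Quotient.eq]; rfl

lemma cls_eq_zero {v : V} {hv : v ∈ Z} : cls B v hv = 0 ↔ v ∈ B := by
  rw [cls, Submodule.Quotient.mk_eq_zero]; rfl

lemma cls_add {v w : V} (hv : v ∈ Z) (hw : w ∈ Z) :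
    cls B v hv + cls B w hw = cls B (v + w) (Z.add_mem hv hw) := rfl

/-- The map of subquotients induced by a linear map. -/
def map (f : V →ₗ[k] V') (hZ : ∀ x ∈ Z, f x ∈ Z') (hB : ∀ x ∈ Z, x ∈ B → f x ∈ B') :
    SQ Z B →ₗ[k] SQ Z' B' :=
  Submodule.mapQ _ _ (f.restrict hZ) (by rintro ⟨v, hv⟩ hv'; exact hB v hv hv')

/-- The classes of the elements of a given subspace. -/
def gr (Z B : Submodule k V) (S : Submodule k V) : Submodule k (SQ Z B) :=
  (S.comap Z.subtype).map (B.comap Z.subtype).mkQ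

lemma mem_gr {S : Submodule k V} {x : SQ Z B} :
    x ∈ gr Z B S ↔ ∃ v, ∃ hv : v ∈ Z, v ∈ S ∧ cls B v hv = x := by
  constructor
  · rintro ⟨⟨v, hv⟩, hS, rfl⟩
    exact ⟨v, hv, hS, rfl⟩
  · rintro ⟨v, hv, hS, rfl⟩
    exact ⟨⟨v, hv⟩, hS, rfl⟩

lemma cls_mem_gr {S : Submodule k V} {v : V} (hv : v ∈ Z) (hS : v ∈ S) : cls B v hv ∈ gr Z B S :=
  mem_gr.mpr ⟨v, hv, hS, rfl⟩

lemma gr_le_comap {S : Submodule k V} {P : Submodule k V''} (F : SQ Z B →ₗ[k] V'')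
    (h : ∀ v hv, v ∈ S → F (cls B v hv) ∈ P) : gr Z B S ≤ P.comap F := by
  intro x hx
  obtain ⟨v, hv, hS, rfl⟩ := mem_gr.mp hx
  exact h v hv hS

end SQ

end Subquotient

end PHHH

/-! ### Slash homology and homotopy equivalences -/

namespace PHHH

/-- The drop of the two gradings under a topological differential: the `q`-degree (index `false`)
is preserved, the topological degree (index `true`) drops by one. -/
def tau (b : Bool) : ℤ := if b then 1 else 0

/-- A `p`-complex with an operator `∂_q` and two families of subspaces: the pieces of the
`q`-grading (index `false`) and of the topological grading (index `true`). -/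
structure L2 (k : Type u) [Field k] where
  V : Type u
  [addCommGroup : AddCommGroup V]
  [module : Module k V]
  D : Module.End k V
  Q : Module.End k V
  DQ : ∀ x, D (Q x) = Q (D x)
  G : Bool → ℤ → Submodule k V

attribute [instance] L2.addCommGroup L2.module

variable {k : Type u} [Field k]

lemma L2.QD (X : L2 k) : X.Q * X.D = X.D * X.Q := LinearMap.ext fun x => (X.DQ x).symm

/-- The differential is homogeneous for both gradings. -/
def L2.Homog (X : L2 k) : Prop := ∀ b j x, x ∈ X.G b j → X.D x ∈ X.G b (j - tau b)

/-- A homotopy equivalence of `p`-complexes preserving both gradings, in which only the forward map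
has to commute with `∂_q`. -/
structure HEquiv (p : ℕ) (X Y : L2 k) where
  f : X.V →ₗ[k] Y.V
  g : Y.V →ₗ[k] X.V
  fD : ∀ x, f (X.D x) = Y.D (f x)
  gD : ∀ x, g (Y.D x) = X.D (g x)
  fQ : ∀ x, f (X.Q x) = Y.Q (f x)
  fG : ∀ b j x, x ∈ X.G b j → f x ∈ Y.G b j
  gG : ∀ b j x, x ∈ Y.G b j → g x ∈ X.G b j
  H : Module.End k X.V
  K : Module.End k Y.V
  gf : ∀ x, g (f x) = x - adp p X.D H x
  fg : ∀ x, f (g x) = x - adp p Y.D K x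

/-- An isomorphism of slash homologies compatible with `∂_q`, the residual differentials and both
gradings. -/
structure SlashIso (p : ℕ) (X Y : L2 k) where
  e : Slash p X.D ≃ₗ[k] Slash p Y.D
  map_Q : ∀ x, e (Slash.map p X.D X.Q X.QD x)
    = Slash.map p Y.D Y.Q Y.QD (e x)
  map_res : ∀ x, e (Slash.res p X.D x) = Slash.res p Y.D (e x)
  map_G : ∀ b j, (Slash.gr p X.D (X.G b j)).map e.toLinearMap = Slash.gr p Y.D (Y.G b j)

/-- An isomorphism of `p`-complexes with `∂_q`-action and gradings. -/
structure L2Iso (X Y : L2 k) where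
  e : X.V ≃ₗ[k] Y.V
  eD : ∀ x, e (X.D x) = Y.D (e x)
  eQ : ∀ x, e (X.Q x) = Y.Q (e x)
  eG : ∀ b j x, x ∈ X.G b j → e x ∈ Y.G b j
  eG' : ∀ b j x, x ∈ Y.G b j → e.symm x ∈ X.G b j

namespace SlashIso

variable {p : ℕ} {X Y Z : L2 k}

/-- The inverse isomorphism. -/
def symm (e : SlashIso p X Y) : SlashIso p Y X where
  e := e.e.symm
  map_Q x := by rw [LinearEquiv.symm_apply_eq, e.map_Q, LinearEquiv.apply_symm_apply]
  map_res x := by rw [LinearEquiv.symm_apply_eq, e.map_res, LinearEquiv.apply_symm_apply]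
  map_G b j := by
    rw [← e.map_G, ← Submodule.map_comp]
    convert Submodule.map_id _
    ext x
    simp

/-- The composite isomorphism. -/
def trans (e : SlashIso p X Y) (f : SlashIso p Y Z) : SlashIso p X Z where
  e := e.e.trans f.e
  map_Q x := by simp only [LinearEquiv.trans_apply, e.map_Q, f.map_Q]
  map_res x := by simp only [LinearEquiv.trans_apply, e.map_res, f.map_res]
  map_G b j := by
    rw [← f.map_G, ← e.map_G, ← Submodule.map_comp]
    rfl

end SlashIso

section SlashMap

variable {V W : Type u} [AddCommGroup V] [Module k V] [AddCommGroup W] [Module k W]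

/-- The map on a component of slash homology induced by a map of `p`-complexes. -/
def slashMapPiece (p : ℕ) {D : Module.End k V} {D' : Module.End k W} (f : V →ₗ[k] W)
    (hf : ∀ x, f (D x) = D' (f x)) (j : ℕ) : SlashPiece p D j →ₗ[k] SlashPiece p D' j :=
  SQ.map (Z := LinearMap.ker (D ^ (j + 1)))
    (B := LinearMap.range (D ^ (p - j - 1)) ⊔ LinearMap.ker (D ^ j))
    (Z' := LinearMap.ker (D' ^ (j + 1)))
    (B' := LinearMap.range (D' ^ (p - j - 1)) ⊔ LinearMap.ker (D' ^ j)) f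
    (fun x hx => by
      rw [LinearMap.mem_ker] at hx ⊢
      rw [← pow_map f hf, hx, map_zero])
    (fun x _ hx => by
      obtain ⟨_, ⟨b, rfl⟩, c, hc, rfl⟩ := Submodule.mem_sup.mp hx
      rw [map_add]
      refine Submodule.add_mem_sup ⟨f b, (pow_map f hf _ _).symm⟩ ?_
      rw [LinearMap.mem_ker] at hc ⊢
      rw [← pow_map f hf, hc, map_zero])

/-- The map on slash homology induced by a map of `p`-complexes. -/
def slashMap (p : ℕ) {D : Module.End k V} {D' : Module.End k W} (f : V →ₗ[k] W)
    (hf : ∀ x, f (D x) = D' (f x)) : Slash p D →ₗ[k] Slash p D' :=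
  LinearMap.pi fun j => (slashMapPiece p f hf j).comp (LinearMap.proj j)

/-- The class of an element in a component of slash homology. -/
def slashCls (p : ℕ) (D : Module.End k V) (j : ℕ) (v : V) (hv : v ∈ LinearMap.ker (D ^ (j + 1))) :
    SlashPiece p D j :=
  Submodule.Quotient.mk ⟨v, hv⟩

lemma slash_ind {p : ℕ} {D : Module.End k V} {j : ℕ} {P : SlashPiece p D j → Prop}
    (h : ∀ v hv, P (slashCls p D j v hv)) (x : SlashPiece p D j) : P x := by
  obtain ⟨⟨v, hv⟩, rfl⟩ := Submodule.Quotient.mk_surjective _ x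
  exact h v hv

lemma slashCls_eq {p : ℕ} {D : Module.End k V} {j : ℕ} {v w : V}
    {hv : v ∈ LinearMap.ker (D ^ (j + 1))} {hw : w ∈ LinearMap.ker (D ^ (j + 1))} :
    slashCls p D j v hv = slashCls p D j w hw ↔
      v - w ∈ LinearMap.range (D ^ (p - j - 1)) ⊔ LinearMap.ker (D ^ j) := by
  rw [slashCls, slashCls, Submodule.Quotient.eq]; rfl

lemma slashMap_apply (p : ℕ) {D : Module.End k V} {D' : Module.End k W} (f : V →ₗ[k] W)
    (hf : ∀ x, f (D x) = D' (f x)) (x : Slash p D) (j : Fin (p - 1)) (v : V)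
    (hv : v ∈ LinearMap.ker (D ^ ((j : ℕ) + 1))) (hx : x j = slashCls p D j v hv) :
    slashMap p f hf x j = slashCls p D' j (f v) (by
      rw [LinearMap.mem_ker] at hv ⊢
      rw [← pow_map f hf, hv, map_zero]) := by
  change slashMapPiece p f hf j (x j) = _
  rw [hx]; rfl

lemma mem_slashGr {p : ℕ} {D : Module.End k V} {S : Submodule k V} {x : Slash p D} :
    x ∈ Slash.gr p D S ↔ ∀ j : Fin (p - 1), ∃ v hv, v ∈ S ∧ x j = slashCls p D j v hv := by
  constructor
  · intro h j
    obtain ⟨⟨v, hv⟩, hS, h⟩ := h j trivial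
    exact ⟨v, hv, hS, h.symm⟩
  · intro h j _
    obtain ⟨v, hv, hS, h⟩ := h j
    exact ⟨⟨v, hv⟩, hS, h.symm⟩

/-- If the composite `g ∘ f` of maps of `p`-complexes is homotopic to the identity, the induced maps on
slash homology compose to the identity. -/
lemma slashMap_slashMap (p : ℕ) {D : Module.End k V} {D' : Module.End k W} (f : V →ₗ[k] W)
    (hf : ∀ x, f (D x) = D' (f x)) (g : W →ₗ[k] V) (hg : ∀ x, g (D' x) = D (g x))
    (H : Module.End k V) (hgf : ∀ x, g (f x) = x - adp p D H x) (x : Slash p D) :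
    slashMap p g hg (slashMap p f hf x) = x := by
  funext j
  obtain ⟨v, hv, hx⟩ : ∃ v hv, x j = slashCls p D j v hv :=
    slash_ind (P := fun y => ∃ v hv, y = slashCls p D j v hv) (fun v hv => ⟨v, hv, rfl⟩) (x j)
  rw [slashMap_apply p g hg _ j (f v) _ (slashMap_apply p f hf x j v hv hx), hx, slashCls_eq, hgf,
    sub_sub_cancel_left]
  refine Submodule.neg_mem _ (Submodule.mem_sup_left ?_)
  rw [Nat.sub_sub]
  exact adp_mem_range p _ (by omega) D H v hv

end SlashMap

namespace HEquiv

variable {p : ℕ} {X Y Z : L2 k}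

/-- A homotopy equivalence induces an isomorphism of slash homologies. The inverse is induced by the
backward map, whose compatibility with `∂_q` is then automatic. -/
def slashIso (h : HEquiv p X Y) : SlashIso p X Y where
  e := LinearEquiv.ofLinearMap (slashMap p h.f h.fD) (slashMap p h.g h.gD)
    (LinearMap.ext fun x => slashMap_slashMap p h.g h.gD h.f h.fD h.K h.fg x)
    (LinearMap.ext fun x => slashMap_slashMap p h.f h.fD h.g h.gD h.H h.gf x)
  map_Q x := by
    funext j
    obtain ⟨v, hv, hx⟩ : ∃ v hv, x j = slashCls p X.D j v hv :=
      slash_ind (P := fun y => ∃ v hv, y = slashCls p X.D j v hv) (fun v hv => ⟨v, hv, rfl⟩) (x j)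
    change slashMapPiece p h.f h.fD j (Slash.map p X.D X.Q X.QD x j)
      = Slash.map p Y.D Y.Q Y.QD (slashMap p h.f h.fD x) j
    rw [Slash.map_apply, Slash.map_apply, slashMap_apply p h.f h.fD x j v hv hx, hx]
    exact congrArg Submodule.Quotient.mk (Subtype.ext (h.fQ v))
  map_res x := by
    funext j
    by_cases hj : (j : ℕ) + 1 < p - 1
    · rw [Slash.res_apply_of_lt _ _ hj]
      obtain ⟨v, hv, hx⟩ : ∃ v hv, x ⟨(j : ℕ) + 1, hj⟩ = slashCls p X.D ((j : ℕ) + 1) v hv :=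
        slash_ind (P := fun y => ∃ v hv, y = slashCls p X.D ((j : ℕ) + 1) v hv)
          (fun v hv => ⟨v, hv, rfl⟩) (x ⟨(j : ℕ) + 1, hj⟩)
      change slashMapPiece p h.f h.fD j (Slash.res p X.D x j)
        = Slash.resPiece p Y.D j hj (slashMap p h.f h.fD x ⟨(j : ℕ) + 1, hj⟩)
      rw [Slash.res_apply_of_lt _ _ hj, hx, slashMap_apply p h.f h.fD x ⟨(j : ℕ) + 1, hj⟩ v hv hx]
      exact congrArg Submodule.Quotient.mk (Subtype.ext (h.fD v))
    · rw [Slash.res_apply_of_not_lt _ _ hj]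
      change slashMapPiece p h.f h.fD j (Slash.res p X.D x j) = _
      rw [Slash.res_apply_of_not_lt _ _ hj, map_zero]
  map_G b j := by
    refine le_antisymm ?_ ?_
    · rintro _ ⟨x, hx, rfl⟩
      rw [SetLike.mem_coe, mem_slashGr] at hx
      rw [mem_slashGr]
      intro i
      obtain ⟨v, hv, hS, h1⟩ := hx i
      exact ⟨h.f v, _, h.fG b j v hS, slashMap_apply p h.f h.fD x i v hv h1⟩
    · intro y hy
      refine ⟨slashMap p h.g h.gD y, ?_, slashMap_slashMap p h.g h.gD h.f h.fD h.K h.fg y⟩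
      rw [mem_slashGr] at hy
      rw [SetLike.mem_coe, mem_slashGr]
      intro i
      obtain ⟨v, hv, hS, h1⟩ := hy i
      exact ⟨h.g v, _, h.gG b j v hS, slashMap_apply p h.g h.gD y i v hv h1⟩

end HEquiv

namespace L2Iso

variable {X Y Z : L2 k}

/-- The inverse isomorphism. -/
def symm (e : L2Iso X Y) : L2Iso Y X where
  e := e.e.symm
  eD x := by rw [LinearEquiv.symm_apply_eq, e.eD, LinearEquiv.apply_symm_apply]
  eQ x := by rw [LinearEquiv.symm_apply_eq, e.eQ, LinearEquiv.apply_symm_apply]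
  eG := e.eG'
  eG' := e.eG

/-- The identity. -/
def refl (X : L2 k) : L2Iso X X :=
  ⟨LinearEquiv.refl k X.V, fun _ => rfl, fun _ => rfl, fun _ _ _ h => h, fun _ _ _ h => h⟩

/-- The composite isomorphism. -/
def trans (e : L2Iso X Y) (f : L2Iso Y Z) : L2Iso X Z where
  e := e.e.trans f.e
  eD x := by simp only [LinearEquiv.trans_apply, e.eD, f.eD]
  eQ x := by simp only [LinearEquiv.trans_apply, e.eQ, f.eQ]
  eG b j x hx := f.eG b j _ (e.eG b j x hx)
  eG' b j x hx := e.eG' b j _ (f.eG' b j x hx)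

/-- An isomorphism is a homotopy equivalence. -/
def hEquiv (p : ℕ) (e : L2Iso X Y) : HEquiv p X Y where
  f := e.e
  g := e.e.symm
  fD := e.eD
  gD := e.symm.eD
  fQ := e.eQ
  fG := e.eG
  gG := e.eG'
  H := 0
  K := 0
  gf x := by simp [adp]
  fg x := by simp [adp]

end L2Iso

section SplitExact

/-- If `X_S → X → X_Q` is a short exact sequence of `p`-complexes, split as graded spaces, and `X_Q`
is contractible, then `X_S → X` is a homotopy equivalence. -/
def HEquiv.ofContractibleQuotient {p : ℕ} {S X Q : L2 k} (hX : X.Homog) (hXp : X.D ^ p = 0)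
    (ι : S.V →ₗ[k] X.V) (u : X.V →ₗ[k] S.V) (f : X.V →ₗ[k] Q.V) (w : Q.V →ₗ[k] X.V)
    (ιD : ∀ x, ι (S.D x) = X.D (ι x)) (fD : ∀ x, f (X.D x) = Q.D (f x))
    (ιQ : ∀ x, ι (S.Q x) = X.Q (ι x))
    (ιG : ∀ b j x, x ∈ S.G b j → ι x ∈ X.G b j) (uG : ∀ b j x, x ∈ X.G b j → u x ∈ S.G b j)
    (fG : ∀ b j x, x ∈ X.G b j → f x ∈ Q.G b j) (wG : ∀ b j x, x ∈ Q.G b j → w x ∈ X.G b j)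
    (uι : ∀ x, u (ι x) = x) (fw : ∀ x, f (w x) = x) (fι : ∀ x, f (ι x) = 0)
    (sum : ∀ x, ι (u x) + w (f x) = x)
    (h : Module.End k Q.V) (hh : ∀ x, adp p Q.D h x = x)
    (hG : ∀ b j x, x ∈ Q.G b j → h x ∈ Q.G b (j + (p - 1 : ℕ) * tau b)) : HEquiv p S X := by
  -- `1 - adp H` is a chain map with image in `X_S`, since `adp H` covers the identity of `X_Q`
  let H : Module.End k X.V := w ∘ₗ h ∘ₗ f
  have hfN : ∀ x, f (adp p X.D H x) = f x := fun x => by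
    rw [adp_map p f (D' := Q.D) (H' := h) fD (fun x => fw _), hh]
  have hιu : ∀ x, ι (u (x - adp p X.D H x)) = x - adp p X.D H x := fun x => by
    have := sum (x - adp p X.D H x)
    rwa [map_sub f, hfN, sub_self, map_zero, add_zero] at this
  have hιinj : Function.Injective ι := Function.LeftInverse.injective uι
  have hNι : ∀ x, adp p X.D H (ι x) = 0 := fun x => by
    rw [adp_apply]
    refine Finset.sum_eq_zero fun i _ => ?_
    rw [← pow_map ι ιD]
    simp [H, fι]
  have hND : ∀ x, adp p X.D H (X.D x) = X.D (adp p X.D H x) := fun x =>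
    (LinearMap.congr_fun (adp_comm p X.D H hXp) x).symm
  exact
    { f := ι
      g := u ∘ₗ (1 - adp p X.D H)
      fD := ιD
      gD := fun x => hιinj <| by
        simp only [LinearMap.comp_apply, LinearMap.sub_apply, Module.End.one_apply]
        rw [hιu, ιD, hιu, hND, map_sub]
      fQ := ιQ
      fG := ιG
      gG := fun b j x hx => uG b j _ (Submodule.sub_mem _ hx
        (adp_mem (tau b) (hX b) (fun j x hx => wG b _ _ (hG b _ _ (fG b _ _ hx))) j x hx))
      H := 0
      K := H
      gf := fun x => by
        simp only [LinearMap.comp_apply, LinearMap.sub_apply, Module.End.one_apply]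
        rw [hNι, sub_zero, uι]
        simp [adp]
      fg := fun x => hιu x }

/-- If `X_S → X → X_Q` is a short exact sequence of `p`-complexes, split as graded spaces, and `X_S`
is contractible, then `X → X_Q` is a homotopy equivalence. -/
def HEquiv.ofContractibleSub {p : ℕ} {S X Q : L2 k} (hX : X.Homog) (hXp : X.D ^ p = 0)
    (ι : S.V →ₗ[k] X.V) (u : X.V →ₗ[k] S.V) (f : X.V →ₗ[k] Q.V) (w : Q.V →ₗ[k] X.V)
    (ιD : ∀ x, ι (S.D x) = X.D (ι x)) (fD : ∀ x, f (X.D x) = Q.D (f x))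
    (fQ : ∀ x, f (X.Q x) = Q.Q (f x))
    (ιG : ∀ b j x, x ∈ S.G b j → ι x ∈ X.G b j) (uG : ∀ b j x, x ∈ X.G b j → u x ∈ S.G b j)
    (fG : ∀ b j x, x ∈ X.G b j → f x ∈ Q.G b j) (wG : ∀ b j x, x ∈ Q.G b j → w x ∈ X.G b j)
    (uι : ∀ x, u (ι x) = x) (fw : ∀ x, f (w x) = x) (fι : ∀ x, f (ι x) = 0)
    (sum : ∀ x, ι (u x) + w (f x) = x)
    (h : Module.End k S.V) (hh : ∀ x, adp p S.D h x = x)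
    (hG : ∀ b j x, x ∈ S.G b j → h x ∈ S.G b (j + (p - 1 : ℕ) * tau b)) : HEquiv p X Q := by
  -- `adp H` is the identity on `X_S`, so `1 - adp H` factors through `X_Q`
  let H : Module.End k X.V := ι ∘ₗ h ∘ₗ u
  have hNι : ∀ x, adp p X.D H (ι x) = ι x := fun x => by
    rw [← adp_map p ι (D := S.D) (H := h) ιD (fun x => by simp [H, uι]), hh]
  have hfN : ∀ x, f (adp p X.D H x) = 0 := fun x => by
    rw [adp_apply, map_sum]
    refine Finset.sum_eq_zero fun i _ => ?_
    rw [pow_map f fD]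
    simp [H, fι]
  have hND : ∀ x, adp p X.D H (X.D x) = X.D (adp p X.D H x) := fun x =>
    (LinearMap.congr_fun (adp_comm p X.D H hXp) x).symm
  have hker : ∀ x, f x = 0 → adp p X.D H x = x := fun x hx => by
    have := sum x
    rw [hx, map_zero, add_zero] at this
    rw [← this, hNι]
  exact
    { f := f
      g := (1 - adp p X.D H) ∘ₗ w
      fD := fD
      gD := fun x => by
        simp only [LinearMap.comp_apply, LinearMap.sub_apply, Module.End.one_apply]
        have := hker (w (Q.D x) - X.D (w x)) (by rw [map_sub, fw, fD, fw, sub_self])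
        rw [map_sub, hND] at this
        rw [map_sub, sub_eq_sub_iff_sub_eq_sub, ← this]
      fQ := fQ
      fG := fG
      gG := fun b j x hx => (Submodule.sub_mem _ (wG b j x hx)
        (adp_mem (tau b) (hX b) (fun j x hx => ιG b _ _ (hG b _ _ (uG b _ _ hx))) j _ (wG b j x hx)))
      H := H
      K := 0
      gf := fun x => by
        simp only [LinearMap.comp_apply, LinearMap.sub_apply, Module.End.one_apply]
        have := hker (x - w (f x)) (by rw [map_sub, fw, sub_self])
        rw [map_sub] at this
        rw [sub_eq_sub_iff_sub_eq_sub, ← neg_sub x, ← this]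
        abel
      fg := fun x => by
        simp only [LinearMap.comp_apply, LinearMap.sub_apply, Module.End.one_apply]
        rw [map_sub, hfN, fw]
        simp [adp] }

end SplitExact

namespace L2

/-- The direct sum. -/
abbrev prod (X Y : L2 k) : L2 k where
  V := X.V × Y.V
  D := X.D.prodMap Y.D
  Q := X.Q.prodMap Y.Q
  DQ x := Prod.ext (X.DQ x.1) (Y.DQ x.2)
  G b j := (X.G b j).prod (Y.G b j)

/-- The translation of the gradings. -/
abbrev shift (X : L2 k) (c : Bool → ℤ) : L2 k := { X with G := fun b j => X.G b (j - c b) }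

/-- The tensor product with the chain of length `p - 1` whose terms sit in topological degrees
`0, …, p - 2`. -/
abbrev up (p : ℕ) (X : L2 k) : L2 k where
  V := Fin (p - 1) → X.V
  D := X.D.compLeft (Fin (p - 1)) + shDown k (p - 1) X.V
  Q := X.Q.compLeft (Fin (p - 1))
  DQ x := by
    have := LinearMap.congr_fun (shDown_compLeft (p - 1) X.Q) x
    simp only [Module.End.mul_apply] at this
    rw [LinearMap.add_apply, LinearMap.add_apply, this, map_add]
    congr 1
    exact funext fun s => X.DQ (x s)
  G b j := Submodule.pi Set.univ fun s : Fin (p - 1) => X.G b (j - tau b * (s : ℕ))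

end L2

/-- A componentwise homotopy has a componentwise null-homotopic endomorphism, whether or not the shift
is added to the differential. -/
lemma adp_add_shDown {Y : Type*} [AddCommGroup Y] [Module k Y] (p q : ℕ) [Fact p.Prime] [CharP k p]
    (hodd : Odd p) (D H : Module.End k Y) (x : Fin q → Y) (s : Fin q) :
    adp p (D.compLeft (Fin q) + shDown k q Y) (H.compLeft (Fin q)) x s = adp p D H (x s) := by
  rw [adp_add p hodd _ _ _ (shDown_compLeft q D) (shDown_compLeft q H)]
  exact adp_map p (LinearMap.proj (R := k) (φ := fun _ : Fin q => Y) s) (D := D.compLeft (Fin q))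
    (H := H.compLeft (Fin q)) (fun _ => rfl) (fun _ => rfl) x

namespace HEquiv

variable {p : ℕ} {X Y X' Y' : L2 k}

lemma compLeft_shDown {V W : Type*} [AddCommGroup V] [Module k V] [AddCommGroup W] [Module k W]
    (q : ℕ) (f : V →ₗ[k] W) (x : Fin q → V) :
    f.compLeft (Fin q) (shDown k q V x) = shDown k q W (f.compLeft (Fin q) x) := by
  funext s
  simp only [shDown_apply, LinearMap.compLeft_apply, Function.comp_apply]
  split_ifs <;> simp

/-- The direct sum of homotopy equivalences. -/
def prod (h : HEquiv p X Y) (h' : HEquiv p X' Y') : HEquiv p (X.prod X') (Y.prod Y') where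
  f := h.f.prodMap h'.f
  g := h.g.prodMap h'.g
  fD x := Prod.ext (h.fD x.1) (h'.fD x.2)
  gD x := Prod.ext (h.gD x.1) (h'.gD x.2)
  fQ x := Prod.ext (h.fQ x.1) (h'.fQ x.2)
  fG b j x hx := ⟨h.fG b j x.1 hx.1, h'.fG b j x.2 hx.2⟩
  gG b j x hx := ⟨h.gG b j x.1 hx.1, h'.gG b j x.2 hx.2⟩
  H := h.H.prodMap h'.H
  K := h.K.prodMap h'.K
  gf x := by
    have h1 := adp_map p (LinearMap.fst k X.V X'.V) (D := (X.prod X').D) (H := h.H.prodMap h'.H)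
      (D' := X.D) (H' := h.H) (fun _ => rfl) (fun _ => rfl) x
    have h2 := adp_map p (LinearMap.snd k X.V X'.V) (D := (X.prod X').D) (H := h.H.prodMap h'.H)
      (D' := X'.D) (H' := h'.H) (fun _ => rfl) (fun _ => rfl) x
    refine Prod.ext ((h.gf x.1).trans ?_) ((h'.gf x.2).trans ?_)
    · exact congrArg (x.1 - ·) h1.symm
    · exact congrArg (x.2 - ·) h2.symm
  fg x := by
    have h1 := adp_map p (LinearMap.fst k Y.V Y'.V) (D := (Y.prod Y').D) (H := h.K.prodMap h'.K)
      (D' := Y.D) (H' := h.K) (fun _ => rfl) (fun _ => rfl) x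
    have h2 := adp_map p (LinearMap.snd k Y.V Y'.V) (D := (Y.prod Y').D) (H := h.K.prodMap h'.K)
      (D' := Y'.D) (H' := h'.K) (fun _ => rfl) (fun _ => rfl) x
    refine Prod.ext ((h.fg x.1).trans ?_) ((h'.fg x.2).trans ?_)
    · exact congrArg (x.1 - ·) h1.symm
    · exact congrArg (x.2 - ·) h2.symm

/-- The tensor product of a homotopy equivalence with the chain of length `p - 1`: the homotopies act
componentwise, as they commute with the shift. -/
def up [Fact p.Prime] [CharP k p] (hodd : Odd p) (h : HEquiv p X Y) :
    HEquiv p (X.up p) (Y.up p) where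
  f := h.f.compLeft (Fin (p - 1))
  g := h.g.compLeft (Fin (p - 1))
  fD x := by
    have := compLeft_shDown (p - 1) h.f x
    rw [LinearMap.add_apply, LinearMap.add_apply, map_add]
    rw [this]
    congr 1
    exact funext fun s => h.fD (x s)
  gD x := by
    have := compLeft_shDown (p - 1) h.g x
    rw [LinearMap.add_apply, LinearMap.add_apply, map_add]
    rw [this]
    congr 1
    exact funext fun s => h.gD (x s)
  fQ x := funext fun s => h.fQ (x s)
  fG b j x hx s _ := h.fG b _ _ (hx s trivial)
  gG b j x hx s _ := h.gG b _ _ (hx s trivial)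
  H := h.H.compLeft (Fin (p - 1))
  K := h.K.compLeft (Fin (p - 1))
  gf x := funext fun s => (h.gf (x s)).trans
    (congrArg (x s - ·) (adp_add_shDown p (p - 1) hodd X.D h.H x s).symm)
  fg x := funext fun s => (h.fg (x s)).trans
    (congrArg (x s - ·) (adp_add_shDown p (p - 1) hodd Y.D h.K x s).symm)

end HEquiv

end PHHH

/-! ### Contracted homology and split sequences -/

namespace PHHH

/-- A `p`-complex for a Hochschild differential `D`, with a commuting topological differential `T`
and an operator `∂_q`, graded by the Hochschild degree (`A`); the pieces `G` of the internal
`q`-grading (index `false`) and topological grading (index `true`) are stable under `D`. -/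
structure L1 (k : Type u) [Field k] where
  V : Type u
  [addCommGroup : AddCommGroup V]
  [module : Module k V]
  D : Module.End k V
  T : Module.End k V
  Q : Module.End k V
  DT : ∀ x, D (T x) = T (D x)
  DQ : ∀ x, D (Q x) = Q (D x)
  TQ : ∀ x, T (Q x) = Q (T x)
  A : ℤ → Submodule k V
  G : Bool → ℤ → Submodule k V
  DA : ∀ d x, x ∈ A d → D x ∈ A (d - 1)
  TA : ∀ d x, x ∈ A d → T x ∈ A d
  QA : ∀ d x, x ∈ A d → Q x ∈ A d
  DG : ∀ b j x, x ∈ G b j → D x ∈ G b j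
  TG : ∀ b j x, x ∈ G b j → T x ∈ G b (j - tau b)

attribute [instance] L1.addCommGroup L1.module

variable {k : Type u} [Field k]

lemma iSup_map_mem {V W ι : Type*} [AddCommGroup V] [Module k V] [AddCommGroup W] [Module k W]
    {A : ι → Submodule k V} {B : Submodule k W} (f : V →ₗ[k] W)
    (h : ∀ i, ∀ x ∈ A i, f x ∈ B) (x : V) (hx : x ∈ ⨆ i, A i) : f x ∈ B :=
  (iSup_le (fun i x hx => h i x hx) : ⨆ i, A i ≤ B.comap f) hx

lemma SQ.cls_congr {V : Type*} [AddCommGroup V] [Module k V] {Z B : Submodule k V} {v w : V}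
    (h : v = w) (hv : v ∈ Z) (hw : w ∈ Z) : SQ.cls B v hv = SQ.cls B w hw := by subst h; rfl

lemma SQ.cls_zero {V : Type*} [AddCommGroup V] [Module k V] {Z B : Submodule k V} {v : V}
    (h : v = 0) (hv : v ∈ Z) : SQ.cls B v hv = 0 :=
  SQ.cls_eq_zero.mpr (h ▸ B.zero_mem)

namespace L1

lemma TD (X : L1 k) (x : X.V) : X.T (X.D x) = X.D (X.T x) := (X.DT x).symm

lemma QD (X : L1 k) (x : X.V) : X.Q (X.D x) = X.D (X.Q x) := (X.DQ x).symm

/-- The part of Hochschild degree congruent to `ρ` modulo `p`. -/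
def residue (p : ℕ) (X : L1 k) (ρ : ℤ) : Submodule k X.V := ⨆ r : ℤ, X.A (r * p + ρ)

lemma mem_residue {p : ℕ} {X : L1 k} {ρ : ℤ} (r : ℤ) {x : X.V} (hx : x ∈ X.A (r * p + ρ)) :
    x ∈ X.residue p ρ := Submodule.mem_iSup_of_mem r hx

lemma residue_map {p : ℕ} {X Y : L1 k} (f : X.V →ₗ[k] Y.V) {e : ℤ}
    (hA : ∀ d x, x ∈ X.A d → f x ∈ Y.A (d + e)) {ρ : ℤ} {x : X.V} (hx : x ∈ X.residue p ρ) :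
    f x ∈ Y.residue p (ρ + e) := by
  refine iSup_map_mem f (fun r x hx => mem_residue r ?_) x hx
  have := hA _ _ hx
  rwa [add_assoc] at this

lemma residue_map' {p : ℕ} {X Y : L1 k} (f : X.V →ₗ[k] Y.V)
    (hA : ∀ d x, x ∈ X.A d → f x ∈ Y.A d) {ρ : ℤ} {x : X.V} (hx : x ∈ X.residue p ρ) :
    f x ∈ Y.residue p ρ := by
  have := residue_map f (e := 0) (fun d x hx => by rw [add_zero]; exact hA d x hx) hx
  rwa [add_zero] at this

lemma D_pow_mem {X : L1 k} (r : ℕ) : ∀ d x, x ∈ X.A d → (X.D ^ r) x ∈ X.A (d - r) := by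
  induction r with
  | zero => intro d x hx; simpa using hx
  | succ r ih =>
    intro d x hx
    rw [pow_succ, Module.End.mul_apply]
    have := ih _ _ (X.DA _ _ hx)
    have e : d - 1 - r = d - ((r + 1 : ℕ) : ℤ) := by push_cast; ring
    rwa [e] at this

lemma D_pow_memG {X : L1 k} (r : ℕ) (b : Bool) (j : ℤ) (x : X.V) (hx : x ∈ X.G b j) :
    (X.D ^ r) x ∈ X.G b j := by
  induction r generalizing x with
  | zero => exact hx
  | succ r ih => rw [pow_succ, Module.End.mul_apply]; exact ih _ (X.DG b j x hx)

section HL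

variable (p c : ℕ) (ρ : ℤ)

/-- The subspace of cycles defining `HL`. -/
abbrev cyc (X : L1 k) : Submodule k X.V := X.residue p ρ ⊓ LinearMap.ker (X.D ^ c)

variable {p c ρ}

section

variable {X Y : L1 k} (f : X.V →ₗ[k] Y.V) (hD : ∀ x, f (X.D x) = Y.D (f x))
  (hA : ∀ d x, x ∈ X.A d → f x ∈ Y.A d)

include hD hA in
lemma map_mem_cyc (x : X.V) (hx : x ∈ X.cyc p c ρ) : f x ∈ Y.cyc p c ρ := by
  refine ⟨residue_map' f hA hx.1, ?_⟩
  rw [SetLike.mem_coe, LinearMap.mem_ker, ← pow_map f hD, LinearMap.mem_ker.mp hx.2, map_zero]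

variable (p c ρ) in
/-- The map on homology induced by a map commuting with the Hochschild differentials. -/
def hlMap : SQ (X.cyc p c ρ) (LinearMap.range (X.D ^ (p - c))) →ₗ[k]
    SQ (Y.cyc p c ρ) (LinearMap.range (Y.D ^ (p - c))) :=
  SQ.map f (map_mem_cyc f hD hA) (by
    rintro _ _ ⟨y, rfl⟩
    exact ⟨f y, (pow_map f hD _ _).symm⟩)

lemma hlMap_cls (v : X.V) (hv : v ∈ X.cyc p c ρ) :
    hlMap p c ρ f hD hA (SQ.cls _ v hv) = SQ.cls _ (f v) (map_mem_cyc f hD hA v hv) := rfl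

end

variable (p c ρ) in
/-- The homology of the two-term-periodic complex obtained from a `p`-complex by contracting it
along the residue classes modulo `p`: in degrees congruent to `ρ`, the kernel of `D ^ c` modulo the
image of `D ^ (p - c)`. The topological differential becomes the differential. A class of degree
`r p + ρ` is placed in degrees shifted by `idx b r`. -/
abbrev HL (idx : Bool → ℤ → ℤ) (X : L1 k) : L2 k where
  V := SQ (X.cyc p c ρ) (LinearMap.range (X.D ^ (p - c)))
  D := hlMap p c ρ X.T X.TD X.TA
  Q := hlMap p c ρ X.Q X.QD X.QA
  DQ x := SQ.ind (P := fun x => hlMap p c ρ X.T X.TD X.TA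
      (hlMap p c ρ X.Q X.QD X.QA x)
      = hlMap p c ρ X.Q X.QD X.QA
      (hlMap p c ρ X.T X.TD X.TA x))
    (fun v hv => SQ.cls_congr (X.TQ v) _ _) x
  G b j := ⨆ r : ℤ, SQ.gr _ _ (X.A (r * p + ρ) ⊓ X.G b (j - idx b r))

variable {idx : Bool → ℤ → ℤ} {X Y Z : L1 k}

lemma cls_mem_G {b : Bool} {j : ℤ} (r : ℤ) {v : X.V} (hv : v ∈ X.cyc p c ρ)
    (h1 : v ∈ X.A (r * p + ρ)) (h2 : v ∈ X.G b (j - idx b r)) :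
    SQ.cls _ v hv ∈ (HL p c ρ idx X).G b j :=
  Submodule.mem_iSup_of_mem r (SQ.cls_mem_gr hv ⟨h1, h2⟩)

lemma G_induction {W : Type*} [AddCommGroup W] [Module k W] {b : Bool} {j : ℤ}
    {P : Submodule k W} (F : (HL p c ρ idx X).V →ₗ[k] W)
    (h : ∀ r v (hv : v ∈ X.cyc p c ρ), v ∈ X.A (r * p + ρ) → v ∈ X.G b (j - idx b r) →
      F (SQ.cls _ v hv) ∈ P) (x : (HL p c ρ idx X).V) (hx : x ∈ (HL p c ρ idx X).G b j) : F x ∈ P :=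
  iSup_map_mem F (fun r x hx => SQ.gr_le_comap (S := X.A (r * p + ρ) ⊓ X.G b (j - idx b r)) F
    (fun v hv hS => h r v hv hS.1 hS.2) hx) x hx

lemma hlMap_G (f : X.V →ₗ[k] Y.V) (hD : ∀ x, f (X.D x) = Y.D (f x))
    (hA : ∀ d x, x ∈ X.A d → f x ∈ Y.A d) (e : Bool → ℤ)
    (hG : ∀ b j x, x ∈ X.G b j → f x ∈ Y.G b (j + e b)) (b : Bool) (j : ℤ)
    (x : (HL p c ρ idx X).V) (hx : x ∈ (HL p c ρ idx X).G b j) :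
    hlMap p c ρ f hD hA x ∈ (HL p c ρ idx Y).G b (j + e b) := by
  refine G_induction (X := X) (idx := idx) (hlMap p c ρ f hD hA)
    (fun r v hv h1 h2 => cls_mem_G (X := Y) (idx := idx) r _ (hA _ _ h1) ?_) x hx
  have := hG _ _ _ h2
  have e : j - idx b r + e b = j + e b - idx b r := by ring
  rwa [e] at this

lemma hlMap_G' (f : X.V →ₗ[k] Y.V) (hD : ∀ x, f (X.D x) = Y.D (f x))
    (hA : ∀ d x, x ∈ X.A d → f x ∈ Y.A d)
    (hG : ∀ b j x, x ∈ X.G b j → f x ∈ Y.G b j) (b : Bool) (j : ℤ)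
    (x : (HL p c ρ idx X).V) (hx : x ∈ (HL p c ρ idx X).G b j) :
    hlMap p c ρ f hD hA x ∈ (HL p c ρ idx Y).G b j := by
  have := hlMap_G (idx := idx) f hD hA (fun _ => 0)
    (fun b j x hx => by rw [add_zero]; exact hG b j x hx) b j x hx
  rwa [add_zero] at this

variable (X) in
lemma HL_homog : (HL p c ρ idx X).Homog := fun b j x hx =>
  hlMap_G (idx := idx) X.T X.TD X.TA (fun b => -tau b) X.TG b j x hx

lemma hlMap_comm (f : X.V →ₗ[k] Y.V) (hD : ∀ x, f (X.D x) = Y.D (f x))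
    (hA : ∀ d x, x ∈ X.A d → f x ∈ Y.A d) (E : Module.End k X.V) (hE : ∀ x, E (X.D x) = X.D (E x))
    (hEA : ∀ d x, x ∈ X.A d → E x ∈ X.A d) (E' : Module.End k Y.V)
    (hE' : ∀ x, E' (Y.D x) = Y.D (E' x)) (hEA' : ∀ d x, x ∈ Y.A d → E' x ∈ Y.A d)
    (h : ∀ x, f (E x) = E' (f x)) (x : SQ (X.cyc p c ρ) (LinearMap.range (X.D ^ (p - c)))) :
    hlMap p c ρ f hD hA (hlMap p c ρ E hE hEA x) = hlMap p c ρ E' hE' hEA' (hlMap p c ρ f hD hA x) := by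
  refine SQ.ind (P := fun x => hlMap p c ρ f hD hA (hlMap p c ρ E hE hEA x)
    = hlMap p c ρ E' hE' hEA' (hlMap p c ρ f hD hA x)) (fun v hv => SQ.cls_congr (h v) _ _) x

lemma HL_pow (hT : X.T ^ p = 0) : (HL p c ρ idx X).D ^ p = 0 := by
  refine LinearMap.ext fun x => SQ.ind (P := fun x => ((HL p c ρ idx X).D ^ p) x = 0)
    (fun v hv => ?_) x
  have h1 := pow_map (D := X.T.restrict (map_mem_cyc (p := p) (c := c) (ρ := ρ) X.T
    X.TD X.TA)) (D' := (HL p c ρ idx X).D)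
    (Submodule.mkQ ((LinearMap.range (X.D ^ (p - c))).comap (X.cyc p c ρ).subtype))
    (fun _ => rfl) p ⟨v, hv⟩
  have h2 := pow_map (D := X.T.restrict (map_mem_cyc (p := p) (c := c) (ρ := ρ) X.T
    X.TD X.TA)) (D' := X.T) (X.cyc p c ρ).subtype (fun _ => rfl) p ⟨v, hv⟩
  rw [hT] at h2
  exact h1.symm.trans ((congrArg _ (Subtype.ext h2)).trans (map_zero _))

/-- A contraction of the topological differential that is compatible with the Hochschild structure
contracts the homology. -/
lemma HL_adp (h : Module.End k X.V) (hD : ∀ x, h (X.D x) = X.D (h x))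
    (hA : ∀ d x, x ∈ X.A d → h x ∈ X.A d) (hT : ∀ x, adp p X.T h x = x)
    (x : (HL p c ρ idx X).V) : adp p (HL p c ρ idx X).D (hlMap p c ρ h hD hA) x = x := by
  refine SQ.ind (P := fun x => adp p (HL p c ρ idx X).D (hlMap p c ρ h hD hA) x = x)
    (fun v hv => ?_) x
  have h1 := adp_map p (D := X.T.restrict (map_mem_cyc (p := p) (c := c) (ρ := ρ) X.T
    X.TD X.TA)) (D' := (HL p c ρ idx X).D)
    (H := h.restrict (map_mem_cyc (p := p) (c := c) (ρ := ρ) h hD hA)) (H' := hlMap p c ρ h hD hA)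
    (Submodule.mkQ ((LinearMap.range (X.D ^ (p - c))).comap (X.cyc p c ρ).subtype))
    (fun _ => rfl) (fun _ => rfl) ⟨v, hv⟩
  have h2 := adp_map p (D := X.T.restrict (map_mem_cyc (p := p) (c := c) (ρ := ρ) X.T
    X.TD X.TA)) (D' := X.T)
    (H := h.restrict (map_mem_cyc (p := p) (c := c) (ρ := ρ) h hD hA)) (H' := h)
    (X.cyc p c ρ).subtype (fun _ => rfl) (fun _ => rfl) ⟨v, hv⟩
  refine h1.symm.trans (congrArg _ (Subtype.ext (h2.trans (hT v))))

end HL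

/-- A contraction of the topological differential, compatible with the Hochschild structure. -/
structure TCon (p : ℕ) (X : L1 k) where
  h : Module.End k X.V
  hD : ∀ x, h (X.D x) = X.D (h x)
  hA : ∀ d x, x ∈ X.A d → h x ∈ X.A d
  hG : ∀ b j x, x ∈ X.G b j → h x ∈ X.G b (j + (p - 1 : ℕ) * tau b)
  hT : ∀ x, adp p X.T h x = x

/-- A short exact sequence `S → X → Q` compatible with all the structure except `∂_q`, which
splits up to homotopy for the Hochschild differential: `u` is a retraction onto `S`, `w` a linear
section of `f`, and `H` contracts the common kernel of `u` and `f`. -/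
structure Split (p : ℕ) (S X Q : L1 k) where
  ι : S.V →ₗ[k] X.V
  u : X.V →ₗ[k] S.V
  f : X.V →ₗ[k] Q.V
  w : Q.V →ₗ[k] X.V
  H : Module.End k X.V
  ιD : ∀ x, ι (S.D x) = X.D (ι x)
  uD : ∀ x, u (X.D x) = S.D (u x)
  fD : ∀ x, f (X.D x) = Q.D (f x)
  ιT : ∀ x, ι (S.T x) = X.T (ι x)
  fT : ∀ x, f (X.T x) = Q.T (f x)
  ιA : ∀ d x, x ∈ S.A d → ι x ∈ X.A d
  uA : ∀ d x, x ∈ X.A d → u x ∈ S.A d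
  fA : ∀ d x, x ∈ X.A d → f x ∈ Q.A d
  wA : ∀ d x, x ∈ Q.A d → w x ∈ X.A d
  HA : ∀ d x, x ∈ X.A d → H x ∈ X.A (d + (p - 1 : ℕ))
  ιG : ∀ b j x, x ∈ S.G b j → ι x ∈ X.G b j
  uG : ∀ b j x, x ∈ X.G b j → u x ∈ S.G b j
  fG : ∀ b j x, x ∈ X.G b j → f x ∈ Q.G b j
  wG : ∀ b j x, x ∈ Q.G b j → w x ∈ X.G b j
  HG : ∀ b j x, x ∈ X.G b j → H x ∈ X.G b j
  uι : ∀ x, u (ι x) = x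
  fι : ∀ x, f (ι x) = 0
  fw : ∀ x, f (w x) = x
  uw : ∀ x, u (w x) = 0
  uH : ∀ x, u (H x) = 0
  fH : ∀ x, f (H x) = 0
  Hι : ∀ x, H (ι x) = 0
  con : ∀ x, u x = 0 → f x = 0 → adp p X.D H x = x

namespace Split

variable {p : ℕ} {S X Q : L1 k} (s : Split p S X Q)

/-- The section of `f`, corrected so as to commute with the Hochschild differential. -/
def sec : Q.V →ₗ[k] X.V := (1 - adp p X.D s.H) ∘ₗ s.w

lemma sec_apply (x : Q.V) : s.sec x = s.w x - adp p X.D s.H (s.w x) := rfl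

lemma f_adp (x : X.V) : s.f (adp p X.D s.H x) = 0 := by
  rw [adp_apply, map_sum]
  exact Finset.sum_eq_zero fun i _ => by rw [pow_map s.f s.fD, s.fH, map_zero]

lemma adp_ι (x : S.V) : adp p X.D s.H (s.ι x) = 0 := by
  rw [adp_apply]
  exact Finset.sum_eq_zero fun i _ => by rw [← pow_map s.ι s.ιD, s.Hι, map_zero]

lemma f_sec (x : Q.V) : s.f (s.sec x) = x := by
  rw [sec_apply, map_sub, f_adp, s.fw, sub_zero]

/-- The identity decomposes, up to a null-homotopic map, through the sub and the quotient. -/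
lemma sum (x : X.V) : s.ι (s.u x) + s.sec (s.f x) = x - adp p X.D s.H x := by
  have h := s.con (x - s.ι (s.u x) - s.w (s.f x))
    (by rw [map_sub, map_sub, s.uι, s.uw, sub_self, sub_zero])
    (by rw [map_sub, map_sub, s.fι, s.fw, sub_zero, sub_self])
  rw [map_sub, map_sub, s.adp_ι, sub_zero] at h
  rw [sec_apply]
  have h2 : adp p X.D s.H x = adp p X.D s.H (s.w (s.f x)) + (x - s.ι (s.u x) - s.w (s.f x)) := by
    rw [← h]; abel
  rw [h2]
  abel

/-- The corrected section commutes with the Hochschild differential, because the defect of `w` lies in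
the contracted part of the sequence. -/
lemma sec_D (hX : X.D ^ p = 0) (x : Q.V) : s.sec (Q.D x) = X.D (s.sec x) := by
  have h := s.con (s.w (Q.D x) - X.D (s.w x))
    (by rw [map_sub, s.uw, s.uD, s.uw, map_zero, sub_zero])
    (by rw [map_sub, s.fw, s.fD, s.fw, sub_self])
  have h2 : adp p X.D s.H (X.D (s.w x)) = X.D (adp p X.D s.H (s.w x)) :=
    (LinearMap.congr_fun (adp_comm p X.D s.H hX) _).symm
  rw [map_sub, h2] at h
  rw [sec_apply, sec_apply, map_sub, sub_eq_sub_iff_sub_eq_sub, ← h]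

lemma sec_A (d : ℤ) (x : Q.V) (hx : x ∈ Q.A d) : s.sec x ∈ X.A d := by
  refine Submodule.sub_mem _ (s.wA d x hx) (adp_mem 1 X.DA (fun j x hx => ?_) d _ (s.wA d x hx))
  rw [mul_one]
  exact s.HA j x hx

lemma sec_G (b : Bool) (j : ℤ) (x : Q.V) (hx : x ∈ Q.G b j) : s.sec x ∈ X.G b j := by
  refine Submodule.sub_mem _ (s.wG b j x hx) (adp_mem 0 (fun j x hx => ?_) (fun j x hx => ?_) j _
    (s.wG b j x hx))
  · rw [sub_zero]; exact X.DG b j x hx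
  · rw [mul_zero, add_zero]; exact s.HG b j x hx

variable (c : ℕ) (hc : c ≤ p) (ρ : ℤ) (idx : Bool → ℤ → ℤ)

include hc in
/-- On homology the sequence splits: the null-homotopic correction in `Split.sum` vanishes there. -/
lemma hl_sum (hX : X.D ^ p = 0) (x : (HL p c ρ idx X).V) :
    hlMap p c ρ s.ι s.ιD s.ιA (hlMap p c ρ s.u s.uD s.uA x)
      + hlMap p c ρ s.sec (s.sec_D hX) s.sec_A (hlMap p c ρ s.f s.fD s.fA x) = x := by
  refine SQ.ind (P := fun x => hlMap p c ρ s.ι s.ιD s.ιA (hlMap p c ρ s.u s.uD s.uA x)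
      + hlMap p c ρ s.sec (s.sec_D hX) s.sec_A (hlMap p c ρ s.f s.fD s.fA x) = x) (fun v hv => ?_) x
  simp only [hlMap_cls]
  rw [SQ.cls_add, SQ.cls_eq, s.sum, sub_sub_cancel_left]
  exact Submodule.neg_mem _ (adp_mem_range p c hc _ _ _ hv.2)

/-- If the quotient has contractible topological differential, the sub has the same homology. -/
def hEquivSub (hX : X.D ^ p = 0) (hT : X.T ^ p = 0) (hQ : TCon p Q)
    (ιQ : ∀ x, s.ι (S.Q x) = X.Q (s.ι x)) : HEquiv p (HL p c ρ idx S) (HL p c ρ idx X) :=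
  HEquiv.ofContractibleQuotient (Q := HL p c ρ idx Q) (HL_homog X) (HL_pow hT)
    (hlMap p c ρ s.ι s.ιD s.ιA) (hlMap p c ρ s.u s.uD s.uA) (hlMap p c ρ s.f s.fD s.fA)
    (hlMap p c ρ s.sec (s.sec_D hX) s.sec_A)
    (hlMap_comm s.ι s.ιD s.ιA S.T S.TD S.TA X.T X.TD X.TA s.ιT)
    (hlMap_comm s.f s.fD s.fA X.T X.TD X.TA Q.T Q.TD Q.TA s.fT)
    (hlMap_comm s.ι s.ιD s.ιA S.Q S.QD S.QA X.Q X.QD X.QA ιQ)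
    (hlMap_G' _ _ _ s.ιG) (hlMap_G' _ _ _ s.uG) (hlMap_G' _ _ _ s.fG) (hlMap_G' _ _ _ s.sec_G)
    (fun x => SQ.ind (P := fun x => hlMap p c ρ s.u s.uD s.uA (hlMap p c ρ s.ι s.ιD s.ιA x) = x)
      (fun v hv => SQ.cls_congr (s.uι v) _ _) x)
    (fun x => SQ.ind (P := fun x => hlMap p c ρ s.f s.fD s.fA
        (hlMap p c ρ s.sec (s.sec_D hX) s.sec_A x) = x)
      (fun v hv => SQ.cls_congr (s.f_sec v) _ _) x)
    (fun x => SQ.ind (P := fun x => hlMap p c ρ s.f s.fD s.fA (hlMap p c ρ s.ι s.ιD s.ιA x) = 0)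
      (fun v hv => SQ.cls_zero (s.fι v) _) x)
    (s.hl_sum c hc ρ idx hX) (hlMap p c ρ hQ.h hQ.hD hQ.hA) (HL_adp _ _ _ hQ.hT)
    (hlMap_G _ _ _ _ hQ.hG)

/-- If the sub has contractible topological differential, the quotient has the same homology. -/
def hEquivQuotient (hX : X.D ^ p = 0) (hT : X.T ^ p = 0) (hS : TCon p S)
    (fQ : ∀ x, s.f (X.Q x) = Q.Q (s.f x)) : HEquiv p (HL p c ρ idx X) (HL p c ρ idx Q) :=
  HEquiv.ofContractibleSub (S := HL p c ρ idx S) (HL_homog X) (HL_pow hT)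
    (hlMap p c ρ s.ι s.ιD s.ιA) (hlMap p c ρ s.u s.uD s.uA) (hlMap p c ρ s.f s.fD s.fA)
    (hlMap p c ρ s.sec (s.sec_D hX) s.sec_A)
    (hlMap_comm s.ι s.ιD s.ιA S.T S.TD S.TA X.T X.TD X.TA s.ιT)
    (hlMap_comm s.f s.fD s.fA X.T X.TD X.TA Q.T Q.TD Q.TA s.fT)
    (hlMap_comm s.f s.fD s.fA X.Q X.QD X.QA Q.Q Q.QD Q.QA fQ)
    (hlMap_G' _ _ _ s.ιG) (hlMap_G' _ _ _ s.uG) (hlMap_G' _ _ _ s.fG) (hlMap_G' _ _ _ s.sec_G)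
    (fun x => SQ.ind (P := fun x => hlMap p c ρ s.u s.uD s.uA (hlMap p c ρ s.ι s.ιD s.ιA x) = x)
      (fun v hv => SQ.cls_congr (s.uι v) _ _) x)
    (fun x => SQ.ind (P := fun x => hlMap p c ρ s.f s.fD s.fA
        (hlMap p c ρ s.sec (s.sec_D hX) s.sec_A x) = x)
      (fun v hv => SQ.cls_congr (s.f_sec v) _ _) x)
    (fun x => SQ.ind (P := fun x => hlMap p c ρ s.f s.fD s.fA (hlMap p c ρ s.ι s.ιD s.ιA x) = 0)
      (fun v hv => SQ.cls_zero (s.fι v) _) x)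
    (s.hl_sum c hc ρ idx hX) (hlMap p c ρ hS.h hS.hD hS.hA) (HL_adp _ _ _ hS.hT)
    (hlMap_G _ _ _ _ hS.hG)

end Split

/-- The degree shift of the even part: a class of Hochschild degree `r p` comes from the ordinary
Hochschild degree `2 r`. -/
def idxE (p : ℕ) (b : Bool) (r : ℤ) : ℤ := if b then r * p else 4 * r

/-- The degree shift of the odd part: the chain of classes of Hochschild degrees `(r - 1) p + 1, …,
r p - 1` comes from the ordinary Hochschild degree `2 r - 1`; the shift is that of its last term. -/
def idxO (p : ℕ) (b : Bool) (r : ℤ) : ℤ := if b then (r - 1) * p + 1 else 4 * r - 2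

/-- The `p`-extension of the contracted homology: even homology is kept, odd homology is replaced
by a chain of length `p - 1`. -/
abbrev ext (p : ℕ) (X : L1 k) : L2 k :=
  (HL p 1 0 (idxE p) X).prod ((HL p (p - 1) (-1) (idxO p) X).up p)

end L1

end PHHH

/-! ### Totals of maps and their contractions -/

namespace PHHH

variable {k : Type u} [Field k]

/-- A map of `p`-complexes for both differentials, preserving all gradings. -/
structure L1Map (X Y : L1 k) where
  f : X.V →ₗ[k] Y.V
  fD : ∀ x, f (X.D x) = Y.D (f x)
  fT : ∀ x, f (X.T x) = Y.T (f x)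
  fA : ∀ d x, x ∈ X.A d → f x ∈ Y.A d
  fG : ∀ b j x, x ∈ X.G b j → f x ∈ Y.G b j

/-- A map of `p`-complexes is used as a function. -/
instance (X Y : L1 k) : CoeFun (L1Map X Y) (fun _ => X.V → Y.V) := ⟨fun f => f.f⟩

/-- The identity. -/
abbrev L1Map.id (X : L1 k) : L1Map X X :=
  ⟨LinearMap.id, fun _ => rfl, fun _ => rfl, fun _ _ h => h, fun _ _ _ h => h⟩

/-- A short exact sequence that splits for all the structure except `∂_q`. -/
structure L1SES (X Y Z : L1 k) where
  t : L1Map X Y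
  ev : L1Map Y Z
  div : L1Map Y X
  const : L1Map Z Y
  tQ : ∀ x, t (X.Q x) = Y.Q (t x)
  evQ : ∀ x, ev (Y.Q x) = Z.Q (ev x)
  div_t : ∀ x, div (t x) = x
  ev_t : ∀ x, ev (t x) = 0
  ev_const : ∀ x, ev (const x) = x
  div_const : ∀ x, div (const x) = 0
  sum : ∀ x, t (div x) + const (ev x) = x

lemma mem_of_eq {ι V : Type*} [AddCommGroup V] [Module k V] {G : ι → Submodule k V} {i j : ι} {x : V}
    (h : x ∈ G i) (e : i = j) : x ∈ G j := e ▸ h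

lemma shDown_mem {q : ℕ} {Y : Type*} [AddCommGroup Y] [Module k Y] {G : ℕ → Submodule k Y}
    (x : Fin q → Y) (h : ∀ s : Fin q, x s ∈ G ((s : ℕ))) (s : Fin q) :
    shDown k q Y x s ∈ G (s + 1) := by
  rw [shDown_apply]
  split_ifs with h'
  · exact h ⟨_, h'⟩
  · exact Submodule.zero_mem _

namespace L1

variable (p : ℕ)

section Up

/-- The tensor product with the topological chain of length `p - 1`, whose bottom term is placed in
topological degree `-c`. -/
abbrev up (c : ℤ) (X : L1 k) : L1 k where
  V := Fin (p - 1) → X.V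
  D := X.D.compLeft (Fin (p - 1))
  T := X.T.compLeft (Fin (p - 1)) + shDown k (p - 1) X.V
  Q := X.Q.compLeft (Fin (p - 1))
  DT x := by
    have := LinearMap.congr_fun (shDown_compLeft (p - 1) X.D) x
    simp only [Module.End.mul_apply] at this
    rw [LinearMap.add_apply, LinearMap.add_apply, this, map_add]
    congr 1
    exact funext fun s => X.DT (x s)
  DQ x := funext fun s => X.DQ (x s)
  TQ x := by
    have := LinearMap.congr_fun (shDown_compLeft (p - 1) X.Q) x
    simp only [Module.End.mul_apply] at this
    rw [LinearMap.add_apply, LinearMap.add_apply, this, map_add]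
    congr 1
    exact funext fun s => X.TQ (x s)
  A d := Submodule.pi Set.univ fun _ => X.A d
  G b j := Submodule.pi Set.univ fun s : Fin (p - 1) => X.G b (j - tau b * (s : ℕ) + tau b * c)
  DA d x hx s _ := X.DA d _ (hx s trivial)
  TA d x hx s _ := Submodule.add_mem _ (X.TA d _ (hx s trivial))
    (shDown_mem (G := fun _ => X.A d) x (fun s => hx s trivial) s)
  QA d x hx s _ := X.QA d _ (hx s trivial)
  DG b j x hx s _ := X.DG _ _ _ (hx s trivial)
  TG b j x hx s _ := by
    refine Submodule.add_mem _ ?_ ?_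
    · exact mem_of_eq (G := X.G b) (X.TG _ _ _ (hx s trivial)) (by ring)
    · exact mem_of_eq (G := X.G b) (shDown_mem (G := fun s : ℕ => X.G b (j - tau b * s + tau b * c)) x
        (fun s => hx s trivial) s) (by push_cast; ring)

end Up

/-- The tensor product with the chain of length `p - 1` in the Hochschild direction, whose terms sit
in Hochschild degrees `1, …, p - 1` and in `q`-degree `2`. -/
abbrev susp (X : L1 k) : L1 k where
  V := Fin (p - 1) → X.V
  D := X.D.compLeft (Fin (p - 1)) + shDown k (p - 1) X.V
  T := X.T.compLeft (Fin (p - 1))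
  Q := X.Q.compLeft (Fin (p - 1))
  DT x := by
    have := LinearMap.congr_fun (shDown_compLeft (p - 1) X.T) x
    simp only [Module.End.mul_apply] at this
    rw [LinearMap.add_apply, LinearMap.add_apply, this, map_add]
    congr 1
    exact funext fun s => X.DT (x s)
  DQ x := by
    have := LinearMap.congr_fun (shDown_compLeft (p - 1) X.Q) x
    simp only [Module.End.mul_apply] at this
    rw [LinearMap.add_apply, LinearMap.add_apply, this, map_add]
    congr 1
    exact funext fun s => X.DQ (x s)
  TQ x := funext fun s => X.TQ (x s)
  A d := Submodule.pi Set.univ fun s : Fin (p - 1) => X.A (d - ((s : ℕ) + 1))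
  G b j := Submodule.pi Set.univ fun _ => X.G b (j - if b then 0 else 2)
  DA d x hx s _ := by
    refine Submodule.add_mem _ ?_ ?_
    · exact mem_of_eq (G := X.A) (X.DA _ _ (hx s trivial)) (by ring)
    · exact mem_of_eq (G := X.A) (shDown_mem (G := fun s : ℕ => X.A (d - (s + 1))) x
        (fun s => hx s trivial) s) (by push_cast; ring)
  TA d x hx s _ := X.TA _ _ (hx s trivial)
  QA d x hx s _ := X.QA _ _ (hx s trivial)
  DG b j x hx s _ := Submodule.add_mem _ (X.DG _ _ _ (hx s trivial))
    (shDown_mem (G := fun _ => X.G b (j - if b then 0 else 2)) x (fun s => hx s trivial) s)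
  TG b j x hx s _ := mem_of_eq (G := X.G b) (X.TG _ _ _ (hx s trivial)) (by ring)

section LoHi

variable {X Y : L1 k} (t : L1Map X Y) (tQ : ∀ x, t (X.Q x) = Y.Q (t x))

/-- The vector supported at the last place. -/
def last (k : Type*) [Field k] (q : ℕ) (Y : Type*) [AddCommGroup Y] [Module k Y] :
    Y →ₗ[k] (Fin q → Y) :=
  LinearMap.pi fun s => if (s : ℕ) + 1 = q then LinearMap.id else 0

lemma last_apply {q : ℕ} {Y : Type*} [AddCommGroup Y] [Module k Y] (y : Y) (s : Fin q) :
    last k q Y y s = if (s : ℕ) + 1 = q then y else 0 := by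
  by_cases h : (s : ℕ) + 1 = q
  · simp only [last, LinearMap.pi_apply, if_pos h]; rfl
  · simp only [last, LinearMap.pi_apply, if_neg h]; rfl

lemma compLeft_last {q : ℕ} {Y Z : Type*} [AddCommGroup Y] [Module k Y] [AddCommGroup Z]
    [Module k Z] (f : Y →ₗ[k] Z) (y : Y) :
    f.compLeft (Fin q) (last k q Y y) = last k q Z (f y) := by
  funext s
  simp only [LinearMap.compLeft_apply, Function.comp_apply, last_apply]
  split_ifs <;> simp

/-- The first component. -/
def first (k : Type*) [Field k] (q : ℕ) (Y : Type*) [AddCommGroup Y] [Module k Y] :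
    (Fin q → Y) →ₗ[k] Y :=
  if h : 0 < q then LinearMap.proj ⟨0, h⟩ else 0

lemma first_apply {q : ℕ} {Y : Type*} [AddCommGroup Y] [Module k Y] (x : Fin q → Y) :
    first k q Y x = if h : 0 < q then x ⟨0, h⟩ else 0 := by
  by_cases h : 0 < q
  · simp only [first, dif_pos h]; rfl
  · simp only [first, dif_neg h]; rfl

lemma first_compLeft {q : ℕ} {Y Z : Type*} [AddCommGroup Y] [Module k Y] [AddCommGroup Z]
    [Module k Z] (f : Y →ₗ[k] Z) (x : Fin q → Y) :
    first k q Z (f.compLeft (Fin q) x) = f (first k q Y x) := by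
  simp only [first_apply]
  split_ifs <;> simp

/-- The total space of `X → Y = ⋯ = Y` (with `p - 1` copies of `Y`), in which `X` has topological
degree `0`. -/
abbrev lo : L1 k where
  V := X.V × (up p (p - 1) Y).V
  D := X.D.prodMap (up p (p - 1) Y).D
  T := (X.T ∘ₗ LinearMap.fst _ _ _).prod ((up p (p - 1) Y).T ∘ₗ LinearMap.snd _ _ _
    + last k (p - 1) Y.V ∘ₗ t.f ∘ₗ LinearMap.fst _ _ _)
  Q := X.Q.prodMap (up p (p - 1) Y).Q
  DT x := Prod.ext (X.DT _) (by
    have h1 := (up p (p - 1) Y).DT x.2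
    have h2 := compLeft_last (q := p - 1) Y.D (t.f x.1)
    change (up p (p - 1) Y).D ((up p (p - 1) Y).T x.2 + last k (p - 1) Y.V (t x.1))
      = (up p (p - 1) Y).T ((up p (p - 1) Y).D x.2) + last k (p - 1) Y.V (t (X.D x.1))
    rw [map_add, h1, t.fD, ← h2])
  DQ x := Prod.ext (X.DQ _) ((up p (p - 1) Y).DQ _)
  TQ x := Prod.ext (X.TQ _) (by
    have h1 := (up p (p - 1) Y).TQ x.2
    have h2 := compLeft_last (q := p - 1) Y.Q (t.f x.1)
    change (up p (p - 1) Y).T ((up p (p - 1) Y).Q x.2) + last k (p - 1) Y.V (t (X.Q x.1))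
      = (up p (p - 1) Y).Q ((up p (p - 1) Y).T x.2 + last k (p - 1) Y.V (t x.1))
    rw [map_add, h1, tQ, ← h2])
  A d := (X.A d).prod ((up p (p - 1) Y).A d)
  G b j := (X.G b j).prod ((up p (p - 1) Y).G b j)
  DA d x hx := ⟨X.DA d _ hx.1, (up p (p - 1) Y).DA d _ hx.2⟩
  TA d x hx := ⟨X.TA d _ hx.1, Submodule.add_mem _ ((up p (p - 1) Y).TA d _ hx.2)
    (fun s _ => by
      change last k (p - 1) Y.V (t x.1) s ∈ _
      rw [last_apply]
      split_ifs
      · exact t.fA _ _ hx.1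
      · exact Submodule.zero_mem _)⟩
  QA d x hx := ⟨X.QA d _ hx.1, (up p (p - 1) Y).QA d _ hx.2⟩
  DG b j x hx := ⟨X.DG b j _ hx.1, (up p (p - 1) Y).DG b j _ hx.2⟩
  TG b j x hx := ⟨X.TG b j _ hx.1, Submodule.add_mem _ ((up p (p - 1) Y).TG b j _ hx.2)
    (fun s _ => by
      change last k (p - 1) Y.V (t x.1) s ∈ _
      rw [last_apply]
      split_ifs with h
      · refine mem_of_eq (G := Y.G b) (t.fG _ _ _ hx.1) ?_
        have : ((s : ℕ) : ℤ) + 1 + 1 = p := by exact_mod_cast (by omega : (s : ℕ) + 1 + 1 = p)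
        rw [← this]
        ring
      · exact Submodule.zero_mem _)⟩

/-- The total space of `X = ⋯ = X → Y` (with `p - 1` copies of `X`), in which `Y` has topological
degree `0`. -/
abbrev hi : L1 k where
  V := Y.V × (up p (-1) X).V
  D := Y.D.prodMap (up p (-1) X).D
  T := (Y.T ∘ₗ LinearMap.fst k Y.V (up p (-1) X).V
      + t.f ∘ₗ first k (p - 1) X.V ∘ₗ LinearMap.snd k Y.V (up p (-1) X).V).prod
    ((up p (-1) X).T ∘ₗ LinearMap.snd k Y.V (up p (-1) X).V)
  Q := Y.Q.prodMap (up p (-1) X).Q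
  DT x := Prod.ext (by
    change Y.D (Y.T x.1 + t (first k (p - 1) X.V x.2))
      = Y.T (Y.D x.1) + t (first k (p - 1) X.V (X.D.compLeft (Fin (p - 1)) x.2))
    rw [map_add, Y.DT, first_compLeft, t.fD]) ((up p (-1) X).DT x.2)
  DQ x := Prod.ext (Y.DQ _) ((up p (-1) X).DQ _)
  TQ x := Prod.ext (by
    change Y.T (Y.Q x.1) + t (first k (p - 1) X.V (X.Q.compLeft (Fin (p - 1)) x.2))
      = Y.Q (Y.T x.1 + t (first k (p - 1) X.V x.2))
    rw [map_add, Y.TQ, first_compLeft, tQ]) ((up p (-1) X).TQ x.2)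
  A d := (Y.A d).prod ((up p (-1) X).A d)
  G b j := (Y.G b j).prod ((up p (-1) X).G b j)
  DA d x hx := ⟨Y.DA d _ hx.1, (up p (-1) X).DA d _ hx.2⟩
  TA d x hx := ⟨Submodule.add_mem _ (Y.TA d _ hx.1) (t.fA _ _ (by
      change first k (p - 1) X.V x.2 ∈ X.A d
      rw [first_apply]
      split_ifs
      · exact hx.2 _ trivial
      · exact Submodule.zero_mem _)), (up p (-1) X).TA d _ hx.2⟩
  QA d x hx := ⟨Y.QA d _ hx.1, (up p (-1) X).QA d _ hx.2⟩
  DG b j x hx := ⟨Y.DG b j _ hx.1, (up p (-1) X).DG b j _ hx.2⟩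
  TG b j x hx := ⟨Submodule.add_mem _ (Y.TG b j _ hx.1) (t.fG _ _ _ (by
      change first k (p - 1) X.V x.2 ∈ X.G b _
      rw [first_apply]
      split_ifs with h
      · exact mem_of_eq (G := X.G b) (hx.2 ⟨0, h⟩ trivial) (by push_cast; ring)
      · exact Submodule.zero_mem _)), (up p (-1) X).TG b j _ hx.2⟩

end LoHi

section Contractions

variable [Fact p.Prime] [CharP k p]

/-- Transport of a contraction along an injective map of topological complexes. -/
lemma adp_of_injective {V W : Type*} [AddCommGroup V] [Module k V] [AddCommGroup W] [Module k W]
    {D H : Module.End k V} {D' H' : Module.End k W} (f : V →ₗ[k] W) (hf : Function.Injective f)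
    (hD : ∀ x, f (D x) = D' (f x)) (hH : ∀ x, f (H x) = H' (f x)) (h : adp p D' H' = 1) (x : V) :
    adp p D H x = x :=
  hf (by rw [adp_map p f hD hH, h]; rfl)

variable {p} in
/-- The total space of `X = ⋯ = X` is contractible. -/
def loCon (hodd : Odd p) (X : L1 k) (hQ) : TCon p (lo p (L1Map.id X) hQ) where
  h := (first k (p - 1) X.V ∘ₗ LinearMap.snd _ _ _).prod 0
  hD x := Prod.ext (first_compLeft X.D x.2) (map_zero (up p (p - 1) X).D).symm
  hA d x hx := ⟨by
    change first k (p - 1) X.V x.2 ∈ X.A d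
    rw [first_apply]
    split_ifs
    · exact hx.2 _ trivial
    · exact Submodule.zero_mem _, Submodule.zero_mem _⟩
  hG b j x hx := ⟨by
    change first k (p - 1) X.V x.2 ∈ X.G b _
    rw [first_apply]
    split_ifs with h
    · refine mem_of_eq (G := X.G b) (hx.2 ⟨0, h⟩ trivial) ?_
      rw [Nat.cast_sub (by omega)]
      push_cast
      ring
    · exact Submodule.zero_mem _, Submodule.zero_mem _⟩
  hT x := by
    have hp := (Fact.out : p.Prime).two_le
    let F : (lo p (L1Map.id X) hQ).V →ₗ[k] (Fin p → X.V) := LinearMap.pi fun s =>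
      if h : (s : ℕ) < p - 1 then LinearMap.proj ⟨s, h⟩ ∘ₗ LinearMap.snd _ _ _
      else LinearMap.fst _ _ _
    have hF : ∀ x s, F x s = if h : (s : ℕ) < p - 1 then x.2 ⟨s, h⟩ else x.1 := by
      intro x s
      by_cases h : (s : ℕ) < p - 1
      · simp only [F, LinearMap.pi_apply, dif_pos h]; rfl
      · simp only [F, LinearMap.pi_apply, dif_neg h]; rfl
    refine adp_of_injective p F ?_ ?_ ?_ (adp_compLeft_add_shDown p hodd X.T) x
    · intro x y h
      refine Prod.ext ?_ (funext fun s => ?_)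
      · have := congrFun h ⟨p - 1, by omega⟩
        rwa [hF, hF, dif_neg (by simp), dif_neg (by simp)] at this
      · have := congrFun h ⟨s, by omega⟩
        rwa [hF, hF, dif_pos s.2, dif_pos s.2] at this
    · intro x
      funext s
      have e : (lo p (L1Map.id X) hQ).T x = (X.T x.1, X.T.compLeft (Fin (p - 1)) x.2
        + shDown k (p - 1) X.V x.2 + last k (p - 1) X.V x.1) := rfl
      rw [hF, e, LinearMap.add_apply, Pi.add_apply, LinearMap.compLeft_apply, Function.comp_apply, hF,
        shDown_apply]
      by_cases h : (s : ℕ) < p - 1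
      · rw [dif_pos h, dif_pos h, dif_pos (by omega), hF]
        simp only [Pi.add_apply, shDown_apply, last_apply, LinearMap.compLeft_apply,
          Function.comp_apply]
        by_cases h' : (s : ℕ) + 1 < p - 1
        · rw [dif_pos h', dif_pos h', if_neg (by omega), add_zero]
        · rw [dif_neg h', dif_neg h', if_pos (by omega), add_zero]
      · rw [dif_neg h, dif_neg h, dif_neg (by omega), add_zero]
    · intro x
      funext s
      rw [hF, topOfBot_apply]
      by_cases h : (s : ℕ) < p - 1
      · rw [dif_pos h, dif_neg (by omega)]; rfl
      · rw [dif_neg h, dif_pos (by omega), hF, dif_pos (by simp only; omega)]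
        change first k (p - 1) X.V x.2 = _
        rw [first_apply, dif_pos (by omega)]

variable {p} in
/-- The total space of `X = ⋯ = X` is contractible. -/
def hiCon (hodd : Odd p) (X : L1 k) (hQ) : TCon p (hi p (L1Map.id X) hQ) where
  h := (0 : _ →ₗ[k] X.V).prod (last k (p - 1) X.V ∘ₗ LinearMap.fst k X.V (up p (-1) X).V)
  hD x := Prod.ext (map_zero X.D).symm (compLeft_last X.D x.1).symm
  hA d x hx := ⟨Submodule.zero_mem _, fun s _ => by
    change last k (p - 1) X.V x.1 s ∈ X.A d
    rw [last_apply]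
    split_ifs
    · exact hx.1
    · exact Submodule.zero_mem _⟩
  hG b j x hx := ⟨Submodule.zero_mem _, fun s _ => by
    change last k (p - 1) X.V x.1 s ∈ X.G b _
    rw [last_apply]
    split_ifs with h
    · refine mem_of_eq (G := X.G b) hx.1 ?_
      have : ((s : ℕ) : ℤ) + 1 = (p - 1 : ℕ) := by exact_mod_cast h
      rw [← this]
      ring
    · exact Submodule.zero_mem _⟩
  hT x := by
    have hp := (Fact.out : p.Prime).two_le
    let F : (hi p (L1Map.id X) hQ).V →ₗ[k] (Fin p → X.V) := LinearMap.pi fun s =>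
      if h : (s : ℕ) = 0 then LinearMap.fst k X.V (up p (-1) X).V
      else LinearMap.proj (⟨s - 1, by omega⟩ : Fin (p - 1)) ∘ₗ LinearMap.snd k X.V (up p (-1) X).V
    have hF : ∀ x s, F x s = if h : (s : ℕ) = 0 then x.1 else x.2 ⟨s - 1, by omega⟩ := by
      intro x s
      by_cases h : (s : ℕ) = 0
      · simp only [F, LinearMap.pi_apply, dif_pos h]; rfl
      · simp only [F, LinearMap.pi_apply, dif_neg h]; rfl
    refine adp_of_injective p F ?_ ?_ ?_ (adp_compLeft_add_shDown p hodd X.T) x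
    · intro x y h
      refine Prod.ext ?_ (funext fun s => ?_)
      · have := congrFun h ⟨0, by omega⟩
        rwa [hF, hF, dif_pos rfl, dif_pos rfl] at this
      · have := congrFun h ⟨s + 1, by omega⟩
        rwa [hF, hF, dif_neg (by simp), dif_neg (by simp)] at this
    · intro x
      funext s
      have e : (hi p (L1Map.id X) hQ).T x = (X.T x.1 + first k (p - 1) X.V x.2,
        X.T.compLeft (Fin (p - 1)) x.2 + shDown k (p - 1) X.V x.2) := rfl
      rw [hF, e, LinearMap.add_apply, Pi.add_apply, LinearMap.compLeft_apply, Function.comp_apply, hF,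
        shDown_apply]
      by_cases h : (s : ℕ) = 0
      · rw [dif_pos h, dif_pos h, dif_pos (by omega), hF, dif_neg (by simp), first_apply,
          dif_pos (by omega)]
        simp only [h]
      · rw [dif_neg h, dif_neg h]
        simp only
        rw [Pi.add_apply, shDown_apply, LinearMap.compLeft_apply,
          Function.comp_apply]
        by_cases h' : (s : ℕ) + 1 < p
        · rw [dif_pos h', dif_pos (by simp only; omega), hF, dif_neg (by simp)]
          have e1 : (⟨(s : ℕ) - 1 + 1, by omega⟩ : Fin (p - 1)) = ⟨(s : ℕ) + 1 - 1, by omega⟩ :=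
            Fin.ext (by simp only; omega)
          rw [e1]
        · rw [dif_neg h', dif_neg (by simp only; omega)]
    · intro x
      funext s
      rw [hF, topOfBot_apply]
      by_cases h : (s : ℕ) = 0
      · rw [dif_pos h, dif_neg (by omega)]; rfl
      · rw [dif_neg h]
        change last k (p - 1) X.V x.1 _ = _
        rw [last_apply]
        by_cases h' : (s : ℕ) + 1 = p
        · rw [dif_pos h', if_pos (by simp only; omega), hF, dif_pos rfl]
        · rw [dif_neg h', if_neg (by simp only; omega)]

end Contractions

variable {p} in
/-- The kernel of the map of total spaces `(X → Y = ⋯ = Y) → (Z = ⋯ = Z)` is `X = ⋯ = X`. -/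
def splitLo {X Y Z : L1 k} (s : L1SES X Y Z) :
    Split p (lo p (L1Map.id X) fun _ => rfl) (lo p s.t s.tQ) (up p (p - 1) Z) where
  ι := LinearMap.prodMap LinearMap.id (s.t.f.compLeft (Fin (p - 1)))
  u := LinearMap.prodMap LinearMap.id (s.div.f.compLeft (Fin (p - 1)))
  f := s.ev.f.compLeft (Fin (p - 1)) ∘ₗ LinearMap.snd k X.V (up p (p - 1) Y).V
  w := (0 : _ →ₗ[k] X.V).prod (s.const.f.compLeft (Fin (p - 1)))
  H := 0
  ιD x := Prod.ext rfl (funext fun i => s.t.fD _)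
  uD x := Prod.ext rfl (funext fun i => s.div.fD _)
  fD x := funext fun i => s.ev.fD _
  ιT x := Prod.ext rfl (by
    change s.t.f.compLeft (Fin (p - 1)) (X.T.compLeft (Fin (p - 1)) x.2
      + shDown k (p - 1) X.V x.2 + last k (p - 1) X.V x.1) = Y.T.compLeft (Fin (p - 1))
      (s.t.f.compLeft (Fin (p - 1)) x.2) + shDown k (p - 1) Y.V (s.t.f.compLeft (Fin (p - 1)) x.2)
      + last k (p - 1) Y.V (s.t.f x.1)
    rw [map_add, map_add, HEquiv.compLeft_shDown, compLeft_last]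
    congr 2
    exact funext fun i => s.t.fT _)
  fT x := by
    change s.ev.f.compLeft (Fin (p - 1)) (Y.T.compLeft (Fin (p - 1)) x.2
      + shDown k (p - 1) Y.V x.2 + last k (p - 1) Y.V (s.t.f x.1)) = Z.T.compLeft (Fin (p - 1))
      (s.ev.f.compLeft (Fin (p - 1)) x.2) + shDown k (p - 1) Z.V (s.ev.f.compLeft (Fin (p - 1)) x.2)
    rw [map_add, map_add, HEquiv.compLeft_shDown, compLeft_last, s.ev_t, map_zero, add_zero]
    congr 1
    exact funext fun i => s.ev.fT _
  ιA d x hx := ⟨hx.1, fun i _ => s.t.fA _ _ (hx.2 i trivial)⟩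
  uA d x hx := ⟨hx.1, fun i _ => s.div.fA _ _ (hx.2 i trivial)⟩
  fA d x hx i _ := s.ev.fA _ _ (hx.2 i trivial)
  wA d x hx := ⟨Submodule.zero_mem _, fun i _ => s.const.fA _ _ (hx i trivial)⟩
  HA d x hx := Submodule.zero_mem _
  ιG b j x hx := ⟨hx.1, fun i _ => s.t.fG _ _ _ (hx.2 i trivial)⟩
  uG b j x hx := ⟨hx.1, fun i _ => s.div.fG _ _ _ (hx.2 i trivial)⟩
  fG b j x hx i _ := s.ev.fG _ _ _ (hx.2 i trivial)
  wG b j x hx := ⟨Submodule.zero_mem _, fun i _ => s.const.fG _ _ _ (hx i trivial)⟩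
  HG b j x hx := Submodule.zero_mem _
  uι x := Prod.ext rfl (funext fun i => s.div_t _)
  fι x := funext fun i => s.ev_t _
  fw x := funext fun i => s.ev_const _
  uw x := Prod.ext rfl (funext fun i => s.div_const _)
  uH x := map_zero _
  fH x := map_zero _
  Hι x := rfl
  con x hu hf := by
    have h : x = 0 := Prod.ext (show x.1 = 0 from congrArg Prod.fst hu) (funext fun i => by
      rw [← s.sum (x.2 i), show s.div (x.2 i) = 0 from congrFun (congrArg Prod.snd hu) i,
        show s.ev (x.2 i) = 0 from congrFun hf i, map_zero, map_zero, add_zero]; rfl)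
    rw [h, map_zero]

variable {p} in
/-- The kernel of the map of total spaces `(X = ⋯ = X → Y) → Z` is `X = ⋯ = X`. -/
def splitHi {X Y Z : L1 k} (s : L1SES X Y Z) :
    Split p (hi p (L1Map.id X) fun _ => rfl) (hi p s.t s.tQ) Z where
  ι := LinearMap.prodMap s.t.f LinearMap.id
  u := LinearMap.prodMap s.div.f LinearMap.id
  f := s.ev.f ∘ₗ LinearMap.fst k Y.V (up p (-1) X).V
  w := s.const.f.prod (0 : _ →ₗ[k] (up p (-1) X).V)
  H := 0
  ιD x := Prod.ext (s.t.fD _) rfl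
  uD x := Prod.ext (s.div.fD _) rfl
  fD x := s.ev.fD _
  ιT x := Prod.ext (by
    change s.t.f (X.T x.1 + first k (p - 1) X.V x.2) = Y.T (s.t.f x.1)
      + s.t.f (first k (p - 1) X.V x.2)
    rw [map_add, s.t.fT]) rfl
  fT x := by
    change s.ev.f (Y.T x.1 + s.t.f (first k (p - 1) X.V x.2)) = Z.T (s.ev.f x.1)
    rw [map_add, s.ev.fT, s.ev_t, add_zero]
  ιA d x hx := ⟨s.t.fA _ _ hx.1, hx.2⟩
  uA d x hx := ⟨s.div.fA _ _ hx.1, hx.2⟩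
  fA d x hx := s.ev.fA _ _ hx.1
  wA d x hx := ⟨s.const.fA _ _ hx, Submodule.zero_mem _⟩
  HA d x hx := Submodule.zero_mem _
  ιG b j x hx := ⟨s.t.fG _ _ _ hx.1, hx.2⟩
  uG b j x hx := ⟨s.div.fG _ _ _ hx.1, hx.2⟩
  fG b j x hx := s.ev.fG _ _ _ hx.1
  wG b j x hx := ⟨s.const.fG _ _ _ hx, Submodule.zero_mem _⟩
  HG b j x hx := Submodule.zero_mem _
  uι x := Prod.ext (s.div_t _) rfl
  fι x := s.ev_t _
  fw x := s.ev_const _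
  uw x := Prod.ext (s.div_const _) rfl
  uH x := map_zero _
  fH x := map_zero _
  Hι x := rfl
  con x hu hf := by
    have h : x = 0 := Prod.ext (by
      rw [← s.sum x.1, show s.div x.1 = 0 from congrArg Prod.fst hu, show s.ev x.1 = 0 from hf,
        map_zero, map_zero, add_zero]; rfl) (show x.2 = 0 from congrArg Prod.snd hu)
    rw [h, map_zero]

/-- The suspension of a map. -/
abbrev suspMap {X Y : L1 k} (f : L1Map X Y) : L1Map (susp p X) (susp p Y) where
  f := f.f.compLeft (Fin (p - 1))
  fD x := by
    have := HEquiv.compLeft_shDown (p - 1) f.f x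
    rw [LinearMap.add_apply, LinearMap.add_apply, map_add, this]
    congr 1
    exact funext fun s => f.fD _
  fT x := funext fun s => f.fT _
  fA d x hx s _ := f.fA _ _ (hx s trivial)
  fG b j x hx s _ := f.fG _ _ _ (hx s trivial)

/-- The suspension of a short exact sequence. -/
abbrev suspSES {X Y Z : L1 k} (s : L1SES X Y Z) : L1SES (susp p X) (susp p Y) (susp p Z) where
  t := suspMap p s.t
  ev := suspMap p s.ev
  div := suspMap p s.div
  const := suspMap p s.const
  tQ x := funext fun i => s.tQ _
  evQ x := funext fun i => s.evQ _
  div_t x := funext fun i => s.div_t _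
  ev_t x := funext fun i => s.ev_t _
  ev_const x := funext fun i => s.ev_const _
  div_const x := funext fun i => s.div_const _
  sum x := funext fun i => s.sum _

end L1

end PHHH

/-! ### The contracted homology of a suspension -/

namespace PHHH

variable {k : Type u} [Field k]

namespace L1

/-- An isomorphism between two homologies `HL` given by maps that need not commute with the
Hochschild differentials. -/
def hlIso {p c c' : ℕ} {ρ ρ' : ℤ} {idx idx' : Bool → ℤ → ℤ} {X Y : L1 k} (f : X.V →ₗ[k] Y.V)
    (g : Y.V →ₗ[k] X.V)
    (fZ : ∀ x ∈ X.cyc p c ρ, f x ∈ Y.cyc p c' ρ')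
    (fB : ∀ x ∈ X.cyc p c ρ, x ∈ LinearMap.range (X.D ^ (p - c)) →
      f x ∈ LinearMap.range (Y.D ^ (p - c')))
    (gZ : ∀ x ∈ Y.cyc p c' ρ', g x ∈ X.cyc p c ρ)
    (gB : ∀ x ∈ Y.cyc p c' ρ', x ∈ LinearMap.range (Y.D ^ (p - c')) →
      g x ∈ LinearMap.range (X.D ^ (p - c)))
    (gf : ∀ x ∈ X.cyc p c ρ, g (f x) - x ∈ LinearMap.range (X.D ^ (p - c)))
    (fg : ∀ x ∈ Y.cyc p c' ρ', f (g x) - x ∈ LinearMap.range (Y.D ^ (p - c')))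
    (fT : ∀ x, f (X.T x) = Y.T (f x)) (fQ : ∀ x, f (X.Q x) = Y.Q (f x)) (e : Bool → ℤ)
    (fG : ∀ b j r x, x ∈ X.A (r * p + ρ) → x ∈ X.G b (j - idx b r) →
      ∃ r', f x ∈ Y.A (r' * p + ρ') ∧ f x ∈ Y.G b (j - e b - idx' b r'))
    (gG : ∀ b j r x, x ∈ Y.A (r * p + ρ') → x ∈ Y.G b (j - e b - idx' b r) →
      ∃ r', g x ∈ X.A (r' * p + ρ) ∧ g x ∈ X.G b (j - idx b r')) :
    L2Iso (HL p c ρ idx X) ((HL p c' ρ' idx' Y).shift e) where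
  e := LinearEquiv.ofLinearMap (SQ.map f fZ fB) (SQ.map g gZ gB)
    (LinearMap.ext fun x => SQ.ind (P := fun x => SQ.map f fZ fB (SQ.map g gZ gB x) = x)
      (fun v hv => SQ.cls_eq.mpr (fg v hv)) x)
    (LinearMap.ext fun x => SQ.ind (P := fun x => SQ.map g gZ gB (SQ.map f fZ fB x) = x)
      (fun v hv => SQ.cls_eq.mpr (gf v hv)) x)
  eD x := SQ.ind (P := fun x => SQ.map f fZ fB ((HL p c ρ idx X).D x)
    = (HL p c' ρ' idx' Y).D (SQ.map f fZ fB x)) (fun v hv => SQ.cls_congr (fT v) _ _) x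
  eQ x := SQ.ind (P := fun x => SQ.map f fZ fB ((HL p c ρ idx X).Q x)
    = (HL p c' ρ' idx' Y).Q (SQ.map f fZ fB x)) (fun v hv => SQ.cls_congr (fQ v) _ _) x
  eG b j x hx := by
    refine G_induction (X := X) (idx := idx) (SQ.map f fZ fB) (fun r v hv h1 h2 => ?_) x hx
    obtain ⟨r', h3, h4⟩ := fG b j r v h1 h2
    exact cls_mem_G (X := Y) (idx := idx') r' (fZ v hv) h3 h4
  eG' b j x hx := by
    refine G_induction (X := Y) (idx := idx') (SQ.map g gZ gB) (fun r v hv h1 h2 => ?_) x hx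
    obtain ⟨r', h3, h4⟩ := gG b j r v h1 h2
    exact cls_mem_G (X := X) (idx := idx) r' (gZ v hv) h3 h4

variable (p : ℕ)

section Up

variable (c : ℕ) (ρ : ℤ) (idx : Bool → ℤ → ℤ) (e : ℤ) (X : L1 k)

lemma compLeft_single {V W : Type*} [AddCommGroup V] [Module k V] [AddCommGroup W] [Module k W]
    {q : ℕ} (f : V →ₗ[k] W) (s : Fin q) (x : V) :
    f.compLeft (Fin q) (LinearMap.single k (fun _ => V) s x)
      = LinearMap.single k (fun _ => W) s (f x) := by
  funext i
  simp only [LinearMap.compLeft_apply, Function.comp_apply, LinearMap.single_apply]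
  by_cases h : i = s
  · subst h; simp
  · simp [h]

lemma single_mem {V : Type*} [AddCommGroup V] [Module k V] {q : ℕ} {B : Fin q → Submodule k V}
    (s : Fin q) {x : V} (hx : x ∈ B s) :
    LinearMap.single k (fun _ => V) s x ∈ Submodule.pi Set.univ B := by
  intro i _
  by_cases h : i = s
  · subst h; simpa using hx
  · simp [h]

/-- The component `s` of a homology class of `up p e X`. -/
abbrev upProj (s : Fin (p - 1)) : (HL p c ρ idx (up p e X)).V →ₗ[k] (HL p c ρ idx X).V :=
  hlMap (X := up p e X) p c ρ (LinearMap.proj s) (fun _ => rfl) (fun d x hx => hx s trivial)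

/-- The homology class of `up p e X` with a single component. -/
abbrev upSingle (s : Fin (p - 1)) : (HL p c ρ idx X).V →ₗ[k] (HL p c ρ idx (up p e X)).V :=
  hlMap (Y := up p e X) p c ρ (LinearMap.single k (fun _ => X.V) s)
    (fun x => (compLeft_single X.D s x).symm) (fun d x hx => single_mem s hx)

lemma upProj_upSingle (s i : Fin (p - 1)) (x : (HL p c ρ idx X).V) :
    upProj p c ρ idx e X i (upSingle p c ρ idx e X s x) = if i = s then x else 0 := by
  refine SQ.ind (P := fun x => upProj p c ρ idx e X i (upSingle p c ρ idx e X s x)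
    = if i = s then x else 0) (fun v hv => ?_) x
  by_cases h : i = s
  · subst h
    rw [if_pos rfl]
    exact SQ.cls_congr (by simp) _ _
  · rw [if_neg h]
    exact SQ.cls_zero (by simp [h]) _

lemma sum_upSingle_upProj (x : (HL p c ρ idx (up p e X)).V) :
    ∑ s, upSingle p c ρ idx e X s (upProj p c ρ idx e X s x) = x := by
  refine SQ.ind (P := fun x => ∑ s, upSingle p c ρ idx e X s (upProj p c ρ idx e X s x) = x)
    (fun v hv => ?_) x
  have h1 : ∀ s, LinearMap.single k (fun _ => X.V) s (v s) ∈ (up p e X).cyc p c ρ := fun s =>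
    map_mem_cyc (X := X) (Y := up p e X) (LinearMap.single k (fun _ => X.V) s)
      (fun x => (compLeft_single X.D s x).symm) (fun d x hx => single_mem s hx) _
      (map_mem_cyc (X := up p e X) (Y := X) (LinearMap.proj s) (fun _ => rfl)
        (fun d x hx => hx s trivial) v hv)
  refine (map_sum (Submodule.mkQ ((LinearMap.range ((up p e X).D ^ (p - c))).comap
    ((up p e X).cyc p c ρ).subtype)) (fun s => ⟨LinearMap.single k (fun _ => X.V) s (v s), h1 s⟩)
    Finset.univ).symm.trans (congrArg _ (Subtype.ext ?_))
  rw [AddSubmonoidClass.coe_finsetSum]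
  exact LinearMap.sum_single_apply (φ := fun _ : Fin (p - 1) => X.V) v

/-- Homology commutes with the tensor product with a topological chain. -/
def hlUp : L2Iso (HL p c ρ idx (up p e X)) (((HL p c ρ idx X).up p).shift fun b => -(tau b * e)) where
  e := LinearEquiv.ofLinearMap (LinearMap.pi (upProj p c ρ idx e X))
    (∑ s : Fin (p - 1), upSingle p c ρ idx e X s ∘ₗ LinearMap.proj s)
    (LinearMap.ext fun x => funext fun i => by
      simp only [LinearMap.comp_apply, LinearMap.sum_apply, LinearMap.pi_apply, map_sum,
        LinearMap.proj_apply]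
      refine (Finset.sum_congr rfl fun s _ => upProj_upSingle p c ρ idx e X s i (x s)).trans ?_
      rw [Finset.sum_ite_eq, if_pos (Finset.mem_univ _)]
      rfl)
    (LinearMap.ext fun x => by
      simp only [LinearMap.comp_apply, LinearMap.sum_apply, LinearMap.pi_apply,
        LinearMap.proj_apply]
      exact sum_upSingle_upProj p c ρ idx e X x)
  eD x := funext fun s => by
    refine SQ.ind (P := fun x => upProj p c ρ idx e X s ((HL p c ρ idx (up p e X)).D x)
      = ((HL p c ρ idx X).up p).D (fun s => upProj p c ρ idx e X s x) s) (fun v hv => ?_) x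
    rw [LinearMap.add_apply, Pi.add_apply, shDown_apply]
    by_cases h : (s : ℕ) + 1 < p - 1
    · rw [dif_pos h]
      exact SQ.cls_congr (by
        change X.T (v s) + shDown k (p - 1) X.V v s = X.T (v s) + v ⟨s + 1, h⟩
        rw [shDown_apply, dif_pos h]) _ _
    · rw [dif_neg h, add_zero]
      exact SQ.cls_congr (by
        change X.T (v s) + shDown k (p - 1) X.V v s = X.T (v s)
        rw [shDown_apply, dif_neg h, add_zero]) _ _
  eQ x := funext fun s => SQ.ind (P := fun x => upProj p c ρ idx e X s
      ((HL p c ρ idx (up p e X)).Q x) = (HL p c ρ idx X).Q (upProj p c ρ idx e X s x))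
    (fun v hv => rfl) x
  eG b j x hx s _ := by
    have := hlMap_G (X := up p e X) (Y := X) (p := p) (c := c) (ρ := ρ) (idx := idx)
      (LinearMap.proj s) (fun _ => rfl)
      (fun d x hx => hx s trivial) (fun b => - (tau b * (s : ℕ)) + tau b * e)
      (fun b j x hx => mem_of_eq (G := X.G b) (hx s trivial) (by ring)) b j x hx
    exact mem_of_eq (G := (HL p c ρ idx X).G b) this (by ring)
  eG' b j x hx := by
    change (∑ s : Fin (p - 1), upSingle p c ρ idx e X s ∘ₗ LinearMap.proj s) x ∈ _
    rw [LinearMap.sum_apply]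
    refine Submodule.sum_mem _ fun s _ => ?_
    have := hlMap_G (X := X) (Y := up p e X) (p := p) (c := c) (ρ := ρ) (idx := idx)
      (LinearMap.single k (fun _ => X.V) s) (fun x => (compLeft_single X.D s x).symm)
      (fun d x hx => single_mem s hx) (fun b => tau b * (s : ℕ) - tau b * e)
      (fun b j x hx => single_mem s (mem_of_eq (G := X.G b) hx (by ring))) b _ _ (hx s trivial)
    exact mem_of_eq (G := (HL p c ρ idx (up p e X)).G b) this (by ring)

end Up

end L1

lemma pow_compLeft {V : Type*} [AddCommGroup V] [Module k V] (q r : ℕ) (D : Module.End k V) :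
    (D.compLeft (Fin q)) ^ r = (D ^ r).compLeft (Fin q) := by
  induction r with
  | zero => rfl
  | succ r ih => rw [pow_succ, ih, pow_succ]; rfl

/-- In characteristic `p`, the tensor product of a `p`-complex with a chain is a `p`-complex. -/
lemma compLeft_add_shDown_pow {V : Type*} [AddCommGroup V] [Module k V] (p q : ℕ) (hq : q ≤ p)
    [Fact p.Prime] [CharP k p] (D : Module.End k V) (hD : D ^ p = 0) :
    (D.compLeft (Fin q) + shDown k q V) ^ p = 0 := by
  obtain ⟨r, hr⟩ := Commute.exists_add_pow_prime_eq (Fact.out : p.Prime)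
    (show Commute (D.compLeft (Fin q)) (shDown k q V) from (shDown_compLeft q D).symm)
  have h2 : shDown k q V ^ p = 0 := by
    refine LinearMap.ext fun x => funext fun s => ?_
    rw [shDown_pow_apply, dif_neg (by omega)]; rfl
  rw [hr, h2, natCast_end_eq_zero, pow_compLeft, hD]
  simp
  rfl

/-- The signed form of `sub_pow_pred_prime` for a sum of commuting elements. -/
lemma add_pow_pred_prime {A : Type*} [Ring A] (p : ℕ) [Fact p.Prime] (hp : (p : A) = 0)
    (hodd : Odd p) {x y : A} (h : Commute x y) :
    (x + y) ^ (p - 1) = ∑ m ∈ Finset.range p, (-1) ^ m * y ^ m * x ^ (p - 1 - m) := by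
  have hev : Even (p - 1) := by obtain ⟨q, rfl⟩ := hodd; simp
  rw [show x + y = -(-y - x) by abel, hev.neg_pow, sub_pow_pred_prime p hp hodd h.symm.neg_left]
  refine Finset.sum_congr rfl fun m _ => ?_
  rw [neg_pow]

/-- The component `i` of the power `(D + S) ^ (p - 1)` of the differential of a suspension. -/
lemma susp_pow_apply {V : Type*} [AddCommGroup V] [Module k V] (p q : ℕ) (hodd : Odd p)
    [Fact p.Prime] [CharP k p] (D : Module.End k V) (x : Fin q → V) (i : Fin q) :
    ((D.compLeft (Fin q) + shDown k q V) ^ (p - 1)) x i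
      = ∑ m ∈ Finset.range p, (-1 : k) ^ m • (D ^ (p - 1 - m))
        (if h : (i : ℕ) + m < q then x ⟨i + m, h⟩ else 0) := by
  obtain ⟨E, hE⟩ : ∃ E : Module.End k (Fin q → V), E = D.compLeft (Fin q) := ⟨_, rfl⟩
  have hc : Commute (shDown k q V) E := hE ▸ shDown_compLeft q D
  have key := add_pow_pred_prime p (natCast_end_eq_zero (k := k) (V := Fin q → V) p) hodd hc.symm
  rw [← hE]
  refine (congrFun (LinearMap.congr_fun key x) i).trans ?_
  rw [LinearMap.sum_apply, Finset.sum_apply]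
  refine Finset.sum_congr rfl fun m hm => ?_
  have e2 : ((-1 : Module.End k (Fin q → V)) ^ m) = algebraMap k _ ((-1 : k) ^ m) := by simp
  rw [e2, mul_assoc, (hc.pow_pow m (p - 1 - m)).eq, Module.End.mul_apply,
    Module.algebraMap_end_apply, Pi.smul_apply, Module.End.mul_apply, hE, pow_compLeft,
    LinearMap.compLeft_apply, Function.comp_apply, shDown_pow_apply]

namespace L1

section Susp

variable (p : ℕ) [Fact p.Prime] [CharP k p] (X : L1 k)

lemma sign_pred_pred (hodd : Odd p) : (-1 : k) ^ (p - 2) = -1 := by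
  have hp := (Fact.out : p.Prime).two_le
  have : Odd (p - 2) := by obtain ⟨q, rfl⟩ := hodd; exact ⟨q - 1, by omega⟩
  exact this.neg_one_pow

/-- The element `(a, -D a, D² a, …)`. -/
def geom (q : ℕ) {V : Type*} [AddCommGroup V] [Module k V] (D : Module.End k V) : V →ₗ[k] (Fin q → V) :=
  LinearMap.pi fun i => (-1 : k) ^ (i : ℕ) • D ^ (i : ℕ)

lemma geom_apply {q : ℕ} {V : Type*} [AddCommGroup V] [Module k V] (D : Module.End k V) (a : V)
    (i : Fin q) : geom q D a i = (-1 : k) ^ (i : ℕ) • (D ^ (i : ℕ)) a := rfl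

/-- The alternating sum `∑ (-1) ^ i D ^ (q - 1 - i) z_i`. -/
def altSum (q : ℕ) {V : Type*} [AddCommGroup V] [Module k V] (D : Module.End k V) : (Fin q → V) →ₗ[k] V :=
  ∑ i : Fin q, ((-1 : k) ^ (i : ℕ)) • ((D ^ (q - 1 - (i : ℕ))) ∘ₗ LinearMap.proj i)

lemma altSum_apply {q : ℕ} {V : Type*} [AddCommGroup V] [Module k V] (D : Module.End k V)
    (z : Fin q → V) : altSum q D z = ∑ i : Fin q, (-1 : k) ^ (i : ℕ) • (D ^ (q - 1 - (i : ℕ))) (z i) := by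
  simp [altSum, LinearMap.sum_apply]

/-- On `geom D a` the differential of a suspension telescopes: only the last component survives. -/
lemma susp_geom {q : ℕ} {V : Type*} [AddCommGroup V] [Module k V] (D : Module.End k V) (a : V) :
    (D.compLeft (Fin q) + shDown k q V) (geom q D a) = (-1 : k) ^ (q - 1) • last k q V ((D ^ q) a) := by
  funext i
  rw [LinearMap.add_apply, Pi.add_apply, shDown_apply, LinearMap.compLeft_apply, Function.comp_apply,
    geom_apply, map_smul, ← Module.End.mul_apply, ← pow_succ', Pi.smul_apply, last_apply]
  by_cases h : (i : ℕ) + 1 < q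
  · rw [dif_pos h, geom_apply, pow_succ (-1 : k), mul_neg_one, neg_smul, add_neg_cancel,
      if_neg (by omega), smul_zero]
  · rw [dif_neg h, add_zero, if_pos (by omega), show (i : ℕ) + 1 = q by omega,
      show (i : ℕ) = q - 1 by omega]

/-- A cycle of a suspension is determined by its first component, which is killed by `D ^ q`. -/
lemma eq_geom {q : ℕ} {V : Type*} [AddCommGroup V] [Module k V] (D : Module.End k V) (z : Fin q → V)
    (h0 : 0 < q) (hz : (D.compLeft (Fin q) + shDown k q V) z = 0) :
    geom q D (z ⟨0, h0⟩) = z ∧ (D ^ q) (z ⟨0, h0⟩) = 0 := by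
  have h1 : ∀ i (h : i < q), z ⟨i, h⟩ = (-1 : k) ^ i • (D ^ i) (z ⟨0, h0⟩) := by
    intro i
    induction i with
    | zero => intro h; simp
    | succ i ih =>
      intro h
      have := congrFun hz ⟨i, by omega⟩
      rw [LinearMap.add_apply, Pi.add_apply, shDown_apply, dif_pos h, LinearMap.compLeft_apply,
        Function.comp_apply, ih (by omega), map_smul, ← Module.End.mul_apply, ← pow_succ'] at this
      rw [pow_succ (-1 : k), mul_neg_one, neg_smul]
      exact eq_neg_of_add_eq_zero_right this
  refine ⟨funext fun i => (h1 i i.2).symm, ?_⟩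
  have := congrFun hz ⟨q - 1, by omega⟩
  rw [LinearMap.add_apply, Pi.add_apply, shDown_apply, dif_neg (by simp only; omega),
    LinearMap.compLeft_apply, Function.comp_apply, h1, map_smul, ← Module.End.mul_apply,
    ← pow_succ', add_zero, Nat.sub_add_cancel (by omega)] at this
  exact (smul_eq_zero.mp this).resolve_left (pow_ne_zero _ (by simp))

/-- The image of the power `p - 1` of the differential of a suspension contains `geom` of every
boundary. -/
lemma susp_pow_last {q : ℕ} {V : Type*} [AddCommGroup V] [Module k V] (hodd : Odd p)
    (hq : q = p - 1) (D : Module.End k V) (a : V) :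
    ((D.compLeft (Fin q) + shDown k q V) ^ (p - 1)) (last k q V a) = - geom q D (D a) := by
  have hp := (Fact.out : p.Prime).two_le
  funext i
  rw [susp_pow_apply p q hodd, Finset.sum_eq_single (q - 1 - i)]
  · rw [dif_pos (by omega), last_apply, if_pos (by simp only; omega), Pi.neg_apply, geom_apply,
      ← Module.End.mul_apply, ← pow_succ, ← neg_smul, show p - 1 - (q - 1 - (i : ℕ)) = i + 1 by omega]
    congr 1
    have h1 := sign_pred_pred (k := k) p hodd
    rw [show p - 2 = q - 1 - i + i by omega, pow_add] at h1
    have h2 : ((-1 : k) ^ (i : ℕ)) * (-1) ^ (i : ℕ) = 1 := by rw [← mul_pow]; simp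
    linear_combination ((-1 : k) ^ (i : ℕ)) * h1 - (-1) ^ (q - 1 - (i : ℕ)) * h2
  · intro m hm hne
    split_ifs
    · rw [last_apply, if_neg (by simp only; omega), map_zero, smul_zero]
    · rw [map_zero, smul_zero]
  · intro h
    exact absurd (Finset.mem_range.mpr (by omega)) h

lemma susp_pow_zero {q : ℕ} {V : Type*} [AddCommGroup V] [Module k V] (hodd : Odd p)
    (hq : q = p - 1) (D : Module.End k V) (z : Fin q → V) (h0 : 0 < q) :
    ((D.compLeft (Fin q) + shDown k q V) ^ (p - 1)) z ⟨0, h0⟩ = D (altSum q D z) := by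
  rw [susp_pow_apply p q hodd, altSum_apply, show p = q + 1 by omega, Finset.sum_range_succ,
    dif_neg (by simp), map_zero, smul_zero, add_zero, Finset.sum_range, map_sum]
  refine Finset.sum_congr rfl fun i _ => ?_
  rw [dif_pos (by simp), map_smul, ← Module.End.mul_apply, ← pow_succ']
  simp only [zero_add]
  congr 3
  omega

/-- The alternating sum of a boundary telescopes. -/
lemma altSum_susp {q : ℕ} {V : Type*} [AddCommGroup V] [Module k V] (D : Module.End k V)
    (y : Fin q → V) (h0 : 0 < q) :
    altSum q D ((D.compLeft (Fin q) + shDown k q V) y) = (D ^ q) (y ⟨0, h0⟩) := by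
  obtain ⟨q, rfl⟩ : ∃ r, q = r + 1 := ⟨q - 1, by omega⟩
  rw [altSum_apply]
  let Y : ℕ → V := fun i => if h : i < q + 1 then (-1 : k) ^ i • (D ^ (q + 1 - i)) (y ⟨i, h⟩) else 0
  have h1 : ∀ i : Fin (q + 1), (-1 : k) ^ (i : ℕ) • (D ^ (q + 1 - 1 - (i : ℕ)))
      ((D.compLeft (Fin (q + 1)) + shDown k (q + 1) V) y i) = Y i - Y (i + 1) := by
    intro i
    simp only [LinearMap.add_apply, Pi.add_apply, shDown_apply, LinearMap.compLeft_apply,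
      Function.comp_apply, map_add, smul_add, Y, dif_pos i.2]
    rw [← Module.End.mul_apply, ← pow_succ, sub_eq_add_neg, show q + 1 - 1 - (i : ℕ) + 1 = q + 1 - i by omega]
    congr 1
    by_cases h : (i : ℕ) + 1 < q + 1
    · rw [dif_pos h, dif_pos h, pow_succ (-1 : k), mul_neg_one, neg_smul, neg_neg,
        show q + 1 - 1 - (i : ℕ) = q + 1 - (i + 1) by omega]
    · rw [dif_neg h, dif_neg h, map_zero, smul_zero, neg_zero]
  rw [Finset.sum_congr rfl fun i _ => h1 i, ← Finset.sum_range (fun i => Y i - Y (i + 1)),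
    Finset.sum_range_sub']
  simp [Y]

/-- Cycles of a suspension are determined, up to boundaries, by their alternating sums. -/
lemma exists_susp {q : ℕ} {V : Type*} [AddCommGroup V] [Module k V] (hodd : Odd p)
    (hq : q = p - 1) (D : Module.End k V) (z : Fin q → V) :
    z + last k q V (altSum q D z) ∈ LinearMap.range (D.compLeft (Fin q) + shDown k q V) := by
  have hp := (Fact.out : p.Prime).two_le
  let Z : ℕ → V := fun i => if h : i < q then z ⟨i, h⟩ else 0
  let Y : ℕ → V := fun m => ∑ j ∈ Finset.range m, (-1 : k) ^ (m - 1 - j) • (D ^ (m - 1 - j)) (Z j)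
  have hY : ∀ m, Y (m + 1) = Z m - D (Y m) := by
    intro m
    simp only [Y, Finset.sum_range_succ, map_sum, map_smul]
    rw [add_comm, sub_eq_add_neg, ← Finset.sum_neg_distrib]
    congr 1
    · simp
    · refine Finset.sum_congr rfl fun j hj => ?_
      have := Finset.mem_range.mp hj
      rw [show m + 1 - 1 - j = m - 1 - j + 1 by omega, pow_succ (-1 : k), mul_neg_one, neg_smul,
        pow_succ', Module.End.mul_apply]
  have hq2 : Y q = - altSum q D z := by
    rw [altSum_apply, ← Finset.sum_neg_distrib]
    simp only [Y]
    rw [Finset.sum_range]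
    refine Finset.sum_congr rfl fun j _ => ?_
    have h1 := sign_pred_pred (k := k) p hodd
    have h2 : ((-1 : k) ^ (j : ℕ)) * (-1) ^ (j : ℕ) = 1 := by rw [← mul_pow]; simp
    rw [show p - 2 = q - 1 - j + j by omega, pow_add] at h1
    have h3 : (-1 : k) ^ (q - 1 - (j : ℕ)) = - (-1) ^ (j : ℕ) := by
      linear_combination ((-1 : k) ^ (j : ℕ)) * h1 - (-1) ^ (q - 1 - (j : ℕ)) * h2
    rw [h3, neg_smul]
    simp only [Z, dif_pos j.2]
  refine ⟨fun i => Y i, funext fun i => ?_⟩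
  rw [LinearMap.add_apply, Pi.add_apply, Pi.add_apply, shDown_apply, LinearMap.compLeft_apply,
    Function.comp_apply, last_apply]
  have h1 := hY i
  have h2 : Z i = z i := by simp only [Z, dif_pos i.2]
  rw [h2] at h1
  by_cases h : (i : ℕ) + 1 < q
  · rw [dif_pos h, if_neg (by omega), h1, add_zero]; abel
  · rw [dif_neg h, if_pos (by omega), add_zero]
    rw [show (i : ℕ) + 1 = q by omega, hq2] at h1
    have h4 : D (Y i) = z i + altSum q D z := by
      rw [eq_sub_iff_add_eq, neg_add_eq_iff_eq_add] at h1
      rw [h1, add_comm]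
    exact h4

lemma altSum_last {q : ℕ} {V : Type*} [AddCommGroup V] [Module k V] (h0 : 0 < q)
    (D : Module.End k V) (a : V) : altSum q D (last k q V a) = (-1 : k) ^ (q - 1) • a := by
  rw [altSum_apply, Finset.sum_eq_single ⟨q - 1, by omega⟩]
  · rw [last_apply, if_pos (by simp only; omega)]; simp
  · intro i _ hi
    rw [last_apply, if_neg, map_zero, smul_zero]
    intro h
    exact hi (Fin.ext (by simp only; omega))
  · simp

variable {p X} in
lemma residue_add {ρ ρ' : ℤ} (m : ℤ) (h : ρ = ρ' + m * p) {x : X.V} (hx : x ∈ X.residue p ρ) :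
    x ∈ X.residue p ρ' :=
  iSup_map_mem LinearMap.id (fun r x hx => mem_residue (r + m)
    (mem_of_eq (G := X.A) hx (by rw [h]; ring))) x hx

/-- The even homology of a suspension is the odd homology of the original complex. -/
def suspE (hodd : Odd p) : L2Iso (HL p 1 0 (idxE p) (susp p X))
    ((HL p (p - 1) (-1) (idxO p) X).shift fun b => if b then (p : ℤ) - 1 else 4) :=
  have hp := (Fact.out : p.Prime).two_le
  hlIso (X := susp p X) (LinearMap.proj (⟨0, by omega⟩ : Fin (p - 1))) (geom (p - 1) X.D)
    (fun x hx => by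
      have h2 := hx.2
      rw [SetLike.mem_coe, LinearMap.mem_ker, pow_one] at h2
      have h3 := residue_map (X := susp p X) (Y := X) (e := -1) (LinearMap.proj (⟨0, by omega⟩ : Fin (p - 1)))
        (fun d x hx => mem_of_eq (G := X.A) (hx _ trivial) (by simp [sub_eq_add_neg])) hx.1
      rw [zero_add] at h3
      exact ⟨h3, (eq_geom X.D x (by omega) h2).2⟩)
    (by
      rintro _ _ ⟨y, rfl⟩
      have := susp_pow_zero p hodd rfl X.D y (by omega)
      rw [Nat.sub_sub_self (by omega), pow_one]
      exact ⟨_, this.symm⟩)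
    (fun x hx => by
      have h3 := residue_map (X := X) (Y := susp p X) (e := 1) (geom (p - 1) X.D)
        (fun d x hx i _ => Submodule.smul_mem _ _ (mem_of_eq (G := X.A) (D_pow_mem (i : ℕ) d x hx) (by ring)))
        hx.1
      refine ⟨h3, ?_⟩
      rw [SetLike.mem_coe, LinearMap.mem_ker, pow_one]
      have h2 : (X.D ^ (p - 1)) x = 0 := hx.2
      exact (susp_geom X.D x).trans (by rw [h2, map_zero, smul_zero]))
    (by
      rintro _ _ ⟨y, rfl⟩
      rw [Nat.sub_sub_self (by omega), pow_one]
      refine ⟨- last k (p - 1) X.V y, ?_⟩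
      rw [map_neg]
      exact (congrArg Neg.neg (susp_pow_last p hodd rfl X.D y)).trans (neg_neg _))
    (fun x hx => by
      have h2 := hx.2
      rw [SetLike.mem_coe, LinearMap.mem_ker, pow_one] at h2
      have := (eq_geom X.D x (by omega) h2).1
      rw [show geom (p - 1) X.D (LinearMap.proj (⟨0, by omega⟩ : Fin (p - 1)) x) = x from this, sub_self]
      exact Submodule.zero_mem _)
    (fun x hx => by
      rw [LinearMap.proj_apply, geom_apply]
      simp)
    (fun x => rfl) (fun x => rfl) _
    (fun b j r x h1 h2 => ⟨r, mem_of_eq (G := X.A) (h1 _ trivial) (by simp [sub_eq_add_neg]),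
      mem_of_eq (G := X.G b) (h2 _ trivial) (by cases b <;> simp [idxE, idxO] <;> ring)⟩)
    (fun b j r x h1 h2 => ⟨r, fun i _ => Submodule.smul_mem _ _
      (mem_of_eq (G := X.A) (D_pow_mem (i : ℕ) _ x h1) (by ring)),
      fun i _ => Submodule.smul_mem _ _ (mem_of_eq (G := X.G b) (D_pow_memG (i : ℕ) _ _ x h2)
        (by cases b <;> simp [idxE, idxO] <;> ring))⟩)

lemma altSum_A (d : ℤ) (x : (susp p X).V) (hx : x ∈ (susp p X).A d) :
    altSum (p - 1) X.D x ∈ X.A (d - (p - 1 : ℕ)) := by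
  rw [altSum_apply]
  refine Submodule.sum_mem _ fun i _ => Submodule.smul_mem _ _ ?_
  refine mem_of_eq (G := X.A) (D_pow_mem _ _ _ (hx i trivial)) ?_
  have : ((p - 1 - 1 - (i : ℕ) : ℕ) : ℤ) = ((p - 1 : ℕ) : ℤ) - 1 - i := by omega
  rw [this]
  ring

lemma last_A (d : ℤ) (x : X.V) (hx : x ∈ X.A d) :
    last k (p - 1) X.V x ∈ (susp p X).A (d + (p - 1 : ℕ)) := by
  intro i _
  rw [last_apply]
  split_ifs with h
  · refine mem_of_eq (G := X.A) hx ?_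
    have : ((i : ℕ) : ℤ) + 1 = (p - 1 : ℕ) := by exact_mod_cast h
    rw [this]
    ring
  · exact Submodule.zero_mem _

/-- The odd homology of a suspension is the even homology of the original complex. -/
def suspO (hodd : Odd p) : L2Iso (HL p (p - 1) (-1) (idxO p) (susp p X))
    ((HL p 1 0 (idxE p) X).shift fun b => if b then 1 else 4) :=
  have hp := (Fact.out : p.Prime).two_le
  have hp1 : ((p - 1 : ℕ) : ℤ) = p - 1 := by omega
  hlIso (X := susp p X) (altSum (p - 1) X.D) (- last k (p - 1) X.V)
    (fun x hx => by
      have h3 := residue_map (X := susp p X) (Y := X) (e := -(p - 1 : ℕ)) (altSum (p - 1) X.D)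
        (altSum_A p X) hx.1
      refine ⟨residue_add (-1) (by rw [hp1]; ring) h3, ?_⟩
      rw [SetLike.mem_coe, LinearMap.mem_ker, pow_one]
      have h2 := hx.2
      rw [SetLike.mem_coe, LinearMap.mem_ker] at h2
      exact (susp_pow_zero p hodd rfl X.D x (by omega)).symm.trans (congrFun h2 _))
    (by
      rintro _ _ ⟨y, rfl⟩
      rw [Nat.sub_sub_self (by omega), pow_one]
      exact ⟨_, (altSum_susp X.D y (by omega)).symm⟩)
    (fun x hx => by
      have h3 := residue_map (X := X) (Y := susp p X) (e := (p - 1 : ℕ)) (last k (p - 1) X.V)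
        (last_A p X) hx.1
      have h2 := hx.2
      rw [SetLike.mem_coe, LinearMap.mem_ker, pow_one] at h2
      refine Submodule.neg_mem _ ⟨residue_add 1 (by rw [hp1]; ring) h3, ?_⟩
      rw [SetLike.mem_coe, LinearMap.mem_ker]
      exact (susp_pow_last p hodd rfl X.D x).trans (by rw [h2, map_zero, neg_zero]))
    (by
      rintro _ _ ⟨y, rfl⟩
      rw [Nat.sub_sub_self (by omega), pow_one]
      refine ⟨geom (p - 1) X.D y, (susp_geom X.D y).trans ?_⟩
      rw [Nat.sub_sub, sign_pred_pred p hodd, neg_one_smul]; rfl)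
    (fun x hx => by
      have := Submodule.neg_mem _ (exists_susp p hodd rfl X.D x)
      rw [Nat.sub_sub_self (by omega), pow_one]
      rw [neg_add] at this
      rw [LinearMap.neg_apply, sub_eq_add_neg, add_comm]
      exact this)
    (fun x hx => by
      rw [LinearMap.neg_apply, map_neg, altSum_last (by omega), Nat.sub_sub, sign_pred_pred p hodd,
        neg_one_smul, neg_neg, sub_self]
      exact Submodule.zero_mem _)
    (fun x => by
      rw [altSum_apply, altSum_apply, map_sum]
      refine Finset.sum_congr rfl fun i _ => ?_
      rw [map_smul, pow_map X.T X.TD]; rfl)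
    (fun x => by
      rw [altSum_apply, altSum_apply, map_sum]
      refine Finset.sum_congr rfl fun i _ => ?_
      rw [map_smul, pow_map X.Q X.QD]; rfl) _
    (fun b j r x h1 h2 => ⟨r - 1, mem_of_eq (G := X.A) (altSum_A p X _ x h1) (by rw [hp1]; ring), by
      rw [altSum_apply]
      refine Submodule.sum_mem _ fun i _ => Submodule.smul_mem _ _ ?_
      exact mem_of_eq (G := X.G b) (D_pow_memG _ _ _ _ (h2 i trivial))
        (by cases b <;> simp [idxE, idxO] <;> ring)⟩)
    (fun b j r x h1 h2 => ⟨r + 1, Submodule.neg_mem _ (mem_of_eq (G := (susp p X).A) (last_A p X _ x h1)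
      (by rw [hp1]; ring)), Submodule.neg_mem _ fun i _ => by
      change last k (p - 1) X.V x i ∈ X.G b _
      rw [last_apply]
      by_cases h : (i : ℕ) + 1 = p - 1
      · rw [if_pos h]
        exact mem_of_eq (G := X.G b) h2 (by cases b <;> simp [idxE, idxO] <;> ring)
      · rw [if_neg h]; exact Submodule.zero_mem _⟩)

end Susp

end L1

end PHHH

/-! ### The tensor square of the chain of length p - 1 -/

namespace PHHH

variable {k : Type u} [Field k]

namespace L2

variable (p : ℕ) (X : L2 k)

/-- The tensor product with the contractible chain of length `p`. -/
abbrev chain : L2 k where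
  V := Fin p → X.V
  D := X.D.compLeft (Fin p) + shDown k p X.V
  Q := X.Q.compLeft (Fin p)
  DQ x := by
    have := LinearMap.congr_fun (shDown_compLeft p X.Q) x
    simp only [Module.End.mul_apply] at this
    rw [LinearMap.add_apply, LinearMap.add_apply, this, map_add]
    congr 1
    exact funext fun s => X.DQ (x s)
  G b j := Submodule.pi Set.univ fun s : Fin p => X.G b (j - tau b * (s : ℕ))

lemma topOfBot_mem (b : Bool) (j : ℤ) (x : Fin p → X.V) (hx : x ∈ (X.chain p).G b j) :
    topOfBot k p X.V x ∈ (X.chain p).G b (j + (p - 1 : ℕ) * tau b) := by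
  intro s _
  change topOfBot k p X.V x s ∈ X.G b _
  rw [topOfBot_apply]
  by_cases h : (s : ℕ) + 1 = p
  · rw [dif_pos h]
    refine mem_of_eq (G := X.G b) (hx ⟨0, by omega⟩ trivial) ?_
    rw [show p - 1 = (s : ℕ) by omega]
    push_cast
    ring
  · rw [dif_neg h]; exact Submodule.zero_mem _

variable [Fact p.Prime]

/-- The first component of the last component. -/
def corner : (Fin p → Fin (p - 1) → X.V) →ₗ[k] X.V :=
  LinearMap.proj (⟨0, by have := (Fact.out : p.Prime).two_le; omega⟩ : Fin (p - 1)) ∘ₗ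
    LinearMap.proj (⟨p - 1, by have := (Fact.out : p.Prime).two_le; omega⟩ : Fin p)

/-- The tensor product of `X` with the `p`-complex glued from the tensor square of the chain of
length `p - 1` and the trivial chain: it contains either of the two as a subcomplex with contractible
quotient. -/
abbrev glue : L2 k where
  V := (Fin p → (X.up p).V) × X.V
  D := (((X.up p).chain p).D ∘ₗ LinearMap.fst k (Fin p → (X.up p).V) X.V).prod
    (X.D ∘ₗ LinearMap.snd k (Fin p → (X.up p).V) X.V
      + corner p X ∘ₗ LinearMap.fst k (Fin p → (X.up p).V) X.V)
  Q := ((X.up p).chain p).Q.prodMap X.Q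
  DQ x := Prod.ext (((X.up p).chain p).DQ x.1) (by
    change X.D (X.Q x.2) + X.Q _ = X.Q (X.D x.2 + _)
    rw [map_add, X.DQ]; rfl)
  G b j := ((((X.up p).shift fun b => -(tau b * (p - 1))).chain p).G b j).prod (X.G b (j + tau b))

lemma up_homog (hX : X.Homog) : (X.up p).Homog := by
  intro b j x hx s _
  refine Submodule.add_mem _ ?_ ?_
  · exact mem_of_eq (G := X.G b) (hX _ _ _ (hx s trivial)) (by ring)
  · exact mem_of_eq (G := X.G b) (shDown_mem (G := fun s : ℕ => X.G b (j - tau b * s)) x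
      (fun s => hx s trivial) s) (by push_cast; ring)

lemma shift_homog (hX : X.Homog) (c : Bool → ℤ) : (X.shift c).Homog := fun b j x hx =>
  mem_of_eq (G := X.G b) (hX b _ x hx) (by ring)

lemma chain_homog (hX : X.Homog) : (X.chain p).Homog := by
  intro b j x hx s _
  refine Submodule.add_mem _ ?_ ?_
  · exact mem_of_eq (G := X.G b) (hX _ _ _ (hx s trivial)) (by ring)
  · exact mem_of_eq (G := X.G b) (shDown_mem (G := fun s : ℕ => X.G b (j - tau b * s)) x
      (fun s => hx s trivial) s) (by push_cast; ring)

lemma glue_homog (hX : X.Homog) : (X.glue p).Homog := fun b j x hx =>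
  ⟨chain_homog p ((X.up p).shift fun b => -(tau b * (p - 1))) (shift_homog _ (up_homog p X hX) _)
    b j x.1 hx.1, Submodule.add_mem _
      (mem_of_eq (G := X.G b) (hX b _ _ hx.2) (by ring))
      (by
        have hp := (Fact.out : p.Prime).one_le
        refine mem_of_eq (G := X.G b) (hx.1 ⟨p - 1, by omega⟩ trivial ⟨0, _⟩ trivial) ?_
        simp only
        push_cast [Nat.cast_sub hp]
        ring)⟩

variable [CharP k p]

/-- The quotient of `glue` by the tensor square. -/
def glueTop : (X.glue p).V →ₗ[k] (Fin p → X.V) := LinearMap.pi fun s =>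
  if h : (s : ℕ) = 0 then LinearMap.snd k (Fin p → (X.up p).V) X.V
  else LinearMap.proj (⟨s - 1, by omega⟩ : Fin (p - 1)) ∘ₗ
    LinearMap.proj (⟨p - 1, by omega⟩ : Fin p) ∘ₗ LinearMap.fst k (Fin p → (X.up p).V) X.V

lemma glueTop_apply (x : (X.glue p).V) (s : Fin p) : glueTop p X x s
    = if h : (s : ℕ) = 0 then x.2 else x.1 ⟨p - 1, by omega⟩ ⟨s - 1, by omega⟩ := by
  by_cases h : (s : ℕ) = 0
  · simp only [glueTop, LinearMap.pi_apply, dif_pos h]; rfl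
  · simp only [glueTop, LinearMap.pi_apply, dif_neg h]; rfl

/-- The quotient of `glue` by the tensor square is the contractible chain on `X`, hence contractible. -/
lemma glueTop_D (x : (X.glue p).V) : glueTop p X ((X.glue p).D x)
    = (X.chain p).D (glueTop p X x) := by
  have hp := (Fact.out : p.Prime).two_le
  have e1 : ((X.glue p).D x).2 = X.D x.2 + x.1 ⟨p - 1, by omega⟩ ⟨0, by omega⟩ := rfl
  have e2 : ((X.glue p).D x).1 ⟨p - 1, by omega⟩ = (X.up p).D (x.1 ⟨p - 1, by omega⟩) := by
    change (X.up p).D (x.1 ⟨p - 1, by omega⟩) + shDown k p _ x.1 ⟨p - 1, by omega⟩ = _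
    rw [shDown_apply, dif_neg (by simp only; omega), add_zero]
  funext s
  rw [LinearMap.add_apply, Pi.add_apply, shDown_apply, LinearMap.compLeft_apply, Function.comp_apply,
    glueTop_apply, glueTop_apply, e1]
  by_cases h : (s : ℕ) = 0
  · rw [dif_pos h, dif_pos h, dif_pos (by omega), glueTop_apply, dif_neg (by simp)]
    simp only [h]
  · rw [dif_neg h, dif_neg h]
    refine (congrFun e2 _).trans ?_
    rw [LinearMap.add_apply, Pi.add_apply, shDown_apply, LinearMap.compLeft_apply,
      Function.comp_apply]
    congr 1
    by_cases h' : (s : ℕ) + 1 < p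
    · rw [dif_pos h', dif_pos (by simp only; omega), glueTop_apply, dif_neg (by simp)]
      have e1 : (⟨(s : ℕ) - 1 + 1, by omega⟩ : Fin (p - 1)) = ⟨(s : ℕ) + 1 - 1, by omega⟩ :=
        Fin.ext (by simp only; omega)
      rw [e1]
    · rw [dif_neg h', dif_neg (by simp only; omega)]

lemma glue_pow (hX : X.D ^ p = 0) : (X.glue p).D ^ p = 0 := by
  have hp := (Fact.out : p.Prime).two_le
  refine LinearMap.ext fun x => Prod.ext ?_ ?_
  · have h1 := pow_map (D := (X.glue p).D) (D' := ((X.up p).chain p).D)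
      (LinearMap.fst k (Fin p → (X.up p).V) X.V) (fun _ => rfl) p x
    rw [compLeft_add_shDown_pow p p le_rfl _ (compLeft_add_shDown_pow p (p - 1) (by omega) _ hX)] at h1
    exact h1
  · have h1 := congrFun (pow_map (D := (X.glue p).D) (D' := (X.chain p).D) (glueTop p X)
      (glueTop_D p X) p x) ⟨0, by omega⟩
    rw [compLeft_add_shDown_pow p p le_rfl _ hX, glueTop_apply, dif_pos rfl] at h1
    exact h1

/-- Restriction to the first components. -/
def initial (Y : Type*) [AddCommGroup Y] [Module k Y] : (Fin p → Y) →ₗ[k] (Fin (p - 1) → Y) :=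
  LinearMap.pi fun s => LinearMap.proj ⟨s, by omega⟩

/-- Extension by zero. -/
def extend (Y : Type*) [AddCommGroup Y] [Module k Y] : (Fin (p - 1) → Y) →ₗ[k] (Fin p → Y) :=
  LinearMap.pi fun s => if h : (s : ℕ) < p - 1 then LinearMap.proj ⟨s, h⟩ else 0

lemma extend_apply {Y : Type*} [AddCommGroup Y] [Module k Y] (x : Fin (p - 1) → Y) (s : Fin p) :
    extend (k := k) p Y x s = if h : (s : ℕ) < p - 1 then x ⟨s, h⟩ else 0 := by
  by_cases h : (s : ℕ) < p - 1
  · simp only [extend, LinearMap.pi_apply, dif_pos h]; rfl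
  · simp only [extend, LinearMap.pi_apply, dif_neg h]; rfl

/-- The section of `glueTop` supported at the last place. -/
def glueSec : (Fin p → X.V) →ₗ[k] (X.glue p).V :=
  (L1.last k p (Fin (p - 1) → X.V) ∘ₗ
    LinearMap.pi fun i : Fin (p - 1) => LinearMap.proj ⟨i + 1, by omega⟩).prod
  (LinearMap.proj ⟨0, (Fact.out : p.Prime).pos⟩)

lemma glueSec_fst (x : Fin p → X.V) (s : Fin p) :
    (glueSec p X x).1 s = if (s : ℕ) + 1 = p then fun i : Fin (p - 1) => x ⟨i + 1, by omega⟩ else 0 :=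
  L1.last_apply _ s

/-- The inclusion of the tensor square is a homotopy equivalence. -/
def hEquivGlueSquare (hodd : Odd p) (hX : X.Homog) (hXp : X.D ^ p = 0) :
    HEquiv p (((X.up p).shift fun b => -(tau b * (p - 1))).up p) (X.glue p) :=
  have hp := (Fact.out : p.Prime).two_le
  HEquiv.ofContractibleQuotient (Q := (X.shift fun b => - tau b).chain p) (glue_homog p X hX)
    (glue_pow p X hXp)
    ((extend p (X.up p).V).prod 0) (initial p (X.up p).V ∘ₗ LinearMap.fst _ _ _) (glueTop p X)
    (glueSec p X)
    (fun x => Prod.ext (funext fun s => by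
        change extend p (X.up p).V ((X.up p).D.compLeft (Fin (p - 1)) x + shDown k (p - 1) _ x) s
          = (X.up p).D (extend p (X.up p).V x s) + shDown k p _ (extend p (X.up p).V x) s
        rw [extend_apply, extend_apply, shDown_apply]
        by_cases h : (s : ℕ) < p - 1
        · rw [dif_pos h, dif_pos h, dif_pos (by omega), extend_apply, Pi.add_apply, shDown_apply]; rfl
        · rw [dif_neg h, dif_neg h, dif_neg (by omega), map_zero, add_zero])
      (show (0 : X.V) = X.D 0 + extend p (X.up p).V x _ _ by
        rw [map_zero, zero_add, extend_apply, dif_neg (by simp)]; rfl))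
    (glueTop_D p X)
    (fun x => Prod.ext (funext fun s => by
        change extend p (X.up p).V ((X.up p).Q.compLeft (Fin (p - 1)) x) s
          = (X.up p).Q (extend p (X.up p).V x s)
        rw [extend_apply, extend_apply]
        by_cases h : (s : ℕ) < p - 1
        · rw [dif_pos h, dif_pos h]; rfl
        · rw [dif_neg h, dif_neg h, map_zero]) (map_zero X.Q).symm)
    (fun b j x hx => ⟨fun s _ => by
        change extend p (X.up p).V x s ∈ _
        rw [extend_apply]
        by_cases h : (s : ℕ) < p - 1
        · rw [dif_pos h]; exact hx ⟨s, h⟩ trivial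
        · rw [dif_neg h]; exact Submodule.zero_mem _, Submodule.zero_mem _⟩)
    (fun b j x hx s _ => hx.1 ⟨s, by omega⟩ trivial)
    (fun b j x hx s _ => by
        change glueTop p X x s ∈ X.G b _
        rw [glueTop_apply]
        by_cases h : (s : ℕ) = 0
        · rw [dif_pos h]
          exact mem_of_eq (G := X.G b) hx.2 (by simp [h])
        · rw [dif_neg h]
          refine mem_of_eq (G := X.G b) (hx.1 ⟨p - 1, by omega⟩ trivial ⟨s - 1, by omega⟩ trivial) ?_
          simp only
          push_cast [Nat.cast_sub (by omega : 1 ≤ p), Nat.cast_sub (by omega : 1 ≤ (s : ℕ))]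
          ring)
    (fun b j x hx => ⟨fun s _ i _ => by
        change (glueSec p X x).1 s i ∈ X.G b _
        rw [glueSec_fst]
        by_cases h : (s : ℕ) + 1 = p
        · rw [if_pos h]
          refine mem_of_eq (G := X.G b) (hx ⟨i + 1, by omega⟩ trivial) ?_
          have : ((s : ℕ) : ℤ) = p - 1 := by omega
          rw [this]
          push_cast
          ring
        · rw [if_neg h]; exact Submodule.zero_mem _,
      mem_of_eq (G := X.G b) (hx ⟨0, by omega⟩ trivial) (by simp)⟩)
    (fun x => funext fun s => by
        change extend p (X.up p).V x ⟨s, by omega⟩ = x s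
        rw [extend_apply, dif_pos s.2])
    (fun x => funext fun s => by
        rw [glueTop_apply]
        by_cases h : (s : ℕ) = 0
        · rw [dif_pos h]
          exact congrArg x (Fin.ext h.symm)
        · rw [dif_neg h]
          refine (congrFun (glueSec_fst p X x ⟨p - 1, by omega⟩) _).trans ?_
          rw [if_pos (by simp only; omega)]
          exact congrArg x (Fin.ext (by simp only; omega)))
    (fun x => funext fun s => by
        rw [glueTop_apply]
        by_cases h : (s : ℕ) = 0
        · rw [dif_pos h]; rfl
        · rw [dif_neg h]
          change extend p (X.up p).V x ⟨p - 1, _⟩ _ = 0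
          rw [extend_apply, dif_neg (by simp)]; rfl)
    (fun x => Prod.ext (funext fun s => by
        change extend (k := k) p (X.up p).V (initial (k := k) p (X.up p).V x.1) s + (glueSec p X (glueTop p X x)).1 s
          = x.1 s
        rw [extend_apply, glueSec_fst]
        by_cases h : (s : ℕ) < p - 1
        · rw [dif_pos h, if_neg (by omega), add_zero]; rfl
        · rw [dif_neg h, if_pos (by omega), zero_add]
          funext i
          rw [glueTop_apply, dif_neg (by simp)]
          have e : s = ⟨p - 1, by omega⟩ := Fin.ext (by simp only; omega)
          rw [e]
          rfl)
      (by
        change (0 : X.V) + glueTop p X x ⟨0, by omega⟩ = x.2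
        rw [zero_add, glueTop_apply, dif_pos rfl]))
    (topOfBot k p X.V)
    (fun x => LinearMap.congr_fun (adp_compLeft_add_shDown p hodd X.D) x)
    (topOfBot_mem p (X.shift fun b => - tau b))

/-- The quotient of `glue` by the trivial chain. -/
abbrev glueQuot : L2 k := ((X.up p).chain p).shift fun b => -(tau b * (p - 1))

/-- The projection to the quotient of `glue` by the trivial chain. -/
def glueFst : (X.glue p).V →ₗ[k] (X.glueQuot p).V := LinearMap.fst k (Fin p → (X.up p).V) X.V

/-- The section of `glueFst`. -/
def glueInl : (X.glueQuot p).V →ₗ[k] (X.glue p).V := LinearMap.inl k (Fin p → (X.up p).V) X.V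

lemma glueFst_D (x : (X.glue p).V) :
    glueFst p X ((X.glue p).D x) = (X.glueQuot p).D (glueFst p X x) := rfl

/-- The inclusion of the trivial chain is a homotopy equivalence. -/
def hEquivGlueUnit (hodd : Odd p) (hX : X.Homog) (hXp : X.D ^ p = 0) :
    HEquiv p (X.shift fun b => - tau b) (X.glue p) :=
  HEquiv.ofContractibleQuotient (Q := X.glueQuot p) (glue_homog p X hX) (glue_pow p X hXp)
    (LinearMap.inr k (Fin p → (X.up p).V) X.V) (LinearMap.snd k (Fin p → (X.up p).V) X.V)
    (glueFst p X) (glueInl p X)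
    (fun x => Prod.ext (show (0 : Fin p → (X.up p).V) = ((X.up p).chain p).D 0 from
        (map_zero ((X.up p).chain p).D).symm)
      (show X.D x = X.D x + corner p X 0 by rw [map_zero, add_zero]))
    (glueFst_D p X)
    (fun x => Prod.ext (show (0 : Fin p → (X.up p).V) = ((X.up p).chain p).Q 0 from
      (map_zero ((X.up p).chain p).Q).symm) rfl)
    (fun b j x hx => ⟨Submodule.zero_mem _, mem_of_eq (G := X.G b) hx (by ring)⟩)
    (fun b j x hx => mem_of_eq (G := X.G b) hx.2 (by ring))
    (fun b j x hx s _ => mem_of_eq (G := (X.up p).G b) (hx.1 s trivial) (by ring))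
    (fun b j x hx => ⟨fun s _ => mem_of_eq (G := (X.up p).G b) (hx s trivial) (by ring),
      Submodule.zero_mem _⟩)
    (fun x => rfl) (fun x => rfl) (fun x => rfl) (fun x => Prod.ext (zero_add _) (add_zero _))
    (topOfBot k p (X.up p).V)
    (fun x => LinearMap.congr_fun (adp_compLeft_add_shDown p hodd (X.up p).D) x)
    (fun b j x hx => mem_of_eq (G := ((X.up p).chain p).G b) (topOfBot_mem p (X.up p) b _ x hx)
      (by ring))

end L2
end PHHH

/-! ### Suspensions in the Hochschild direction -/

namespace PHHH

variable {k : Type u} [Field k]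

namespace L2Iso

variable {X Y Z X' Y' : L2 k}

/-- The identity, between two translations of the gradings that agree. -/
def ofG (X : L2 k) (G G' : Bool → ℤ → Submodule k X.V) (h : ∀ b j, G b j = G' b j) :
    L2Iso { X with G := G } { X with G := G' } where
  e := LinearEquiv.refl k X.V
  eD x := rfl
  eQ x := rfl
  eG b j x hx := (h b j).le hx
  eG' b j x hx := (h b j).ge hx

/-- The translation of an isomorphism. -/
def shift (e : L2Iso X Y) (c : Bool → ℤ) : L2Iso (X.shift c) (Y.shift c) where
  e := e.e
  eD := e.eD
  eQ := e.eQ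
  eG b j := e.eG b _
  eG' b j := e.eG' b _

/-- The direct sum of isomorphisms. -/
def prod (e : L2Iso X Y) (e' : L2Iso X' Y') : L2Iso (X.prod X') (Y.prod Y') where
  e := e.e.prodCongr e'.e
  eD x := Prod.ext (e.eD _) (e'.eD _)
  eQ x := Prod.ext (e.eQ _) (e'.eQ _)
  eG b j x hx := ⟨e.eG b j _ hx.1, e'.eG b j _ hx.2⟩
  eG' b j x hx := ⟨e.eG' b j _ hx.1, e'.eG' b j _ hx.2⟩

/-- The exchange of the summands. -/
def prodComm (X Y : L2 k) : L2Iso (X.prod Y) (Y.prod X) where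
  e := LinearEquiv.prodComm k X.V Y.V
  eD x := rfl
  eQ x := rfl
  eG b j x hx := ⟨hx.2, hx.1⟩
  eG' b j x hx := ⟨hx.2, hx.1⟩

/-- The tensor product of an isomorphism with the chain of length `p - 1`. -/
def up (p : ℕ) (e : L2Iso X Y) : L2Iso (X.up p) (Y.up p) where
  e := LinearEquiv.piCongrRight fun _ => e.e
  eD x := by
    have h := HEquiv.compLeft_shDown (p - 1) e.e.toLinearMap x
    funext s
    have h1 := congrFun h s
    change e.e (X.D (x s) + shDown k (p - 1) X.V x s) = Y.D (e.e (x s)) + shDown k (p - 1) Y.V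
      (fun s => e.e (x s)) s
    rw [map_add, e.eD]
    exact congrArg _ h1
  eQ x := funext fun s => e.eQ _
  eG b j x hx s _ := e.eG b _ _ (hx s trivial)
  eG' b j x hx s _ := e.eG' b _ _ (hx s trivial)

end L2Iso

lemma L2.shift_pow {p : ℕ} {X : L2 k} (c : Bool → ℤ) (h : X.D ^ p = 0) : (X.shift c).D ^ p = 0 := h

namespace L1

/-- The translation of the internal gradings. -/
abbrev shift (X : L1 k) (c : Bool → ℤ) : L1 k :=
  { X with
    G := fun b j => X.G b (j - c b)
    DG := fun b j x hx => X.DG b _ x hx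
    TG := fun b j x hx => mem_of_eq (G := X.G b) (X.TG b _ x hx) (by ring) }

variable (p : ℕ) [Fact p.Prime] [CharP k p]

/-- Homology commutes with translation. -/
def hlShift (c : ℕ) (ρ : ℤ) (idx : Bool → ℤ → ℤ) (X : L1 k) (e : Bool → ℤ) (d : Bool → ℤ)
    (h : d = e) : L2Iso ((HL p c ρ idx X).shift d) (HL p c ρ idx (X.shift e)) :=
  L2Iso.ofG (HL p c ρ idx X) _ (HL p c ρ idx (X.shift e)).G fun b j => by
    subst h
    change (⨆ r : ℤ, SQ.gr _ _ (X.A (r * p + ρ) ⊓ X.G b (j - d b - idx b r)))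
      = ⨆ r : ℤ, SQ.gr _ _ (X.A (r * p + ρ) ⊓ X.G b (j - idx b r - d b))
    simp only [sub_right_comm]

/-- The translation of the `q`-grading by `a`. -/
def qsh (a : ℤ) (b : Bool) : ℤ := if b then 0 else a

/-- The even homology, placed so as to match the odd homology of a suspension. -/
abbrev evenShift (B : L1 k) : L2 k := (HL p 1 0 (idxE p) B).shift fun b => if b then 1 else 4

/-- The odd part of `ext`, translated. -/
abbrev oddUp (B : L1 k) : L2 k := ((HL p (p - 1) (-1) (idxO p) B).shift (qsh 4)).up p

/-- The even homology of `up (susp B)` is a chain of copies of the odd homology of `B`. -/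
def extUpSuspEven (hodd : Odd p) (B : L1 k) :
    L2Iso (HL p 1 0 (idxE p) (up p (p - 1) (susp p B))) (oddUp p B) :=
  (hlUp p 1 0 (idxE p) (p - 1) (susp p B)).trans
    ((((suspE p B hodd).up p).shift _).trans
      (L2Iso.ofG ((HL p (p - 1) (-1) (idxO p) B).up p) _ (oddUp p B).G (by
        intro b j
        refine Submodule.ext fun x => forall_congr' fun s => forall_congr' fun _ => ?_
        change x s ∈ (HL p (p - 1) (-1) (idxO p) B).G b (j - -(tau b * (p - 1)) - tau b * (s : ℕ)
          - (if b then (p : ℤ) - 1 else 4)) ↔ x s ∈ (HL p (p - 1) (-1) (idxO p) B).G b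
          (j - tau b * (s : ℕ) - qsh 4 b)
        rw [show j - -(tau b * (p - 1)) - tau b * (s : ℕ) - (if b then (p : ℤ) - 1 else 4)
          = j - tau b * (s : ℕ) - qsh 4 b by cases b <;> simp [tau, qsh] <;> ring])))

/-- The odd part of `ext` of `up (susp B)` is the tensor product of the even homology of `B` with the
square of the chain. -/
def extUpSuspOdd (hodd : Odd p) (B : L1 k) :
    L2Iso ((HL p (p - 1) (-1) (idxO p) (up p (p - 1) (susp p B))).up p)
      ((((evenShift p B).up p).shift fun b => -(tau b * (p - 1))).up p) :=
  ((hlUp p (p - 1) (-1) (idxO p) (p - 1) (susp p B)).trans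
    (((suspO p B hodd).up p).shift _)).up p

/-- The degree shift left over by the square of the chain amounts to raising the `q`-degree by `4`. -/
def evenShiftIso (B : L1 k) :
    L2Iso ((evenShift p B).shift fun b => - tau b) (HL p 1 0 (idxE p) (B.shift (qsh 4))) :=
  (L2Iso.ofG (HL p 1 0 (idxE p) B) _ ((HL p 1 0 (idxE p) B).shift (qsh 4)).G (by
    intro b j
    change (HL p 1 0 (idxE p) B).G b (j - -tau b - if b then 1 else 4)
      = (HL p 1 0 (idxE p) B).G b (j - qsh 4 b)
    congr 1
    cases b <;> simp [tau, qsh])).trans (hlShift p 1 0 (idxE p) B _ _ rfl)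

/-- Suspending in the Hochschild direction and then tensoring with the topological chain of length
`p - 1` exchanges the even and odd parts twice, up to homotopy: the even part becomes the odd
one, and the odd part the even one tensored with the square of the chain. The square is homotopy
equivalent to the trivial chain in topological degree `p - 2`, since both sit in `glue` with
contractible quotient. -/
def extUpSusp (hodd : Odd p) (B : L1 k) (hB : B.T ^ p = 0) :
    SlashIso p (ext p (up p (p - 1) (susp p B))) (ext p (B.shift (qsh 4))) :=
  have hE : (evenShift p B).Homog := L2.shift_homog _ (HL_homog B) _
  let h1 := ((extUpSuspEven p hodd B).hEquiv p).prod ((extUpSuspOdd p hodd B).hEquiv p)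
  let h2 := ((L2Iso.refl (oddUp p B)).hEquiv p).prod
    ((evenShift p B).hEquivGlueSquare p hodd hE (L2.shift_pow _ (HL_pow hB)))
  let h3 := ((L2Iso.refl (oddUp p B)).hEquiv p).prod
    ((evenShift p B).hEquivGlueUnit p hodd hE (L2.shift_pow _ (HL_pow hB)))
  let i4 := (L2Iso.prodComm (oddUp p B) ((evenShift p B).shift fun b => - tau b)).trans
    ((evenShiftIso p B).prod ((hlShift p (p - 1) (-1) (idxO p) B _ _ rfl).up p))
  (h1.slashIso.trans h2.slashIso).trans (h3.slashIso.symm.trans (i4.hEquiv p).slashIso)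

end L1

end PHHH

/-! ### Exactness of one Koszul factor -/

namespace PHHH
open MvPolynomial (X)
variable {k : Type u} [Field k]

section Step

variable {Y : Type*} [AddCommGroup Y] [Module k Y]

/-- The differential of the tensor product of `(Y, D)` with the `p`-extended Koszul complex of the
endomorphism `φ`. -/
def stepD (p : ℕ) (φ D : Module.End k Y) : Module.End k (Fin p → Y) :=
  D.compLeft (Fin p) + (LinearMap.pi fun s : Fin p =>
    (if (s : ℕ) = 0 then φ else 1) ∘ₗ LinearMap.proj s) * shDown k p Y

lemma stepD_apply (p : ℕ) (φ D : Module.End k Y) (w : Fin p → Y) (s : Fin p) : stepD p φ D w s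
    = D (w s) + if h : (s : ℕ) + 1 < p then (if (s : ℕ) = 0 then φ (w ⟨s + 1, h⟩) else w ⟨s + 1, h⟩)
      else 0 := by
  change D (w s) + (if (s : ℕ) = 0 then φ else 1) (shDown k p Y w s) = _
  rw [shDown_apply]
  split_ifs <;> simp

lemma stepD_pow (p : ℕ) [Fact p.Prime] [CharP k p] (φ D : Module.End k Y)
    (hφ : ∀ x, φ (D x) = D (φ x)) (hD : D ^ p = 0) : stepD p φ D ^ p = 0 := by
  obtain ⟨N, hN⟩ : ∃ N : Module.End k (Fin p → Y), N = (LinearMap.pi fun s : Fin p =>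
    (if (s : ℕ) = 0 then φ else 1) ∘ₗ LinearMap.proj s) * shDown k p Y := ⟨_, rfl⟩
  have hNa : ∀ w s, N w s = if h : (s : ℕ) + 1 < p then
      (if (s : ℕ) = 0 then φ (w ⟨s + 1, h⟩) else w ⟨s + 1, h⟩) else 0 := by
    intro w s
    rw [hN]
    change (if (s : ℕ) = 0 then φ else 1) (shDown k p Y w s) = _
    rw [shDown_apply]
    split_ifs <;> simp
  have hc : Commute (D.compLeft (Fin p) : Module.End k (Fin p → Y)) N := by
    refine LinearMap.ext fun w => funext fun s => ?_
    change D (N w s) = N (D.compLeft (Fin p) w) s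
    rw [hNa, hNa]
    by_cases h : (s : ℕ) + 1 < p
    · rw [dif_pos h, dif_pos h]
      by_cases h0 : (s : ℕ) = 0
      · rw [if_pos h0, if_pos h0]; exact (hφ _).symm
      · rw [if_neg h0, if_neg h0]; rfl
    · rw [dif_neg h, dif_neg h, map_zero]
  have hNp : N ^ p = 0 := by
    have h : ∀ r w (s : Fin p), p ≤ (s : ℕ) + r → (N ^ r) w s = 0 := by
      intro r
      induction r with
      | zero => intro w s hs; omega
      | succ r ih =>
        intro w s hs
        rw [pow_succ', Module.End.mul_apply, hNa]
        by_cases h : (s : ℕ) + 1 < p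
        · rw [dif_pos h, ih w _ (by simp only; omega), map_zero, ite_self]
        · rw [dif_neg h]
    exact LinearMap.ext fun w => funext fun s => h p w s (by omega)
  obtain ⟨r, hr⟩ := Commute.exists_add_pow_prime_eq (Fact.out : p.Prime) hc
  have e : stepD p φ D = D.compLeft (Fin p) + N := by rw [hN]; rfl
  rw [e]
  refine hr.trans ?_
  rw [hNp, natCast_end_eq_zero, pow_compLeft, hD]
  simp
  rfl

/-- Exactness away from the degrees congruent to `0` and `s`: an element of degree `d` killed by
`D ^ s` lies in the image of `D ^ (p - s)`, and the preimage can be chosen in `S`. -/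
def PExact (p : ℕ) (D : Module.End k Y) (A : ℤ → Submodule k Y) (S : Submodule k Y) : Prop :=
  ∀ (d : ℤ) (s : ℕ) (v : Y), 1 ≤ s → s < p → ¬ (p : ℤ) ∣ d → ¬ (p : ℤ) ∣ d - s → v ∈ A d → v ∈ S →
    (D ^ s) v = 0 → ∃ w, w ∈ A (d + p - s) ∧ w ∈ S ∧ (D ^ (p - s)) w = v

lemma pow_mem_sub {V : Type*} [AddCommGroup V] [Module k V] {D : Module.End k V}
    {G : ℤ → Submodule k V} (hD : ∀ j x, x ∈ G j → D x ∈ G (j - 1)) (r : ℕ) :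
    ∀ j x, x ∈ G j → (D ^ r) x ∈ G (j - r) := by
  induction r with
  | zero => intro j x hx; simpa using hx
  | succ r ih =>
    intro j x hx
    rw [pow_succ, Module.End.mul_apply]
    exact mem_of_eq (ih _ _ (hD _ _ hx)) (by push_cast; ring)

/-- Exactness is inherited by the tensor product with one more Koszul factor. The components of
nonzero index form a complex that embeds in a contractible chain with quotient `(Y, D)`; a preimage
there is corrected by the exactness of `(Y, D)` in its top component, and the difference then lives
in the bottom term, which is exact by hypothesis. -/
lemma PExact.step {p : ℕ} [Fact p.Prime] [CharP k p] (hodd : Odd p) {φ D : Module.End k Y}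
    {A : ℤ → Submodule k Y} {S S' : Submodule k Y} (hφ : ∀ x, φ (D x) = D (φ x)) (hD : D ^ p = 0)
    (hDA : ∀ d x, x ∈ A d → D x ∈ A (d - 1)) (hφA : ∀ d x, x ∈ A d → φ x ∈ A d)
    (hDS : ∀ x ∈ S, D x ∈ S) (hDS' : ∀ x ∈ S', D x ∈ S') (hφS : ∀ x ∈ S', φ x ∈ S)
    (h : PExact p D A S) (h' : PExact p D A S') :
    PExact p (stepD p φ D) (fun d => Submodule.pi Set.univ fun s : Fin p => A (d - (s : ℕ)))
      (Submodule.pi Set.univ fun s : Fin p => if (s : ℕ) = 0 then S else S') := by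
  have hp := (Fact.out : p.Prime).two_le
  intro d s v hs1 hsp hd hds hvA hvS hv
  -- the quotient by the bottom term is embedded in a contractible chain `F`
  let F : Module.End k (Fin p → Y) := D.compLeft (Fin p) + shDown k p Y
  have hF : ∀ w i, F w i = D (w i) + if h : (i : ℕ) + 1 < p then w ⟨i + 1, h⟩ else 0 := by
    intro w i
    rw [← shDown_apply (k := k)]; rfl
  have hXF : ∀ w, shDown k p Y (stepD p φ D w) = F (shDown k p Y w) := by
    intro w
    funext i
    rw [hF, shDown_apply, shDown_apply]
    by_cases h : (i : ℕ) + 1 < p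
    · rw [dif_pos h, dif_pos h, dif_pos h, stepD_apply, shDown_apply]
      simp only [Nat.add_eq_zero_iff, one_ne_zero, and_false, if_false]
    · rw [dif_neg h, dif_neg h, dif_neg h, map_zero, add_zero]
  have hFp : F ^ p = 0 := compLeft_add_shDown_pow p p le_rfl D hD
  let GF : ℤ → Submodule k (Fin p → Y) := fun e =>
    Submodule.pi Set.univ fun i : Fin p => A (e - ((i : ℕ) + 1)) ⊓ S'
  have hGF : ∀ e x, x ∈ GF e → F x ∈ GF (e - 1) := by
    intro e x hx i _
    rw [hF]
    refine Submodule.add_mem _ ⟨mem_of_eq (hDA _ _ (hx i trivial).1) (by ring), hDS' _ (hx i trivial).2⟩ ?_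
    split_ifs with h
    · have := hx ⟨i + 1, h⟩ trivial
      exact ⟨mem_of_eq this.1 (by push_cast; ring), this.2⟩
    · exact Submodule.zero_mem _
  have hGT : ∀ e x, x ∈ GF e → topOfBot k p Y x ∈ GF (e + (p - 1 : ℕ) * 1) := by
    intro e x hx i _
    rw [topOfBot_apply]
    split_ifs with h
    · have := hx ⟨0, by omega⟩ trivial
      refine ⟨mem_of_eq this.1 ?_, this.2⟩
      simp only [Nat.cast_zero]
      omega
    · exact Submodule.zero_mem _
  have hGX : ∀ e x, x ∈ (Submodule.pi Set.univ fun i : Fin p => A (e - (i : ℕ)) ⊓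
        if (i : ℕ) = 0 then S else S') → stepD p φ D x ∈ (Submodule.pi Set.univ fun i : Fin p =>
        A (e - 1 - (i : ℕ)) ⊓ if (i : ℕ) = 0 then S else S') := by
    intro e x hx i _
    rw [stepD_apply]
    have h1 := hx i trivial
    refine Submodule.add_mem _ ⟨mem_of_eq (hDA _ _ h1.1) (by ring), ?_⟩ ?_
    · have h2 := h1.2
      by_cases h0 : (i : ℕ) = 0
      · simp only [h0, if_true] at h2 ⊢; exact hDS _ h2
      · simp only [h0, if_false] at h2 ⊢; exact hDS' _ h2
    · by_cases h : (i : ℕ) + 1 < p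
      · rw [dif_pos h]
        have h1 := hx ⟨i + 1, h⟩ trivial
        have h2 : x ⟨i + 1, h⟩ ∈ S' := h1.2
        have h3 : x ⟨i + 1, h⟩ ∈ A (e - 1 - (i : ℕ)) := mem_of_eq h1.1 (by push_cast; ring)
        by_cases h0 : (i : ℕ) = 0
        · simp only [h0, if_true] at h3 ⊢
          simp only [h0] at h2
          exact ⟨hφA _ _ h3, hφS _ h2⟩
        · simp only [h0, if_false]
          exact ⟨h3, h2⟩
      · rw [dif_neg h]; exact Submodule.zero_mem _
  have hvT : shDown k p Y v ∈ GF d := by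
    intro i _
    rw [shDown_apply]
    split_ifs with h
    · have h2 := hvS ⟨i + 1, h⟩ trivial
      exact ⟨mem_of_eq (hvA ⟨i + 1, h⟩ trivial) (by push_cast; ring), h2⟩
    · exact Submodule.zero_mem _
  have hvF : (F ^ s) (shDown k p Y v) = 0 := by
    rw [← pow_map (shDown k p Y) hXF, hv, map_zero]
  let u : Fin p → Y := ∑ i ∈ Finset.range s, (F ^ i) (topOfBot k p Y ((F ^ (s - 1 - i))
    (shDown k p Y v)))
  have hu : (F ^ (p - s)) u = shDown k p Y v := by
    rw [← adp_apply_of_pow_eq_zero p s hsp.le F _ _ hvF, adp_compLeft_add_shDown p hodd D]; rfl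
  have huG : u ∈ GF (d + p - s) := by
    refine Submodule.sum_mem _ fun i hi => ?_
    have hi' := Finset.mem_range.mp hi
    refine mem_of_eq (pow_mem_sub hGF i _ _ (hGT _ _ (pow_mem_sub hGF _ _ _ hvT))) ?_
    rw [Nat.cast_sub (by omega : i ≤ s - 1), Nat.cast_sub hs1, Nat.cast_sub (by omega : 1 ≤ p)]
    push_cast
    ring
  let T : Fin p := ⟨p - 1, by omega⟩
  have hTF : ∀ w, (F w) T = D (w T) := by
    intro w
    rw [hF, dif_neg (by simp only [T]; omega), add_zero]
  have hpT : ∀ r w, ((F ^ r) w) T = (D ^ r) (w T) := fun r w =>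
    pow_map (LinearMap.proj (R := k) (φ := fun _ : Fin p => Y) T) hTF r w
  -- the top component of the preimage in `F` is corrected to zero
  have huT : (D ^ (p - s)) (u T) = 0 := by
    rw [← hpT, hu, shDown_apply, dif_neg (by simp only [T]; omega)]
  obtain ⟨y, hyA, hyS, hy⟩ := h' (d - s) (p - s) (u T) (by omega) (by omega) hds
    (by
      rw [Nat.cast_sub hsp.le]
      intro h
      apply hd
      have h2 := dvd_add h (dvd_refl (p : ℤ))
      rwa [show d - s - ((p : ℤ) - s) + p = d by ring] at h2)
    (mem_of_eq (huG T trivial).1 (by simp only [T]; rw [Nat.cast_sub (by omega : 1 ≤ p)]; push_cast; ring))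
    (huG T trivial).2 huT
  rw [show p - (p - s) = s by omega] at hy
  have hyG : L1.last k p Y y ∈ GF (d + p) := by
    intro i _
    rw [L1.last_apply]
    split_ifs with h
    · refine ⟨mem_of_eq hyA ?_, hyS⟩
      have : ((i : ℕ) : ℤ) + 1 = p := by exact_mod_cast h
      rw [this, Nat.cast_sub hsp.le]
      ring
    · exact Submodule.zero_mem _
  let u' : Fin p → Y := u - (F ^ s) (L1.last k p Y y)
  have hu'G : u' ∈ GF (d + p - s) := Submodule.sub_mem _ huG (pow_mem_sub hGF s _ _ hyG)
  have hu'T : u' T = 0 := by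
    change u T - (F ^ s) (L1.last k p Y y) T = 0
    rw [hpT, L1.last_apply, if_pos (by simp only [T]; omega), hy, sub_self]
  have hu' : (F ^ (p - s)) u' = shDown k p Y v := by
    simp only [u']
    rw [map_sub, hu, ← Module.End.mul_apply, ← pow_add, Nat.sub_add_cancel hsp.le, hFp]
    simp
  let w1 : Fin p → Y := fun i => if h : (i : ℕ) = 0 then 0 else u' ⟨i - 1, by omega⟩
  have hw1 : shDown k p Y w1 = u' := by
    funext i
    rw [shDown_apply]
    by_cases h : (i : ℕ) + 1 < p
    · rw [dif_pos h]
      simp only [w1]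
      rw [dif_neg (by omega)]
      rfl
    · rw [dif_neg h, show i = T from Fin.ext (by simp only [T]; omega), hu'T]
  have hw1G : w1 ∈ (Submodule.pi Set.univ fun i : Fin p => A (d + p - s - (i : ℕ)) ⊓
        if (i : ℕ) = 0 then S else S') := by
    intro i _
    simp only [w1]
    by_cases h : (i : ℕ) = 0
    · rw [dif_pos h]; exact Submodule.zero_mem _
    · rw [dif_neg h, if_neg h]
      have h3 := hu'G ⟨i - 1, by omega⟩ trivial
      refine ⟨mem_of_eq h3.1 ?_, h3.2⟩
      simp only
      rw [Nat.cast_sub (by omega)]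
      push_cast
      ring
  have hXp := stepD_pow p φ D hφ hD
  -- what remains of `v` is concentrated in the bottom term
  let v' := v - (stepD p φ D ^ (p - s)) w1
  have hv'G : v' ∈ (Submodule.pi Set.univ fun i : Fin p => A (d - (i : ℕ)) ⊓
        if (i : ℕ) = 0 then S else S') := by
    refine Submodule.sub_mem _ (fun i _ => ⟨hvA i trivial, hvS i trivial⟩) ?_
    have := pow_mem_sub (G := fun e => Submodule.pi Set.univ fun i : Fin p => A (e - (i : ℕ)) ⊓
        if (i : ℕ) = 0 then S else S') hGX (p - s) _ _ hw1G
    refine mem_of_eq (G := fun e => Submodule.pi Set.univ fun i : Fin p => A (e - (i : ℕ)) ⊓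
        if (i : ℕ) = 0 then S else S') this ?_
    rw [Nat.cast_sub hsp.le]
    ring
  let Z : Fin p := ⟨0, by omega⟩
  let inc : Y →ₗ[k] (Fin p → Y) := LinearMap.single k (fun _ => Y) Z
  have hinc : ∀ x, inc (D x) = stepD p φ D (inc x) := by
    intro x
    funext i
    rw [stepD_apply]
    have h2 : ∀ h : (i : ℕ) + 1 < p, inc x ⟨i + 1, h⟩ = 0 := fun h => by
      have hne : (⟨i + 1, h⟩ : Fin p) ≠ Z :=
        fun h' => absurd (congrArg Fin.val h') (Nat.succ_ne_zero i)
      simp [inc, Pi.single_eq_of_ne hne]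
    have h3 : (if h : (i : ℕ) + 1 < p then
      (if (i : ℕ) = 0 then φ (inc x ⟨i + 1, h⟩) else inc x ⟨i + 1, h⟩) else 0) = 0 := by
      split_ifs with h h0
      · rw [h2, map_zero]
      · exact h2 h
      · rfl
    rw [h3, add_zero]
    exact (congrFun (L1.compLeft_single D Z x) i).symm
  have hv'T : inc (v' Z) = v' := by
    funext i
    by_cases h : i = Z
    · subst h; simp [inc]
    · have h0 : (i : ℕ) ≠ 0 := fun h0 => h (Fin.ext h0)
      have h1 : shDown k p Y v' = 0 := by
        simp only [v']
        rw [map_sub, pow_map (shDown k p Y) hXF, hw1, hu', sub_self]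
      have h2 := congrFun h1 ⟨i - 1, by omega⟩
      rw [shDown_apply, dif_pos (by simp only; omega)] at h2
      have e : (⟨(i : ℕ) - 1 + 1, by omega⟩ : Fin p) = i := Fin.ext (by simp only; omega)
      simp only [e] at h2
      rw [h2]
      exact Pi.single_eq_of_ne h _
  have hv's : (stepD p φ D ^ s) v' = 0 := by
    simp only [v']
    rw [map_sub, hv, ← Module.End.mul_apply, ← pow_add, Nat.add_sub_cancel' hsp.le, hXp]
    simp
  have hv'0 : (D ^ s) (v' Z) = 0 := by
    have h1 := pow_map inc hinc s (v' Z)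
    rw [hv'T, hv's] at h1
    have h2 := congrFun h1 Z
    simpa [inc] using h2
  have h3 := hv'G Z trivial
  obtain ⟨y', hy'A, hy'S, hy'⟩ := h d s (v' Z) hs1 hsp hd hds (mem_of_eq h3.1 (by simp [Z]))
    (by simpa [Z] using h3.2) hv'0
  refine ⟨w1 + inc y', Submodule.add_mem _ (fun i _ => (hw1G i trivial).1)
    (L1.single_mem (B := fun i : Fin p => A (d + p - s - (i : ℕ))) Z (mem_of_eq hy'A (by simp [Z]))),
    Submodule.add_mem _ (fun i _ => (hw1G i trivial).2)
    (L1.single_mem (B := fun i : Fin p => if (i : ℕ) = 0 then S else S') Z (by simpa [Z] using hy'S)), ?_⟩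
  rw [map_add, ← pow_map inc hinc, hy', hv'T]
  simp only [v']
  abel

end Step

end PHHH

/-! ### Slash homology of an exact p-complex -/

namespace PHHH
open MvPolynomial (X)
variable {k : Type u} [Field k]

namespace L1

/-- Projections onto the homogeneous components for the Hochschild degree. -/
structure Decomp (X : L1 k) where
  F : Finset ℤ
  π : ℤ → Module.End k X.V
  πA : ∀ d x, π d x ∈ X.A d
  sum : ∀ x, ∑ d ∈ F, π d x = x
  self : ∀ d x, x ∈ X.A d → π d x = x
  ne : ∀ d e x, x ∈ X.A d → e ≠ d → π e x = 0

namespace Decomp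

variable {X : L1 k} (P : Decomp X) (p : ℕ)

open Classical in
/-- The projection onto the part of degree congruent to `ρ` modulo `p`. -/
def res (ρ : ℤ) : Module.End k X.V := ∑ d ∈ P.F with (p : ℤ) ∣ d - ρ, P.π d

variable {p}

lemma π_D (d : ℤ) (r : ℕ) (x : X.V) : P.π (d - r) ((X.D ^ r) x) = (X.D ^ r) (P.π d x) := by
  conv_lhs => rw [← P.sum x]
  rw [map_sum, map_sum]
  have h2 : ∀ e ∈ P.F, P.π (d - r) ((X.D ^ r) (P.π e x))
      = if e = d then (X.D ^ r) (P.π d x) else 0 := by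
    intro e _
    split_ifs with h
    · subst h; exact P.self _ _ (D_pow_mem r _ _ (P.πA _ _))
    · exact P.ne _ _ _ (D_pow_mem r _ _ (P.πA _ _)) (by omega)
  rw [Finset.sum_congr rfl h2, Finset.sum_ite_eq']
  split_ifs with h
  · rfl
  · have : P.π d x = 0 := by
      rw [← P.sum (P.π d x)]
      exact Finset.sum_eq_zero fun e he => P.ne _ _ _ (P.πA _ _) (fun h' => h (h' ▸ he))
    rw [this, map_zero]

lemma res_of_mem {ρ d : ℤ} (hd : (p : ℤ) ∣ d - ρ) {x : X.V} (hx : x ∈ X.A d) :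
    P.res p ρ x = x := by
  classical
  conv_rhs => rw [← P.sum x]
  rw [res, LinearMap.sum_apply, Finset.sum_filter]
  refine Finset.sum_congr rfl fun e _ => ?_
  split_ifs with h
  · rfl
  · refine (P.ne d e x hx ?_).symm
    rintro rfl
    exact h hd

lemma res_of_not_mem {ρ d : ℤ} (hd : ¬ (p : ℤ) ∣ d - ρ) {x : X.V} (hx : x ∈ X.A d) :
    P.res p ρ x = 0 := by
  classical
  rw [res, LinearMap.sum_apply]
  refine Finset.sum_eq_zero fun e he => P.ne d e x hx ?_
  rintro rfl
  exact hd (Finset.mem_filter.mp he).2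

lemma res_D (ρ : ℤ) (r : ℕ) (x : X.V) : P.res p (ρ - r) ((X.D ^ r) x) = (X.D ^ r) (P.res p ρ x) := by
  conv_lhs => rw [← P.sum x]
  conv_rhs => rw [← P.sum x]
  simp only [map_sum]
  refine Finset.sum_congr rfl fun d _ => ?_
  have h1 := P.πA d x
  by_cases hd : (p : ℤ) ∣ d - ρ
  · rw [P.res_of_mem hd h1, P.res_of_mem (by rwa [sub_sub_sub_cancel_right]) (D_pow_mem r _ _ h1)]
  · rw [P.res_of_not_mem hd h1, map_zero,
      P.res_of_not_mem (by rwa [sub_sub_sub_cancel_right]) (D_pow_mem r _ _ h1)]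

lemma res_residue {ρ ρ' : ℤ} (h : (p : ℤ) ∣ ρ - ρ') {x : X.V} (hx : x ∈ X.residue p ρ) :
    P.res p ρ' x = x := by
  have := iSup_map_mem (B := (⊥ : Submodule k X.V)) (P.res p ρ' - 1) (fun r x hx => by
    rw [Submodule.mem_bot]
    change P.res p ρ' x - x = 0
    rw [P.res_of_mem ?_ hx, sub_self]
    rw [add_sub_assoc]
    exact dvd_add (Dvd.intro_left _ rfl) h) x hx
  exact sub_eq_zero.mp ((Submodule.mem_bot k).mp this)

lemma res_residue_ne {ρ ρ' : ℤ} (h : ¬ (p : ℤ) ∣ ρ - ρ') {x : X.V} (hx : x ∈ X.residue p ρ) :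
    P.res p ρ' x = 0 := by
  have := iSup_map_mem (B := (⊥ : Submodule k X.V)) (P.res p ρ') (fun r x hx => by
    rw [Submodule.mem_bot]
    refine P.res_of_not_mem (fun h' => h ?_) hx
    rw [add_sub_assoc] at h'
    exact (Int.dvd_add_right (Dvd.intro_left _ rfl)).mp h') x hx
  exact (Submodule.mem_bot k).mp this

/-- `PExact` for a whole residue class of Hochschild degrees, with an arbitrary element killed by
`D ^ s` projected to it. -/
lemma exact_residue (hX : PExact p X.D X.A ⊤) {ρ : ℤ} {s : ℕ} (hs : 1 ≤ s) (hsp : s < p)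
    (h0 : ¬ (p : ℤ) ∣ ρ) (h1 : ¬ (p : ℤ) ∣ ρ - s) {x : X.V} (hx : (X.D ^ s) x = 0) :
    P.res p ρ x ∈ LinearMap.range (X.D ^ (p - s)) := by
  classical
  rw [res, LinearMap.sum_apply]
  refine Submodule.sum_mem _ fun d hd => ?_
  have hd := (Finset.mem_filter.mp hd).2
  obtain ⟨w, -, -, hw⟩ := hX d s (P.π d x) hs hsp
    (fun h => h0 ((Int.dvd_iff_dvd_of_dvd_sub hd).mp h))
    (fun h => h1 ((Int.dvd_iff_dvd_of_dvd_sub (by rwa [sub_sub_sub_cancel_right])).mp h))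
    (P.πA d x) trivial (by rw [← π_D, hx, map_zero])
  exact ⟨w, hw⟩

end Decomp

variable (p : ℕ) (X : L1 k)

/-- The `q`-shift by twice the ordinary Hochschild degree and the topological shift by the
Hochschild degree. -/
def hochShift (b : Bool) (d : ℤ) : ℤ :=
  if b then d else 2 * (2 * (d / p) + if (p : ℤ) ∣ d then 0 else 1)

/-- The slash homology of the Hochschild differential with the sum of the topological and the
residual differential, and the collapsed gradings. -/
abbrev slashHH : L2 k where
  V := Slash p X.D
  D := Slash.map p X.D X.T (LinearMap.ext X.TD) + Slash.res p X.D
  Q := Slash.map p X.D X.Q (LinearMap.ext X.QD)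
  DQ x := by
    rw [LinearMap.add_apply, LinearMap.add_apply, map_add]
    refine congrArg₂ _ ?_ ?_
    · exact LinearMap.congr_fun (Slash.map_comm (LinearMap.ext X.TD) (LinearMap.ext X.QD)
        (LinearMap.ext X.TQ)) x
    · exact (LinearMap.congr_fun (Slash.map_res (LinearMap.ext X.QD)) x).symm
  G b j := ⨆ d : ℤ, Slash.gr p X.D (X.A d ⊓ X.G b (j - hochShift p b d))

variable {X}

/-- The even part maps to the component with index zero of slash homology, as every class of
`ker D` is killed in the other components. -/
def evenPiece (j : ℕ) : (HL p 1 0 (idxE p) X).V →ₗ[k] SlashPiece p X.D j :=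
  SQ.map (Z' := LinearMap.ker (X.D ^ (j + 1)))
    (B' := LinearMap.range (X.D ^ (p - j - 1)) ⊔ LinearMap.ker (X.D ^ j)) LinearMap.id
    (fun x hx => by
      have h := hx.2
      rw [SetLike.mem_coe, LinearMap.mem_ker, pow_one] at h
      rw [LinearMap.mem_ker, pow_succ, Module.End.mul_apply, LinearMap.id_apply, h, map_zero])
    (fun x _ hx => by
      obtain ⟨y, rfl⟩ := hx
      by_cases h : j + 1 ≤ p
      · refine Submodule.mem_sup_left ⟨(X.D ^ j) y, ?_⟩
        rw [← Module.End.mul_apply, ← pow_add, LinearMap.id_apply]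
        congr 2
        omega
      · refine Submodule.mem_sup_left ⟨(X.D ^ (p - 1)) y, ?_⟩
        rw [show p - j - 1 = 0 by omega]
        rfl)

/-- The component with index `j` of slash homology receives the `j`-th term of the chain of the odd
part through `D ^ (p - 2 - j)`. -/
def oddPiece (j : Fin (p - 1)) : (HL p (p - 1) (-1) (idxO p) X).V →ₗ[k] SlashPiece p X.D j :=
  SQ.map (Z' := LinearMap.ker (X.D ^ ((j : ℕ) + 1)))
    (B' := LinearMap.range (X.D ^ (p - j - 1)) ⊔ LinearMap.ker (X.D ^ (j : ℕ))) (X.D ^ (p - 2 - j))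
    (fun x hx => by
      have h := hx.2
      rw [SetLike.mem_coe, LinearMap.mem_ker] at h
      rw [LinearMap.mem_ker, ← Module.End.mul_apply, ← pow_add,
        show (j : ℕ) + 1 + (p - 2 - j) = p - 1 by omega, h])
    (fun x _ hx => by
      obtain ⟨y, rfl⟩ := hx
      refine Submodule.mem_sup_left ⟨y, ?_⟩
      rw [← Module.End.mul_apply, ← pow_add]
      congr 2
      omega)

/-- The comparison of the `p`-extended contracted homology with slash homology. -/
def extToSlash : (ext p X).V →ₗ[k] Slash p X.D :=
  LinearMap.pi fun j : Fin (p - 1) =>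
    evenPiece p (X := X) j ∘ₗ LinearMap.fst k _ _ + oddPiece p j ∘ₗ LinearMap.proj j ∘ₗ LinearMap.snd k _ _

lemma extToSlash_apply (x : (ext p X).V) (j : Fin (p - 1)) :
    extToSlash p x j = evenPiece p j x.1 + oddPiece p j (x.2 j) := rfl

lemma evenPiece_eq_zero (j : ℕ) (hj : j ≠ 0) (x : (HL p 1 0 (idxE p) X).V) :
    evenPiece p j x = 0 := by
  refine SQ.ind (P := fun x => evenPiece p (X := X) j x = 0) (fun v hv => ?_) x
  refine SQ.cls_eq_zero.mpr (Submodule.mem_sup_right ?_)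
  have h := hv.2
  rw [SetLike.mem_coe, LinearMap.mem_ker, pow_one] at h
  obtain ⟨i, rfl⟩ := Nat.exists_eq_succ_of_ne_zero hj
  change (X.D ^ (i + 1)) v = 0
  rw [pow_succ, Module.End.mul_apply, h, map_zero]

lemma extToSlash_Q (x : (ext p X).V) :
    extToSlash p ((ext p X).Q x) = (slashHH p X).Q (extToSlash p x) := by
  obtain ⟨h, o⟩ := x
  funext j
  change evenPiece p j (hlMap p 1 0 X.Q X.QD X.QA h) + oddPiece p j
    (hlMap p (p - 1) (-1) X.Q X.QD X.QA (o j)) = Slash.map p X.D X.Q (LinearMap.ext X.QD) _ j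
  rw [Slash.map_apply, extToSlash_apply, map_add]
  refine congrArg₂ _ ?_ ?_
  · exact SQ.ind (P := fun h => evenPiece p (X := X) j (hlMap p 1 0 X.Q X.QD X.QA h)
      = Slash.mapPiece p X.D X.Q (LinearMap.ext X.QD) j (evenPiece p j h)) (fun v hv => rfl) h
  · refine SQ.ind (P := fun h => oddPiece p (X := X) j (hlMap p (p - 1) (-1) X.Q X.QD X.QA h)
      = Slash.mapPiece p X.D X.Q (LinearMap.ext X.QD) j (oddPiece p j h)) (fun v hv => ?_) (o j)
    exact SQ.cls_congr (Slash.pow_apply_comm (LinearMap.ext X.QD) _ _) _ _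

lemma extToSlash_D (x : (ext p X).V) :
    extToSlash p ((ext p X).D x) = (slashHH p X).D (extToSlash p x) := by
  obtain ⟨h, o⟩ := x
  funext j
  change evenPiece p j (hlMap p 1 0 X.T X.TD X.TA h) + oddPiece p j
    (hlMap p (p - 1) (-1) X.T X.TD X.TA (o j) + shDown k (p - 1) _ o j)
    = Slash.map p X.D X.T (LinearMap.ext X.TD) _ j + Slash.res p X.D (extToSlash p (h, o)) j
  rw [Slash.map_apply, extToSlash_apply, map_add, map_add, ← add_assoc]
  refine congrArg₂ _ (congrArg₂ _ ?_ ?_) ?_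
  · exact SQ.ind (P := fun h => evenPiece p (X := X) j (hlMap p 1 0 X.T X.TD X.TA h)
      = Slash.mapPiece p X.D X.T (LinearMap.ext X.TD) j (evenPiece p j h)) (fun v hv => rfl) h
  · refine SQ.ind (P := fun h => oddPiece p (X := X) j (hlMap p (p - 1) (-1) X.T X.TD X.TA h)
      = Slash.mapPiece p X.D X.T (LinearMap.ext X.TD) j (oddPiece p j h)) (fun v hv => ?_) (o j)
    exact SQ.cls_congr (Slash.pow_apply_comm (LinearMap.ext X.TD) _ _) _ _
  · rw [shDown_apply]
    by_cases hj : (j : ℕ) + 1 < p - 1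
    · rw [dif_pos hj, Slash.res_apply_of_lt _ _ hj, extToSlash_apply, map_add,
        evenPiece_eq_zero p _ (Nat.succ_ne_zero _), map_zero, zero_add]
      refine SQ.ind (P := fun h => oddPiece p (X := X) j h
        = Slash.resPiece p X.D j hj (oddPiece p ⟨(j : ℕ) + 1, hj⟩ h)) (fun v hv => ?_) _
      refine SQ.cls_congr ?_ _ _
      change (X.D ^ (p - 2 - j)) v = X.D ((X.D ^ (p - 2 - ((j : ℕ) + 1))) v)
      rw [← Module.End.mul_apply, ← pow_succ']
      congr 2
      omega
    · rw [dif_neg hj, map_zero, Slash.res_apply_of_not_lt _ _ hj]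

section Bijective

variable [Fact p.Prime]

lemma not_dvd_of_lt {p : ℕ} (i : ℤ) (h0 : 0 < i) (h1 : i < p) : ¬ (p : ℤ) ∣ i :=
  fun h => absurd (Int.le_of_dvd h0 h) (by omega)

/-- The independence of the even and odd parts in the component with index `j` of slash homology: the
two classes live in distinct residue classes modulo `p`, and in the one of the odd part exactness
reduces the relation to a boundary. -/
lemma mem_range_of_add_eq (hp : 2 < p) (P : Decomp X) (hX : PExact p X.D X.A ⊤) (j : ℕ) (hj : j < p - 1) (v : X.V)
    (hv : v ∈ X.cyc p 1 0) (w : X.V) (hw : w ∈ X.cyc p (p - 1) (-1)) (b c : X.V)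
    (hc : (X.D ^ j) c = 0) (h : (X.D ^ (p - j - 1)) b + c = v + (X.D ^ (p - 2 - j)) w) :
      w ∈ LinearMap.range (X.D ^ (p - (p - 1))) ∧
        (j = 0 → v ∈ LinearMap.range (X.D ^ (p - 1))) := by
  have e1 : ((p - 2 - j : ℕ) : ℤ) = p - 2 - j := by omega
  have e2 : ((p - j - 1 : ℕ) : ℤ) = p - 1 - j := by omega
  have hw1 : P.res p (j + 1 : ℤ) ((X.D ^ (p - 2 - j)) w) = (X.D ^ (p - 2 - j)) w := by
    have h1 := P.res_D (p := p) ((j + 1 : ℤ) + (p - 2 - j : ℕ)) (p - 2 - j) w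
    rw [add_sub_cancel_right] at h1
    rw [h1, P.res_residue ?_ hw.1]
    rw [e1]
    exact ⟨-1, by ring⟩
  have hv1 : P.res p (j + 1 : ℤ) v = 0 := P.res_residue_ne (fun h => not_dvd_of_lt (p := p) (j + 1)
    (by omega) (by omega) (by have := (dvd_neg (a := (p : ℤ))).mpr h; rwa [zero_sub, neg_neg] at this)) hv.1
  -- the correction term `c` can be absorbed in the image
  obtain ⟨b', hb'⟩ : ∃ b', P.res p (j + 1 : ℤ) c = (X.D ^ (p - j - 1)) b' := by
    by_cases h0 : j = 0
    · subst h0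
      refine ⟨0, ?_⟩
      have hc' : c = 0 := hc
      rw [hc', map_zero, map_zero]
    · obtain ⟨b', hb'⟩ := P.exact_residue hX (ρ := j + 1) (s := j) (by omega) (by omega)
        (not_dvd_of_lt _ (by omega) (by omega)) (not_dvd_of_lt _ (by omega) (by omega)) hc
      refine ⟨X.D b', ?_⟩
      rw [← hb', ← Module.End.mul_apply, ← pow_succ]
      congr 2
      omega
  constructor
  -- in residue `j + 1` the even class disappears; in residue `0` the odd one does
  · have h2 := congrArg (P.res p (j + 1 : ℤ)) h
    have h4 := P.res_D (p := p) ((j + 1 : ℤ) + (p - j - 1 : ℕ)) (p - j - 1) b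
    rw [add_sub_cancel_right] at h4
    rw [map_add, map_add, hw1, hv1, zero_add, hb', h4, ← map_add] at h2
    set y := P.res p ((j + 1 : ℤ) + (p - j - 1 : ℕ)) b + b' with hy
    have h5 : (X.D ^ (p - 2 - j)) (w - X.D y) = 0 := by
      rw [map_sub, ← h2, ← Module.End.mul_apply (X.D ^ (p - 2 - j)), ← pow_succ,
        show p - 2 - j + 1 = p - j - 1 by omega, sub_self]
    have h6 : P.res p (-1) (w - X.D y) ∈ LinearMap.range (X.D ^ (p - (p - 1))) := by
      by_cases h0 : p - 2 - j = 0
      · rw [h0] at h5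
        have h5' : w - X.D y = 0 := h5
        rw [h5', map_zero]
        exact Submodule.zero_mem _
      · obtain ⟨z, hz⟩ := P.exact_residue hX (ρ := -1) (s := p - 2 - j) (by omega) (by omega)
          (fun h => not_dvd_of_lt (p := p) 1 (by omega) (by omega) ((dvd_neg).mp h))
          (fun h => not_dvd_of_lt (p := p) (j + 1) (by omega) (by omega)
            (by have := dvd_add h (dvd_refl (p : ℤ)); rwa [e1, show (-1 : ℤ) - (p - 2 - j) + p = j + 1 by ring] at this)) h5
        refine ⟨(X.D ^ (p - (p - 2 - j) - 1)) z, ?_⟩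
        rw [← hz, ← Module.End.mul_apply, ← pow_add]
        congr 2
        omega
    have h7 := P.res_D (p := p) 0 1 y
    rw [pow_one, zero_sub, Nat.cast_one] at h7
    rw [map_sub, h7, P.res_residue (by simp) hw.1] at h6
    have h8 := Submodule.add_mem _ h6 (show X.D (P.res p 0 y) ∈ LinearMap.range (X.D ^ (p - (p - 1))) by
      rw [show p - (p - 1) = 1 by omega, pow_one]; exact ⟨_, rfl⟩)
    rwa [sub_add_cancel] at h8
  · rintro rfl
    have hc' : c = 0 := hc
    have h2 := congrArg (P.res p 0) h
    have h4 := P.res_D (p := p) (p - 1 - 0 : ℤ) (p - 0 - 1) b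
    have h5 := P.res_D (p := p) (p - 2 - 0 : ℤ) (p - 2 - 0) w
    rw [show (p - 1 - 0 : ℤ) - (p - 0 - 1 : ℕ) = 0 by omega] at h4
    rw [show (p - 2 - 0 : ℤ) - (p - 2 - 0 : ℕ) = 0 by omega, P.res_residue_ne (fun h =>
      not_dvd_of_lt (p := p) 1 (by omega) (by omega) ?_) hw.1, map_zero] at h5
    · rw [hc', add_zero, map_add, h4, h5, add_zero, P.res_residue (by simp) hv.1] at h2
      exact ⟨_, h2⟩
    · have := dvd_add h (dvd_refl (p : ℤ))
      rwa [show (-1 : ℤ) - (p - 2 - 0) + p = 1 by ring] at this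

lemma extToSlash_injective (hp : 2 < p) (P : Decomp X) (hX : PExact p X.D X.A ⊤) :
    Function.Injective (extToSlash p (X := X)) := by
  rw [injective_iff_map_eq_zero]
  rintro ⟨h, o⟩ ho
  have key : ∀ j : Fin (p - 1), ∀ v (hv : v ∈ X.cyc p 1 0) w (hw : w ∈ X.cyc p (p - 1) (-1)),
      evenPiece p j (SQ.cls _ v hv) + oddPiece p j (SQ.cls _ w hw) = 0 →
      w ∈ LinearMap.range (X.D ^ (p - (p - 1))) ∧
        ((j : ℕ) = 0 → v ∈ LinearMap.range (X.D ^ (p - 1))) := by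
    intro j v hv w hw h
    have hj := j.2
    obtain ⟨_, ⟨b, rfl⟩, c, hc, hbc⟩ := Submodule.mem_sup.mp (show v + (X.D ^ (p - 2 - j)) w ∈
      LinearMap.range (X.D ^ (p - j - 1)) ⊔ LinearMap.ker (X.D ^ (j : ℕ)) from SQ.cls_eq_zero.mp h)
    exact mem_range_of_add_eq p hp P hX j hj v hv w hw b c hc hbc
  have : ∀ j : Fin (p - 1), o j = 0 ∧ ((j : ℕ) = 0 → h = 0) := by
    intro j
    have h1 := congrFun ho j
    rw [extToSlash_apply] at h1
    obtain ⟨v, hv, hv'⟩ : ∃ v hv, h = SQ.cls _ v hv :=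
      SQ.ind (P := fun h => ∃ v hv, h = SQ.cls _ v hv) (fun v hv => ⟨v, hv, rfl⟩) h
    obtain ⟨w, hw, hw'⟩ : ∃ w hw, o j = SQ.cls _ w hw :=
      SQ.ind (P := fun h => ∃ v hv, h = SQ.cls _ v hv) (fun v hv => ⟨v, hv, rfl⟩) (o j)
    have h2 := key j v hv w hw (by rw [← hv', ← hw']; exact h1)
    refine ⟨hw'.trans (SQ.cls_eq_zero.mpr h2.1), fun h0 => hv'.trans (SQ.cls_eq_zero.mpr (h2.2 h0))⟩
  exact Prod.ext ((this ⟨0, by omega⟩).2 rfl) (funext fun j => (this j).1)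

/-- Classes of homogeneous elements come from homogeneous elements of the even or the odd part, the
submodule `S` of homogeneous elements for the internal gradings being preserved. In the component with
index `j`, only the degrees `d` divisible by `p` (with `j = 0`) and those congruent to `j + 1` carry
nonzero classes. -/
lemma exists_extToSlash (hp : 2 < p) (S : Submodule k X.V) (hX : PExact p X.D X.A S)
    (hS : ∀ x ∈ S, X.D x ∈ S) (d : ℤ) (j : Fin (p - 1)) (a : X.V)
    (ha : a ∈ LinearMap.ker (X.D ^ ((j : ℕ) + 1))) (hA : a ∈ X.A d) (haS : a ∈ S) :
    ((∃ r : ℤ, d = r * p ∧ (j : ℕ) = 0 ∧ ∃ hv : a ∈ X.cyc p 1 0, evenPiece p j (SQ.cls _ a hv)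
        = slashCls p X.D j a ha) ∨
      (∃ r : ℤ, d = (r - 1) * p + 1 + j ∧ ∃ w, ∃ hw : w ∈ X.cyc p (p - 1) (-1),
        w ∈ X.A (r * p + -1) ∧ w ∈ S ∧ oddPiece p j (SQ.cls _ w hw) = slashCls p X.D j a ha)) ∨
      slashCls p X.D j a ha = 0 := by
  have hj := j.2
  have hker : (X.D ^ ((j : ℕ) + 1)) a = 0 := ha
  by_cases hd : (p : ℤ) ∣ d
  · by_cases h0 : (j : ℕ) = 0
    · obtain ⟨r, hr⟩ := hd
      rw [h0, zero_add] at hker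
      exact Or.inl (Or.inl ⟨r, by rw [hr, mul_comm], h0,
        ⟨mem_residue r (mem_of_eq hA (by rw [hr]; ring)), hker⟩, rfl⟩)
    -- exactness is applied to `D a`, so that `a` is a boundary up to an element of `ker (D ^ j)`
    · refine Or.inr ?_
      have hd1 : ¬ (p : ℤ) ∣ d - 1 := fun h => not_dvd_of_lt (p := p) 1 (by omega) (by omega)
        (by have := dvd_sub hd h; rwa [sub_sub_cancel] at this)
      have hd2 : ¬ (p : ℤ) ∣ d - 1 - (j : ℕ) := fun h => not_dvd_of_lt (p := p) ((j : ℕ) + 1)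
        (by omega) (by omega)
        (by have := dvd_sub hd h; rwa [show d - (d - 1 - ((j : ℕ) : ℤ)) = (j : ℕ) + 1 by ring] at this)
      obtain ⟨w, -, -, hw⟩ := hX (d - 1) j (X.D a) (by omega) (by omega) hd1 hd2
        (X.DA _ _ hA) (hS _ haS) (by rw [← Module.End.mul_apply, ← pow_succ, hker])
      refine SQ.cls_eq_zero.mpr (Submodule.mem_sup.mpr ⟨_, ⟨w, rfl⟩, a - (X.D ^ (p - j - 1)) w, ?_,
        by abel⟩)
      obtain ⟨i, hi⟩ := Nat.exists_eq_succ_of_ne_zero h0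
      rw [hi, LinearMap.mem_ker, pow_succ, Module.End.mul_apply, map_sub, ← hw,
        ← Module.End.mul_apply (X.D), ← pow_succ', hi,
        show p - (i + 1) - 1 + 1 = p - (i + 1) by omega, sub_self, map_zero]
  · by_cases hd1 : (p : ℤ) ∣ d - ((j : ℕ) + 1 : ℕ)
    · obtain ⟨r, hr⟩ := hd1
      have hr' : d = (r + 1 - 1) * p + 1 + (j : ℕ) := by
        rw [add_sub_cancel_right, mul_comm, ← hr]; push_cast; ring
      -- `a` is moved up to the top of its chain, in degree congruent to `-1`
      have : ∃ w, w ∈ X.A ((r + 1) * p + -1) ∧ w ∈ S ∧ (X.D ^ (p - 2 - j)) w = a := by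
        by_cases hj2 : (j : ℕ) + 2 = p
        · refine ⟨a, mem_of_eq hA ?_, haS, ?_⟩
          · have : (p : ℤ) = (j : ℕ) + 2 := by exact_mod_cast hj2.symm
            rw [hr', add_sub_cancel_right, add_mul]
            omega
          · rw [show p - 2 - (j : ℕ) = 0 by omega]; rfl
        · have hd2 : ¬ (p : ℤ) ∣ d - ((j : ℕ) + 2 : ℕ) := fun h =>
            not_dvd_of_lt (p := p) 1 (by omega) (by omega) (by
              have := dvd_sub (Dvd.intro r hr.symm) h
              rwa [show d - ((j : ℕ) + 1 : ℕ) - (d - ((j : ℕ) + 2 : ℕ)) = (1 : ℤ) by push_cast; ring] at this)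
          obtain ⟨w, hwA, hwS, hw⟩ := hX d (j + 2) a (by omega) (by omega) hd hd2 hA haS (by
            rw [show (j : ℕ) + 2 = 1 + (j + 1) by ring, pow_add, Module.End.mul_apply, hker, map_zero])
          refine ⟨w, mem_of_eq hwA ?_, hwS, ?_⟩
          · rw [hr']; push_cast; ring
          · rw [← hw]
            congr 2
            omega
      obtain ⟨w, hwA, hwS, hw⟩ := this
      refine Or.inl (Or.inr ⟨r + 1, hr', w, ⟨mem_residue _ hwA, ?_⟩, hwA, hwS, SQ.cls_congr hw _ _⟩)
      rw [SetLike.mem_coe, LinearMap.mem_ker, show p - 1 = (j : ℕ) + 1 + (p - 2 - j) by omega, pow_add,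
        Module.End.mul_apply, hw, hker]
    · refine Or.inr ?_
      obtain ⟨w, -, -, hw⟩ := hX d (j + 1) a (by omega) (by omega) hd hd1 hA haS hker
      exact SQ.cls_eq_zero.mpr (Submodule.mem_sup_left ⟨w, by rw [← hw, Nat.sub_sub]⟩)

/-- In Hochschild degree `r p` the collapsed gradings are those of the even part. -/
lemma hochShift_even (b : Bool) (r : ℤ) (hp : 0 < p) : hochShift p b (r * p) = idxE p b r := by
  have : (p : ℤ) ≠ 0 := by exact_mod_cast hp.ne'
  cases b
  · rw [hochShift, idxE, if_neg Bool.false_ne_true, if_neg Bool.false_ne_true,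
      if_pos (Dvd.intro_left _ rfl), Int.mul_ediv_cancel _ this]
    ring
  · rfl

/-- In the degrees `(r - 1) p + 1, …, r p - 1` the collapsed gradings are those of the chain of the odd
part. -/
lemma hochShift_odd (b : Bool) (r : ℤ) (j : ℕ) (hj : j < p - 1) :
    hochShift p b ((r - 1) * p + 1 + j) = idxO p b r + tau b * j := by
  have : (p : ℤ) ≠ 0 := by omega
  cases b
  · have h2 : ((r - 1) * p + 1 + j) / (p : ℤ) = r - 1 := by
      rw [add_assoc, add_comm, Int.add_mul_ediv_right _ _ this, Int.ediv_eq_zero_of_lt (by omega)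
        (by omega), zero_add]
    have h3 : ¬ (p : ℤ) ∣ (r - 1) * p + 1 + j := by
      rw [add_assoc, Int.dvd_add_right (Dvd.intro_left _ rfl)]
      exact not_dvd_of_lt _ (by omega) (by omega)
    simp only [hochShift, idxO, tau, if_neg h3, h2, Bool.false_eq_true, if_false]
    ring
  · simp [hochShift, idxO, tau]

lemma single_mem_slashGr {S : Submodule k X.V} {j : Fin (p - 1)} {v : X.V}
    (hv : v ∈ LinearMap.ker (X.D ^ ((j : ℕ) + 1))) (hS : v ∈ S) :
    LinearMap.single k (fun j : Fin (p - 1) => SlashPiece p X.D j) j (slashCls p X.D j v hv)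
      ∈ Slash.gr p X.D S := by
  refine mem_slashGr.mpr fun i => ?_
  by_cases h : i = j
  · subst h
    exact ⟨v, hv, hS, Pi.single_eq_same _ _⟩
  · exact ⟨0, Submodule.zero_mem _, S.zero_mem, Pi.single_eq_of_ne h _⟩

lemma extToSlash_G (b : Bool) (j : ℤ) (x : (ext p X).V) (hx : x ∈ (ext p X).G b j) :
    extToSlash p x ∈ (slashHH p X).G b j := by
  have hp := (Fact.out : p.Prime).two_le
  obtain ⟨h, o⟩ := x
  have hs : extToSlash p (h, o) = ∑ i : Fin (p - 1),
      LinearMap.single k (fun j : Fin (p - 1) => SlashPiece p X.D j) i (extToSlash p (h, o) i) :=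
    (Finset.univ_sum_single _).symm
  rw [hs]
  refine Submodule.sum_mem _ fun i _ => ?_
  rw [extToSlash_apply, map_add]
  refine Submodule.add_mem _ ?_ ?_
  · by_cases h0 : (i : ℕ) = 0
    · refine G_induction (X := X) (idx := idxE p) (P := (slashHH p X).G b j)
        (LinearMap.single k (fun j : Fin (p - 1) => SlashPiece p X.D j) i ∘ₗ evenPiece p i)
        (fun r v hv h1 h2 => ?_) h hx.1
      refine Submodule.mem_iSup_of_mem (r * p) (single_mem_slashGr p (v := v) _ ⟨?_, ?_⟩)
      · exact mem_of_eq h1 (by ring)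
      · rw [hochShift_even p b r (by omega)]; exact h2
    · rw [evenPiece_eq_zero p i h0, map_zero]; exact Submodule.zero_mem _
  · refine G_induction (X := X) (idx := idxO p) (P := (slashHH p X).G b j)
      (LinearMap.single k (fun j : Fin (p - 1) => SlashPiece p X.D j) i ∘ₗ oddPiece p i)
      (fun r v hv h1 h2 => ?_) (o i) (hx.2 i trivial)
    refine Submodule.mem_iSup_of_mem ((r - 1) * p + 1 + (i : ℕ))
      (single_mem_slashGr p (v := (X.D ^ (p - 2 - i)) v) _ ⟨?_, ?_⟩)
    · exact mem_of_eq (D_pow_mem _ _ _ h1) (by have := i.2; rw [show ((p - 2 - i : ℕ) : ℤ) = p - 2 - (i : ℕ) by omega]; ring)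
    · rw [hochShift_odd p b r i i.2]
      exact D_pow_memG _ _ _ _ (mem_of_eq h2 (by ring))

lemma extToSlash_even (x : (HL p 1 0 (idxE p) X).V) (j : Fin (p - 1)) (hj : (j : ℕ) = 0) :
    extToSlash p (X := X) (x, 0) = LinearMap.single k (fun j : Fin (p - 1) => SlashPiece p X.D j) j
      (evenPiece p j x) := by
  funext i
  rw [extToSlash_apply]
  change _ + oddPiece p i 0 = _
  rw [map_zero, add_zero]
  by_cases h : i = j
  · subst h; exact (Pi.single_eq_same (M := fun j : Fin (p - 1) => SlashPiece p X.D j) i _).symm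
  · refine Eq.trans ?_ (Pi.single_eq_of_ne (M := fun j : Fin (p - 1) => SlashPiece p X.D j) h _).symm
    exact evenPiece_eq_zero p i (fun h' => h (Fin.ext (h'.trans hj.symm))) x

lemma extToSlash_odd (x : (HL p (p - 1) (-1) (idxO p) X).V) (j : Fin (p - 1)) :
    extToSlash p (X := X) (0, Pi.single j x) = LinearMap.single k
      (fun j : Fin (p - 1) => SlashPiece p X.D j) j (oddPiece p j x) := by
  funext i
  rw [extToSlash_apply]
  change evenPiece p i 0 + oddPiece p i (Pi.single (M := fun _ => (HL p (p - 1) (-1) (idxO p) X).V) j x i) = _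
  rw [map_zero, zero_add]
  by_cases h : i = j
  · subst h
    rw [Pi.single_eq_same]
    exact (Pi.single_eq_same (M := fun j : Fin (p - 1) => SlashPiece p X.D j) i _).symm
  · rw [Pi.single_eq_of_ne h, map_zero]
    exact (Pi.single_eq_of_ne (M := fun j : Fin (p - 1) => SlashPiece p X.D j) h _).symm

lemma exists_extToSlash_single (hp : 2 < p) (S : Submodule k X.V) (hX : PExact p X.D X.A S)
    (hS : ∀ x ∈ S, X.D x ∈ S) (d : ℤ) (j : Fin (p - 1)) (a : X.V)
    (ha : a ∈ LinearMap.ker (X.D ^ ((j : ℕ) + 1))) (hA : a ∈ X.A d) (haS : a ∈ S) :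
    ∃ x : (ext p X).V, extToSlash p x = LinearMap.single k
      (fun j : Fin (p - 1) => SlashPiece p X.D j) j (slashCls p X.D j a ha) ∧
      ∀ b i, S = X.G b (i - hochShift p b d) → x ∈ (ext p X).G b i := by
  obtain (⟨r, hr, hj, hv, h⟩ | ⟨r, hr, w, hw, hwA, hwS, h⟩) | h :=
    exists_extToSlash p hp S hX hS d j a ha hA haS
  · refine ⟨(SQ.cls _ a hv, 0), by rw [extToSlash_even p _ j hj, h], ?_⟩
    rintro b i rfl
    refine ⟨cls_mem_G r hv (mem_of_eq hA (by rw [hr]; ring)) ?_, Submodule.zero_mem _⟩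
    rw [hr, hochShift_even p b r (by omega)] at haS
    exact haS
  · refine ⟨(0, Pi.single j (SQ.cls _ w hw)), by rw [extToSlash_odd p, h], ?_⟩
    rintro b i rfl
    refine ⟨Submodule.zero_mem _, single_mem (B := fun s : Fin (p - 1) =>
      (HL p (p - 1) (-1) (idxO p) X).G b (i - tau b * (s : ℕ))) j (cls_mem_G r hw hwA ?_)⟩
    rw [hr, hochShift_odd p b r j j.2] at hwS
    exact mem_of_eq hwS (by ring)
  · exact ⟨0, by rw [map_zero, h, map_zero], fun b i _ => Submodule.zero_mem _⟩

/-- The slash homology of the Hochschild differential is the `p`-extension of the contracted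
homology. -/
noncomputable def extIso (hp : 2 < p) (P : Decomp X) (hX : PExact p X.D X.A ⊤)
    (hG : ∀ b j, PExact p X.D X.A (X.G b j)) : L2Iso (ext p X) (slashHH p X) :=
  have hsurj : LinearMap.range (extToSlash p (X := X)) = ⊤ := by
    refine eq_top_iff.mpr fun y _ => ?_
    rw [show y = ∑ i : Fin (p - 1), LinearMap.single k (fun j : Fin (p - 1) => SlashPiece p X.D j) i
      (y i) from (Finset.univ_sum_single _).symm]
    refine Submodule.sum_mem _ fun j _ => ?_
    refine slash_ind (P := fun z => LinearMap.single k (fun j : Fin (p - 1) => SlashPiece p X.D j) j z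
      ∈ LinearMap.range (extToSlash p (X := X))) (fun v hv => ?_) (y j)
    have hd : ∀ d ∈ P.F, ∃ hd : P.π d v ∈ LinearMap.ker (X.D ^ ((j : ℕ) + 1)),
        LinearMap.single k (fun j : Fin (p - 1) => SlashPiece p X.D j) j (slashCls p X.D j _ hd)
          ∈ LinearMap.range (extToSlash p (X := X)) := fun d _ => by
      have hd : P.π d v ∈ LinearMap.ker (X.D ^ ((j : ℕ) + 1)) := by
        rw [LinearMap.mem_ker] at hv ⊢
        rw [← P.π_D, hv, map_zero]
      obtain ⟨x, hx, -⟩ := exists_extToSlash_single p hp ⊤ hX (fun _ _ => trivial) d j _ hd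
        (P.πA d v) trivial
      exact ⟨hd, x, hx⟩
    let Φ : LinearMap.ker (X.D ^ ((j : ℕ) + 1)) →ₗ[k] Slash p X.D :=
      LinearMap.single k (fun j : Fin (p - 1) => SlashPiece p X.D j) j ∘ₗ Submodule.mkQ _
    have hs : (⟨v, hv⟩ : LinearMap.ker (X.D ^ ((j : ℕ) + 1)))
        = ∑ d ∈ P.F.attach, ⟨P.π d.1 v, (hd d.1 d.2).1⟩ := by
      refine Subtype.ext ?_
      rw [AddSubmonoidClass.coe_finsetSum, Finset.sum_attach P.F fun d => P.π d v]
      exact (P.sum v).symm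
    change Φ ⟨v, hv⟩ ∈ _
    rw [hs, map_sum]
    exact Submodule.sum_mem _ fun d _ => (hd d.1 d.2).2
  have hpre : ∀ b j y, y ∈ (slashHH p X).G b j →
      y ∈ ((ext p X).G b j).map (extToSlash p (X := X)) := by
    intro b j y hy
    refine (iSup_le fun d y hy => ?_ : (slashHH p X).G b j ≤ _) hy
    rw [show y = ∑ i : Fin (p - 1), LinearMap.single k (fun j : Fin (p - 1) => SlashPiece p X.D j) i
      (y i) from (Finset.univ_sum_single _).symm]
    refine Submodule.sum_mem _ fun i _ => ?_
    obtain ⟨v, hv, hS, h⟩ := mem_slashGr.mp hy i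
    obtain ⟨x, hx, hxG⟩ := exists_extToSlash_single p hp _ (hG b (j - hochShift p b d))
      (X.DG b _) d i v hv hS.1 hS.2
    exact ⟨x, hxG b j rfl, by rw [hx, h]⟩
  have hinj := extToSlash_injective p hp P hX
  { e := LinearEquiv.ofBijective (extToSlash p) ⟨hinj, LinearMap.range_eq_top.mp hsurj⟩
    eD := extToSlash_D p
    eQ := extToSlash_Q p
    eG := extToSlash_G p
    eG' := fun b j y hy => by
      obtain ⟨x, hx, rfl⟩ := hpre b j y hy
      have : (LinearEquiv.ofBijective (extToSlash p (X := X))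
        ⟨hinj, LinearMap.range_eq_top.mp hsurj⟩).symm (extToSlash p x) = x :=
        LinearEquiv.ofBijective_symm_apply_apply _ x (h := ⟨hinj, LinearMap.range_eq_top.mp hsurj⟩)
      rw [this]
      exact hx }

end Bijective

end L1
end PHHH

/-! ### The p-extended Koszul complex -/

namespace PHHH
open MvPolynomial (X)
variable {k : Type u} [Field k]

section KosF

variable {V : Type*} [AddCommGroup V] [Module k V] {n : ℕ}

/-- The differential in the `i`-th direction of the `p`-extended Koszul complex of a family of
endomorphisms. -/
def kosFi (p : ℕ) (f : Fin n → Module.End k V) (i : Fin n) :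
    Module.End k ((Fin n → Fin p) → V) :=
  LinearMap.pi fun a =>
    if h : (a i : ℕ) + 1 < p then
      (if (a i : ℕ) = 0 then f i else 1 : Module.End k V).comp
        (LinearMap.proj (Function.update a i ⟨(a i : ℕ) + 1, h⟩))
    else 0

/-- The `p`-extended Koszul complex of a family of endomorphisms. -/
def kosF (p : ℕ) (f : Fin n → Module.End k V) : Module.End k ((Fin n → Fin p) → V) :=
  ∑ i, kosFi p f i

lemma kosFi_apply (p : ℕ) (f : Fin n → Module.End k V) (i : Fin n) (w : (Fin n → Fin p) → V)
    (a : Fin n → Fin p) : kosFi p f i w a = if h : (a i : ℕ) + 1 < p then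
      (if (a i : ℕ) = 0 then f i else 1 : Module.End k V)
        (w (Function.update a i ⟨(a i : ℕ) + 1, h⟩)) else 0 := by
  change (if h : (a i : ℕ) + 1 < p then
      (if (a i : ℕ) = 0 then f i else 1 : Module.End k V).comp
        (LinearMap.proj (Function.update a i ⟨(a i : ℕ) + 1, h⟩))
    else 0 : ((Fin n → Fin p) → V) →ₗ[k] V) w = _
  split_ifs <;> rfl

lemma kosF_apply (p : ℕ) (f : Fin n → Module.End k V) (w : (Fin n → Fin p) → V)
    (a : Fin n → Fin p) : kosF p f w a = ∑ i, kosFi p f i w a := by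
  rw [kosF, LinearMap.sum_apply, Finset.sum_apply]

lemma kosF_map {W : Type*} [AddCommGroup W] [Module k W] (p : ℕ) (f : Fin n → Module.End k V)
    (g : Fin n → Module.End k W) (φ : V →ₗ[k] W) (h : ∀ i x, φ (f i x) = g i (φ x))
    (w : (Fin n → Fin p) → V) :
    (φ.compLeft (Fin n → Fin p)) (kosF p f w) = kosF p g (φ.compLeft _ w) := by
  funext a
  rw [kosF_apply, LinearMap.compLeft_apply, Function.comp_apply, kosF_apply, map_sum]
  refine Finset.sum_congr rfl fun i _ => ?_
  rw [kosFi_apply, kosFi_apply]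
  by_cases h1 : (a i : ℕ) + 1 < p
  · rw [dif_pos h1, dif_pos h1]
    by_cases h0 : (a i : ℕ) = 0
    · rw [if_pos h0, if_pos h0, h]; rfl
    · rw [if_neg h0, if_neg h0]; rfl
  · rw [dif_neg h1, dif_neg h1, map_zero]

variable (k V n) in
/-- The last coordinate of an index is made the first argument. -/
def snocE (p : ℕ) : ((Fin (n + 1) → Fin p) → V) ≃ₗ[k] (Fin p → ((Fin n → Fin p) → V)) where
  toFun w s a := w (Fin.snoc (α := fun _ => Fin p) a s)
  map_add' _ _ := rfl
  map_smul' _ _ := rfl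
  invFun w a := w (a (Fin.last n)) (Fin.init a)
  left_inv w := by
    funext a
    exact congrArg w (Fin.snoc_init_self a)
  right_inv w := by
    funext s a
    change w (Fin.snoc (α := fun _ => Fin p) a s (Fin.last n))
      (Fin.init (Fin.snoc (α := fun _ => Fin p) a s)) = _
    rw [Fin.snoc_last, Fin.init_snoc]

lemma snocE_apply (p : ℕ) (w : (Fin (n + 1) → Fin p) → V) (s : Fin p) (a : Fin n → Fin p) :
    snocE k V n p w s a = w (Fin.snoc (α := fun _ => Fin p) a s) := rfl

/-- The Koszul complex of `n + 1` endomorphisms is the tensor product of the one of the first `n` with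
a single Koszul factor. -/
lemma snocE_kosF (p : ℕ) (f : Fin (n + 1) → Module.End k V) (w : (Fin (n + 1) → Fin p) → V) :
    snocE k V n p (kosF p f w) = stepD p ((f (Fin.last n)).compLeft _)
      (kosF p fun i => f i.castSucc) (snocE k V n p w) := by
  funext s a
  rw [snocE_apply, kosF_apply, Fin.sum_univ_castSucc, stepD_apply, Pi.add_apply, kosF_apply]
  refine congrArg₂ _ (Finset.sum_congr rfl fun i _ => ?_) ?_
  · rw [kosFi_apply, kosFi_apply]
    simp only [Fin.snoc_castSucc, snocE_apply, Fin.snoc_update]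
  · rw [kosFi_apply]
    simp only [Fin.snoc_last, Fin.update_snoc_last]
    by_cases h : (s : ℕ) + 1 < p
    · rw [dif_pos h, dif_pos h]
      split_ifs <;> rfl
    · rw [dif_neg h, dif_neg h]; rfl

lemma kosF_pow (p : ℕ) [Fact p.Prime] [CharP k p] (f : Fin n → Module.End k V)
    (hf : ∀ i j x, f i (f j x) = f j (f i x)) : kosF p f ^ p = 0 := by
  induction n with
  | zero =>
    rw [kosF, Finset.univ_eq_empty, Finset.sum_empty, zero_pow (Fact.out : p.Prime).ne_zero]
  | succ n ih =>
    refine LinearMap.ext fun w => (snocE k V n p).injective ?_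
    have h := pow_map (snocE k V n p).toLinearMap (snocE_kosF p f) p w
    refine h.trans ?_
    rw [stepD_pow p _ _ (kosF_map p _ _ _ fun i x => hf _ _ _) (ih _ fun i j => hf _ _)]
    exact (map_zero (snocE k V n p)).symm

/-- The elements supported in Hochschild degree `d`. -/
def kosA (V : Type*) [AddCommGroup V] [Module k V] (n p : ℕ) (d : ℤ) :
    Submodule k ((Fin n → Fin p) → V) :=
  Submodule.pi Set.univ fun a : Fin n → Fin p => if ∑ s, ((a s : ℕ) : ℤ) = d then ⊤ else ⊥

lemma mem_kosA {p : ℕ} {d : ℤ} {w : (Fin n → Fin p) → V} :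
    w ∈ kosA (k := k) V n p d ↔ ∀ a, ∑ s, ((a s : ℕ) : ℤ) ≠ d → w a = 0 := by
  constructor
  · intro h a ha
    have : w a ∈ (if ∑ s, ((a s : ℕ) : ℤ) = d then ⊤ else ⊥ : Submodule k V) := h a trivial
    rwa [if_neg ha, Submodule.mem_bot] at this
  · intro h a _
    by_cases ha : ∑ s, ((a s : ℕ) : ℤ) = d
    · simp only [if_pos ha]; trivial
    · simp only [if_neg ha]; exact h a ha

/-- The elements of degree `j`, where each generator of nonzero Hochschild degree of a factor has
degree `σ`. -/
def kosG (p : ℕ) (Gr : ℤ → Submodule k V) (σ : ℤ) (j : ℤ) : Submodule k ((Fin n → Fin p) → V) :=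
  Submodule.pi Set.univ fun a : Fin n → Fin p => Gr (j - ∑ s, if (a s : ℕ) = 0 then 0 else σ)

lemma mem_kosG {p : ℕ} {Gr : ℤ → Submodule k V} {σ j : ℤ} {w : (Fin n → Fin p) → V} :
    w ∈ kosG p Gr σ j ↔ ∀ a, w a ∈ Gr (j - ∑ s, if (a s : ℕ) = 0 then 0 else σ) :=
  ⟨fun h a => h a trivial, fun h a _ => h a⟩

lemma sum_update (p : ℕ) (g : Fin p → ℤ) (a : Fin n → Fin p) (i : Fin n) (s : Fin p) :
    ∑ j, g (Function.update a i s j) = ∑ j, g (a j) + (g s - g (a i)) := by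
  have h : (fun j => g (Function.update a i s j)) = Function.update (fun j => g (a j)) i (g s) := by
    funext j
    by_cases h : j = i
    · subst h; simp
    · simp [Function.update_of_ne h]
  rw [h, Finset.sum_update_of_mem (Finset.mem_univ i), ← Finset.add_sum_erase _ _ (Finset.mem_univ i),
    Finset.sdiff_singleton_eq_erase]
  ring

lemma kosF_A {p : ℕ} (f : Fin n → Module.End k V) (d : ℤ) (w : (Fin n → Fin p) → V)
    (hw : w ∈ kosA (k := k) V n p d) : kosF p f w ∈ kosA (k := k) V n p (d - 1) := by
  rw [mem_kosA] at hw ⊢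
  intro a ha
  rw [kosF_apply]
  refine Finset.sum_eq_zero fun i _ => ?_
  rw [kosFi_apply]
  split_ifs with h
  · rw [hw, map_zero]
    rw [sum_update p fun s => ((s : ℕ) : ℤ)]
    push_cast
    omega
  · rw [hw, map_zero]
    rw [sum_update p fun s => ((s : ℕ) : ℤ)]
    push_cast
    omega
  · rfl

lemma kosF_G {p : ℕ} {f : Fin n → Module.End k V} {Gr : ℤ → Submodule k V} {σ : ℤ}
    (hf : ∀ i j x, x ∈ Gr j → f i x ∈ Gr (j + σ)) (j : ℤ) (w : (Fin n → Fin p) → V)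
    (hw : w ∈ kosG p Gr σ j) : kosF p f w ∈ kosG p Gr σ j := by
  rw [mem_kosG] at hw ⊢
  intro a
  rw [kosF_apply]
  refine Submodule.sum_mem _ fun i _ => ?_
  rw [kosFi_apply]
  split_ifs with h h0
  · refine mem_of_eq (hf _ _ _ (hw _)) ?_
    rw [sum_update p fun s => if (s : ℕ) = 0 then 0 else σ, if_neg (by simp), if_pos h0]
    ring
  · refine mem_of_eq (hw _) ?_
    rw [sum_update p fun s => if (s : ℕ) = 0 then 0 else σ, if_neg (by simp), if_neg h0]
    ring
  · exact Submodule.zero_mem _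

lemma snocE_A {p : ℕ} {d : ℤ} {w : (Fin (n + 1) → Fin p) → V} :
    w ∈ kosA (k := k) V (n + 1) p d ↔ snocE k V n p w ∈
      (Submodule.pi Set.univ fun s : Fin p => kosA (k := k) V n p (d - (s : ℕ))) := by
  constructor
  · intro h s _
    refine mem_kosA.mpr fun a ha => mem_kosA.mp h _ ?_
    rw [Fin.sum_univ_castSucc]
    simp only [Fin.snoc_castSucc, Fin.snoc_last]
    omega
  · refine fun h => mem_kosA.mpr fun a ha => ?_
    have := mem_kosA.mp (h (a (Fin.last n)) trivial) (Fin.init a) (by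
      rw [Fin.sum_univ_castSucc] at ha
      simp only [Fin.init]
      omega)
    rwa [snocE_apply, Fin.snoc_init_self] at this

lemma snocE_G {p : ℕ} {Gr : ℤ → Submodule k V} {σ j : ℤ} {w : (Fin (n + 1) → Fin p) → V} :
    w ∈ kosG p Gr σ j ↔ snocE k V n p w ∈ (Submodule.pi Set.univ fun s : Fin p =>
      kosG (n := n) p Gr σ (j - if (s : ℕ) = 0 then 0 else σ)) := by
  constructor
  · intro h s _
    refine mem_kosG.mpr fun a => mem_of_eq (mem_kosG.mp h _) ?_
    rw [Fin.sum_univ_castSucc]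
    simp only [Fin.snoc_castSucc, Fin.snoc_last]
    ring
  · refine fun h => mem_kosG.mpr fun a => ?_
    have := mem_kosG.mp (h (a (Fin.last n)) trivial) (Fin.init a)
    rw [snocE_apply, Fin.snoc_init_self] at this
    refine mem_of_eq this ?_
    rw [Fin.sum_univ_castSucc]
    change j - _ - (∑ s : Fin n, if ((a s.castSucc : Fin p) : ℕ) = 0 then 0 else σ) = _
    ring

/-- The `p`-extended Koszul complex is exact in the sense of `PExact`. -/
lemma kosF_exact {p : ℕ} [Fact p.Prime] [CharP k p] (hodd : Odd p) {f : Fin n → Module.End k V}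
    (hc : ∀ i j x, f i (f j x) = f j (f i x)) {Gr : ℤ → Submodule k V} {σ : ℤ}
    (hf : ∀ i j x, x ∈ Gr j → f i x ∈ Gr (j + σ)) (j : ℤ) :
    PExact p (kosF p f) (kosA V n p) (kosG p Gr σ j) := by
  induction n generalizing j with
  | zero =>
    intro d s v hs hsp hd hds hA hS hv
    have : v = 0 := funext fun a => mem_kosA.mp hA a (by
      rintro rfl
      exact hd (by simp))
    subst this
    exact ⟨0, Submodule.zero_mem _, Submodule.zero_mem _, map_zero _⟩
  | succ n ih =>
    have h := PExact.step hodd (φ := (f (Fin.last n)).compLeft (Fin n → Fin p))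
      (D := kosF p fun i => f i.castSucc) (A := kosA V n p) (S := kosG p Gr σ j)
      (S' := kosG p Gr σ (j - σ)) (kosF_map p _ _ _ fun i x => hc _ _ _)
      (kosF_pow p _ fun i j x => hc _ _ _) (kosF_A _)
      (fun d x hx => mem_kosA.mpr fun a ha => by
        rw [LinearMap.compLeft_apply, Function.comp_apply, mem_kosA.mp hx a ha, map_zero])
      (kosF_G (fun i => hf _) _) (kosF_G (fun i => hf _) _)
      (fun x hx => mem_kosG.mpr fun a => mem_of_eq (hf _ _ _ (mem_kosG.mp hx a)) (by ring))
      (ih (fun _ _ => hc _ _) (fun _ => hf _) j) (ih (fun _ _ => hc _ _) (fun _ => hf _) (j - σ))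
    have e : ∀ w : (Fin (n + 1) → Fin p) → V, w ∈ kosG p Gr σ j ↔ snocE k V n p w ∈
        (Submodule.pi Set.univ fun s : Fin p =>
          if (s : ℕ) = 0 then kosG (n := n) p Gr σ j else kosG p Gr σ (j - σ)) := by
      intro w
      rw [snocE_G]
      refine iff_of_eq (congrArg (fun B : Fin p → Submodule k _ =>
        snocE k V n p w ∈ Submodule.pi Set.univ B) (funext fun s => ?_))
      split_ifs
      · rw [sub_zero]
      · rfl
    intro d s v hs hsp hd hds hA hS hv
    obtain ⟨w, h1, h2, h3⟩ := h d s (snocE k V n p v) hs hsp hd hds (snocE_A.mp hA) ((e _).mp hS)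
      (by
        have := pow_map (snocE k V n p).toLinearMap (snocE_kosF p f) s v
        rw [hv] at this
        exact this.symm.trans (map_zero _))
    obtain ⟨w, rfl⟩ := (snocE k V n p).surjective w
    refine ⟨w, snocE_A.mpr h1, (e _).mpr h2, (snocE k V n p).injective ?_⟩
    exact (pow_map (snocE k V n p).toLinearMap (snocE_kosF p f) _ w).trans h3

end KosF

end PHHH

/-! ### The Koszul complex of a bimodule -/

namespace PHHH
open MvPolynomial (X)
variable {k : Type u} [Field k]

/-- A `p`-complex of bigraded `(R_n, R_n) # H_q`-modules, given by the actions of the variables; in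
comparison with `PBimod`, homogeneity is required, and the nilpotency of the operators is not. -/
structure KMod (k : Type u) [Field k] (n : ℕ) where
  V : Type u
  [addCommGroup : AddCommGroup V]
  [module : Module k V]
  l : Fin n → Module.End k V
  r : Fin n → Module.End k V
  dq : Module.End k V
  dt : Module.End k V
  Gr : Bool → ℤ → Submodule k V
  ll : ∀ i j x, l i (l j x) = l j (l i x)
  rr : ∀ i j x, r i (r j x) = r j (r i x)
  lr : ∀ i j x, l i (r j x) = r j (l i x)
  ql : ∀ i x, dq (l i x) = l i (dq x) + l i (l i x)
  qr : ∀ i x, dq (r i x) = r i (dq x) + r i (r i x)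
  tl : ∀ i x, dt (l i x) = l i (dt x)
  tr : ∀ i x, dt (r i x) = r i (dt x)
  tq : ∀ x, dt (dq x) = dq (dt x)
  lG : ∀ i b j x, x ∈ Gr b j → l i x ∈ Gr b (j + L1.qsh 2 b)
  rG : ∀ i b j x, x ∈ Gr b j → r i x ∈ Gr b (j + L1.qsh 2 b)
  tG : ∀ b j x, x ∈ Gr b j → dt x ∈ Gr b (j - tau b)

attribute [instance] KMod.addCommGroup KMod.module

namespace KMod

variable {n : ℕ} (p : ℕ) (N : KMod k n)

/-- The differences of the left and right actions. -/
def diff (i : Fin n) : Module.End k N.V := N.l i - N.r i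

lemma diff_apply (i : Fin n) (x : N.V) : N.diff i x = N.l i x - N.r i x := rfl

lemma diff_comm (i j : Fin n) (x : N.V) : N.diff i (N.diff j x) = N.diff j (N.diff i x) := by
  simp only [diff_apply, map_sub, N.ll i j, N.rr i j, N.lr]
  abel

lemma diff_G (b : Bool) (i : Fin n) (j : ℤ) (x : N.V) (hx : x ∈ N.Gr b j) :
    N.diff i x ∈ N.Gr b (j + L1.qsh 2 b) :=
  Submodule.sub_mem _ (N.lG _ _ _ _ hx) (N.rG _ _ _ _ hx)

/-- The operator by which `∂_q` on the generator with index `a` is twisted. -/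
def tw (a : Fin n → Fin p) : Module.End k N.V :=
  ∑ i, if (a i : ℕ) = 0 then 0 else N.l i + N.r i

variable {p} in
lemma tw_apply (a : Fin n → Fin p) (x : N.V) :
    N.tw p a x = ∑ i, if (a i : ℕ) = 0 then 0 else N.l i x + N.r i x := by
  rw [tw, LinearMap.sum_apply]
  exact Finset.sum_congr rfl fun i _ => by split_ifs <;> rfl

variable {p} in
lemma tw_comm (a : Fin n → Fin p) (E : Module.End k N.V) (hl : ∀ i x, E (N.l i x) = N.l i (E x))
    (hr : ∀ i x, E (N.r i x) = N.r i (E x)) (x : N.V) : E (N.tw p a x) = N.tw p a (E x) := by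
  rw [tw_apply, tw_apply, map_sum]
  refine Finset.sum_congr rfl fun i _ => ?_
  split_ifs
  · exact map_zero _
  · rw [map_add, hl, hr]

variable {p} in
/-- The twist depends only on which indices vanish, and raising an index from zero adds `x ⊗ 1 + 1 ⊗ x`. -/
lemma tw_update (a : Fin n → Fin p) (i : Fin n) (s : Fin p) (hs : (s : ℕ) ≠ 0) :
    N.tw p (Function.update a i s) = N.tw p a + if (a i : ℕ) = 0 then N.l i + N.r i else 0 := by
  have h : (fun j => if ((Function.update a i s j : Fin p) : ℕ) = 0 then 0 else N.l j + N.r j)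
      = Function.update (fun j => if (a j : ℕ) = 0 then 0 else N.l j + N.r j) i (N.l i + N.r i) := by
    funext j
    by_cases h : j = i
    · subst h; simp [hs]
    · simp [Function.update_of_ne h]
  rw [tw, h, Finset.sum_update_of_mem (Finset.mem_univ i), tw,
    ← Finset.add_sum_erase _ _ (Finset.mem_univ i), Finset.sdiff_singleton_eq_erase]
  split_ifs <;> abel

/-- The Leibniz rule for the difference of the actions: `∂_q (x ⊗ 1 - 1 ⊗ x)` is the product with
`x ⊗ 1 + 1 ⊗ x`. -/
lemma dq_diff (i : Fin n) (x : N.V) :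
    N.dq (N.diff i x) = N.diff i (N.dq x) + N.diff i (N.l i x + N.r i x) := by
  simp only [diff_apply, map_sub, map_add, N.ql, N.qr, N.lr]
  abel

/-- The total `∂_q` on the Koszul complex. -/
def kosQL : Module.End k ((Fin n → Fin p) → N.V) :=
  LinearMap.pi fun a => (N.dq + N.tw p a).comp (LinearMap.proj a)

lemma kosQL_apply (w : (Fin n → Fin p) → N.V) (a : Fin n → Fin p) :
    N.kosQL p w a = N.dq (w a) + N.tw p a (w a) := rfl

/-- The Koszul differential commutes with `∂_q`: the twist of the generators of nonzero degree
compensates the defect `dq_diff` of the bottom differential. -/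
lemma kosF_kosQL (w : (Fin n → Fin p) → N.V) :
    kosF p N.diff (N.kosQL p w) = N.kosQL p (kosF p N.diff w) := by
  funext a
  rw [kosF_apply, kosQL_apply, kosF_apply, map_sum, map_sum, ← Finset.sum_add_distrib]
  refine Finset.sum_congr rfl fun i _ => ?_
  have hc : ∀ x, N.diff i (N.tw p a x) = N.tw p a (N.diff i x) := N.tw_comm a _
    (fun j x => by simp only [diff_apply, map_sub, N.ll i j, N.lr])
    (fun j x => by simp only [diff_apply, map_sub, N.rr i j, N.lr])
  rw [kosFi_apply, kosFi_apply]
  by_cases h : (a i : ℕ) + 1 < p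
  · rw [dif_pos h, dif_pos h, kosQL_apply, tw_update _ _ _ _ (Nat.succ_ne_zero _)]
    by_cases h0 : (a i : ℕ) = 0
    · simp only [if_pos h0]
      rw [dq_diff, LinearMap.add_apply, map_add, map_add, hc, LinearMap.add_apply]
      abel
    · simp only [if_neg h0, add_zero]
      rfl
  · rw [dif_neg h, dif_neg h, map_zero, map_zero, add_zero]

/-- The Koszul complex computing the `p`-Hochschild homology, with all its structure. -/
abbrev kosL : L1 k where
  V := (Fin n → Fin p) → N.V
  D := kosF p N.diff
  T := N.dt.compLeft _
  Q := N.kosQL p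
  DT w := (kosF_map p _ _ N.dt (fun i x => by simp only [diff_apply, map_sub, N.tl, N.tr]) w).symm
  DQ := N.kosF_kosQL p
  TQ w := funext fun a => by
    change N.dt (N.dq (w a) + N.tw p a (w a)) = N.dq (N.dt (w a)) + N.tw p a (N.dt (w a))
    rw [map_add, N.tq, N.tw_comm a N.dt N.tl N.tr]
  A := kosA N.V n p
  G b := kosG p (N.Gr b) (L1.qsh 2 b)
  DA := kosF_A _
  TA d x hx := mem_kosA.mpr fun a ha => by
    rw [LinearMap.compLeft_apply, Function.comp_apply, mem_kosA.mp hx a ha, map_zero]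
  QA d x hx := mem_kosA.mpr fun a ha => by
    rw [kosQL_apply, mem_kosA.mp hx a ha, map_zero, map_zero, add_zero]
  DG b := kosF_G (N.diff_G b)
  TG b j x hx := mem_kosG.mpr fun a => mem_of_eq (N.tG _ _ _ (mem_kosG.mp hx a)) (by ring)

lemma kosL_pow [Fact p.Prime] [CharP k p] : (N.kosL p).D ^ p = 0 := kosF_pow p _ N.diff_comm

/-- The decomposition of the Koszul complex according to the Hochschild degree. -/
noncomputable def kosDecomp : (N.kosL p).Decomp where
  F := by classical exact Finset.univ.image fun a : Fin n → Fin p => ∑ s, ((a s : ℕ) : ℤ)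
  π d := LinearMap.pi fun a => if ∑ s, ((a s : ℕ) : ℤ) = d then LinearMap.proj a else 0
  πA d w := mem_kosA.mpr fun a ha => by rw [LinearMap.pi_apply, if_neg ha]; rfl
  sum w := by
    classical
    funext a
    rw [Finset.sum_apply]
    rw [Finset.sum_eq_single (∑ s, ((a s : ℕ) : ℤ))]
    · rw [LinearMap.pi_apply, if_pos rfl]; rfl
    · intro d _ hd
      rw [LinearMap.pi_apply, if_neg hd.symm]; rfl
    · intro h
      exact absurd (Finset.mem_image_of_mem _ (Finset.mem_univ a)) h
  self d w hw := funext fun a => by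
    rw [LinearMap.pi_apply]
    split_ifs with h
    · rfl
    · exact (mem_kosA.mp hw a h).symm
  ne d e w hw hne := funext fun a => by
    rw [LinearMap.pi_apply]
    split_ifs with h
    · exact mem_kosA.mp hw a (fun h' => hne (h.symm.trans h'))
    · rfl

/-- The slash homology of the Koszul complex is the `p`-extension of its contracted homology. -/
noncomputable def kosExtIso [Fact p.Prime] [CharP k p] (hp : 2 < p) (hodd : Odd p) :
    L2Iso (L1.ext p (N.kosL p)) (L1.slashHH p (N.kosL p)) :=
  L1.extIso p hp (N.kosDecomp p)
    (by
      have h := kosF_exact (p := p) hodd N.diff_comm (Gr := fun _ => (⊤ : Submodule k N.V)) (σ := 0)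
        (fun _ _ _ _ => trivial) 0
      have e : kosG (n := n) p (fun _ => (⊤ : Submodule k N.V)) 0 0 = ⊤ :=
        eq_top_iff.mpr fun w _ => mem_kosG.mpr fun _ => trivial
      rw [e] at h
      exact h)
    (fun b j => kosF_exact hodd N.diff_comm (N.diff_G b) j)

/-- Homomorphisms of `p`-complexes of bigraded bimodules, without compatibility with `∂_q`. -/
structure Hom (N N' : KMod k n) where
  f : N.V →ₗ[k] N'.V
  fl : ∀ i x, f (N.l i x) = N'.l i (f x)
  fr : ∀ i x, f (N.r i x) = N'.r i (f x)
  ft : ∀ x, f (N.dt x) = N'.dt (f x)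
  fG : ∀ b j x, x ∈ N.Gr b j → f x ∈ N'.Gr b j

lemma kosA_compLeft {V W : Type*} [AddCommGroup V] [Module k V] [AddCommGroup W] [Module k W]
    (f : V →ₗ[k] W) (d : ℤ) (x : (Fin n → Fin p) → V) (hx : x ∈ kosA (k := k) V n p d) :
    f.compLeft _ x ∈ kosA (k := k) W n p d := mem_kosA.mpr fun a ha => by
  rw [LinearMap.compLeft_apply, Function.comp_apply, mem_kosA.mp hx a ha, map_zero]

lemma kosG_compLeft {V W : Type*} [AddCommGroup V] [Module k V] [AddCommGroup W] [Module k W]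
    {A : ℤ → Submodule k V} {B : ℤ → Submodule k W}
    (f : V →ₗ[k] W) (e : ℤ) (h : ∀ j x, x ∈ A j → f x ∈ B (j + e)) (σ j : ℤ)
    (x : (Fin n → Fin p) → V) (hx : x ∈ kosG p A σ j) :
    f.compLeft _ x ∈ kosG p B σ (j + e) :=
  mem_kosG.mpr fun a => mem_of_eq (h _ _ (mem_kosG.mp hx a)) (by ring)

variable {N} {N' : KMod k n}

/-- The map of Koszul complexes induced by a homomorphism. -/
abbrev Hom.kos (g : Hom N N') : L1Map (N.kosL p) (N'.kosL p) where
  f := g.f.compLeft _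
  fD := kosF_map p _ _ g.f fun i x => by rw [diff_apply, map_sub, g.fl, g.fr]; rfl
  fT w := funext fun a => g.ft _
  fA := kosA_compLeft p g.f
  fG b j x hx := mem_of_eq (kosG_compLeft p g.f 0
    (fun j x hx => by rw [add_zero]; exact g.fG b j x hx) _ _ x hx) (add_zero j)

lemma Hom.kos_Q (g : Hom N N') (hq : ∀ x, g.f (N.dq x) = N'.dq (g.f x)) (w : (N.kosL p).V) :
    g.kos p ((N.kosL p).Q w) = (N'.kosL p).Q (g.kos p w) := by
  funext a
  change g.f (N.dq (w a) + N.tw p a (w a)) = N'.dq (g.f (w a)) + N'.tw p a (g.f (w a))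
  rw [map_add, hq, tw_apply, tw_apply, map_sum]
  refine congrArg _ (Finset.sum_congr rfl fun i _ => ?_)
  split_ifs
  · exact map_zero _
  · rw [map_add, g.fl, g.fr]

end KMod

end PHHH

/-! ### Koszul complexes and rank factorizations of the last variable -/

namespace PHHH
open MvPolynomial (X)
variable {k : Type u} [Field k]

/-- A rank factorization of the difference `φ` of the two actions of the last variable: `φ` is the
composite of a split surjection `p1 : B → C` with kernel `Z` and of a split injection `c0 : C → B`
with cokernel `R`. The maps `j : Z → B`, `π : B → R` and the retraction `u0` of `j` are compatible
with the remaining actions. -/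
structure RankData {n : ℕ} (B : KMod k (n + 1)) (Z R : KMod k n) where
  C : Type u
  [addCommGroup : AddCommGroup C]
  [module : Module k C]
  fC : Fin n → Module.End k C
  j : Z.V →ₗ[k] B.V
  u0 : B.V →ₗ[k] Z.V
  π : B.V →ₗ[k] R.V
  sec : R.V →ₗ[k] B.V
  c0 : C →ₗ[k] B.V
  c1 : C →ₗ[k] B.V
  p0 : B.V →ₗ[k] C
  p1 : B.V →ₗ[k] C
  jl : ∀ i x, j (Z.l i x) = B.l i.castSucc (j x)
  jr : ∀ i x, j (Z.r i x) = B.r i.castSucc (j x)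
  jt : ∀ x, j (Z.dt x) = B.dt (j x)
  jG : ∀ b i x, x ∈ Z.Gr b i → j x ∈ B.Gr b i
  ud : ∀ i x, u0 (B.diff i.castSucc x) = Z.diff i (u0 x)
  uG : ∀ b i x, x ∈ B.Gr b i → u0 x ∈ Z.Gr b i
  πl : ∀ i x, π (B.l i.castSucc x) = R.l i (π x)
  πr : ∀ i x, π (B.r i.castSucc x) = R.r i (π x)
  πt : ∀ x, π (B.dt x) = R.dt (π x)
  πG : ∀ b i x, x ∈ B.Gr b i → π x ∈ R.Gr b i
  secG : ∀ b i x, x ∈ R.Gr b i → sec x ∈ B.Gr b i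
  c0f : ∀ i x, c0 (fC i x) = B.diff i.castSucc (c0 x)
  c1f : ∀ i x, c1 (fC i x) = B.diff i.castSucc (c1 x)
  cG : ∀ b i x, x ∈ B.Gr b i → c1 (p0 x) ∈ B.Gr b (i - L1.qsh 2 b)
  φ : ∀ x, B.diff (Fin.last n) x = c0 (p1 x)
  uj : ∀ x, u0 (j x) = x
  uc : ∀ x, u0 (c1 x) = 0
  pj : ∀ x, p1 (j x) = 0
  pc1 : ∀ x, p1 (c1 x) = x
  sum1 : ∀ x, j (u0 x) + c1 (p1 x) = x
  πsec : ∀ x, π (sec x) = x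
  πc : ∀ x, π (c0 x) = 0
  pc0 : ∀ x, p0 (c0 x) = x
  sum0 : ∀ x, c0 (p0 x) + sec (π x) = x

attribute [instance] RankData.addCommGroup RankData.module

namespace RankData

variable {n : ℕ} {B : KMod k (n + 1)} {Z R : KMod k n} (d : RankData B Z R) (p : ℕ) [hp : Fact p.Prime]

lemma snoc_eq {V : Type*} [AddCommGroup V] [Module k V] {w w' : (Fin (n + 1) → Fin p) → V}
    (h : ∀ s a, snocE k V n p w s a = snocE k V n p w' s a) : w = w' :=
  (snocE k V n p).injective (funext fun s => funext fun a => h s a)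

lemma kosF_snoc {V : Type*} [AddCommGroup V] [Module k V] (f : Fin (n + 1) → Module.End k V)
    (w : (Fin (n + 1) → Fin p) → V) (s : Fin p) (a : Fin n → Fin p) :
    snocE k V n p (kosF p f w) s a = kosF p (fun i => f i.castSucc) (snocE k V n p w s) a
      + if h : (s : ℕ) + 1 < p then (if (s : ℕ) = 0 then f (Fin.last n) (snocE k V n p w ⟨s + 1, h⟩ a)
        else snocE k V n p w ⟨s + 1, h⟩ a) else 0 := by
  rw [snocE_kosF, stepD_apply, Pi.add_apply]
  congr 1
  split_ifs <;> rfl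

/-- The inclusion of the suspension of the kernel of `φ`. -/
def ι : (L1.susp p (Z.kosL p)).V →ₗ[k] (B.kosL p).V :=
  (snocE k B.V n p).symm.toLinearMap ∘ₗ LinearMap.pi fun s : Fin p =>
    if h : (s : ℕ) = 0 then 0 else d.j.compLeft (Fin n → Fin p) ∘ₗ
      LinearMap.proj (R := k) (φ := fun _ : Fin (p - 1) => (Fin n → Fin p) → Z.V) ⟨s - 1, by omega⟩

lemma ι_apply (z : (L1.susp p (Z.kosL p)).V) (s : Fin p) (a : Fin n → Fin p) :
    snocE k B.V n p (d.ι p z) s a = if h : (s : ℕ) = 0 then 0 else d.j (z ⟨s - 1, by omega⟩ a) := by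
  simp only [ι, LinearMap.comp_apply, LinearEquiv.coe_coe, LinearEquiv.apply_symm_apply,
    LinearMap.pi_apply]
  split_ifs <;> rfl

/-- The retraction of `RankData.ι`. -/
def u : (B.kosL p).V →ₗ[k] (L1.susp p (Z.kosL p)).V :=
  LinearMap.pi fun s : Fin (p - 1) => d.u0.compLeft (Fin n → Fin p) ∘ₗ
    LinearMap.proj (⟨s + 1, by omega⟩ : Fin p) ∘ₗ (snocE k B.V n p).toLinearMap

lemma u_apply (w : (B.kosL p).V) (s : Fin (p - 1)) (a : Fin n → Fin p) :
    d.u p w s a = d.u0 (snocE k B.V n p w ⟨s + 1, by omega⟩ a) := rfl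

/-- The projection to the cokernel of `φ`. -/
def f : (B.kosL p).V →ₗ[k] (R.kosL p).V :=
  d.π.compLeft (Fin n → Fin p) ∘ₗ LinearMap.proj (⟨0, hp.out.pos⟩ : Fin p) ∘ₗ (snocE k B.V n p).toLinearMap

lemma f_apply (w : (B.kosL p).V) (a : Fin n → Fin p) :
    d.f p w a = d.π (snocE k B.V n p w ⟨0, hp.out.pos⟩ a) := rfl

/-- The section of `RankData.f`. -/
def w : (R.kosL p).V →ₗ[k] (B.kosL p).V :=
  (snocE k B.V n p).symm.toLinearMap ∘ₗ LinearMap.pi fun s : Fin p =>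
    if (s : ℕ) = 0 then d.sec.compLeft (Fin n → Fin p) else 0

lemma w_apply (r : (R.kosL p).V) (s : Fin p) (a : Fin n → Fin p) :
    snocE k B.V n p (d.w p r) s a = if (s : ℕ) = 0 then d.sec (r a) else 0 := by
  simp only [w, LinearMap.comp_apply, LinearEquiv.coe_coe, LinearEquiv.apply_symm_apply,
    LinearMap.pi_apply]
  split_ifs <;> rfl

/-- The coordinates with respect to `C`. -/
def proj : (B.kosL p).V →ₗ[k] (Fin p → (Fin n → Fin p) → d.C) :=
  LinearMap.pi fun s : Fin p => (if (s : ℕ) = 0 then d.p0 else d.p1).compLeft (Fin n → Fin p) ∘ₗ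
    LinearMap.proj s ∘ₗ (snocE k B.V n p).toLinearMap

lemma proj_apply (w : (B.kosL p).V) (s : Fin p) (a : Fin n → Fin p) : d.proj p w s a
    = if (s : ℕ) = 0 then d.p0 (snocE k B.V n p w s a) else d.p1 (snocE k B.V n p w s a) := by
  change (if (s : ℕ) = 0 then d.p0 else d.p1) (snocE k B.V n p w s a) = _
  split_ifs <;> rfl

/-- The inclusion of the chain with terms `C`. -/
def inc : (Fin p → (Fin n → Fin p) → d.C) →ₗ[k] (B.kosL p).V :=
  (snocE k B.V n p).symm.toLinearMap ∘ₗ LinearMap.pi fun s : Fin p =>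
    (if (s : ℕ) = 0 then d.c0 else d.c1).compLeft (Fin n → Fin p) ∘ₗ LinearMap.proj s

lemma inc_apply (c : Fin p → (Fin n → Fin p) → d.C) (s : Fin p) (a : Fin n → Fin p) :
    snocE k B.V n p (d.inc p c) s a = if (s : ℕ) = 0 then d.c0 (c s a) else d.c1 (c s a) := by
  simp only [inc, LinearMap.comp_apply, LinearEquiv.coe_coe, LinearEquiv.apply_symm_apply,
    LinearMap.pi_apply]
  change (if (s : ℕ) = 0 then d.c0 else d.c1) (c s a) = _
  split_ifs <;> rfl

lemma ι_eq (z : (L1.susp p (Z.kosL p)).V) (s : Fin p) : snocE k B.V n p (d.ι p z) s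
    = if h : (s : ℕ) = 0 then 0 else d.j.compLeft _ (z ⟨s - 1, by omega⟩) := by
  funext a
  rw [ι_apply]
  split_ifs <;> rfl

lemma u_eq (w : (B.kosL p).V) (s : Fin (p - 1)) :
    d.u p w s = d.u0.compLeft _ (snocE k B.V n p w ⟨s + 1, by omega⟩) := rfl

lemma f_eq (w : (B.kosL p).V) : d.f p w = d.π.compLeft _ (snocE k B.V n p w ⟨0, hp.out.pos⟩) := rfl

lemma w_eq (r : (R.kosL p).V) (s : Fin p) :
    snocE k B.V n p (d.w p r) s = if (s : ℕ) = 0 then d.sec.compLeft _ r else 0 := by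
  funext a
  rw [w_apply]
  split_ifs <;> rfl

lemma H_eq (w : (B.kosL p).V) (s : Fin p) :
    snocE k B.V n p (d.inc p (topOfBot k p _ (d.proj p w))) s = if (s : ℕ) + 1 = p then
      (d.c1 ∘ₗ d.p0).compLeft _ (snocE k B.V n p w ⟨0, hp.out.pos⟩) else 0 := by
  funext a
  have h2 := hp.out.two_le
  rw [inc_apply, topOfBot_apply]
  by_cases h : (s : ℕ) + 1 = p
  · rw [if_neg (by omega), dif_pos h, if_pos h, proj_apply, if_pos rfl]; rfl
  · rw [dif_neg h, if_neg h]
    split_ifs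
    · exact map_zero d.c0
    · exact map_zero d.c1

lemma proj_inc (c : Fin p → (Fin n → Fin p) → d.C) : d.proj p (d.inc p c) = c := by
  funext s a
  rw [proj_apply, inc_apply]
  split_ifs
  · exact d.pc0 _
  · exact d.pc1 _

/-- The common kernel of the retraction and of the projection to the cokernel is the chain on `C`. -/
lemma inc_proj (w : (B.kosL p).V) (hu : d.u p w = 0) (hf : d.f p w = 0) :
    d.inc p (d.proj p w) = w := by
  refine snoc_eq (k := k) p fun s a => ?_
  rw [inc_apply, proj_apply]
  by_cases h : (s : ℕ) = 0
  · rw [if_pos h, if_pos h]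
    have h1 := congrFun hf a
    rw [f_apply] at h1
    have h2 := d.sum0 (snocE k B.V n p w s a)
    rw [show s = ⟨0, hp.out.pos⟩ from Fin.ext h] at h2 ⊢
    rw [h1] at h2
    change _ + d.sec 0 = _ at h2
    rwa [map_zero, add_zero] at h2
  · rw [if_neg h, if_neg h]
    have h1 := congrFun (congrFun hu ⟨s - 1, by omega⟩) a
    rw [u_apply] at h1
    have h2 := d.sum1 (snocE k B.V n p w s a)
    rw [show s = ⟨(s : ℕ) - 1 + 1, by omega⟩ from Fin.ext (by simp only; omega)] at h2 ⊢
    rw [h1] at h2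
    change d.j 0 + _ = _ at h2
    rwa [map_zero, zero_add] at h2

/-- The differential of the chain with terms `C`. -/
def chainD : Module.End k (Fin p → (Fin n → Fin p) → d.C) :=
  (kosF p d.fC).compLeft (Fin p) + shDown k p ((Fin n → Fin p) → d.C)

/-- On the chain on `C` the map `φ` becomes the identity, so that this chain is contractible. -/
lemma inc_D (c : Fin p → (Fin n → Fin p) → d.C) :
    d.inc p (d.chainD p c) = kosF p B.diff (d.inc p c) := by
  refine snoc_eq (k := k) p fun s a => ?_
  rw [inc_apply, kosF_snoc]
  have e : d.chainD p c s a = kosF p d.fC (c s) a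
      + if h : (s : ℕ) + 1 < p then c ⟨s + 1, h⟩ a else 0 := by
    change kosF p d.fC (c s) a + shDown k p _ c s a = _
    rw [shDown_apply]
    congr 1
    split_ifs <;> rfl
  rw [e]
  by_cases h0 : (s : ℕ) = 0
  · have h1 : snocE k B.V n p (d.inc p c) s = d.c0.compLeft _ (c s) := funext fun a => by
      rw [inc_apply, if_pos h0]; rfl
    rw [if_pos h0, h1, ← kosF_map p d.fC _ d.c0 d.c0f, map_add]
    congr 1
    split_ifs with h
    · rw [inc_apply, if_neg (by simp), φ, d.pc1]
    · exact map_zero _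
  · have h1 : snocE k B.V n p (d.inc p c) s = d.c1.compLeft _ (c s) := funext fun a => by
      rw [inc_apply, if_neg h0]; rfl
    rw [if_neg h0, h1, ← kosF_map p d.fC _ d.c1 d.c1f, map_add]
    congr 1
    split_ifs with h
    · rw [inc_apply, if_neg (by simp)]
    · exact map_zero _

lemma tw_snoc (N : KMod k (n + 1)) (s : Fin p) (a : Fin n → Fin p) (x : N.V) :
    N.tw p (Fin.snoc (α := fun _ => Fin p) a s) x
      = (∑ i, if (a i : ℕ) = 0 then 0 else N.l i.castSucc x + N.r i.castSucc x)
        + if (s : ℕ) = 0 then 0 else N.l (Fin.last n) x + N.r (Fin.last n) x := by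
  rw [KMod.tw_apply, Fin.sum_univ_castSucc]
  simp only [Fin.snoc_castSucc, Fin.snoc_last]

/-- The suspension of the kernel carries the `∂_q` of `B` twisted by `x ⊗ 1 + 1 ⊗ x`, for `x` the last
variable. -/
lemma ι_Q (hq : ∀ x, d.j (Z.dq x) = B.dq (d.j x) + (B.l (Fin.last n) (d.j x)
    + B.r (Fin.last n) (d.j x))) (z : (L1.susp p (Z.kosL p)).V) :
    d.ι p ((L1.susp p (Z.kosL p)).Q z) = (B.kosL p).Q (d.ι p z) := by
  refine snoc_eq (k := k) p fun s a => ?_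
  rw [ι_apply]
  change _ = B.dq (snocE k B.V n p (d.ι p z) s a) + B.tw p (Fin.snoc (α := fun _ => Fin p) a s)
    (snocE k B.V n p (d.ι p z) s a)
  rw [ι_apply]
  by_cases h : (s : ℕ) = 0
  · simp only [dif_pos h, map_zero, add_zero]
  · rw [dif_neg h, dif_neg h, tw_snoc, if_neg h]
    change d.j (Z.dq (z ⟨s - 1, by omega⟩ a) + Z.tw p a (z ⟨s - 1, by omega⟩ a)) = _
    rw [map_add, hq, KMod.tw_apply, map_sum]
    have : ∀ i, d.j (if (a i : ℕ) = 0 then 0 else Z.l i (z ⟨s - 1, by omega⟩ a) + Z.r i (z ⟨s - 1, by omega⟩ a))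
      = if (a i : ℕ) = 0 then 0 else B.l i.castSucc (d.j (z ⟨s - 1, by omega⟩ a))
        + B.r i.castSucc (d.j (z ⟨s - 1, by omega⟩ a)) := by
      intro i
      split_ifs
      · exact map_zero _
      · rw [map_add, d.jl, d.jr]
    rw [Finset.sum_congr rfl fun i _ => this i]
    abel

lemma f_Q (hq : ∀ x, d.π (B.dq x) = R.dq (d.π x)) (w : (B.kosL p).V) :
    d.f p ((B.kosL p).Q w) = (R.kosL p).Q (d.f p w) := by
  funext a
  rw [f_apply]
  change d.π (B.dq (snocE k B.V n p w ⟨0, hp.out.pos⟩ a)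
    + B.tw p (Fin.snoc (α := fun _ => Fin p) a ⟨0, hp.out.pos⟩) (snocE k B.V n p w ⟨0, hp.out.pos⟩ a))
    = R.dq (d.f p w a) + R.tw p a (d.f p w a)
  rw [map_add, hq, tw_snoc, if_pos rfl, add_zero, f_apply, KMod.tw_apply, map_sum]
  refine congrArg _ (Finset.sum_congr rfl fun i _ => ?_)
  split_ifs
  · exact map_zero _
  · rw [map_add, d.πl, d.πr]

/-- The Koszul complex in the direction of the last variable: a rank factorization presents it as an
extension of the cokernel of `φ` by the suspension of the kernel, up to homotopy. -/
def split [CharP k p] (hodd : Odd p) :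
    L1.Split p (L1.susp p (Z.kosL p)) (B.kosL p) (R.kosL p) where
  ι := d.ι p
  u := d.u p
  f := d.f p
  w := d.w p
  -- the contraction of the chain on `C` moves its bottom term to the top
  H := d.inc p ∘ₗ topOfBot k p _ ∘ₗ d.proj p
  ιD z := by
    refine snoc_eq (k := k) p fun s a => ?_
    rw [ι_apply, kosF_snoc, ι_eq]
    by_cases h0 : (s : ℕ) = 0
    · rw [dif_pos h0, dif_pos h0, map_zero]
      symm
      rw [Pi.zero_apply, zero_add]
      split_ifs with h
      · rw [ι_apply, dif_neg (by simp), d.φ, d.pj, map_zero]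
      · rfl
    · rw [dif_neg h0, dif_neg h0, ← kosF_map p Z.diff _ d.j fun i x => by
        rw [KMod.diff_apply, map_sub, d.jl, d.jr]; rfl]
      change d.j (kosF p Z.diff _ a + shDown k (p - 1) _ z _ a) = _
      rw [map_add, shDown_apply]
      congr 1
      by_cases h : (s : ℕ) + 1 < p
      · rw [dif_pos h, if_neg h0, dif_pos (by simp only; omega), ι_apply, dif_neg (by simp)]
        have e : (⟨(s : ℕ) - 1 + 1, by omega⟩ : Fin (p - 1)) = ⟨(s : ℕ) + 1 - 1, by omega⟩ :=
          Fin.ext (by simp only; omega)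
        rw [e]
      · rw [dif_neg h, dif_neg (by simp only; omega)]
        exact map_zero _
  uD w := by
    funext s a
    rw [u_apply, kosF_snoc, map_add]
    change _ = kosF p Z.diff (d.u p w s) a + shDown k (p - 1) _ (d.u p w) s a
    rw [u_eq, ← kosF_map p _ Z.diff d.u0 d.ud, shDown_apply]
    congr 1
    by_cases h : (s : ℕ) + 1 < p - 1
    · rw [dif_pos h, dif_pos (by simp only; omega), if_neg (by simp)]; rfl
    · rw [dif_neg h, dif_neg (by simp only; omega), map_zero]; rfl
  fD w := by
    funext a
    rw [f_apply, kosF_snoc, map_add]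
    change _ = kosF p R.diff (d.f p w) a
    rw [f_eq, ← kosF_map p (fun i => B.diff i.castSucc) R.diff d.π fun i x => by
        rw [KMod.diff_apply, map_sub, d.πl, d.πr]; rfl]
    have : 0 + 1 < p := hp.out.one_lt
    rw [dif_pos this, if_pos rfl, d.φ, d.πc, add_zero]
    rfl
  ιT z := by
    refine snoc_eq (k := k) p fun s a => ?_
    rw [ι_apply]
    change _ = B.dt (snocE k B.V n p (d.ι p z) s a)
    rw [ι_apply]
    split_ifs
    · exact (map_zero _).symm
    · exact d.jt _
  fT w := funext fun a => d.πt _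
  ιA e z hz := snocE_A.mpr fun s _ => by
    rw [SetLike.mem_coe, ι_eq]
    split_ifs with h
    · exact Submodule.zero_mem _
    · refine mem_of_eq (KMod.kosA_compLeft p d.j _ _ (hz _ trivial)) ?_
      simp only
      omega
  uA e w hw s _ := mem_of_eq (KMod.kosA_compLeft p d.u0 _ _ (snocE_A.mp hw _ trivial))
    (by push_cast; ring)
  fA e w hw := mem_of_eq (KMod.kosA_compLeft p d.π _ _ (snocE_A.mp hw _ trivial)) (by simp)
  wA e r hr := snocE_A.mpr fun s _ => by
    rw [SetLike.mem_coe, w_eq]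
    split_ifs with h
    · exact mem_of_eq (KMod.kosA_compLeft p d.sec _ _ hr) (by rw [h]; simp)
    · exact Submodule.zero_mem _
  HA e w hw := snocE_A.mpr fun s _ => by
    simp only [LinearMap.comp_apply]
    rw [SetLike.mem_coe, H_eq]
    split_ifs with h
    · refine mem_of_eq (KMod.kosA_compLeft p (d.c1 ∘ₗ d.p0) _ _ (snocE_A.mp hw _ trivial)) ?_
      simp only
      omega
    · exact Submodule.zero_mem _
  ιG b i z hz := snocE_G.mpr fun s _ => by
    rw [SetLike.mem_coe, ι_eq]
    split_ifs with h
    · exact Submodule.zero_mem _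
    · exact mem_of_eq (KMod.kosG_compLeft p d.j 0
        (fun i x hx => by rw [add_zero]; exact d.jG b i x hx) _ _ _ (hz _ trivial)) (by rw [add_zero, if_neg h]; rfl)
  uG b i w hw s _ := mem_of_eq (KMod.kosG_compLeft p d.u0 0
    (fun i x hx => by rw [add_zero]; exact d.uG b i x hx) _ _ _ (snocE_G.mp hw _ trivial))
    (by rw [if_neg (by simp), add_zero]; rfl)
  fG b i w hw := mem_of_eq (KMod.kosG_compLeft p d.π 0
    (fun i x hx => by rw [add_zero]; exact d.πG b i x hx) _ _ _ (snocE_G.mp hw _ trivial))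
    (by rw [if_pos rfl, add_zero, sub_zero])
  wG b i r hr := snocE_G.mpr fun s _ => by
    rw [SetLike.mem_coe, w_eq]
    split_ifs with h
    · exact mem_of_eq (KMod.kosG_compLeft p d.sec 0
        (fun i x hx => by rw [add_zero]; exact d.secG b i x hx) _ _ _ hr) (by rw [add_zero, if_pos h, sub_zero])
    · exact Submodule.zero_mem _
  HG b i w hw := snocE_G.mpr fun s _ => by
    have h2 := hp.out.two_le
    simp only [LinearMap.comp_apply]
    rw [SetLike.mem_coe, H_eq]
    by_cases h : (s : ℕ) + 1 = p
    · rw [if_pos h]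
      exact mem_of_eq (KMod.kosG_compLeft p (d.c1 ∘ₗ d.p0) (-L1.qsh 2 b)
        (fun i x hx => d.cG b i x hx) _ _ _ (snocE_G.mp hw _ trivial))
        (by rw [if_pos rfl, if_neg (by omega), sub_zero]; rfl)
    · rw [if_neg h]
      exact Submodule.zero_mem _
  uι z := by
    funext s a
    rw [u_apply, ι_apply, dif_neg (by simp), d.uj]
    rfl
  fι z := by
    funext a
    rw [f_apply, ι_apply, dif_pos rfl, map_zero]; rfl
  fw r := by
    funext a
    rw [f_apply, w_apply, if_pos rfl, d.πsec]
  uw r := by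
    funext s a
    rw [u_apply, w_apply, if_neg (by simp), map_zero]; rfl
  uH w := by
    funext s a
    rw [u_apply]
    simp only [LinearMap.comp_apply]
    rw [inc_apply, if_neg (by simp), d.uc]; rfl
  fH w := by
    funext a
    rw [f_apply]
    simp only [LinearMap.comp_apply]
    rw [inc_apply, if_pos rfl, d.πc]; rfl
  Hι z := by
    have : d.proj p (d.ι p z) = 0 := by
      funext s a
      rw [proj_apply, ι_apply]
      split_ifs
      · exact map_zero _
      · exact d.pj _
    simp only [LinearMap.comp_apply, this, map_zero]
  con w hu hf := by
    have h := adp_map p (D := d.chainD p) (D' := kosF p B.diff)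
      (H := topOfBot k p _) (H' := d.inc p ∘ₗ topOfBot k p _ ∘ₗ d.proj p) (d.inc p) (d.inc_D p)
      (fun c => congrArg (fun z => d.inc p (topOfBot k p _ z)) (d.proj_inc p c).symm) (d.proj p w)
    rw [show adp p (d.chainD p) (topOfBot k p _) = 1 from adp_compLeft_add_shDown p hodd _, Module.End.one_apply, d.inc_proj p w hu hf] at h
    exact h.symm

end RankData

namespace L1

variable {p : ℕ}

section Functoriality

variable {S₁ X₁ Q₁ S₂ X₂ Q₂ : L1 k} (s₁ : Split p S₁ X₁ Q₁) (s₂ : Split p S₂ X₂ Q₂)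
  (bS : L1Map S₁ S₂) (bX : L1Map X₁ X₂) (bQ : L1Map Q₁ Q₂)

/-- Compatible maps of split sequences induce a split sequence of the total spaces `lo`. -/
def Split.lo (hS) (hX) (hQ) (hι : ∀ x, bX (s₁.ι x) = s₂.ι (bS x))
    (hf : ∀ x, s₂.f (bX x) = bQ (s₁.f x)) :
    Split p (lo p bS hS) (lo p bX hX) (lo p bQ hQ) where
  ι := s₁.ι.prodMap (s₂.ι.compLeft (Fin (p - 1)))
  u := s₁.u.prodMap (s₂.u.compLeft (Fin (p - 1)))
  f := s₁.f.prodMap (s₂.f.compLeft (Fin (p - 1)))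
  w := s₁.w.prodMap (s₂.w.compLeft (Fin (p - 1)))
  H := s₁.H.prodMap (s₂.H.compLeft (Fin (p - 1)))
  ιD x := Prod.ext (s₁.ιD _) (funext fun i => s₂.ιD _)
  uD x := Prod.ext (s₁.uD _) (funext fun i => s₂.uD _)
  fD x := Prod.ext (s₁.fD _) (funext fun i => s₂.fD _)
  ιT x := Prod.ext (s₁.ιT _) (by
    change s₂.ι.compLeft (Fin (p - 1)) (S₂.T.compLeft (Fin (p - 1)) x.2
      + shDown k (p - 1) S₂.V x.2 + last k (p - 1) S₂.V (bS x.1)) = X₂.T.compLeft (Fin (p - 1))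
      (s₂.ι.compLeft (Fin (p - 1)) x.2) + shDown k (p - 1) X₂.V (s₂.ι.compLeft (Fin (p - 1)) x.2)
      + last k (p - 1) X₂.V (bX (s₁.ι x.1))
    rw [map_add, map_add, HEquiv.compLeft_shDown, compLeft_last, hι]
    congr 2
    exact funext fun i => s₂.ιT _)
  fT x := Prod.ext (s₁.fT _) (by
    change s₂.f.compLeft (Fin (p - 1)) (X₂.T.compLeft (Fin (p - 1)) x.2
      + shDown k (p - 1) X₂.V x.2 + last k (p - 1) X₂.V (bX x.1)) = Q₂.T.compLeft (Fin (p - 1))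
      (s₂.f.compLeft (Fin (p - 1)) x.2) + shDown k (p - 1) Q₂.V (s₂.f.compLeft (Fin (p - 1)) x.2)
      + last k (p - 1) Q₂.V (bQ (s₁.f x.1))
    rw [map_add, map_add, HEquiv.compLeft_shDown, compLeft_last, hf]
    congr 2
    exact funext fun i => s₂.fT _)
  ιA d x hx := ⟨s₁.ιA d _ hx.1, fun i _ => s₂.ιA d _ (hx.2 i trivial)⟩
  uA d x hx := ⟨s₁.uA d _ hx.1, fun i _ => s₂.uA d _ (hx.2 i trivial)⟩
  fA d x hx := ⟨s₁.fA d _ hx.1, fun i _ => s₂.fA d _ (hx.2 i trivial)⟩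
  wA d x hx := ⟨s₁.wA d _ hx.1, fun i _ => s₂.wA d _ (hx.2 i trivial)⟩
  HA d x hx := ⟨s₁.HA d _ hx.1, fun i _ => s₂.HA d _ (hx.2 i trivial)⟩
  ιG b j x hx := ⟨s₁.ιG b _ _ hx.1, fun i _ => s₂.ιG b _ _ (hx.2 i trivial)⟩
  uG b j x hx := ⟨s₁.uG b _ _ hx.1, fun i _ => s₂.uG b _ _ (hx.2 i trivial)⟩
  fG b j x hx := ⟨s₁.fG b _ _ hx.1, fun i _ => s₂.fG b _ _ (hx.2 i trivial)⟩
  wG b j x hx := ⟨s₁.wG b _ _ hx.1, fun i _ => s₂.wG b _ _ (hx.2 i trivial)⟩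
  HG b j x hx := ⟨s₁.HG b _ _ hx.1, fun i _ => s₂.HG b _ _ (hx.2 i trivial)⟩
  uι x := Prod.ext (s₁.uι _) (funext fun i => s₂.uι _)
  fι x := Prod.ext (s₁.fι _) (funext fun i => s₂.fι _)
  fw x := Prod.ext (s₁.fw _) (funext fun i => s₂.fw _)
  uw x := Prod.ext (s₁.uw _) (funext fun i => s₂.uw _)
  uH x := Prod.ext (s₁.uH _) (funext fun i => s₂.uH _)
  fH x := Prod.ext (s₁.fH _) (funext fun i => s₂.fH _)
  Hι x := Prod.ext (s₁.Hι _) (funext fun i => s₂.Hι _)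
  con x hu hf := by
    refine Prod.ext ?_ (funext fun i => ?_)
    · exact (adp_map p (LinearMap.fst k X₁.V (up p (p - 1) X₂).V) (fun _ => rfl) (fun _ => rfl) x).trans
        (s₁.con _ (congrArg Prod.fst hu) (congrArg Prod.fst hf))
    · exact (adp_map p (D' := X₂.D) (H' := s₂.H) (LinearMap.proj (R := k) (φ := fun _ : Fin (p - 1) => X₂.V) i ∘ₗ
        LinearMap.snd k X₁.V (Fin (p - 1) → X₂.V)) (fun _ => rfl) (fun _ => rfl) x).trans
        (s₂.con _ (congrFun (congrArg Prod.snd hu) i) (congrFun (congrArg Prod.snd hf) i))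

/-- Compatible maps of split sequences induce a split sequence of the total spaces `hi`. -/
def Split.hi (hS) (hX) (hQ) (hι : ∀ x, bX (s₁.ι x) = s₂.ι (bS x))
    (hf : ∀ x, s₂.f (bX x) = bQ (s₁.f x)) :
    Split p (hi p bS hS) (hi p bX hX) (hi p bQ hQ) where
  ι := s₂.ι.prodMap (s₁.ι.compLeft (Fin (p - 1)))
  u := s₂.u.prodMap (s₁.u.compLeft (Fin (p - 1)))
  f := s₂.f.prodMap (s₁.f.compLeft (Fin (p - 1)))
  w := s₂.w.prodMap (s₁.w.compLeft (Fin (p - 1)))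
  H := s₂.H.prodMap (s₁.H.compLeft (Fin (p - 1)))
  ιD x := Prod.ext (s₂.ιD _) (funext fun i => s₁.ιD _)
  uD x := Prod.ext (s₂.uD _) (funext fun i => s₁.uD _)
  fD x := Prod.ext (s₂.fD _) (funext fun i => s₁.fD _)
  ιT x := Prod.ext (by
    change s₂.ι (S₂.T x.1 + bS (first k (p - 1) S₁.V x.2)) = X₂.T (s₂.ι x.1)
      + bX (first k (p - 1) X₁.V (s₁.ι.compLeft (Fin (p - 1)) x.2))
    rw [map_add, s₂.ιT, first_compLeft, hι]) (by
    change s₁.ι.compLeft (Fin (p - 1)) (S₁.T.compLeft (Fin (p - 1)) x.2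
      + shDown k (p - 1) S₁.V x.2) = X₁.T.compLeft (Fin (p - 1))
      (s₁.ι.compLeft (Fin (p - 1)) x.2) + shDown k (p - 1) X₁.V (s₁.ι.compLeft (Fin (p - 1)) x.2)
    rw [map_add, HEquiv.compLeft_shDown]
    congr 1
    exact funext fun i => s₁.ιT _)
  fT x := Prod.ext (by
    change s₂.f (X₂.T x.1 + bX (first k (p - 1) X₁.V x.2)) = Q₂.T (s₂.f x.1)
      + bQ (first k (p - 1) Q₁.V (s₁.f.compLeft (Fin (p - 1)) x.2))
    rw [map_add, s₂.fT, first_compLeft, hf]) (by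
    change s₁.f.compLeft (Fin (p - 1)) (X₁.T.compLeft (Fin (p - 1)) x.2
      + shDown k (p - 1) X₁.V x.2) = Q₁.T.compLeft (Fin (p - 1))
      (s₁.f.compLeft (Fin (p - 1)) x.2) + shDown k (p - 1) Q₁.V (s₁.f.compLeft (Fin (p - 1)) x.2)
    rw [map_add, HEquiv.compLeft_shDown]
    congr 1
    exact funext fun i => s₁.fT _)
  ιA d x hx := ⟨s₂.ιA d _ hx.1, fun i _ => s₁.ιA d _ (hx.2 i trivial)⟩
  uA d x hx := ⟨s₂.uA d _ hx.1, fun i _ => s₁.uA d _ (hx.2 i trivial)⟩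
  fA d x hx := ⟨s₂.fA d _ hx.1, fun i _ => s₁.fA d _ (hx.2 i trivial)⟩
  wA d x hx := ⟨s₂.wA d _ hx.1, fun i _ => s₁.wA d _ (hx.2 i trivial)⟩
  HA d x hx := ⟨s₂.HA d _ hx.1, fun i _ => s₁.HA d _ (hx.2 i trivial)⟩
  ιG b j x hx := ⟨s₂.ιG b _ _ hx.1, fun i _ => s₁.ιG b _ _ (hx.2 i trivial)⟩
  uG b j x hx := ⟨s₂.uG b _ _ hx.1, fun i _ => s₁.uG b _ _ (hx.2 i trivial)⟩
  fG b j x hx := ⟨s₂.fG b _ _ hx.1, fun i _ => s₁.fG b _ _ (hx.2 i trivial)⟩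
  wG b j x hx := ⟨s₂.wG b _ _ hx.1, fun i _ => s₁.wG b _ _ (hx.2 i trivial)⟩
  HG b j x hx := ⟨s₂.HG b _ _ hx.1, fun i _ => s₁.HG b _ _ (hx.2 i trivial)⟩
  uι x := Prod.ext (s₂.uι _) (funext fun i => s₁.uι _)
  fι x := Prod.ext (s₂.fι _) (funext fun i => s₁.fι _)
  fw x := Prod.ext (s₂.fw _) (funext fun i => s₁.fw _)
  uw x := Prod.ext (s₂.uw _) (funext fun i => s₁.uw _)
  uH x := Prod.ext (s₂.uH _) (funext fun i => s₁.uH _)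
  fH x := Prod.ext (s₂.fH _) (funext fun i => s₁.fH _)
  Hι x := Prod.ext (s₂.Hι _) (funext fun i => s₁.Hι _)
  con x hu hf := by
    refine Prod.ext ?_ (funext fun i => ?_)
    · exact (adp_map p (LinearMap.fst k X₂.V (up p (-1) X₁).V) (fun _ => rfl) (fun _ => rfl) x).trans
        (s₂.con _ (congrArg Prod.fst hu) (congrArg Prod.fst hf))
    · exact (adp_map p (D' := X₁.D) (H' := s₁.H) (LinearMap.proj (R := k) (φ := fun _ : Fin (p - 1) => X₁.V) i ∘ₗ
        LinearMap.snd k X₂.V (Fin (p - 1) → X₁.V)) (fun _ => rfl) (fun _ => rfl) x).trans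
        (s₁.con _ (congrFun (congrArg Prod.snd hu) i) (congrFun (congrArg Prod.snd hf) i))

end Functoriality

end L1

end PHHH

/-! ### Models of complexes of bimodules as totals -/

namespace PHHH
open MvPolynomial (X)
variable {k : Type u} [Field k]

/-- Isomorphisms for all the structure. -/
structure L1Iso (X Y : L1 k) where
  e : X.V ≃ₗ[k] Y.V
  eD : ∀ x, e (X.D x) = Y.D (e x)
  eT : ∀ x, e (X.T x) = Y.T (e x)
  eQ : ∀ x, e (X.Q x) = Y.Q (e x)
  eA : ∀ d x, x ∈ X.A d ↔ e x ∈ Y.A d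
  eG : ∀ b j x, x ∈ X.G b j ↔ e x ∈ Y.G b j

namespace L1Iso

variable {X Y : L1 k} (i : L1Iso X Y) (p : ℕ)

/-- The inverse isomorphism. -/
def symm : L1Iso Y X where
  e := i.e.symm
  eD x := by rw [LinearEquiv.symm_apply_eq, i.eD, LinearEquiv.apply_symm_apply]
  eT x := by rw [LinearEquiv.symm_apply_eq, i.eT, LinearEquiv.apply_symm_apply]
  eQ x := by rw [LinearEquiv.symm_apply_eq, i.eQ, LinearEquiv.apply_symm_apply]
  eA d x := by rw [i.eA, LinearEquiv.apply_symm_apply]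
  eG b j x := by rw [i.eG, LinearEquiv.apply_symm_apply]

/-- The induced isomorphism of homologies. -/
def hl (c : ℕ) (ρ : ℤ) (idx : Bool → ℤ → ℤ) : L2Iso (L1.HL p c ρ idx X) (L1.HL p c ρ idx Y) where
  e := LinearEquiv.ofLinearMap
    (L1.hlMap p c ρ i.e.toLinearMap i.eD fun d x => (i.eA d x).mp)
    (L1.hlMap p c ρ i.symm.e.toLinearMap i.symm.eD fun d x => (i.symm.eA d x).mp)
    (LinearMap.ext fun x => SQ.ind (P := fun x => L1.hlMap p c ρ i.e.toLinearMap i.eD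
        (fun d x => (i.eA d x).mp) (L1.hlMap p c ρ i.symm.e.toLinearMap i.symm.eD
        (fun d x => (i.symm.eA d x).mp) x) = x)
      (fun v hv => SQ.cls_congr (i.e.apply_symm_apply v) _ _) x)
    (LinearMap.ext fun x => SQ.ind (P := fun x => L1.hlMap p c ρ i.symm.e.toLinearMap i.symm.eD
        (fun d x => (i.symm.eA d x).mp) (L1.hlMap p c ρ i.e.toLinearMap i.eD
        (fun d x => (i.eA d x).mp) x) = x)
      (fun v hv => SQ.cls_congr (i.e.symm_apply_apply v) _ _) x)
  eD := L1.hlMap_comm i.e.toLinearMap i.eD (fun d x => (i.eA d x).mp) X.T X.TD X.TA Y.T Y.TD Y.TA i.eT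
  eQ := L1.hlMap_comm i.e.toLinearMap i.eD (fun d x => (i.eA d x).mp) X.Q X.QD X.QA Y.Q Y.QD Y.QA i.eQ
  eG := L1.hlMap_G' i.e.toLinearMap i.eD (fun d x => (i.eA d x).mp) fun b j x => (i.eG b j x).mp
  eG' := L1.hlMap_G' i.symm.e.toLinearMap i.symm.eD (fun d x => (i.symm.eA d x).mp)
    fun b j x => (i.symm.eG b j x).mp

/-- The induced isomorphism of `p`-extended homologies. -/
def ext : L2Iso (L1.ext p X) (L1.ext p Y) :=
  (i.hl p 1 0 (L1.idxE p)).prod ((i.hl p (p - 1) (-1) (L1.idxO p)).up p)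

end L1Iso

namespace L1.Split

variable {p : ℕ} [Fact p.Prime] [CharP k p] {S X Q : L1 k} (s : Split p S X Q)

/-- If the quotient has contractible topological differential, the sub has the same `p`-extended
homology. -/
def extSub (hodd : Odd p) (hX : X.D ^ p = 0) (hT : X.T ^ p = 0) (hQ : TCon p Q)
    (ιQ : ∀ x, s.ι (S.Q x) = X.Q (s.ι x)) : SlashIso p (ext p S) (ext p X) :=
  ((s.hEquivSub 1 (Fact.out : p.Prime).one_le 0 (idxE p) hX hT hQ ιQ).prod
    ((s.hEquivSub (p - 1) (Nat.sub_le _ _) (-1) (idxO p) hX hT hQ ιQ).up hodd)).slashIso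

/-- If the sub has contractible topological differential, the quotient has the same `p`-extended
homology. -/
def extQuotient (hodd : Odd p) (hX : X.D ^ p = 0) (hT : X.T ^ p = 0) (hS : TCon p S)
    (fQ : ∀ x, s.f (X.Q x) = Q.Q (s.f x)) : SlashIso p (ext p X) (ext p Q) :=
  ((s.hEquivQuotient 1 (Fact.out : p.Prime).one_le 0 (idxE p) hX hT hS fQ).prod
    ((s.hEquivQuotient (p - 1) (Nat.sub_le _ _) (-1) (idxO p) hX hT hS fQ).up hodd)).slashIso

include s

/-- Operators on the sub inherit nilpotency. -/
lemma sub_pow {E : Module.End k S.V} {E' : Module.End k X.V} (hE : ∀ x, s.ι (E x) = E' (s.ι x))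
    (h : E' ^ p = 0) : E ^ p = 0 := LinearMap.ext fun x => by
  have h1 := congrArg s.u (pow_map s.ι hE p x)
  rw [s.uι, h, LinearMap.zero_apply, map_zero] at h1
  exact h1

/-- Operators on the quotient inherit nilpotency. -/
lemma quotient_pow {E : Module.End k Q.V} {E' : Module.End k X.V}
    (hE : ∀ x, s.f (E' x) = E (s.f x)) (h : E' ^ p = 0) : E ^ p = 0 := LinearMap.ext fun x => by
  have h1 := pow_map s.f hE p (s.w x)
  rw [s.fw, h, LinearMap.zero_apply, map_zero] at h1
  exact h1.symm

end L1.Split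

namespace KMod

variable {n : ℕ}

/-- The restriction of the actions to all variables but the last. -/
abbrev restrict (N : KMod k (n + 1)) : KMod k n where
  V := N.V
  l i := N.l i.castSucc
  r i := N.r i.castSucc
  dq := N.dq
  dt := N.dt
  Gr := N.Gr
  ll i j := N.ll _ _
  rr i j := N.rr _ _
  lr i j := N.lr _ _
  ql i := N.ql _
  qr i := N.qr _
  tl i := N.tl _
  tr i := N.tr _
  tq := N.tq
  lG i := N.lG _
  rG i := N.rG _
  tG := N.tG

/-- The operator of multiplication by an integral linear form on the right. -/
def form (N : KMod k n) (c : Fin n → ℤ) : Module.End k N.V := ∑ i, c i • N.r i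

lemma form_apply (N : KMod k n) (c : Fin n → ℤ) (x : N.V) : N.form c x = ∑ i, c i • N.r i x := by
  rw [form, LinearMap.sum_apply]; rfl

lemma form_comm (N : KMod k n) (c : Fin n → ℤ) {W : Type*} [AddCommGroup W] [Module k W]
    (E : N.V →ₗ[k] W) (E' : Fin n → Module.End k W) (hr : ∀ i x, E (N.r i x) = E' i (E x)) (x : N.V) :
    E (N.form c x) = ∑ i, c i • E' i (E x) := by
  rw [form_apply, map_sum]
  exact Finset.sum_congr rfl fun i _ => by rw [map_zsmul, hr]

/-- The twist by an integral linear form, with translated gradings. -/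
abbrev twisted (N : KMod k n) (c : Fin n → ℤ) (e : Bool → ℤ) : KMod k n where
  V := N.V
  l := N.l
  r := N.r
  dq := N.dq + N.form c
  dt := N.dt
  Gr b j := N.Gr b (j + e b)
  ll := N.ll
  rr := N.rr
  lr := N.lr
  ql i x := by
    rw [LinearMap.add_apply, LinearMap.add_apply, N.ql, map_add,
      N.form_comm c (N.l i) N.r (fun j x => N.lr i j x), ← form_apply]
    abel
  qr i x := by
    rw [LinearMap.add_apply, LinearMap.add_apply, N.qr, map_add,
      N.form_comm c (N.r i) N.r (fun j x => N.rr i j x), ← form_apply]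
    abel
  tl := N.tl
  tr := N.tr
  tq x := by
    rw [LinearMap.add_apply, LinearMap.add_apply, map_add, N.tq, N.form_comm c N.dt N.r N.tr,
      ← form_apply]
  lG i b j x hx := mem_of_eq (N.lG i b _ x hx) (by ring)
  rG i b j x hx := mem_of_eq (N.rG i b _ x hx) (by ring)
  tG b j x hx := mem_of_eq (N.tG b _ x hx) (by ring)

variable (p : ℕ) {T B R : KMod k n}

/-- An identification of `T` with the total space of `B → R = ⋯ = R`. -/
structure LoModel (T B R : KMod k n) (b : Hom B R) where
  e : T.V ≃ₗ[k] B.V × (Fin (p - 1) → R.V)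
  el : ∀ i x, e (T.l i x) = (B.l i (e x).1, fun s => R.l i ((e x).2 s))
  er : ∀ i x, e (T.r i x) = (B.r i (e x).1, fun s => R.r i ((e x).2 s))
  eq : ∀ x, e (T.dq x) = (B.dq (e x).1, fun s => R.dq ((e x).2 s))
  et : ∀ x, e (T.dt x) = (B.dt (e x).1, fun s => R.dt ((e x).2 s) + shDown k (p - 1) R.V (e x).2 s
    + L1.last k (p - 1) R.V (b.f (e x).1) s)
  eG : ∀ c j x, x ∈ T.Gr c j ↔ (e x).1 ∈ B.Gr c j ∧
    ∀ s : Fin (p - 1), (e x).2 s ∈ R.Gr c (j - tau c * (s : ℕ) + tau c * (p - 1))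

/-- An identification of `T` with the total space of `R = ⋯ = R → B`. -/
structure HiModel (T B R : KMod k n) (b : Hom R B) where
  e : T.V ≃ₗ[k] B.V × (Fin (p - 1) → R.V)
  el : ∀ i x, e (T.l i x) = (B.l i (e x).1, fun s => R.l i ((e x).2 s))
  er : ∀ i x, e (T.r i x) = (B.r i (e x).1, fun s => R.r i ((e x).2 s))
  eq : ∀ x, e (T.dq x) = (B.dq (e x).1, fun s => R.dq ((e x).2 s))
  et : ∀ x, e (T.dt x) = (B.dt (e x).1 + b.f (L1.first k (p - 1) R.V (e x).2),
    fun s => R.dt ((e x).2 s) + shDown k (p - 1) R.V (e x).2 s)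
  eG : ∀ c j x, x ∈ T.Gr c j ↔ (e x).1 ∈ B.Gr c j ∧
    ∀ s : Fin (p - 1), (e x).2 s ∈ R.Gr c (j - tau c * (s : ℕ) + tau c * (-1))

section Model

variable (e : T.V ≃ₗ[k] B.V × (Fin (p - 1) → R.V))

/-- The equivalence of Koszul complexes induced by a decomposition of the coefficients. -/
def modelE : ((Fin n → Fin p) → T.V) ≃ₗ[k]
    ((Fin n → Fin p) → B.V) × (Fin (p - 1) → (Fin n → Fin p) → R.V) where
  toFun w := (fun a => (e (w a)).1, fun s a => (e (w a)).2 s)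
  map_add' w w' := by
    refine Prod.ext (funext fun a => ?_) (funext fun s => funext fun a => ?_)
    · exact congrArg Prod.fst (map_add e (w a) (w' a))
    · exact congrFun (congrArg Prod.snd (map_add e (w a) (w' a))) s
  map_smul' c w := by
    refine Prod.ext (funext fun a => ?_) (funext fun s => funext fun a => ?_)
    · exact congrArg Prod.fst (map_smul e c (w a))
    · exact congrFun (congrArg Prod.snd (map_smul e c (w a))) s
  invFun v a := e.symm (v.1 a, fun s => v.2 s a)
  left_inv w := funext fun a => e.symm_apply_apply _
  right_inv v := by
    refine Prod.ext (funext fun a => ?_) (funext fun s => funext fun a => ?_)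
    · exact congrArg Prod.fst (e.apply_symm_apply (v.1 a, fun s => v.2 s a))
    · exact congrFun (congrArg Prod.snd (e.apply_symm_apply (v.1 a, fun s => v.2 s a))) s

lemma modelE_D (el : ∀ i x, e (T.l i x) = (B.l i (e x).1, fun s => R.l i ((e x).2 s)))
    (er : ∀ i x, e (T.r i x) = (B.r i (e x).1, fun s => R.r i ((e x).2 s)))
    (w : (Fin n → Fin p) → T.V) : modelE p e (kosF p T.diff w)
      = (kosF p B.diff (modelE p e w).1, fun s => kosF p R.diff ((modelE p e w).2 s)) := by
  have hd : ∀ i x, e (T.diff i x) = (B.diff i (e x).1, fun s => R.diff i ((e x).2 s)) := by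
    intro i x
    rw [diff_apply, map_sub, el, er]; rfl
  refine Prod.ext ?_ (funext fun s => ?_)
  · exact kosF_map p T.diff B.diff (LinearMap.fst k _ _ ∘ₗ e.toLinearMap)
      (fun i x => congrArg Prod.fst (hd i x)) w
  · exact kosF_map p T.diff R.diff (LinearMap.proj (R := k) (φ := fun _ : Fin (p - 1) => R.V) s ∘ₗ
      LinearMap.snd k _ _ ∘ₗ e.toLinearMap) (fun i x => congrFun (congrArg Prod.snd (hd i x)) s) w

lemma modelE_Q (el : ∀ i x, e (T.l i x) = (B.l i (e x).1, fun s => R.l i ((e x).2 s)))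
    (er : ∀ i x, e (T.r i x) = (B.r i (e x).1, fun s => R.r i ((e x).2 s)))
    (eq : ∀ x, e (T.dq x) = (B.dq (e x).1, fun s => R.dq ((e x).2 s)))
    (w : (Fin n → Fin p) → T.V) : modelE p e (T.kosQL p w)
      = (B.kosQL p (modelE p e w).1, fun s => R.kosQL p ((modelE p e w).2 s)) := by
  have h : ∀ a x, e (T.tw p a x) = (B.tw p a (e x).1, fun s => R.tw p a ((e x).2 s)) := by
    intro a x
    simp only [tw_apply]
    rw [map_sum]
    refine Prod.ext ?_ (funext fun s => ?_)
    · rw [Prod.fst_sum]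
      refine Finset.sum_congr rfl fun i _ => ?_
      split_ifs
      · rw [map_zero]; rfl
      · rw [map_add, el, er]; rfl
    · rw [Prod.snd_sum, Finset.sum_apply]
      refine Finset.sum_congr rfl fun i _ => ?_
      split_ifs
      · rw [map_zero]; rfl
      · rw [map_add, el, er]; rfl
  have h2 : ∀ a, e (T.kosQL p w a) = (B.kosQL p (modelE p e w).1 a,
      fun s => R.kosQL p ((modelE p e w).2 s) a) := by
    intro a
    rw [kosQL_apply, map_add, eq, h]; rfl
  refine Prod.ext (funext fun a => congrArg Prod.fst (h2 a)) (funext fun s => funext fun a =>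
    congrFun (congrArg Prod.snd (h2 a)) s)

lemma modelE_A (d : ℤ) (w : (Fin n → Fin p) → T.V) : w ∈ kosA (k := k) T.V n p d ↔
    (modelE p e w).1 ∈ kosA (k := k) B.V n p d ∧ ∀ s, (modelE p e w).2 s ∈ kosA (k := k) R.V n p d := by
  simp only [mem_kosA]
  constructor
  · refine fun h => ⟨fun a ha => ?_, fun s a ha => ?_⟩
    · change (e (w a)).1 = 0
      rw [h a ha, map_zero]; rfl
    · change (e (w a)).2 s = 0
      rw [h a ha, map_zero]; rfl
  · intro h a ha
    refine e.injective ((Prod.ext (h.1 a ha) (funext fun s => h.2 s a ha)).trans (map_zero e).symm)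

lemma modelE_G (b : Bool) (f : ℕ → ℤ) (eG : ∀ j x, x ∈ T.Gr b j ↔ (e x).1 ∈ B.Gr b j ∧
      ∀ s : Fin (p - 1), (e x).2 s ∈ R.Gr b (j + f s)) (σ j : ℤ) (w : (Fin n → Fin p) → T.V) :
    w ∈ kosG p (T.Gr b) σ j ↔ (modelE p e w).1 ∈ kosG p (B.Gr b) σ j ∧
      ∀ s : Fin (p - 1), (modelE p e w).2 s ∈ kosG p (R.Gr b) σ (j + f s) := by
  simp only [mem_kosG]
  constructor
  · refine fun h => ⟨fun a => ((eG _ _).mp (h a)).1, fun s a => ?_⟩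
    exact mem_of_eq (((eG _ _).mp (h a)).2 s) (by ring)
  · refine fun h a => (eG _ _).mpr ⟨h.1 a, fun s => mem_of_eq (h.2 s a) (by ring)⟩

end Model

variable {p}

/-- The Koszul complex of `T` is the total space of the map of Koszul complexes induced by `B → R`. -/
def LoModel.iso {b : Hom B R} (m : LoModel p T B R b) (hq) :
    L1Iso (T.kosL p) (L1.lo p (b.kos p) hq) where
  e := modelE p m.e
  eD w := modelE_D p m.e m.el m.er w
  eT w := by
    refine Prod.ext (funext fun a => congrArg Prod.fst (m.et (w a))) (funext fun s => funext fun a => ?_)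
    refine (congrFun (congrArg Prod.snd (m.et (w a))) s).trans ?_
    change R.dt ((m.e (w a)).2 s) + shDown k (p - 1) R.V (m.e (w a)).2 s
      + L1.last k (p - 1) R.V (b.f (m.e (w a)).1) s
      = R.dt ((m.e (w a)).2 s) + shDown k (p - 1) _ (fun s a => (m.e (w a)).2 s) s a
      + L1.last k (p - 1) _ (fun a => b.f (m.e (w a)).1) s a
    rw [shDown_apply, shDown_apply, L1.last_apply, L1.last_apply]
    congr 1
    · congr 1
      split_ifs <;> rfl
    · split_ifs <;> rfl
  eQ w := modelE_Q p m.e m.el m.er m.eq w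
  eA d w := (modelE_A p m.e d w).trans (and_congr_right fun _ => ⟨fun h s _ => h s, fun h s => h s trivial⟩)
  eG c j w := (modelE_G p m.e c (fun s => - tau c * s + tau c * (p - 1))
      (fun j x => (m.eG c j x).trans (and_congr_right fun _ => forall_congr' fun s => iff_of_eq (by
        congr 2; ring))) (L1.qsh 2 c) j w).trans
    (and_congr_right fun _ => ⟨fun h s _ => mem_of_eq (h s) (by ring),
      fun h s => mem_of_eq (h s trivial) (by ring)⟩)

/-- The Koszul complex of `T` is the total space of the map of Koszul complexes induced by `R → B`. -/
def HiModel.iso {b : Hom R B} (m : HiModel p T B R b) (hq) :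
    L1Iso (T.kosL p) (L1.hi p (b.kos p) hq) where
  e := modelE p m.e
  eD w := modelE_D p m.e m.el m.er w
  eT w := by
    refine Prod.ext (funext fun a => (congrArg Prod.fst (m.et (w a))).trans ?_)
      (funext fun s => funext fun a => (congrFun (congrArg Prod.snd (m.et (w a))) s).trans ?_)
    · change B.dt (m.e (w a)).1 + b.f (L1.first k (p - 1) R.V (m.e (w a)).2)
        = B.dt (m.e (w a)).1 + b.f (L1.first k (p - 1) _ (fun s a => (m.e (w a)).2 s) a)
      rw [L1.first_apply, L1.first_apply]
      congr 2
      split_ifs <;> rfl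
    · change R.dt ((m.e (w a)).2 s) + shDown k (p - 1) R.V (m.e (w a)).2 s
        = R.dt ((m.e (w a)).2 s) + shDown k (p - 1) _ (fun s a => (m.e (w a)).2 s) s a
      rw [shDown_apply, shDown_apply]
      congr 1
      split_ifs <;> rfl
  eQ w := modelE_Q p m.e m.el m.er m.eq w
  eA d w := (modelE_A p m.e d w).trans (and_congr_right fun _ => ⟨fun h s _ => h s, fun h s => h s trivial⟩)
  eG c j w := (modelE_G p m.e c (fun s => - tau c * s + tau c * (-1))
      (fun j x => (m.eG c j x).trans (and_congr_right fun _ => forall_congr' fun s => iff_of_eq (by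
        congr 2; ring))) (L1.qsh 2 c) j w).trans
    (and_congr_right fun _ => ⟨fun h s _ => mem_of_eq (h s) (by ring),
      fun h s => mem_of_eq (h s trivial) (by ring)⟩)

end KMod

end PHHH

/-! ### Adjoining a polynomial variable -/

namespace PHHH
open MvPolynomial (X)
variable {k : Type u} [Field k]

/-- The data identifying `N` with `M ⊗ k[y]`: the last variable acts by `y` from both sides, and
`τ = y - x`, for `x` the last variable acting on `M` from the right, is injective with cokernel `M`,
where `ev` is the substitution of `x` for `y`. The maps `div` and `const` provide a splitting of
the resulting short exact sequence, compatible with the actions on `M`. -/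
structure Strand {m : ℕ} (M : KMod k (m + 1)) (N : KMod k (m + 2)) where
  ev : N.V →ₗ[k] M.V
  const : M.V →ₗ[k] N.V
  div : Module.End k N.V
  last : ∀ x, N.l (Fin.last (m + 1)) x = N.r (Fin.last (m + 1)) x
  ev_l : ∀ i x, ev (N.l (Fin.castSucc i) x) = M.l i (ev x)
  ev_r : ∀ i x, ev (N.r (Fin.castSucc i) x) = M.r i (ev x)
  ev_t : ∀ x, ev (N.dt x) = M.dt (ev x)
  ev_q : ∀ x, ev (N.dq x) = M.dq (ev x)
  evG : ∀ b j x, x ∈ N.Gr b j → ev x ∈ M.Gr b j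
  const_l : ∀ i x, const (M.l i x) = N.l (Fin.castSucc i) (const x)
  const_r : ∀ i x, const (M.r i x) = N.r (Fin.castSucc i) (const x)
  const_t : ∀ x, const (M.dt x) = N.dt (const x)
  constG : ∀ b j x, x ∈ M.Gr b j → const x ∈ N.Gr b j
  div_l : ∀ i x, div (N.l (Fin.castSucc i) x) = N.l (Fin.castSucc i) (div x)
  div_r : ∀ i x, div (N.r (Fin.castSucc i) x) = N.r (Fin.castSucc i) (div x)
  div_t : ∀ x, div (N.dt x) = N.dt (div x)
  divG : ∀ b j x, x ∈ N.Gr b j → div x ∈ N.Gr b (j - L1.qsh 2 b)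
  div_τ : ∀ x, div (N.r (Fin.last (m + 1)) x - N.r (Fin.castSucc (Fin.last m)) x) = x
  ev_τ : ∀ x, ev (N.r (Fin.last (m + 1)) x - N.r (Fin.castSucc (Fin.last m)) x) = 0
  ev_const : ∀ x, ev (const x) = x
  div_const : ∀ x, div (const x) = 0
  sum : ∀ x, N.r (Fin.last (m + 1)) (div x) - N.r (Fin.castSucc (Fin.last m)) (div x)
    + const (ev x) = x

namespace Strand

variable {m : ℕ} {M : KMod k (m + 1)} {N : KMod k (m + 2)}

section Basic

variable (N)

/-- The action of `y - x`. -/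
def τ : Module.End k N.V := N.r (Fin.last (m + 1)) - N.r (Fin.castSucc (Fin.last m))

lemma τ_apply (v : N.V) : τ N v = N.r (Fin.last (m + 1)) v - N.r (Fin.castSucc (Fin.last m)) v := rfl

lemma l_τ (i) (v : N.V) : N.l i (τ N v) = τ N (N.l i v) := by
  simp only [τ_apply, map_sub, N.lr]

lemma r_τ (i) (v : N.V) : N.r i (τ N v) = τ N (N.r i v) := by
  simp only [τ_apply, map_sub, N.rr i]

lemma dt_τ (v : N.V) : N.dt (τ N v) = τ N (N.dt v) := by
  simp only [τ_apply, map_sub, N.tr]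

lemma dq_τ (v : N.V) : N.dq (τ N v) = τ N (N.dq v) + τ N (N.r (Fin.castSucc (Fin.last m)) v
    + N.r (Fin.last (m + 1)) v) := by
  simp only [τ_apply, map_sub, map_add, N.qr, N.rr (Fin.last (m + 1)) (Fin.castSucc (Fin.last m))]
  abel

lemma τ_G (b : Bool) (j : ℤ) (v : N.V) (hv : v ∈ N.Gr b j) : τ N v ∈ N.Gr b (j + L1.qsh 2 b) :=
  Submodule.sub_mem _ (N.rG _ _ _ _ hv) (N.rG _ _ _ _ hv)

/-- The linear form `c x + d y`. -/
def xy (m : ℕ) (c d : ℤ) : Fin (m + 2) → ℤ :=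
  Pi.single (Fin.castSucc (Fin.last m)) c + Pi.single (Fin.last (m + 1)) d

lemma form_single {n : ℕ} (L : KMod k n) (i : Fin n) (c : ℤ) (v : L.V) :
    L.form (Pi.single i c) v = c • L.r i v := by
  rw [KMod.form_apply, Finset.sum_eq_single i]
  · rw [Pi.single_eq_same]
  · intro j _ hj
    rw [Pi.single_eq_of_ne hj, zero_smul]
  · exact fun h => absurd (Finset.mem_univ i) h

lemma form_xy (c d : ℤ) (v : N.V) : N.form (xy m c d) v
    = c • N.r (Fin.castSucc (Fin.last m)) v + d • N.r (Fin.last (m + 1)) v := by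
  rw [← form_single, ← form_single, KMod.form_apply, KMod.form_apply, KMod.form_apply,
    ← Finset.sum_add_distrib]
  exact Finset.sum_congr rfl fun i _ => add_smul _ _ _

/-- The sign with which a variable acts differently on the tensor product with `B_i`: the right action
of the variable on `1 ⊗ 1` is `x_i + α_i (y - x)` times `1 ⊗ 1`, minus `α_i` times `y ⊗ 1 - 1 ⊗ x`. -/
def α (m : ℕ) : Fin (m + 2) → ℤ :=
  Pi.single (Fin.castSucc (Fin.last m)) 1 - Pi.single (Fin.last (m + 1)) 1

lemma α_last : α m (Fin.last (m + 1)) = -1 := by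
  rw [α, Pi.sub_apply, Pi.single_eq_same, Pi.single_eq_of_ne (Fin.castSucc_lt_last _).ne']; rfl

lemma α_x : α m (Fin.castSucc (Fin.last m)) = 1 := by
  rw [α, Pi.sub_apply, Pi.single_eq_same, Pi.single_eq_of_ne (Fin.castSucc_lt_last _).ne]; rfl

lemma α_ne (i : Fin (m + 2)) (h1 : i ≠ Fin.castSucc (Fin.last m)) (h2 : i ≠ Fin.last (m + 1)) :
    α m i = 0 := by
  rw [α, Pi.sub_apply, Pi.single_eq_of_ne h1, Pi.single_eq_of_ne h2]; rfl

/-- For the two variables moved by the transposition, `x + y` is twice the variable plus its signed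
difference from the other; for the remaining variables both sides vanish. -/
lemma α_xy (i : Fin (m + 2)) (v : N.V) : α m i • (N.r (Fin.castSucc (Fin.last m)) v
    + N.r (Fin.last (m + 1)) v) = (2 * α m i) • N.r i v + (α m i * α m i) • τ N v := by
  by_cases h1 : i = Fin.castSucc (Fin.last m)
  · subst h1
    rw [α_x, τ_apply]
    module
  · by_cases h2 : i = Fin.last (m + 1)
    · subst h2
      rw [α_last, τ_apply]
      module
    · rw [α_ne i h1 h2]
      module

end Basic

variable (N) in
/-- The tensor product of `N` with `B_i`, twisted: the basis `1 ⊗ 1, y ⊗ 1 - 1 ⊗ x` of `B_i` identifies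
it with `N × N`. As `∂_q` multiplies the second basis element by `x + y`, the twist `c (x + y)` becomes
`(c + 1) (x + y)` on the second factor. -/
abbrev bsMod (c : ℤ) (e : Bool → ℤ) : KMod k (m + 2) where
  V := N.V × N.V
  l i := (N.l i).prodMap (N.l i)
  r i := (N.r i).prodMap (N.r i) + α m i • (τ N ∘ₗ LinearMap.fst k N.V N.V).prod (-LinearMap.fst k N.V N.V)
  dq := (N.dq + N.form (xy m c c)).prodMap (N.dq + N.form (xy m (c + 1) (c + 1)))
  dt := N.dt.prodMap N.dt
  Gr b j := (N.Gr b (j + e b)).prod (N.Gr b (j + e b - L1.qsh 2 b))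
  ll i j x := Prod.ext (N.ll i j _) (N.ll i j _)
  rr i j x := by
    refine Prod.ext ?_ ?_
    · change N.r i (N.r j x.1 + α m j • τ N x.1) + α m i • τ N (N.r j x.1 + α m j • τ N x.1)
        = N.r j (N.r i x.1 + α m i • τ N x.1) + α m j • τ N (N.r i x.1 + α m i • τ N x.1)
      simp only [map_add, map_zsmul, r_τ, N.rr i j]
      module
    · change N.r i (N.r j x.2 + α m j • -x.1) + α m i • -(N.r j x.1 + α m j • τ N x.1)
        = N.r j (N.r i x.2 + α m i • -x.1) + α m j • -(N.r i x.1 + α m i • τ N x.1)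
      simp only [map_add, map_zsmul, map_neg, N.rr i j]
      module
  lr i j x := by
    refine Prod.ext ?_ ?_
    · change N.l i (N.r j x.1 + α m j • τ N x.1) = N.r j (N.l i x.1) + α m j • τ N (N.l i x.1)
      rw [map_add, map_zsmul, l_τ, N.lr]
    · change N.l i (N.r j x.2 + α m j • -x.1) = N.r j (N.l i x.2) + α m j • -(N.l i x.1)
      rw [map_add, map_zsmul, map_neg, N.lr]
  ql i x := Prod.ext ((N.twisted (xy m c c) e).ql i x.1)
    ((N.twisted (xy m (c + 1) (c + 1)) e).ql i x.2)
  qr i x := by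
    refine Prod.ext ?_ ?_
    · change N.dq (N.r i x.1 + α m i • τ N x.1) + N.form (xy m c c) (N.r i x.1 + α m i • τ N x.1)
        = N.r i (N.dq x.1 + N.form (xy m c c) x.1) + α m i • τ N (N.dq x.1 + N.form (xy m c c) x.1)
          + (N.r i (N.r i x.1 + α m i • τ N x.1) + α m i • τ N (N.r i x.1 + α m i • τ N x.1))
      have h := congrArg (τ N) (α_xy N i x.1)
      simp only [map_add, map_zsmul] at h
      simp only [form_xy, map_add, map_zsmul, N.qr, dq_τ, r_τ, N.rr (Fin.castSucc (Fin.last m)) i,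
        N.rr (Fin.last (m + 1)) i]
      linear_combination (norm := module) h
    · change N.dq (N.r i x.2 + α m i • -x.1) + N.form (xy m (c + 1) (c + 1)) (N.r i x.2 + α m i • -x.1)
        = N.r i (N.dq x.2 + N.form (xy m (c + 1) (c + 1)) x.2) + α m i • -(N.dq x.1 + N.form (xy m c c) x.1)
          + (N.r i (N.r i x.2 + α m i • -x.1) + α m i • -(N.r i x.1 + α m i • τ N x.1))
      have h := α_xy N i x.1
      simp only [form_xy, map_add, map_zsmul, map_neg, N.qr, N.rr (Fin.castSucc (Fin.last m)) i,
        N.rr (Fin.last (m + 1)) i]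
      linear_combination (norm := module) -h
  tl i x := Prod.ext (N.tl i _) (N.tl i _)
  tr i x := by
    refine Prod.ext ?_ ?_
    · change N.dt (N.r i x.1 + α m i • τ N x.1) = N.r i (N.dt x.1) + α m i • τ N (N.dt x.1)
      rw [map_add, map_zsmul, dt_τ, N.tr]
    · change N.dt (N.r i x.2 + α m i • -x.1) = N.r i (N.dt x.2) + α m i • -(N.dt x.1)
      rw [map_add, map_zsmul, map_neg, N.tr]
  tq x := Prod.ext ((N.twisted (xy m c c) e).tq x.1) ((N.twisted (xy m (c + 1) (c + 1)) e).tq x.2)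
  lG i b j x hx := ⟨mem_of_eq (N.lG i b _ _ hx.1) (by ring), mem_of_eq (N.lG i b _ _ hx.2) (by ring)⟩
  rG i b j x hx := ⟨Submodule.add_mem _ (mem_of_eq (N.rG i b _ _ hx.1) (by ring))
      (zsmul_mem (mem_of_eq (τ_G N b _ _ hx.1) (by ring)) _),
    Submodule.add_mem _ (mem_of_eq (N.rG i b _ _ hx.2) (by ring))
      (zsmul_mem (Submodule.neg_mem _ (mem_of_eq hx.1 (by ring))) _)⟩
  tG b j x hx := ⟨mem_of_eq (N.tG b _ _ hx.1) (by ring), mem_of_eq (N.tG b _ _ hx.2) (by ring)⟩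

end Strand

end PHHH

/-! ### Closing the last strand -/

namespace PHHH
open MvPolynomial (X)
variable {k : Type u} [Field k]

namespace L1Iso

variable {X Y : L1 k} (i : L1Iso X Y) {p : ℕ}
include i

lemma pow_D (h : X.D ^ p = 0) : Y.D ^ p = 0 := LinearMap.ext fun x => by
  have h1 := pow_map i.e.toLinearMap i.eD p (i.e.symm x)
  rw [h, LinearMap.zero_apply, map_zero] at h1
  exact (h1.trans (congrArg _ (i.e.apply_symm_apply x))).symm

lemma pow_T (h : X.T ^ p = 0) : Y.T ^ p = 0 := LinearMap.ext fun x => by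
  have h1 := pow_map i.e.toLinearMap i.eT p (i.e.symm x)
  rw [h, LinearMap.zero_apply, map_zero] at h1
  exact (h1.trans (congrArg _ (i.e.apply_symm_apply x))).symm

end L1Iso

namespace RankData

variable {n : ℕ} {B B' : KMod k (n + 1)} {Z R Z' R' : KMod k n} (d : RankData B Z R)
  (d' : RankData B' Z' R') (p : ℕ) [Fact p.Prime] (b : KMod.Hom B B')

lemma ι_map (z : KMod.Hom Z Z') (h : ∀ x, b.f (d.j x) = d'.j (z.f x)) (x : (L1.susp p (Z.kosL p)).V) :
    b.kos p (d.ι p x) = d'.ι p (L1.suspMap p (z.kos p) x) := by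
  refine snoc_eq (k := k) p fun s a => ?_
  change b.f (snocE k B.V n p (d.ι p x) s a) = _
  rw [ι_apply, ι_apply]
  split_ifs
  · exact map_zero _
  · exact h _

lemma f_map (r : KMod.Hom R R') (h : ∀ x, d'.π (b.f x) = r.f (d.π x)) (x : (B.kosL p).V) :
    d'.f p (b.kos p x) = r.kos p (d.f p x) := funext fun a => h _

end RankData

lemma KMod.kosL_T_pow {n : ℕ} {M : KMod k n} {p : ℕ} (h : M.dt ^ p = 0) : (M.kosL p).T ^ p = 0 :=
  LinearMap.ext fun x => funext fun a => by
    have h1 := pow_map (LinearMap.proj (R := k) (φ := fun _ : Fin n → Fin p => M.V) a)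
      (D := (M.kosL p).T) (D' := M.dt) (fun _ => rfl) p x
    rw [h, LinearMap.zero_apply] at h1
    exact h1

/-- The identity. -/
abbrev KMod.Hom.id {n : ℕ} (N : KMod k n) : KMod.Hom N N :=
  ⟨LinearMap.id, fun _ _ => rfl, fun _ _ => rfl, fun _ => rfl, fun _ _ _ h => h⟩

namespace Strand

variable {m : ℕ} {M : KMod k (m + 1)} {N : KMod k (m + 2)}

/-- The translation of gradings by `e`, lowered by `2` in the `q`-direction. -/
abbrev lower (e : Bool → ℤ) (b : Bool) : ℤ := e b - L1.qsh 2 b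

/-- The restriction of the actions on the twist of `N` by `c x + d y` to all variables but `y`. -/
abbrev res (N : KMod k (m + 2)) (c d : ℤ) (e : Bool → ℤ) : KMod k (m + 1) :=
  (N.twisted (xy m c d) e).restrict

lemma diff_bsMod (c : ℤ) (e : Bool → ℤ) (i : Fin (m + 2)) (x : N.V × N.V) : (bsMod N c e).diff i x
    = (N.diff i x.1 - α m i • τ N x.1, N.diff i x.2 + α m i • x.1) := by
  refine Prod.ext ?_ ?_
  · change N.l i x.1 - (N.r i x.1 + α m i • τ N x.1) = N.l i x.1 - N.r i x.1 - α m i • τ N x.1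
    abel
  · change N.l i x.2 - (N.r i x.2 + α m i • -x.1) = N.l i x.2 - N.r i x.2 + α m i • x.1
    module

lemma diff_τ (i : Fin (m + 2)) (x : N.V) : N.diff i (τ N x) = τ N (N.diff i x) := by
  rw [KMod.diff_apply, KMod.diff_apply, map_sub, l_τ, r_τ]

section

variable (S : Strand M N)
include S

lemma div_diff (i : Fin (m + 1)) (x : N.V) : S.div (N.diff i.castSucc x) = N.diff i.castSucc (S.div x) := by
  rw [KMod.diff_apply, KMod.diff_apply, map_sub, S.div_l, S.div_r]

lemma div_τ' (x : N.V) : S.div (τ N x) = x := S.div_τ x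

lemma ev_y (x : N.V) : S.ev (N.r (Fin.last (m + 1)) x) = M.r (Fin.last m) (S.ev x) := by
  have h := S.ev_τ x
  rw [map_sub, S.ev_r] at h
  exact sub_eq_zero.mp h

/-- The action of `y` on the tensor product with `B_i` differs from the left action by a map that
factors through the first coordinate: it sends `(a, b)` to `(τ a, -a)`. Its kernel is the second
coordinate, and its cokernel is identified with `N` by `(a, b) ↦ a + τ b`. -/
def rankBs (c c' d' : ℤ) (e : Bool → ℤ) :
    RankData (bsMod N c e) (res N c' d' (lower e)) (res N c c e) where
  C := N.V
  fC i := N.diff i.castSucc - α m i.castSucc • τ N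
  j := LinearMap.inr k N.V N.V
  u0 := LinearMap.snd k N.V N.V + S.div ∘ₗ LinearMap.fst k N.V N.V
  π := LinearMap.fst k N.V N.V + τ N ∘ₗ LinearMap.snd k N.V N.V
  sec := LinearMap.inl k N.V N.V
  c0 := (τ N).prod (-LinearMap.id)
  c1 := LinearMap.id.prod (-S.div)
  p0 := -LinearMap.snd k N.V N.V
  p1 := LinearMap.fst k N.V N.V
  jl i x := Prod.ext (map_zero (N.l i.castSucc)).symm rfl
  jr i x := by
    refine Prod.ext ?_ ?_
    · change (0 : N.V) = N.r i.castSucc 0 + α m i.castSucc • τ N 0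
      rw [map_zero, map_zero, smul_zero, add_zero]
    · change N.r i.castSucc x = N.r i.castSucc x + α m i.castSucc • -(0 : N.V)
      rw [neg_zero, smul_zero, add_zero]
  jt x := Prod.ext (map_zero N.dt).symm rfl
  jG b i x hx := ⟨Submodule.zero_mem _, mem_of_eq (G := N.Gr b) hx (by simp only [lower]; ring)⟩
  ud i x := by
    rw [diff_bsMod]
    change N.diff i.castSucc x.2 + α m i.castSucc • x.1
      + S.div (N.diff i.castSucc x.1 - α m i.castSucc • τ N x.1)
      = N.diff i.castSucc (x.2 + S.div x.1)
    rw [map_sub, map_zsmul, S.div_τ', S.div_diff, map_add]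
    abel
  uG b i x hx := Submodule.add_mem _ (mem_of_eq (G := N.Gr b) hx.2 (by simp only [lower]; ring))
    (mem_of_eq (G := N.Gr b) (S.divG b _ _ hx.1) (by simp only [lower]; ring))
  πl i x := by
    change N.l i.castSucc x.1 + τ N (N.l i.castSucc x.2) = N.l i.castSucc (x.1 + τ N x.2)
    rw [map_add, l_τ]
  πr i x := by
    change N.r i.castSucc x.1 + α m i.castSucc • τ N x.1
      + τ N (N.r i.castSucc x.2 + α m i.castSucc • -x.1) = N.r i.castSucc (x.1 + τ N x.2)
    rw [map_add, map_add, map_zsmul, map_neg, r_τ]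
    module
  πt x := by
    change N.dt x.1 + τ N (N.dt x.2) = N.dt (x.1 + τ N x.2)
    rw [map_add, dt_τ]
  πG b i x hx := Submodule.add_mem _ hx.1 (mem_of_eq (G := N.Gr b) (τ_G N b _ _ hx.2) (by ring))
  secG b i x hx := ⟨hx, Submodule.zero_mem _⟩
  c0f i x := by
    rw [diff_bsMod]
    refine Prod.ext ?_ ?_
    · change τ N (N.diff i.castSucc x - α m i.castSucc • τ N x)
        = N.diff i.castSucc (τ N x) - α m i.castSucc • τ N (τ N x)
      rw [map_sub, map_zsmul, diff_τ]
    · change -(N.diff i.castSucc x - α m i.castSucc • τ N x)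
        = N.diff i.castSucc (-x) + α m i.castSucc • τ N x
      rw [map_neg]
      abel
  c1f i x := by
    rw [diff_bsMod]
    refine Prod.ext rfl ?_
    change -S.div (N.diff i.castSucc x - α m i.castSucc • τ N x)
      = N.diff i.castSucc (-S.div x) + α m i.castSucc • x
    rw [map_neg, map_sub, map_zsmul, S.div_τ', S.div_diff]
    abel
  cG b i x hx := by
    refine ⟨Submodule.neg_mem _ (mem_of_eq (G := N.Gr b) hx.2 (by ring)), Submodule.neg_mem _ ?_⟩
    exact mem_of_eq (G := N.Gr b) (S.divG b _ _ (Submodule.neg_mem _ hx.2)) (by ring)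
  φ x := by
    rw [diff_bsMod, α_last, KMod.diff_apply, KMod.diff_apply, S.last, S.last, sub_self, sub_self]
    refine Prod.ext ?_ ?_
    · change 0 - (-1 : ℤ) • τ N x.1 = τ N x.1
      module
    · change 0 + (-1 : ℤ) • x.1 = -x.1
      module
  uj x := by
    change x + S.div 0 = x
    rw [map_zero, add_zero]
  uc x := neg_add_cancel (S.div x)
  pj x := rfl
  pc1 x := rfl
  sum1 x := by
    refine Prod.ext (zero_add x.1) ?_
    change x.2 + S.div x.1 + -S.div x.1 = x.2
    abel
  πsec x := by
    change x + τ N 0 = x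
    rw [map_zero, add_zero]
  πc x := by
    change τ N x + τ N (-x) = 0
    rw [map_neg, add_neg_cancel]
  pc0 x := neg_neg x
  sum0 x := by
    refine Prod.ext ?_ ?_
    · change τ N (-x.2) + (x.1 + τ N x.2) = x.1
      rw [map_neg]
      abel
    · change - -x.2 + 0 = x.2
      rw [neg_neg, add_zero]

/-- The two actions of `y` on `N` agree, so the rank factorization is through zero: kernel and cokernel
are `N` itself. -/
def rankR (c d : ℤ) (e : Bool → ℤ) :
    RankData (N.twisted (xy m c d) e) (res N c (d + 2) e) (res N c d e) where
  C := PUnit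
  fC i := 0
  j := LinearMap.id
  u0 := LinearMap.id
  π := LinearMap.id
  sec := LinearMap.id
  c0 := 0
  c1 := 0
  p0 := 0
  p1 := 0
  jl i x := rfl
  jr i x := rfl
  jt x := rfl
  jG b i x hx := hx
  ud i x := rfl
  uG b i x hx := hx
  πl i x := rfl
  πr i x := rfl
  πt x := rfl
  πG b i x hx := hx
  secG b i x hx := hx
  c0f i x := (map_zero _).symm
  c1f i x := (map_zero _).symm
  cG b i x hx := Submodule.zero_mem _
  φ x := (KMod.diff_apply N _ x).trans (sub_eq_zero.mpr (S.last x))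
  uj x := rfl
  uc x := rfl
  pj x := rfl
  pc1 x := rfl
  sum1 x := add_zero x
  πsec x := rfl
  πc x := rfl
  pc0 x := rfl
  sum0 x := zero_add x

/-- The twist of the kernel: `c + 1` from the second basis element of `B_i`, and `2 y` from the
suspension. -/
lemma rankBs_jq {c c' d' : ℤ} (hc : c' = c + 1) (hd : d' = c + 3) (e : Bool → ℤ) (x : N.V) : (S.rankBs c c' d' e).j ((res N c' d' (lower e)).dq x)
    = (bsMod N c e).dq ((S.rankBs c c' d' e).j x) + ((bsMod N c e).l (Fin.last (m + 1)) ((S.rankBs c c' d' e).j x)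
      + (bsMod N c e).r (Fin.last (m + 1)) ((S.rankBs c c' d' e).j x)) := by
  subst hc hd
  refine Prod.ext ?_ ?_
  · change (0 : N.V) = N.dq 0 + N.form (xy m c c) 0 + (N.l (Fin.last (m + 1)) 0
      + (N.r (Fin.last (m + 1)) 0 + α m (Fin.last (m + 1)) • τ N 0))
    simp only [map_zero, smul_zero, add_zero]
  · change N.dq x + N.form (xy m (c + 1) (c + 3)) x = N.dq x + N.form (xy m (c + 1) (c + 1)) x
      + (N.l (Fin.last (m + 1)) x + (N.r (Fin.last (m + 1)) x + α m (Fin.last (m + 1)) • -(0 : N.V)))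
    rw [S.last, form_xy, form_xy]
    module

lemma rankBs_πq (c c' d' : ℤ) (e : Bool → ℤ) (x : N.V × N.V) : (S.rankBs c c' d' e).π ((bsMod N c e).dq x)
    = (res N c c e).dq ((S.rankBs c c' d' e).π x) := by
  change N.dq x.1 + N.form (xy m c c) x.1 + τ N (N.dq x.2 + N.form (xy m (c + 1) (c + 1)) x.2)
    = N.dq (x.1 + τ N x.2) + N.form (xy m c c) (x.1 + τ N x.2)
  rw [form_xy, form_xy, form_xy]
  simp only [map_add, map_zsmul, dq_τ, r_τ]
  module

lemma rankR_jq (c d : ℤ) (e : Bool → ℤ) (x : N.V) : (S.rankR c d e).j ((res N c (d + 2) e).dq x)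
    = (N.twisted (xy m c d) e).dq ((S.rankR c d e).j x)
      + ((N.twisted (xy m c d) e).l (Fin.last (m + 1)) ((S.rankR c d e).j x)
      + (N.twisted (xy m c d) e).r (Fin.last (m + 1)) ((S.rankR c d e).j x)) := by
  change N.dq x + N.form (xy m c (d + 2)) x = N.dq x + N.form (xy m c d) x
      + (N.l (Fin.last (m + 1)) x + N.r (Fin.last (m + 1)) x)
  rw [S.last, form_xy, form_xy]
  module

end

section Hom

variable (N)

/-- Multiplication from the tensor product with `B_i`. -/
abbrev brHom (e : Bool → ℤ) : KMod.Hom (bsMod N 0 e) (N.twisted (xy m 0 0) e) where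
  f := LinearMap.fst k N.V N.V + τ N ∘ₗ LinearMap.snd k N.V N.V
  fl i x := by
    change N.l i x.1 + τ N (N.l i x.2) = N.l i (x.1 + τ N x.2)
    rw [map_add, l_τ]
  fr i x := by
    change N.r i x.1 + α m i • τ N x.1 + τ N (N.r i x.2 + α m i • -x.1) = N.r i (x.1 + τ N x.2)
    rw [map_add, map_add, map_zsmul, map_neg, r_τ]
    module
  ft x := by
    change N.dt x.1 + τ N (N.dt x.2) = N.dt (x.1 + τ N x.2)
    rw [map_add, dt_τ]
  fG b i x hx := Submodule.add_mem _ hx.1 (mem_of_eq (G := N.Gr b) (τ_G N b _ _ hx.2) (by ring))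

lemma brHom_q (e : Bool → ℤ) (x : N.V × N.V) : (brHom N e).f ((bsMod N 0 e).dq x)
    = (N.twisted (xy m 0 0) e).dq ((brHom N e).f x) := by
  change N.dq x.1 + N.form (xy m 0 0) x.1 + τ N (N.dq x.2 + N.form (xy m (0 + 1) (0 + 1)) x.2)
    = N.dq (x.1 + τ N x.2) + N.form (xy m 0 0) (x.1 + τ N x.2)
  rw [form_xy, form_xy, form_xy]
  simp only [map_add, map_zsmul, dq_τ, r_τ]
  module

/-- The bimodule map with value `y ⊗ 1 - 1 ⊗ x` at `1`, tensored with `N`. -/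
abbrev rbHom (e : Bool → ℤ) : KMod.Hom (N.twisted (xy m 0 0) (lower e)) (bsMod N (-1) e) where
  f := LinearMap.inr k N.V N.V
  fl i x := Prod.ext (map_zero (N.l i)).symm rfl
  fr i x := by
    refine Prod.ext ?_ ?_
    · change (0 : N.V) = N.r i 0 + α m i • τ N 0
      rw [map_zero, map_zero, smul_zero, add_zero]
    · change N.r i x = N.r i x + α m i • -(0 : N.V)
      rw [neg_zero, smul_zero, add_zero]
  ft x := Prod.ext (map_zero N.dt).symm rfl
  fG b i x hx := ⟨Submodule.zero_mem _, mem_of_eq (G := N.Gr b) hx (by simp only [lower]; ring)⟩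

lemma rbHom_q (e : Bool → ℤ) (x : N.V) : (rbHom N e).f ((N.twisted (xy m 0 0) (lower e)).dq x)
    = (bsMod N (-1) e).dq ((rbHom N e).f x) := by
  refine Prod.ext ?_ rfl
  change (0 : N.V) = N.dq 0 + N.form (xy m (-1) (-1)) 0
  rw [map_zero, map_zero, add_zero]

/-- Multiplication by `τ`. -/
abbrev τHom (c' d' c d : ℤ) (e : Bool → ℤ) : KMod.Hom (res N c' d' (lower e)) (res N c d e) where
  f := τ N
  fl i x := (l_τ N _ x).symm
  fr i x := (r_τ N _ x).symm
  ft x := (dt_τ N x).symm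
  fG b i x hx := mem_of_eq (G := N.Gr b) (τ_G N b _ _ hx) (by simp only [lower]; ring)

/-- Multiplication by `τ = y - x` shifts the twist by `x + y`, as `∂_q τ = (x + y) τ`. -/
lemma τHom_q {c' d' c d : ℤ} (hc : c' = c + 1) (hd : d' = d + 1) (e : Bool → ℤ) (x : N.V) :
    (τHom N c' d' c d e).f ((res N c' d' (lower e)).dq x) = (res N c d e).dq ((τHom N c' d' c d e).f x) := by
  subst hc hd
  change τ N (N.dq x + N.form (xy m (c + 1) (d + 1)) x) = N.dq (τ N x) + N.form (xy m c d) (τ N x)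
  rw [form_xy, form_xy]
  simp only [map_add, map_zsmul, dq_τ, r_τ]
  module

end Hom

variable (S : Strand M N) (p : ℕ)

/-- The result of closing the last strand: the substitution of `x` for `y` turns a twist by
`c x + d y` into a twist by `(c + d) x`. -/
abbrev closed (M : KMod k (m + 1)) (c : ℤ) (e : Bool → ℤ) : KMod k (m + 1) :=
  M.twisted (Pi.single (Fin.last m) c) e

/-- The substitution of `x` for `y`. -/
abbrev evHom (c d f : ℤ) (e : Bool → ℤ) : KMod.Hom (res N c d e) (closed M f e) where
  f := S.ev
  fl := S.ev_l
  fr := S.ev_r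
  ft := S.ev_t
  fG b i x hx := S.evG b _ x hx

lemma evHom_q {c d f : ℤ} (hf : f = c + d) (e : Bool → ℤ) (x : N.V) :
    (S.evHom c d f e).f ((res N c d e).dq x) = (closed M f e).dq ((S.evHom c d f e).f x) := by
  subst hf
  change S.ev (N.dq x + N.form (xy m c d) x) = M.dq (S.ev x) + M.form (Pi.single (Fin.last m) (c + d)) (S.ev x)
  rw [form_xy, form_single, map_add, map_add, map_zsmul, map_zsmul, S.ev_y, S.ev_r, S.ev_q]
  module

/-- The inclusion of the constants in `y`. -/
abbrev constHom (c d f : ℤ) (e : Bool → ℤ) : KMod.Hom (closed M f e) (res N c d e) where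
  f := S.const
  fl := S.const_l
  fr := S.const_r
  ft := S.const_t
  fG b i x hx := S.constG b _ x hx

/-- The divided difference, a retraction of the multiplication by `τ`. -/
abbrev divHom (c' d' c d : ℤ) (e : Bool → ℤ) : KMod.Hom (res N c d e) (res N c' d' (lower e)) where
  f := S.div
  fl := S.div_l
  fr := S.div_r
  ft := S.div_t
  fG b i x hx := mem_of_eq (G := N.Gr b) (S.divG b _ x hx) (by simp only [lower]; ring)

/-- The short exact sequence of Koszul complexes given by multiplication by `τ`. -/
abbrev ses {c' d' c d f : ℤ} (hc : c' = c + 1) (hd : d' = d + 1) (hf : f = c + d) (e : Bool → ℤ) :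
    L1SES ((res N c' d' (lower e)).kosL p) ((res N c d e).kosL p) ((closed M f e).kosL p) where
  t := (τHom N c' d' c d e).kos p
  ev := (S.evHom c d f e).kos p
  div := (S.divHom c' d' c d e).kos p
  const := (S.constHom c d f e).kos p
  tQ := KMod.Hom.kos_Q p _ (τHom_q N hc hd e)
  evQ := KMod.Hom.kos_Q p _ (S.evHom_q hf e)
  div_t x := funext fun a => S.div_τ _
  ev_t x := funext fun a => S.ev_τ _
  ev_const x := funext fun a => S.ev_const _
  div_const x := funext fun a => S.div_const _
  sum x := funext fun a => S.sum _

variable {p} [Fact p.Prime] [CharP k p]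

/-- Closing the last strand after a positive crossing. The kernels of the rank factorizations form
the suspension of the total space of multiplication by `τ`, and the cokernels the total space of an
identity, which is contractible. The former reduces to the chain of copies of the cokernel of `τ`, a
twist of `M`, and the chain cancels against the suspension. -/
noncomputable def loIso (hodd : Odd p) (e : Bool → ℤ) {T : KMod k (m + 2)}
    (L : KMod.LoModel p T (bsMod N 0 e) (N.twisted (xy m 0 0) e) (brHom N e))
    (hT : (T.kosL p).T ^ p = 0) (hM : M.dt ^ p = 0) :
    SlashIso p (L1.ext p (T.kosL p)) (L1.ext p (((closed M 2 e).kosL p).shift (L1.qsh 4))) :=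
  let i := L.iso (KMod.Hom.kos_Q p _ (brHom_q N e))
  let E := S.ses (c' := 1) (d' := 3) (c := 0) (d := 2) (f := 2) p rfl rfl rfl e
  let dB := S.rankBs 0 1 3 e
  let dR := S.rankR 0 0 e
  let s := (dB.split p hodd).lo (dR.split p hodd)
    (L1.suspMap p E.t) ((brHom N e).kos p) (L1Map.id _) (L1.suspSES p E).tQ
    (KMod.Hom.kos_Q p _ (brHom_q N e)) (fun _ => rfl)
    (RankData.ι_map dB dR p (brHom N e) (τHom N 1 3 0 2 e) fun x => zero_add _)
    (RankData.f_map dB dR p (brHom N e) (KMod.Hom.id _) fun x => rfl)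
  have hD' := i.pow_D (KMod.kosL_pow p T)
  have hT' := i.pow_T hT
  let s' := L1.splitLo (L1.suspSES p E)
  ((i.ext p).hEquiv p).slashIso.trans
    ((s.extSub hodd hD' hT' (L1.loCon hodd _ _) fun x => Prod.ext
      (dB.ι_Q p (S.rankBs_jq rfl rfl e) x.1) (funext fun s => dR.ι_Q p (S.rankR_jq 0 0 e) (x.2 s))).symm.trans
    ((s'.extQuotient hodd (s.sub_pow s.ιD hD') (s.sub_pow s.ιT hT') (L1.loCon hodd _ _)
      fun x => funext fun s => (L1.suspSES p E).evQ (x.2 s)).trans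
    (L1.extUpSusp p hodd _ (KMod.kosL_T_pow hM))))

/-- Closing the last strand after a negative crossing. The kernels of the rank factorizations form
the total space of an identity, which is contractible, and the cokernels the total space of
multiplication by `τ`, which reduces to the cokernel of `τ`, a twist of `M`. -/
noncomputable def hiIso (hodd : Odd p) (e : Bool → ℤ) {T : KMod k (m + 2)}
    (L : KMod.HiModel p T (bsMod N (-1) e) (N.twisted (xy m 0 0) (lower e)) (rbHom N e))
    (hT : (T.kosL p).T ^ p = 0) :
    SlashIso p (L1.ext p (T.kosL p)) (L1.ext p ((closed M (-2) e).kosL p)) :=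
  let i := L.iso (KMod.Hom.kos_Q p _ (rbHom_q N e))
  let E := S.ses (c' := 0) (d' := 0) (c := -1) (d := -1) (f := -2) p rfl rfl rfl e
  let dB := S.rankBs (-1) 0 2 e
  let dR := S.rankR 0 0 (lower e)
  let s := (dR.split p hodd).hi (dB.split p hodd)
    (L1Map.id _) ((rbHom N e).kos p) E.t (fun _ => rfl) (KMod.Hom.kos_Q p _ (rbHom_q N e)) E.tQ
    (RankData.ι_map dR dB p (rbHom N e) (KMod.Hom.id _) fun x => rfl)
    (RankData.f_map dR dB p (rbHom N e) (τHom N 0 0 (-1) (-1) e) fun x => zero_add _)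
  have hD' := i.pow_D (KMod.kosL_pow p T)
  have hT' := i.pow_T hT
  let s' := L1.splitHi E
  ((i.ext p).hEquiv p).slashIso.trans
    ((s.extQuotient hodd hD' hT' (L1.hiCon hodd _ _) fun x => Prod.ext
      (dB.f_Q p (S.rankBs_πq (-1) 0 2 e) x.1) (funext fun s => dR.f_Q p (fun _ => rfl) (x.2 s))).trans
    (s'.extQuotient hodd (s.quotient_pow s.fD hD') (s.quotient_pow s.fT hT') (L1.hiCon hodd _ _)
      fun x => E.evQ x.1))

end Strand

end PHHH

/-! ### Homogeneity of the braid complexes -/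

namespace PHHH
open MvPolynomial (X)
variable {k : Type u} [Field k]

section Gradings

lemma polGr_le {n : ℕ} {j : ℤ} {S : Submodule k (Pol k n)}
    (h : ∀ d : ℕ, 2 * (d : ℤ) = j → ∀ f : Pol k n, f.IsHomogeneous d → f ∈ S) : polGr k n j ≤ S :=
  iSup₂_le fun d hd f hf => h d hd f hf

lemma mem_polGr {n d : ℕ} {j : ℤ} {f : Pol k n} (hf : f.IsHomogeneous d) (h : 2 * (d : ℤ) = j) :
    f ∈ polGr k n j :=
  Submodule.mem_iSup_of_mem d (Submodule.mem_iSup_of_mem h hf)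

lemma mul_mem_polGr {n : ℕ} {a b : ℤ} {f g : Pol k n} (hf : f ∈ polGr k n a) (hg : g ∈ polGr k n b) :
    f * g ∈ polGr k n (a + b) := by
  refine polGr_le (S := (polGr k n (a + b)).comap (LinearMap.mulRight k g)) (fun d hd f hf => ?_) hf
  refine polGr_le (S := (polGr k n (a + b)).comap (LinearMap.mulLeft k f)) (fun e he g hg => ?_) hg
  exact mem_polGr (hf.mul hg) (by push_cast; omega)

lemma X_mem_polGr {n : ℕ} (i : Fin n) : X i ∈ polGr k n 2 :=
  mem_polGr (MvPolynomial.isHomogeneous_X k i) rfl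

lemma one_mem_polGr {n : ℕ} : (1 : Pol k n) ∈ polGr k n 0 :=
  mem_polGr (MvPolynomial.isHomogeneous_one _ k) rfl

variable {R M N : Type*} [CommRing R] [Algebra k R] [AddCommGroup M] [AddCommGroup N]
  [Module R M] [Module R N] [Module k M] [Module k N] [IsScalarTower k R M] [IsScalarTower k R N]

lemma tensorGr_map {F : ℤ → Submodule k M} {G : ℤ → Submodule k N} {V : Type*} [AddCommGroup V]
    [Module k V] (f : M ⊗[R] N →ₗ[k] V) {S : Submodule k V} {j : ℤ}
    (h : ∀ a b, a + b = j → ∀ m ∈ F a, ∀ n ∈ G b, f (m ⊗ₜ n) ∈ S) {x : M ⊗[R] N}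
    (hx : x ∈ tensorGr F G j) : f x ∈ S := by
  refine (Submodule.span_le (p := S.comap f)).mpr ?_ hx
  rintro _ ⟨a, b, hab, m, hm, n, hn, rfl⟩
  exact h a b hab m hm n hn

lemma tmul_mem_tensorGr {F : ℤ → Submodule k M} {G : ℤ → Submodule k N} {a b j : ℤ} {m : M} {n : N}
    (hm : m ∈ F a) (hn : n ∈ G b) (h : a + b = j) : m ⊗ₜ[R] n ∈ tensorGr F G j :=
  Submodule.subset_span ⟨a, b, h, m, hm, n, hn, rfl⟩

end Gradings

variable {p n : ℕ}

/-- All operators are homogeneous: the variables have `q`-degree `2`, and the boundary map has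
topological degree `-1`. -/
structure PBimod.Homog (M : PBimod k p n) : Prop where
  lq : ∀ i j x, x ∈ M.grq j → M.left (X i) x ∈ M.grq (j + 2)
  rq : ∀ i j x, x ∈ M.grq j → M.right (X i) x ∈ M.grq (j + 2)
  lt : ∀ i j x, x ∈ M.grt j → M.left (X i) x ∈ M.grt j
  rt : ∀ i j x, x ∈ M.grt j → M.right (X i) x ∈ M.grt j
  tq : ∀ j x, x ∈ M.grq j → M.dt x ∈ M.grq j
  tt : ∀ j x, x ∈ M.grt j → M.dt x ∈ M.grt (j - 1)

namespace PBimod.Homog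

section Action

variable {V : Type*} [AddCommGroup V] [Module k V] (ρ : Pol k n →ₐ[k] Module.End k V)

lemma act_mem {S : Submodule k V} (h : ∀ i, ∀ x ∈ S, ρ (X i) x ∈ S) (f : Pol k n) :
    ∀ x ∈ S, ρ f x ∈ S := by
  induction f using MvPolynomial.induction_on with
  | C a =>
    intro x hx
    rw [show MvPolynomial.C a = algebraMap k (Pol k n) a from rfl, ρ.commutes]
    exact S.smul_mem a hx
  | add f g hf hg =>
    intro x hx
    rw [map_add]
    exact S.add_mem (hf x hx) (hg x hx)
  | mul_X f i hf =>
    intro x hx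
    rw [map_mul]
    exact hf _ (h i x hx)

lemma act_monomial_mem {G : ℤ → Submodule k V} (h : ∀ i j, ∀ x ∈ G j, ρ (X i) x ∈ G (j + 2))
    (e : Fin n →₀ ℕ) : ∀ (c : k) (j : ℤ), ∀ x ∈ G j,
      ρ (MvPolynomial.monomial e c) x ∈ G (j + 2 * (e.degree : ℕ)) := by
  have hc : ∀ (c : k) (j : ℤ), ∀ x ∈ G j, ρ (MvPolynomial.C c) x ∈ G j := by
    intro c j x hx
    rw [show MvPolynomial.C c = algebraMap k (Pol k n) c from rfl, ρ.commutes]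
    exact (G j).smul_mem c hx
  induction e using Finsupp.induction_linear with
  | zero =>
    intro c j x hx
    exact mem_of_eq (G := G) (hc c j x hx) (by simp)
  | add e e' he he' =>
    intro c j x hx
    rw [← one_mul c, ← MvPolynomial.monomial_mul, map_mul]
    exact mem_of_eq (G := G) (he 1 _ _ (he' c j x hx)) (by rw [map_add]; push_cast; ring)
  | single i r =>
    intro c j x hx
    rw [← MvPolynomial.C_mul_X_pow_eq_monomial, map_mul]
    refine hc _ _ _ ?_
    have : ∀ r : ℕ, ρ (X i ^ r) x ∈ G (j + 2 * (r : ℕ)) := by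
      intro r
      induction r with
      | zero => rw [pow_zero, map_one]; exact mem_of_eq (G := G) hx (by simp)
      | succ r ih =>
        rw [pow_succ', map_mul]
        exact mem_of_eq (G := G) (h i _ _ ih) (by push_cast; ring)
    exact mem_of_eq (G := G) (this r) (by simp)

lemma act_polGr_mem {G : ℤ → Submodule k V} (h : ∀ i j, ∀ x ∈ G j, ρ (X i) x ∈ G (j + 2))
    {d j : ℤ} {f : Pol k n} (hf : f ∈ polGr k n d) {x : V} (hx : x ∈ G j) : ρ f x ∈ G (j + d) := by
  refine polGr_le (S := (G (j + d)).comap ((LinearMap.applyₗ x).comp ρ.toLinearMap))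
    (fun e he f hf => ?_) hf
  change ρ f x ∈ G (j + d)
  rw [← MvPolynomial.support_sum_monomial_coeff f, map_sum, LinearMap.sum_apply]
  refine Submodule.sum_mem _ fun s hs => mem_of_eq (G := G) (act_monomial_mem ρ h s _ j x hx) ?_
  have : s.degree = e := by
    have := hf (MvPolynomial.mem_support_iff.mp hs)
    rw [Finsupp.degree_eq_weight_one]
    exact this
  rw [this, he]

end Action

/-- The associated `KMod`. -/
noncomputable abbrev toKMod {M : PBimod k p n} (h : M.Homog) : KMod k n where
  V := M.carrier
  l i := M.left (X i)
  r i := M.right (X i)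
  dq := M.dq
  dt := M.dt
  Gr b := if b then M.grt else M.grq
  ll i j x := by
    rw [← Module.End.mul_apply, ← map_mul, mul_comm, map_mul]; rfl
  rr i j x := by
    rw [← Module.End.mul_apply, ← map_mul, mul_comm, map_mul]; rfl
  lr i j x := LinearMap.congr_fun (M.left_right (X i) (X j)) x
  ql i x := by
    have := LinearMap.congr_fun (M.dq_left (X i)) x
    rwa [dPol, MvPolynomial.mkDerivation_X, pow_two, map_mul] at this
  qr i x := by
    have := LinearMap.congr_fun (M.dq_right (X i)) x
    rwa [dPol, MvPolynomial.mkDerivation_X, pow_two, map_mul] at this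
  tl i x := LinearMap.congr_fun (M.dt_left (X i)) x
  tr i x := LinearMap.congr_fun (M.dt_right (X i)) x
  tq x := LinearMap.congr_fun M.dt_dq x
  lG i b j x hx := by
    cases b
    · exact h.lq i j x hx
    · exact mem_of_eq (G := M.grt) (h.lt i j x hx) (add_zero j).symm
  rG i b j x hx := by
    cases b
    · exact h.rq i j x hx
    · exact mem_of_eq (G := M.grt) (h.rt i j x hx) (add_zero j).symm
  tG b j x hx := by
    cases b
    · exact mem_of_eq (G := M.grq) (h.tq j x hx) (sub_zero j).symm
    · exact h.tt j x hx

variable [Fact p.Prime] [CharP k p]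

lemma reg_left_mem (i : Fin n) (j : ℤ) (f : Pol k n) (hf : f ∈ polGr k n j) : X i * f ∈ polGr k n (j + 2) :=
  mem_of_eq (G := polGr k n) (mul_mem_polGr (X_mem_polGr i) hf) (add_comm 2 j)

lemma reg : ((reg k p n).toPBimod (Fact.out : p.Prime).ne_zero).Homog where
  lq := reg_left_mem
  rq := reg_left_mem
  lt i j x hx := act_mem (Algebra.lmul k (Pol k n)) (S := if j = 0 then ⊤ else ⊥)
    (fun i x hx => by
      by_cases h : j = 0
      · rw [if_pos h]; trivial
      · rw [if_neg h] at hx ⊢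
        rw [(Submodule.mem_bot k).mp hx, map_zero]
        exact Submodule.zero_mem _) (X i) x hx
  rt i j x hx := act_mem (Algebra.lmul k (Pol k n)) (S := if j = 0 then ⊤ else ⊥)
    (fun i x hx => by
      by_cases h : j = 0
      · rw [if_pos h]; trivial
      · rw [if_neg h] at hx ⊢
        rw [(Submodule.mem_bot k).mp hx, map_zero]
        exact Submodule.zero_mem _) (X i) x hx
  tq j x hx := Submodule.zero_mem _
  tt j x hx := Submodule.zero_mem _

lemma mem_of_val_eq {V : Type*} [AddCommGroup V] [Module k V] {S : Submodule k V} {x y : V} (h : x = y)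
    (hy : y ∈ S) : x ∈ S := h ▸ hy

lemma tensor {M N : PBimod k p n} (hM : M.Homog) (hN : N.Homog) : (M.tensor N).Homog := by
  have hq : ∀ {a b j : ℤ} {u : M.AsRight} {v : N.AsLeft}, u ∈ M.grqR a → v ∈ N.grqL b → a + b = j →
    u ⊗ₜ[Pol k n] v ∈ tensorGr M.grqR N.grqL j := tmul_mem_tensorGr
  have ht : ∀ {a b j : ℤ} {u : M.AsRight} {v : N.AsLeft}, u ∈ M.grtR a → v ∈ N.grtL b → a + b = j →
    u ⊗ₜ[Pol k n] v ∈ tensorGr M.grtR N.grtL j := tmul_mem_tensorGr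
  have hl : ∀ (f : Pol k n) (u : M.AsRight) (v : N.AsLeft),
    (M.tensor N).left f (u ⊗ₜ[Pol k n] v) = M.leftR f u ⊗ₜ[Pol k n] v :=
    actL_tmul M.leftR M.leftR_smul
  have hr : ∀ (f : Pol k n) (u : M.AsRight) (v : N.AsLeft),
    (M.tensor N).right f (u ⊗ₜ[Pol k n] v) = u ⊗ₜ[Pol k n] N.rightL f v :=
    actR_tmul N.rightL N.rightL_smul
  refine ⟨fun i j x hx => ?_, fun i j x hx => ?_, fun i j x hx => ?_, fun i j x hx => ?_,
    fun j x hx => ?_, fun j x hx => ?_⟩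
  · refine tensorGr_map (F := M.grqR) (G := N.grqL) ((M.tensor N).left (X i)) (fun a b hab u hu v hv => ?_) hx
    exact mem_of_val_eq (hl _ _ _) (hq (hM.lq i a u hu) hv (by omega))
  · refine tensorGr_map (F := M.grqR) (G := N.grqL) ((M.tensor N).right (X i)) (fun a b hab u hu v hv => ?_) hx
    exact mem_of_val_eq (hr _ _ _) (hq hu (hN.rq i b v hv) (by omega))
  · refine tensorGr_map (F := M.grtR) (G := N.grtL) ((M.tensor N).left (X i)) (fun a b hab u hu v hv => ?_) hx
    exact mem_of_val_eq (hl _ _ _) (ht (hM.lt i a u hu) hv hab)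
  · refine tensorGr_map (F := M.grtR) (G := N.grtL) ((M.tensor N).right (X i)) (fun a b hab u hu v hv => ?_) hx
    exact mem_of_val_eq (hr _ _ _) (ht hu (hN.rt i b v hv) hab)
  · exact tensorGr_map (F := M.grqR) (G := N.grqL) (M.tensor N).dt (fun a b hab u hu v hv =>
      Submodule.add_mem _ (hq (hM.tq a u hu) hv hab) (hq hu (hN.tq b v hv) hab)) hx
  · exact tensorGr_map (F := M.grtR) (G := N.grtL) (M.tensor N).dt (fun a b hab u hu v hv =>
      Submodule.add_mem _ (ht (hM.tt a u hu) hv (by omega)) (ht hu (hN.tt b v hv) (by omega))) hx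

section Adjoin

variable {V : Type u} [AddCommGroup V] [Module k V] (ρ : Pol k n →ₐ[k] Module.End k V)
  {G : ℤ → Submodule k V}

lemma actExt_memq (h : ∀ i j, ∀ x ∈ G j, ρ (X i) x ∈ G (j + 2)) (i : Fin (n + 1)) (j : ℤ)
    (x : V ⊗[k] Pol k 1) (hx : x ∈ tensorGr G (polGr k 1) j) :
    actExt ρ (X i) x ∈ tensorGr G (polGr k 1) (j + 2) := by
  refine tensorGr_map _ (fun a b hab u hu v hv => ?_) hx
  induction i using Fin.lastCases with
  | last =>
    rw [actExt_last]
    exact tmul_mem_tensorGr hu (reg_left_mem (k := k) 0 b v hv) (by omega)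
  | cast i =>
    rw [actExt_castSucc]
    exact tmul_mem_tensorGr (h i a u hu) hv (by omega)

lemma actExt_memt (h : ∀ i j, ∀ x ∈ G j, ρ (X i) x ∈ G j) (i : Fin (n + 1)) (j : ℤ)
    (x : V ⊗[k] Pol k 1) (hx : x ∈ tensorGr G (fun j => if j = 0 then ⊤ else ⊥) j) :
    actExt ρ (X i) x ∈ tensorGr G (fun j => if j = 0 then ⊤ else ⊥) j := by
  refine tensorGr_map _ (fun a b hab u hu v hv => ?_) hx
  induction i using Fin.lastCases with
  | last =>
    rw [actExt_last]
    refine tmul_mem_tensorGr hu ?_ hab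
    by_cases hb : b = 0
    · simp [hb]
    · rw [if_neg hb] at hv ⊢
      rw [(Submodule.mem_bot k).mp hv, mul_zero]
      exact Submodule.zero_mem _
  | cast i =>
    rw [actExt_castSucc]
    exact tmul_mem_tensorGr (h i a u hu) hv hab

end Adjoin

lemma adjoin {M : PBimod k p n} (h : M.Homog) : M.adjoin.Homog where
  lq := actExt_memq M.left h.lq
  rq := actExt_memq M.right h.rq
  lt := actExt_memt M.left h.lt
  rt := actExt_memt M.right h.rt
  tq j x hx := tensorGr_map _ (fun a b hab u hu v hv => tmul_mem_tensorGr (h.tq a u hu) hv hab) hx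
  tt j x hx := tensorGr_map _ (fun a b hab u hu v hv =>
    tmul_mem_tensorGr (h.tt a u hu) hv (by omega)) hx

section LowHigh

variable {M N : HBimod k p n} (f : M.Hom N)
  (lM : ∀ i j x, x ∈ M.grq j → M.left (X i) x ∈ M.grq (j + 2))
  (rM : ∀ i j x, x ∈ M.grq j → M.right (X i) x ∈ M.grq (j + 2))
  (lN : ∀ i j x, x ∈ N.grq j → N.left (X i) x ∈ N.grq (j + 2))
  (rN : ∀ i j x, x ∈ N.grq j → N.right (X i) x ∈ N.grq (j + 2))
  (hf : ∀ j x, x ∈ M.grq j → f.toLin x ∈ N.grq j)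

lemma map_ite {V W : Type*} [AddCommGroup V] [Module k V] [AddCommGroup W] [Module k W] (g : V →ₗ[k] W)
    {P Q : Prop} [Decidable P] [Decidable Q] (h : P → Q) {x : V}
    (hx : x ∈ (if P then ⊤ else ⊥ : Submodule k V)) : g x ∈ (if Q then ⊤ else ⊥ : Submodule k W) := by
  by_cases hP : P
  · rw [if_pos (h hP)]; trivial
  · rw [if_neg hP, Submodule.mem_bot] at hx
    rw [hx, map_zero]
    exact Submodule.zero_mem _

include lM rM lN rN hf

lemma low : f.low.Homog where
  lq i j x hx := ⟨lM i j _ hx.1, fun s _ => lN i j _ (hx.2 s trivial)⟩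
  rq i j x hx := ⟨rM i j _ hx.1, fun s _ => rN i j _ (hx.2 s trivial)⟩
  lt i j x hx := ⟨map_ite (M.left (X i)) id hx.1, fun s _ => map_ite (N.left (X i)) id (hx.2 s trivial)⟩
  rt i j x hx := ⟨map_ite (M.right (X i)) id hx.1, fun s _ => map_ite (N.right (X i)) id (hx.2 s trivial)⟩
  tq j x hx := ⟨Submodule.zero_mem _, fun s _ => by
    change (if (s : ℕ) = 0 then f.toLin x.1 else x.2 ⟨(s : ℕ) - 1, by omega⟩) ∈ N.grq j
    split_ifs
    · exact hf j _ hx.1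
    · exact hx.2 _ trivial⟩
  tt j x hx := ⟨Submodule.zero_mem _, fun s _ => by
    change (if (s : ℕ) = 0 then f.toLin x.1 else x.2 ⟨(s : ℕ) - 1, by omega⟩) ∈
      (if j - 1 = -((s : ℤ) + 1) then ⊤ else ⊥ : Submodule k N.carrier)
    by_cases h : (s : ℕ) = 0
    · rw [if_pos h]
      exact map_ite f.toLin (fun h => by omega) hx.1
    · rw [if_neg h]
      exact map_ite LinearMap.id (fun h => by simp only at h; omega) (hx.2 ⟨(s : ℕ) - 1, by omega⟩ trivial)⟩

lemma high : f.high.Homog where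
  lq i j x hx := ⟨lN i j _ hx.1, fun s _ => lM i j _ (hx.2 s trivial)⟩
  rq i j x hx := ⟨rN i j _ hx.1, fun s _ => rM i j _ (hx.2 s trivial)⟩
  lt i j x hx := ⟨map_ite (N.left (X i)) id hx.1, fun s _ => map_ite (M.left (X i)) id (hx.2 s trivial)⟩
  rt i j x hx := ⟨map_ite (N.right (X i)) id hx.1, fun s _ => map_ite (M.right (X i)) id (hx.2 s trivial)⟩
  tq j x hx := ⟨hf j _ (hx.2 _ trivial), fun s _ => by
    change (if h : (s : ℕ) + 1 < p - 1 then x.2 ⟨(s : ℕ) + 1, h⟩ else 0) ∈ M.grq j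
    split_ifs
    · exact hx.2 _ trivial
    · exact Submodule.zero_mem _⟩
  tt j x hx := ⟨map_ite f.toLin (fun h => by simp only at h; omega)
      (hx.2 ⟨0, Nat.sub_pos_of_lt (Fact.out : p.Prime).one_lt⟩ trivial), fun s _ => by
    change (if h : (s : ℕ) + 1 < p - 1 then x.2 ⟨(s : ℕ) + 1, h⟩ else 0) ∈
      (if j - 1 = (s : ℤ) + 1 then ⊤ else ⊥ : Submodule k M.carrier)
    by_cases h : (s : ℕ) + 1 < p - 1
    · rw [dif_pos h]
      exact map_ite LinearMap.id (fun h => by simp only at h; omega) (hx.2 ⟨(s : ℕ) + 1, h⟩ trivial)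
    · rw [dif_neg h]
      exact Submodule.zero_mem _⟩

end LowHigh

lemma qshift {M : PBimod k p n} (h : M.Homog) (a : ℤ) : (M.qshift a).Homog where
  lq i j x hx := mem_of_eq (G := M.grq) (h.lq i _ x hx) (by ring)
  rq i j x hx := mem_of_eq (G := M.grq) (h.rq i _ x hx) (by ring)
  lt := h.lt
  rt := h.rt
  tq j := h.tq _
  tt := h.tt

section Crossing

variable (a b : Fin n)

lemma bs_left_mem (i : Fin n) (j : ℤ) (x : BS k a b) (hx : x ∈ tensorGr (polGr k n) (polGr k n) j) :
    bsLeft k a b (X i) x ∈ tensorGr (polGr k n) (polGr k n) (j + 2) :=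
  tensorGr_map _ (fun c d hcd u hu v hv => by
    rw [bsLeft_tmul]
    exact tmul_mem_tensorGr (reg_left_mem i c u hu) hv (by omega)) hx

lemma bs_right_mem (i : Fin n) (j : ℤ) (x : BS k a b) (hx : x ∈ tensorGr (polGr k n) (polGr k n) j) :
    bsRight k a b (X i) x ∈ tensorGr (polGr k n) (polGr k n) (j + 2) :=
  tensorGr_map _ (fun c d hcd u hu v hv => by
    rw [bsRight_tmul]
    exact tmul_mem_tensorGr hu (reg_left_mem i d v hv) (by omega)) hx

lemma brLin_mem (j : ℤ) (x : BS k a b) (hx : x ∈ tensorGr (polGr k n) (polGr k n) j) :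
    brLin k a b x ∈ polGr k n j :=
  tensorGr_map _ (fun c d hcd u hu v hv => by
    rw [brLin_tmul, ← hcd]
    exact mul_mem_polGr hu hv) hx

lemma rbElt_mem : rbElt k a b ∈ tensorGr (polGr k n) (polGr k n) 2 :=
  Submodule.sub_mem _ (tmul_mem_tensorGr (X_mem_polGr b) one_mem_polGr rfl)
    (tmul_mem_tensorGr one_mem_polGr (X_mem_polGr a) rfl)

lemma rb_mem (j : ℤ) (f : Pol k n) (hf : f ∈ polGr k n j) :
    bsLeft k a b f (rbElt k a b) ∈ tensorGr (polGr k n) (polGr k n) (2 + j) :=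
  act_polGr_mem (bsLeft k a b) (fun i j x hx => bs_left_mem a b i j x hx) hf (rbElt_mem a b)

lemma pTpos {m : ℕ} (i : Fin m) : (PHHH.pTpos k p i).Homog :=
  qshift (low (br k p i.castSucc i.succ) (bs_left_mem _ _) (bs_right_mem _ _) reg_left_mem reg_left_mem
    (brLin_mem _ _)) _

lemma pTneg {m : ℕ} (i : Fin m) : (PHHH.pTneg k p i).Homog :=
  qshift (high (rb k p i.castSucc i.succ) reg_left_mem reg_left_mem
    (fun i j x hx => mem_of_eq (G := tensorGr (polGr k _) (polGr k _)) (bs_left_mem _ _ i _ x hx) (by ring))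
    (fun i j x hx => mem_of_eq (G := tensorGr (polGr k _) (polGr k _)) (bs_right_mem _ _ i _ x hx) (by ring))
    (fun j x hx => mem_of_eq (G := tensorGr (polGr k _) (polGr k _)) (rb_mem _ _ j x hx) (by ring))) _

lemma pT {m : ℕ} (β : List (Fin m × Bool)) : (PHHH.pT k p β).Homog := by
  induction β with
  | nil => exact reg
  | cons s w ih =>
    obtain ⟨i, b⟩ := s
    cases b
    · exact tensor (pTneg i) ih
    · exact tensor (pTpos i) ih

end Crossing

end PBimod.Homog

end PHHH

/-! ### The strand adjoined to a bimodule -/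

namespace PHHH
open MvPolynomial (X)
variable {k : Type u} [Field k]

section OneVariable

variable {V : Type u} [AddCommGroup V] [Module k V]

lemma monomial_fin_one (e : Fin 1 →₀ ℕ) : MvPolynomial.monomial e (1 : k) = (X 0 : Pol k 1) ^ e 0 := by
  rw [MvPolynomial.X_pow_eq_monomial]
  exact congrArg (fun e => MvPolynomial.monomial e (1 : k)) (Finsupp.ext fun i => by
    rw [Subsingleton.elim i 0, Finsupp.single_eq_same])

/-- Induction on tensors with powers of the new variable. -/
lemma adjoin_ind {S : Submodule k (V ⊗[k] Pol k 1)} (h : ∀ v (r : ℕ), v ⊗ₜ (X 0 ^ r) ∈ S)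
    (z : V ⊗[k] Pol k 1) : z ∈ S := by
  induction z using TensorProduct.induction_on with
  | zero => exact S.zero_mem
  | add a b ha hb => exact S.add_mem ha hb
  | tmul v g =>
    rw [← MvPolynomial.support_sum_monomial_coeff g, TensorProduct.tmul_sum]
    refine Submodule.sum_mem _ fun e _ => ?_
    rw [← mul_one (MvPolynomial.coeff e g), ← smul_eq_mul, ← MvPolynomial.smul_monomial,
      TensorProduct.tmul_smul, monomial_fin_one]
    exact S.smul_mem _ (h _ _)

lemma adjoin_ext {W : Type*} [AddCommGroup W] [Module k W] {f g : V ⊗[k] Pol k 1 →ₗ[k] W}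
    (h : ∀ v (r : ℕ), f (v ⊗ₜ (X 0 ^ r)) = g (v ⊗ₜ (X 0 ^ r))) (z : V ⊗[k] Pol k 1) : f z = g z :=
  sub_eq_zero.mp (adjoin_ind (S := LinearMap.ker (f - g)) (fun v r => sub_eq_zero.mpr (h v r)) z)

/-- A homogeneous polynomial in one variable is a multiple of a power of it. -/
lemma polGr_one {b : ℤ} {S : Submodule k (Pol k 1)} (h : ∀ r : ℕ, 2 * (r : ℤ) = b → X 0 ^ r ∈ S) :
    polGr k 1 b ≤ S := polGr_le fun d hd f hf => by
  rw [← MvPolynomial.support_sum_monomial_coeff f]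
  refine Submodule.sum_mem _ fun e he => ?_
  rw [← mul_one (MvPolynomial.coeff e f), ← smul_eq_mul, ← MvPolynomial.smul_monomial, monomial_fin_one]
  refine S.smul_mem _ (h _ ?_)
  have h1 := hf (MvPolynomial.mem_support_iff.mp he)
  have h2 : e.degree = d := by rw [Finsupp.degree_eq_weight_one]; exact h1
  rw [Finsupp.degree_eq_sum, Fin.sum_univ_one] at h2
  rw [h2, hd]

/-- The linear map with prescribed values on the tensors with powers of the new variable. -/
noncomputable def adjoinLift {W : Type u} [AddCommGroup W] [Module k W] (f : ℕ → V →ₗ[k] W) :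
    V ⊗[k] Pol k 1 →ₗ[k] W :=
  TensorProduct.lift (((MvPolynomial.basisMonomials (Fin 1) k).constr k fun e => f (e 0)).flip)

lemma adjoinLift_tmul {W : Type u} [AddCommGroup W] [Module k W] (f : ℕ → V →ₗ[k] W) (v : V) (r : ℕ) :
    adjoinLift f (v ⊗ₜ (X 0 ^ r)) = f r v := by
  rw [adjoinLift, TensorProduct.lift.tmul, LinearMap.flip_apply, MvPolynomial.X_pow_eq_monomial]
  have := (MvPolynomial.basisMonomials (Fin 1) k).constr_basis k (fun e => f (e 0)) (Finsupp.single 0 r)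
  rw [MvPolynomial.coe_basisMonomials] at this
  rw [this, Finsupp.single_eq_same]

variable (ρ : Module.End k V)

/-- The quotients of `x ^ r - y ^ r` by `x - y`. -/
noncomputable def divPow : ℕ → V →ₗ[k] V ⊗[k] Pol k 1
  | 0 => 0
  | r + 1 => (TensorProduct.mk k V (Pol k 1)).flip (X 0 ^ r) + ρ.rTensor (Pol k 1) ∘ₗ divPow r

lemma divPow_succ (r : ℕ) (v : V) : divPow ρ (r + 1) v = v ⊗ₜ (X 0 ^ r) + ρ.rTensor (Pol k 1) (divPow ρ r v) := rfl

lemma divPow_comm (E : Module.End k V) (h : ∀ v, E (ρ v) = ρ (E v)) (r : ℕ) (v : V) :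
    divPow ρ r (E v) = E.rTensor (Pol k 1) (divPow ρ r v) := by
  induction r generalizing v with
  | zero => exact (map_zero _).symm
  | succ r ih =>
    have hc : ρ ∘ₗ E = E ∘ₗ ρ := LinearMap.ext fun v => (h v).symm
    have hc' := congrArg (LinearMap.rTensor (Pol k 1)) hc
    rw [LinearMap.rTensor_comp, LinearMap.rTensor_comp] at hc'
    rw [divPow_succ, divPow_succ, map_add, ih, LinearMap.rTensor_tmul]
    exact congrArg _ (LinearMap.congr_fun hc' _)

lemma divPow_memq {G : ℤ → Submodule k V} (h : ∀ j, ∀ x ∈ G j, ρ x ∈ G (j + 2)) (r : ℕ) (j : ℤ) (v : V)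
    (hv : v ∈ G j) : divPow ρ r v ∈ tensorGr G (polGr k 1) (j + 2 * r - 2) := by
  induction r with
  | zero => exact Submodule.zero_mem _
  | succ r ih =>
    rw [divPow_succ]
    refine Submodule.add_mem _ (tmul_mem_tensorGr hv
      (mem_polGr (MvPolynomial.isHomogeneous_X_pow (0 : Fin 1) r) rfl) (by push_cast; ring)) ?_
    refine tensorGr_map (ρ.rTensor (Pol k 1)) (fun a b hab m hm g hg => ?_) ih
    rw [LinearMap.rTensor_tmul]
    exact tmul_mem_tensorGr (h a m hm) hg (by push_cast; omega)

lemma divPow_memt {G : ℤ → Submodule k V} (h : ∀ j, ∀ x ∈ G j, ρ x ∈ G j) (r : ℕ) (j : ℤ) (v : V)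
    (hv : v ∈ G j) : divPow ρ r v ∈ tensorGr G (fun j => if j = 0 then (⊤ : Submodule k (Pol k 1)) else ⊥) j := by
  induction r with
  | zero => exact Submodule.zero_mem _
  | succ r ih =>
    rw [divPow_succ]
    refine Submodule.add_mem _ (tmul_mem_tensorGr hv (b := 0) (by rw [if_pos rfl]; trivial) (add_zero j)) ?_
    refine tensorGr_map (ρ.rTensor (Pol k 1)) (fun a b hab m hm g hg => ?_) ih
    rw [LinearMap.rTensor_tmul]
    exact tmul_mem_tensorGr (h a m hm) hg hab

/-- An induction principle for the topological grading of `V ⊗ k[y]`, where `y` has degree zero. -/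
lemma tensorGr_topBot {G : ℤ → Submodule k V} {W : Type*} [AddCommGroup W] [Module k W]
    (f : V ⊗[k] Pol k 1 →ₗ[k] W) {S : Submodule k W} {j : ℤ} (h : ∀ v ∈ G j, ∀ r : ℕ, f (v ⊗ₜ (X 0 ^ r)) ∈ S)
    {z : V ⊗[k] Pol k 1} (hz : z ∈ tensorGr G (fun j => if j = 0 then ⊤ else ⊥) j) : f z ∈ S := by
  refine tensorGr_map f (fun a b hab v hv g hg => ?_) hz
  by_cases hb : b = 0
  · have hv' : v ∈ G j := mem_of_eq (G := G) hv (by omega)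
    rw [← MvPolynomial.support_sum_monomial_coeff g, TensorProduct.tmul_sum, map_sum]
    refine Submodule.sum_mem _ fun e _ => ?_
    rw [← mul_one (MvPolynomial.coeff e g), ← smul_eq_mul, ← MvPolynomial.smul_monomial,
      TensorProduct.tmul_smul, monomial_fin_one, map_smul]
    exact S.smul_mem _ (h v hv' _)
  · rw [if_neg hb, Submodule.mem_bot] at hg
    rw [hg, TensorProduct.tmul_zero, map_zero]
    exact S.zero_mem

/-- An induction principle for the `q`-grading of `V ⊗ k[y]`. -/
lemma tensorGr_powers {G : ℤ → Submodule k V} {W : Type*} [AddCommGroup W] [Module k W]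
    (f : V ⊗[k] Pol k 1 →ₗ[k] W) {S : Submodule k W} {j : ℤ}
    (h : ∀ a (r : ℕ), a + 2 * r = j → ∀ v ∈ G a, f (v ⊗ₜ (X 0 ^ r)) ∈ S)
    {z : V ⊗[k] Pol k 1} (hz : z ∈ tensorGr G (polGr k 1) j) : f z ∈ S :=
  tensorGr_map f (fun a b hab v hv g hg => polGr_one
    (S := S.comap (f ∘ₗ TensorProduct.mk k V (Pol k 1) v))
    (fun r hr => h a r (by omega) v hv) hg) hz

end OneVariable

namespace PBimod.Homog

variable {p m : ℕ} [Fact p.Prime] [CharP k p] {M : PBimod k p (m + 1)}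

lemma rTensor_eq_actExt {V : Type u} [AddCommGroup V] [Module k V] {n : ℕ} (ρ : Pol k n →ₐ[k] Module.End k V)
    (i : Fin n) : (ρ (X i)).rTensor (Pol k 1) = actExt ρ (X i.castSucc) :=
  tensor_ext fun v g => (actExt_castSucc ρ i v g).symm

lemma actExt_last_pow {V : Type u} [AddCommGroup V] [Module k V] {n : ℕ} (ρ : Pol k n →ₐ[k] Module.End k V)
    (v : V) (r : ℕ) : actExt ρ (X (Fin.last n)) (v ⊗ₜ (X 0 ^ r)) = v ⊗ₜ (X 0 ^ (r + 1)) := by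
  rw [actExt_last, pow_succ']

section

variable (M)

/-- Multiplication by the last variable on the right. -/
noncomputable abbrev lastR : Module.End k M.carrier := M.right (X (Fin.last m))

/-- Substitution of the last variable of `M` for the new variable. -/
noncomputable abbrev evLast : M.carrier ⊗[k] Pol k 1 →ₗ[k] M.carrier := adjoinLift fun r => lastR M ^ r

/-- The divided difference. -/
noncomputable abbrev divLast : Module.End k (M.carrier ⊗[k] Pol k 1) := adjoinLift (divPow (lastR M))

lemma evLast_map (E : Module.End k M.carrier) (h : ∀ v, E (lastR M v) = lastR M (E v))
    (z : M.carrier ⊗[k] Pol k 1) : evLast M (E.rTensor (Pol k 1) z) = E (evLast M z) :=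
  adjoin_ext (f := evLast M ∘ₗ E.rTensor (Pol k 1)) (g := E ∘ₗ evLast M) (fun v r => by
    rw [LinearMap.comp_apply, LinearMap.comp_apply, LinearMap.rTensor_tmul, adjoinLift_tmul, adjoinLift_tmul]
    exact (pow_map E h r v).symm) z

lemma divLast_map (E : Module.End k M.carrier) (h : ∀ v, E (lastR M v) = lastR M (E v))
    (z : M.carrier ⊗[k] Pol k 1) : divLast M (E.rTensor (Pol k 1) z) = E.rTensor (Pol k 1) (divLast M z) :=
  adjoin_ext (f := divLast M ∘ₗ E.rTensor (Pol k 1)) (g := E.rTensor (Pol k 1) ∘ₗ divLast M) (fun v r => by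
    rw [LinearMap.comp_apply, LinearMap.comp_apply, LinearMap.rTensor_tmul, adjoinLift_tmul, adjoinLift_tmul]
    exact divPow_comm _ E h r v) z

lemma right_lastR (i : Fin (m + 1)) (v : M.carrier) : M.right (X i) (lastR M v) = lastR M (M.right (X i) v) := by
  rw [lastR, ← Module.End.mul_apply, ← Module.End.mul_apply, ← map_mul, mul_comm, map_mul]

lemma left_lastR (i : Fin (m + 1)) (v : M.carrier) : M.left (X i) (lastR M v) = lastR M (M.left (X i) v) :=
  LinearMap.congr_fun (M.left_right (X i) (X (Fin.last m))) v

lemma dt_lastR (v : M.carrier) : M.dt (lastR M v) = lastR M (M.dt v) :=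
  LinearMap.congr_fun (M.dt_right (X (Fin.last m))) v

lemma evLast_dq (z : M.carrier ⊗[k] Pol k 1) : evLast M (dqExt M.dq z) = M.dq (evLast M z) :=
  adjoin_ext (f := evLast M ∘ₗ dqExt M.dq) (g := M.dq ∘ₗ evLast M) (fun v r => by
    rw [LinearMap.comp_apply, LinearMap.comp_apply, dqExt_tmul, adjoinLift_tmul, map_add, adjoinLift_tmul,
      Derivation.leibniz_pow, smul_eq_mul]
    rw [show dPol k 1 (X 0) = X 0 ^ 2 from MvPolynomial.mkDerivation_X _ _ _]
    have h : ∀ r : ℕ, M.dq ((lastR M ^ r) v) = (lastR M ^ r) (M.dq v) + r • (lastR M ^ (r + 1)) v := by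
      intro r
      induction r with
      | zero => simp
      | succ r ih =>
        have h1 := LinearMap.congr_fun (M.dq_right (X (Fin.last m))) ((lastR M ^ r) v)
        rw [dPol, MvPolynomial.mkDerivation_X, pow_two, map_mul] at h1
        simp only [LinearMap.add_apply, Module.End.mul_apply] at h1
        rw [pow_succ', Module.End.mul_apply, h1, ih, map_add, map_nsmul, pow_succ' (lastR M) (r + 1),
          Module.End.mul_apply, pow_succ' (lastR M) r, Module.End.mul_apply, Module.End.mul_apply, add_smul,
          one_smul]
        abel
    rw [h, TensorProduct.tmul_smul, map_nsmul]
    cases r with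
    | zero => rw [zero_smul, zero_smul]
    | succ r => rw [Nat.add_sub_cancel, ← pow_add, adjoinLift_tmul]) z

/-- Division with remainder by `y - x`. -/
lemma tau_divLast (z : M.carrier ⊗[k] Pol k 1) : actExt M.right (X (Fin.last (m + 1))) (divLast M z)
    - actExt M.right (X (Fin.last m).castSucc) (divLast M z) + evLast M z ⊗ₜ 1 = z :=
  adjoin_ext (f := actExt M.right (X (Fin.last (m + 1))) ∘ₗ divLast M
      - actExt M.right (X (Fin.last m).castSucc) ∘ₗ divLast M
      + (TensorProduct.mk k M.carrier (Pol k 1)).flip 1 ∘ₗ evLast M) (g := LinearMap.id) (fun v r => by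
    rw [LinearMap.add_apply, LinearMap.sub_apply, LinearMap.comp_apply, LinearMap.comp_apply,
      LinearMap.comp_apply, adjoinLift_tmul, adjoinLift_tmul, LinearMap.flip_apply, TensorProduct.mk_apply,
      LinearMap.id_apply, ← rTensor_eq_actExt]
    induction r with
    | zero =>
      rw [show divPow (lastR M) 0 v = 0 from rfl, map_zero, map_zero, pow_zero, pow_zero, sub_zero, zero_add]
      rfl
    | succ r ih =>
      have h1 : actExt M.right (X (Fin.last (m + 1))) ((lastR M).rTensor (Pol k 1) (divPow (lastR M) r v))
          = (lastR M).rTensor (Pol k 1) (actExt M.right (X (Fin.last (m + 1))) (divPow (lastR M) r v)) := by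
        rw [rTensor_eq_actExt, ← Module.End.mul_apply, ← map_mul, mul_comm, map_mul]; rfl
      have h2 := congrArg ((lastR M).rTensor (Pol k 1)) ih
      rw [map_add, map_sub, LinearMap.rTensor_tmul, LinearMap.rTensor_tmul] at h2
      rw [divPow_succ, map_add, map_add, actExt_last_pow, LinearMap.rTensor_tmul, h1, pow_succ' (lastR M),
        Module.End.mul_apply]
      rw [← h2]
      abel) z

lemma divLast_tau (z : M.carrier ⊗[k] Pol k 1) : divLast M (M.adjoin.right (X (Fin.last (m + 1))) z
    - M.adjoin.right (X (Fin.last m).castSucc) z) = z :=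
  adjoin_ext (f := divLast M ∘ₗ (actExt M.right (X (Fin.last (m + 1)))
      - actExt M.right (X (Fin.last m).castSucc))) (g := LinearMap.id) (fun v r => by
    rw [LinearMap.comp_apply, LinearMap.sub_apply, actExt_last_pow, ← rTensor_eq_actExt, map_sub,
      divLast_map M _ fun v => rfl, adjoinLift_tmul, adjoinLift_tmul, divPow_succ, add_sub_cancel_right]
    rfl) z

lemma evLast_tau (z : M.carrier ⊗[k] Pol k 1) : evLast M (M.adjoin.right (X (Fin.last (m + 1))) z
    - M.adjoin.right (X (Fin.last m).castSucc) z) = 0 :=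
  adjoin_ext (f := evLast M ∘ₗ (actExt M.right (X (Fin.last (m + 1)))
      - actExt M.right (X (Fin.last m).castSucc))) (g := 0) (fun v r => by
    rw [LinearMap.comp_apply, LinearMap.sub_apply, actExt_last_pow, ← rTensor_eq_actExt, map_sub,
      evLast_map M _ fun v => rfl, adjoinLift_tmul, adjoinLift_tmul, pow_succ', Module.End.mul_apply, sub_self]
    rfl) z

end

lemma lastR_memq (h : M.Homog) (j : ℤ) (v : M.carrier) (hv : v ∈ M.grq j) (r : ℕ) :
    (lastR M ^ r) v ∈ M.grq (j + 2 * r) := by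
  rw [lastR, ← map_pow]
  exact act_polGr_mem M.right h.rq (mem_polGr (MvPolynomial.isHomogeneous_X_pow _ r) rfl) hv

lemma lastR_memt (h : M.Homog) (j : ℤ) (v : M.carrier) (hv : v ∈ M.grt j) (r : ℕ) :
    (lastR M ^ r) v ∈ M.grt j := by
  rw [lastR, ← map_pow]
  exact act_mem M.right (fun i x hx => h.rt i j x hx) _ v hv

/-- Adjoining a strand. -/
noncomputable def strand (h : M.Homog) : Strand h.toKMod h.adjoin.toKMod where
  ev := evLast M
  const := (TensorProduct.mk k M.carrier (Pol k 1)).flip 1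
  div := divLast M
  last z := adjoin_ext (f := M.adjoin.left (X (Fin.last (m + 1)))) (g := M.adjoin.right (X (Fin.last (m + 1))))
    (fun v r => (actExt_last _ _ _).trans (actExt_last _ _ _).symm) z
  ev_l i z := by
    change evLast M (actExt M.left (X i.castSucc) z) = _
    rw [← rTensor_eq_actExt]
    exact evLast_map M _ (left_lastR M i) z
  ev_r i z := by
    change evLast M (actExt M.right (X i.castSucc) z) = _
    rw [← rTensor_eq_actExt]
    exact evLast_map M _ (right_lastR M i) z
  ev_t z := evLast_map M _ (dt_lastR M) z
  ev_q z := evLast_dq M z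
  evG b j z hz := by
    cases b
    · exact tensorGr_powers (evLast M) (fun a r har v hv => by
        rw [adjoinLift_tmul]
        exact mem_of_eq (G := M.grq) (h.lastR_memq a v hv r) har) hz
    · exact tensorGr_topBot (evLast M) (fun v hv r => by
        rw [adjoinLift_tmul]
        exact h.lastR_memt j v hv r) hz
  const_l i v := (actExt_castSucc _ _ _ _).symm
  const_r i v := (actExt_castSucc _ _ _ _).symm
  const_t v := rfl
  constG b j v hv := by
    cases b
    · exact tmul_mem_tensorGr hv one_mem_polGr (add_zero j)
    · exact tmul_mem_tensorGr (b := 0) hv (by rw [if_pos rfl]; trivial) (add_zero j)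
  div_l i z := by
    change divLast M (actExt M.left (X i.castSucc) z) = actExt M.left (X i.castSucc) (divLast M z)
    rw [← rTensor_eq_actExt]
    exact divLast_map M _ (left_lastR M i) z
  div_r i z := by
    change divLast M (actExt M.right (X i.castSucc) z) = actExt M.right (X i.castSucc) (divLast M z)
    rw [← rTensor_eq_actExt]
    exact divLast_map M _ (right_lastR M i) z
  div_t z := divLast_map M _ (dt_lastR M) z
  divG b j z hz := by
    cases b
    · exact tensorGr_powers (divLast M) (fun a r har v hv => by
        rw [adjoinLift_tmul]
        exact mem_of_eq (G := tensorGr M.grq (polGr k 1))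
          (divPow_memq (lastR M) (h.rq (Fin.last m)) r a v hv) (by rw [har]; rfl)) hz
    · exact mem_of_eq (G := tensorGr M.grt _) (tensorGr_topBot (divLast M) (fun v hv r => by
        rw [adjoinLift_tmul]
        exact divPow_memt (lastR M) (h.rt (Fin.last m)) r j v hv) hz) (sub_zero j).symm
  div_τ := divLast_tau M
  ev_τ := evLast_tau M
  ev_const v := by
    change evLast M (v ⊗ₜ 1) = v
    rw [← pow_zero (X 0), adjoinLift_tmul]; rfl
  div_const v := by
    change divLast M (v ⊗ₜ 1) = 0
    rw [← pow_zero (X 0), adjoinLift_tmul]; rfl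
  sum := tau_divLast M

end PBimod.Homog

end PHHH

/-! ### Tensor products with the complex of a crossing -/

namespace PHHH
open MvPolynomial (X)
variable {k : Type u} [Field k]

section Tens

variable {p n : ℕ} [Fact p.Prime] [CharP k p] (L T : PBimod k p n)

/-- The bilinear map to the tensor product. -/
noncomputable def tens : L.carrier →ₗ[k] T.carrier →ₗ[k] (L.tensor T).carrier :=
  LinearMap.mk₂ k (fun m z => (m : L.AsRight) ⊗ₜ[Pol k n] (z : T.AsLeft))
    (fun a b z => TensorProduct.add_tmul (M := L.AsRight) (N := T.AsLeft) a b z)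
    (fun c a z => (TensorProduct.smul_tmul' (R := Pol k n) (M := L.AsRight) (N := T.AsLeft) c a z).symm)
    (fun a b z => TensorProduct.tmul_add (M := L.AsRight) (N := T.AsLeft) a b z)
    (fun c a z => TensorProduct.tmul_smul (R := Pol k n) (M := L.AsRight) (N := T.AsLeft) c a z)

variable {L T}

lemma tens_bal (f : Pol k n) (m : L.carrier) (z : T.carrier) :
    tens L T (L.right f m) z = tens L T m (T.left f z) :=
  (show ∀ (m : L.AsRight) (z : T.AsLeft), (f • m) ⊗ₜ[Pol k n] z = m ⊗ₜ[Pol k n] (f • z) from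
    fun m z => TensorProduct.smul_tmul f m z) m z

lemma left_tens (f : Pol k n) (m : L.carrier) (z : T.carrier) :
    (L.tensor T).left f (tens L T m z) = tens L T (L.left f m) z :=
  actL_tmul (R := Pol k n) (M := L.AsRight) (N := T.AsLeft) L.leftR L.leftR_smul f m z

lemma right_tens (f : Pol k n) (m : L.carrier) (z : T.carrier) :
    (L.tensor T).right f (tens L T m z) = tens L T m (T.right f z) :=
  actR_tmul (R := Pol k n) (M := L.AsRight) (N := T.AsLeft) T.rightL T.rightL_smul f m z

lemma dq_tens (m : L.carrier) (z : T.carrier) :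
    (L.tensor T).dq (tens L T m z) = tens L T (L.dq m) z + tens L T m (T.dq z) := rfl

lemma dt_tens (m : L.carrier) (z : T.carrier) :
    (L.tensor T).dt (tens L T m z) = tens L T (L.dt m) z + tens L T m (T.dt z) := rfl

lemma tens_ind {S : Submodule k (L.tensor T).carrier} (h : ∀ m z, tens L T m z ∈ S)
    (x : (L.tensor T).carrier) : x ∈ S := by
  induction x using TensorProduct.induction_on with
  | zero => exact S.zero_mem
  | tmul m z => exact h m z
  | add x y hx hy => exact S.add_mem hx hy

lemma tens_grq {a b j : ℤ} {m : L.carrier} {z : T.carrier} (hm : m ∈ L.grq a) (hz : z ∈ T.grq b)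
    (h : a + b = j) : tens L T m z ∈ (L.tensor T).grq j :=
  tmul_mem_tensorGr (R := Pol k n) (M := L.AsRight) (N := T.AsLeft) hm hz h

lemma tens_grt {a b j : ℤ} {m : L.carrier} {z : T.carrier} (hm : m ∈ L.grt a) (hz : z ∈ T.grt b)
    (h : a + b = j) : tens L T m z ∈ (L.tensor T).grt j :=
  tmul_mem_tensorGr (R := Pol k n) (M := L.AsRight) (N := T.AsLeft) hm hz h

lemma tens_grq_ind {V : Type*} [AddCommGroup V] [Module k V] (F : (L.tensor T).carrier →ₗ[k] V)
    {S : Submodule k V} {j : ℤ} (h : ∀ a b, a + b = j → ∀ m ∈ L.grq a, ∀ z ∈ T.grq b, F (tens L T m z) ∈ S)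
    {x : (L.tensor T).carrier} (hx : x ∈ (L.tensor T).grq j) : F x ∈ S :=
  tensorGr_map (R := Pol k n) (M := L.AsRight) (N := T.AsLeft) (F := L.grqR) (G := T.grqL) F h hx

lemma tens_grt_ind {V : Type*} [AddCommGroup V] [Module k V] (F : (L.tensor T).carrier →ₗ[k] V)
    {S : Submodule k V} {j : ℤ} (h : ∀ a b, a + b = j → ∀ m ∈ L.grt a, ∀ z ∈ T.grt b, F (tens L T m z) ∈ S)
    {x : (L.tensor T).carrier} (hx : x ∈ (L.tensor T).grt j) : F x ∈ S :=
  tensorGr_map (R := Pol k n) (M := L.AsRight) (N := T.AsLeft) (F := L.grtR) (G := T.grtL) F h hx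

variable (L) in
/-- The contraction of the tensor product with a left linear form. -/
noncomputable def contract (φ : T.carrier →ₗ[k] Pol k n) (hφ : ∀ f z, φ (T.left f z) = f * φ z) :
    (L.tensor T).carrier →ₗ[k] L.carrier :=
  liftBal (R := Pol k n) (M := L.AsRight) (N := T.AsLeft)
    ((L.right.toLinearMap ∘ₗ φ).flip)
    (have h : ∀ f (m : L.carrier) (z : T.carrier), L.right (φ z) (L.right f m) = L.right (φ (T.left f z)) m :=
      fun f m z => by rw [hφ, mul_comm, map_mul]; rfl
    h)

end Tens

section Swap

variable {n : ℕ} (a b : Fin n)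

/-- The map `f ⊗ g ↦ f s(g)`, where `s` exchanges the two variables. -/
noncomputable def brSwap : BS k a b →ₗ[k] Pol k n :=
  liftBal (R := symSub k a b)
    ((LinearMap.mul k (Pol k n)).compl₂ (MvPolynomial.rename (Equiv.swap a b)).toLinearMap)
    (fun r f g => by
      have hr : MvPolynomial.rename (Equiv.swap a b) (r : Pol k n) = r := r.2
      simp only [Subalgebra.smul_def, smul_eq_mul, LinearMap.compl₂_apply, LinearMap.mul_apply',
        AlgHom.toLinearMap_apply, map_mul, hr]
      ring)

lemma brSwap_tmul (f g : Pol k n) : brSwap a b (f ⊗ₜ[symSub k a b] g)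
    = f * MvPolynomial.rename (Equiv.swap a b) g := rfl

lemma brSwap_left (f : Pol k n) (z : BS k a b) : brSwap a b (bsLeft k a b f z) = f * brSwap a b z :=
  LinearMap.congr_fun (tensor_ext (F := brSwap a b ∘ₗ bsLeft k a b f)
    (G := (Algebra.lmul k (Pol k n) f) ∘ₗ brSwap a b) fun x y => by
      simp [bsLeft_tmul, brSwap_tmul, mul_assoc]) z

lemma brLin_left (f : Pol k n) (z : BS k a b) : brLin k a b (bsLeft k a b f z) = f * brLin k a b z :=
  LinearMap.congr_fun (tensor_ext (F := brLin k a b ∘ₗ bsLeft k a b f)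
    (G := (Algebra.lmul k (Pol k n) f) ∘ₗ brLin k a b) fun x y => by
      simp [bsLeft_tmul, brLin_tmul, mul_assoc]) z

lemma brSwap_rbElt : brSwap a b (rbElt k a b) = 0 := by
  rw [rbElt, map_sub, brSwap_tmul, brSwap_tmul, map_one, MvPolynomial.rename_X, Equiv.swap_apply_left,
    mul_one, one_mul, sub_self]

lemma brLin_rbElt : brLin k a b (rbElt k a b) = X b - X a := by
  rw [rbElt, map_sub, brLin_tmul, brLin_tmul, mul_one, one_mul]

lemma brSwap_mem (j : ℤ) (x : BS k a b) (hx : x ∈ tensorGr (polGr k n) (polGr k n) j) :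
    brSwap a b x ∈ polGr k n j :=
  tensorGr_map _ (fun c d hcd u hu v hv => by
    rw [brSwap_tmul, ← hcd]
    refine mul_mem_polGr hu (polGr_le (S := (polGr k n d).comap
      (MvPolynomial.rename (Equiv.swap a b)).toLinearMap) (fun e he f hf => ?_) hv)
    exact mem_polGr (MvPolynomial.IsHomogeneous.rename_isHomogeneous hf) he) hx

end Swap

section Cross

variable {p m : ℕ} [Fact p.Prime] [CharP k p]

/-- The variable `x` of the last strand but one. -/
abbrev vx (m : ℕ) : Fin (m + 2) := Fin.castSucc (Fin.last m)
/-- The variable `y` of the last strand. -/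
abbrev vy (m : ℕ) : Fin (m + 2) := Fin.last (m + 1)

/-- The element `1 ⊗ 1` of `B`. -/
noncomputable abbrev bsUnit (k : Type u) [Field k] (m : ℕ) : BS k (vx m) (vy m) :=
  (1 : Pol k (m + 2)) ⊗ₜ[symSub k (vx m) (vy m)] (1 : Pol k (m + 2))

/-- The right action on `B` in terms of the left one and the basis `1 ⊗ 1`, `y ⊗ 1 - 1 ⊗ x`. -/
lemma bsRight_one (i : Fin (m + 2)) : bsRight k (vx m) (vy m) (X i) (bsUnit k m)
    = bsLeft k (vx m) (vy m) (X i + Strand.α m i • (X (vy m) - X (vx m))) (bsUnit k m)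
      - Strand.α m i • rbElt k (vx m) (vy m) := by
  rw [bsRight_tmul, bsLeft_tmul, mul_one, mul_one]
  by_cases h1 : i = vx m
  · subst h1
    rw [Strand.α_x, one_smul, one_smul, rbElt, add_sub_cancel, sub_sub_cancel]
  · by_cases h2 : i = vy m
    · subst h2
      rw [Strand.α_last, neg_one_smul, neg_one_smul, rbElt]
      have h := tmul_sym k (add_mem_symSub k (vx m) (vy m)) 1 1
      rw [mul_one, TensorProduct.add_tmul, TensorProduct.tmul_add] at h
      have h' : (1 : Pol k (m + 2)) ⊗ₜ[symSub k (vx m) (vy m)] X (vy m)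
        = X (vx m) ⊗ₜ[symSub k (vx m) (vy m)] (1 : Pol k (m + 2))
          + X (vy m) ⊗ₜ[symSub k (vx m) (vy m)] (1 : Pol k (m + 2))
          - (1 : Pol k (m + 2)) ⊗ₜ[symSub k (vx m) (vy m)] X (vx m) := by rw [h]; abel
      rw [h', neg_sub, add_sub_cancel]
      abel
    · rw [Strand.α_ne i h1 h2, zero_smul, zero_smul, add_zero, sub_zero]
      have h := tmul_sym k (X_mem_symSub k h1 h2) 1 1
      rw [mul_one] at h
      exact h.symm

/-- An identification of `T` with the sum of `B` and of `p - 1` copies of the polynomial ring, for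
the left and right actions. -/
structure Cross (T : PBimod k p (m + 2)) where
  e : T.carrier ≃ₗ[k] BS k (vx m) (vy m) × (Fin (p - 1) → Pol k (m + 2))
  eL : ∀ f z, e (T.left f z) = (bsLeft k (vx m) (vy m) f (e z).1, fun s => f * (e z).2 s)
  eR : ∀ f z, e (T.right f z) = (bsRight k (vx m) (vy m) f (e z).1, fun s => f * (e z).2 s)

namespace Cross

variable {T : PBimod k p (m + 2)} (c : Cross T)

/-- The element `1 ⊗ 1` of `B`. -/
noncomputable def one : T.carrier := c.e.symm (bsUnit k m, 0)

/-- The element `y ⊗ 1 - 1 ⊗ x` of `B`. -/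
noncomputable def eta : T.carrier := c.e.symm (rbElt k (vx m) (vy m), 0)

/-- The unit elements of the copies of the polynomial ring. -/
noncomputable def gen (s : Fin (p - 1)) : T.carrier := c.e.symm (0, Pi.single s 1)

lemma e_one : c.e c.one = (bsUnit k m, 0) := c.e.apply_symm_apply _
lemma e_eta : c.e c.eta = (rbElt k (vx m) (vy m), 0) := c.e.apply_symm_apply _
lemma e_gen (s) : c.e (c.gen s) = (0, Pi.single s 1) := c.e.apply_symm_apply _

lemma right_one (i : Fin (m + 2)) : T.right (X i) c.one
    = T.left (X i + Strand.α m i • (X (vy m) - X (vx m))) c.one - Strand.α m i • c.eta := by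
  refine c.e.injective ?_
  rw [map_sub, map_zsmul, c.eL, c.eR, c.e_one, c.e_eta, bsRight_one]
  refine Prod.ext rfl (funext fun s => ?_)
  change X i * (0 : Pol k (m + 2)) = (X i + Strand.α m i • (X (vy m) - X (vx m))) * 0
    - Strand.α m i • (0 : Pol k (m + 2))
  rw [mul_zero, mul_zero, smul_zero, sub_zero]

/-- The two actions agree on `y ⊗ 1 - 1 ⊗ x`. -/
lemma right_eta (f : Pol k (m + 2)) : T.right f c.eta = T.left f c.eta := by
  refine c.e.injective ?_
  rw [c.eL, c.eR, c.e_eta, left_rbElt]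

lemma right_gen (f : Pol k (m + 2)) (s) : T.right f (c.gen s) = T.left f (c.gen s) := by
  refine c.e.injective ?_
  rw [c.eL, c.eR, c.e_gen]
  exact Prod.ext ((map_zero (bsRight k (vx m) (vy m) f)).trans (map_zero (bsLeft k (vx m) (vy m) f)).symm) rfl

variable (L : PBimod k p (m + 2))

/-- The expansion of elements of the tensor product in the generators. -/
noncomputable def expand : (L.carrier × L.carrier) × (Fin (p - 1) → L.carrier) →ₗ[k] (L.tensor T).carrier :=
  (((tens L T).flip c.one).coprod ((tens L T).flip c.eta)).coprod
    (∑ s, ((tens L T).flip (c.gen s)) ∘ₗ LinearMap.proj s)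

lemma expand_apply (v : (L.carrier × L.carrier) × (Fin (p - 1) → L.carrier)) : c.expand L v
    = tens L T v.1.1 c.one + tens L T v.1.2 c.eta + ∑ s, tens L T (v.2 s) (c.gen s) := by
  rw [expand, LinearMap.coprod_apply, LinearMap.coprod_apply, LinearMap.sum_apply]
  rfl

variable {L} (h : L.Homog)

lemma expand_left (i : Fin (m + 2)) (v : (L.carrier × L.carrier) × (Fin (p - 1) → L.carrier)) :
    (L.tensor T).left (X i) (c.expand L v) = c.expand L
      ((L.left (X i) v.1.1, L.left (X i) v.1.2), fun s => L.left (X i) (v.2 s)) := by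
  rw [expand_apply, expand_apply, map_add, map_add, map_sum, left_tens, left_tens]
  exact congrArg _ (Finset.sum_congr rfl fun s _ => left_tens _ _ _)

lemma expand_right (i : Fin (m + 2)) (v : (L.carrier × L.carrier) × (Fin (p - 1) → L.carrier)) :
    (L.tensor T).right (X i) (c.expand L v) = c.expand L
      ((Strand.bsMod h.toKMod 0 0).r i v.1, fun s => L.right (X i) (v.2 s)) := by
  rw [expand_apply, expand_apply, map_add, map_add, map_sum, right_tens, right_tens, c.right_one, c.right_eta,
    map_sub, map_zsmul, ← tens_bal, ← tens_bal]
  change _ = tens L T (L.right (X i) v.1.1 + Strand.α m i • (L.right (X (vy m)) v.1.1 - L.right (X (vx m)) v.1.1)) c.one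
      + tens L T (L.right (X i) v.1.2 + Strand.α m i • -v.1.1) c.eta + _
  have h1 : ∑ s, (L.tensor T).right (X i) (tens L T (v.2 s) (c.gen s))
      = ∑ s, tens L T (L.right (X i) (v.2 s)) (c.gen s) :=
    Finset.sum_congr rfl fun s _ => by rw [right_tens, c.right_gen, tens_bal]
  rw [h1]
  simp only [map_add, map_sub, map_zsmul, map_neg, LinearMap.add_apply, LinearMap.sub_apply,
    LinearMap.smul_apply, LinearMap.neg_apply, smul_neg]
  abel

include h in
lemma expand_surjective (x : (L.tensor T).carrier) : x ∈ LinearMap.range (c.expand L) := by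
  refine tens_ind (fun l z => ?_) x
  have h1 : ∀ s (f : Pol k (m + 2)), c.e.symm (0, Pi.single s f) = T.left f (c.gen s) := by
    intro s f
    rw [LinearEquiv.symm_apply_eq, c.eL, c.e_gen]
    refine Prod.ext (map_zero (bsLeft k (vx m) (vy m) f)).symm (funext fun t => ?_)
    change (Pi.single s f : Fin (p - 1) → Pol k (m + 2)) t = f * (Pi.single s 1 : Fin (p - 1) → Pol k (m + 2)) t
    by_cases ht : t = s
    · subst ht; rw [Pi.single_eq_same, Pi.single_eq_same, mul_one]
    · rw [Pi.single_eq_of_ne ht, Pi.single_eq_of_ne ht, mul_zero]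
  have h2 : ∀ f g : Pol k (m + 2), c.e.symm (f ⊗ₜ g, 0) = T.left f (T.right g c.one) := by
    intro f g
    rw [LinearEquiv.symm_apply_eq, c.eL, c.eR, c.e_one]
    refine Prod.ext ?_ (funext fun t => ?_)
    · change _ = bsLeft k (vx m) (vy m) f (bsRight k (vx m) (vy m) g (bsUnit k m))
      rw [bsRight_tmul, bsLeft_tmul, mul_one, mul_one]
    · change 0 = f * (g * 0)
      rw [mul_zero, mul_zero]
  have hz : z = c.e.symm ((c.e z).1, 0) + ∑ s, c.e.symm (0, Pi.single s ((c.e z).2 s)) := by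
    rw [← map_sum, ← map_add, LinearEquiv.eq_symm_apply]
    refine Prod.ext ?_ ?_
    · rw [Prod.fst_add, Prod.fst_sum, Finset.sum_const_zero, add_zero]
    · rw [Prod.snd_add, Prod.snd_sum, zero_add]
      exact (Finset.univ_sum_single _).symm
  rw [hz, map_add, map_sum]
  refine Submodule.add_mem _ ?_ (Submodule.sum_mem _ fun s _ => ?_)
  · generalize (c.e z).1 = w
    have hw : w ∈ (LinearMap.range (c.expand L)).comap (tens L T l ∘ₗ c.e.symm.toLinearMap ∘ₗ
        LinearMap.inl k (BS k (vx m) (vy m)) (Fin (p - 1) → Pol k (m + 2))) := by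
      induction w using TensorProduct.induction_on with
      | zero => exact Submodule.zero_mem _
      | add x y hx hy => exact Submodule.add_mem _ hx hy
      | tmul f g =>
        change tens L T l (c.e.symm (f ⊗ₜ g, 0)) ∈ LinearMap.range (c.expand L)
        rw [h2, ← tens_bal, ← right_tens]
        refine PBimod.Homog.act_mem (L.tensor T).right ?_ g _ ?_
        · rintro i _ ⟨v, rfl⟩
          exact ⟨_, (c.expand_right h i v).symm⟩
        · refine ⟨((L.right f l, 0), 0), ?_⟩
          rw [expand_apply]
          simp
    exact hw
  · rw [h1, ← tens_bal]
    refine ⟨((0, 0), Pi.single s (L.right ((c.e z).2 s) l)), ?_⟩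
    rw [expand_apply, Finset.sum_eq_single s]
    · simp only [Pi.single_eq_same, map_zero, LinearMap.zero_apply, zero_add]
    · intro t _ ht
      simp only [Pi.single_eq_of_ne ht, map_zero, LinearMap.zero_apply]
    · exact fun hs => absurd (Finset.mem_univ s) hs

variable (L) in
/-- The contraction with `f ⊗ g ↦ f s(g)`. -/
noncomputable def cSwap : (L.tensor T).carrier →ₗ[k] L.carrier :=
  contract L (brSwap (vx m) (vy m) ∘ₗ LinearMap.fst k _ _ ∘ₗ c.e.toLinearMap)
    (fun f z => (congrArg (fun w => brSwap (vx m) (vy m) (Prod.fst w)) (c.eL f z)).trans (brSwap_left _ _ _ _))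

variable (L) in
/-- The contraction with `f ⊗ g ↦ f g`. -/
noncomputable def cMul : (L.tensor T).carrier →ₗ[k] L.carrier :=
  contract L (brLin k (vx m) (vy m) ∘ₗ LinearMap.fst k _ _ ∘ₗ c.e.toLinearMap)
    (fun f z => (congrArg (fun w => brLin k (vx m) (vy m) (Prod.fst w)) (c.eL f z)).trans (brLin_left _ _ _ _))

variable (L) in
/-- The contractions with the projections to the copies of the polynomial ring. -/
noncomputable def cProj (s : Fin (p - 1)) : (L.tensor T).carrier →ₗ[k] L.carrier :=
  contract L (LinearMap.proj s ∘ₗ LinearMap.snd k _ _ ∘ₗ c.e.toLinearMap)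
    (fun f z => congrFun (congrArg Prod.snd (c.eL f z)) s)

lemma cSwap_tens (l : L.carrier) (z : T.carrier) :
    c.cSwap L (tens L T l z) = L.right (brSwap (vx m) (vy m) (c.e z).1) l := rfl

lemma cMul_tens (l : L.carrier) (z : T.carrier) :
    c.cMul L (tens L T l z) = L.right (brLin k (vx m) (vy m) (c.e z).1) l := rfl

lemma cProj_tens (s) (l : L.carrier) (z : T.carrier) :
    c.cProj L s (tens L T l z) = L.right ((c.e z).2 s) l := rfl

lemma cSwap_expand (v) : c.cSwap L (c.expand L v) = v.1.1 := by
  rw [expand_apply, map_add, map_add, map_sum]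
  simp only [cSwap_tens, e_one, e_eta, e_gen, brSwap_rbElt, map_zero, LinearMap.zero_apply,
    Finset.sum_const_zero, add_zero]
  rw [brSwap_tmul, map_one, one_mul, map_one]; rfl

lemma cMul_expand (v) : c.cMul L (c.expand L v) = v.1.1 + Strand.τ h.toKMod v.1.2 := by
  rw [expand_apply, map_add, map_add, map_sum]
  simp only [cMul_tens, e_one, e_eta, e_gen, brLin_rbElt, map_zero, LinearMap.zero_apply,
    Finset.sum_const_zero, add_zero]
  rw [brLin_tmul, one_mul, map_one, map_sub]; rfl

lemma cProj_expand (s) (v) : c.cProj L s (c.expand L v) = v.2 s := by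
  rw [expand_apply, map_add, map_add, map_sum, Finset.sum_eq_single s]
  · simp only [cProj_tens, e_one, e_eta, e_gen, Pi.zero_apply, Pi.single_eq_same, map_zero, map_one,
      LinearMap.zero_apply, zero_add]
    rfl
  · intro t _ ht
    simp only [cProj_tens, e_gen, Pi.single_eq_of_ne ht.symm, map_zero, LinearMap.zero_apply]
  · exact fun hs => absurd (Finset.mem_univ s) hs

variable {M : KMod k (m + 1)} (S : Strand M h.toKMod)

/-- The coordinates of elements of the tensor product, where `div` inverts the difference of the
variables: the two coordinates with respect to `B` are recovered from the two contractions
`f ⊗ g ↦ f s(g)` and `f ⊗ g ↦ f g`. -/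
noncomputable def coords : (L.tensor T).carrier →ₗ[k] (L.carrier × L.carrier) × (Fin (p - 1) → L.carrier) :=
  ((c.cSwap L).prod (S.div ∘ₗ (c.cMul L - c.cSwap L))).prod (LinearMap.pi (c.cProj L))

lemma coords_expand (v : (L.carrier × L.carrier) × (Fin (p - 1) → L.carrier)) :
    c.coords h S (c.expand L v) = v := by
  refine Prod.ext (Prod.ext (c.cSwap_expand v) ?_) (funext fun s => c.cProj_expand s v)
  change S.div (c.cMul L (c.expand L v) - c.cSwap L (c.expand L v)) = v.1.2
  rw [cMul_expand c h, cSwap_expand, add_sub_cancel_left, S.div_τ']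

lemma expand_coords (x : (L.tensor T).carrier) : c.expand L (c.coords h S x) = x := by
  obtain ⟨v, rfl⟩ := c.expand_surjective h x
  rw [coords_expand]

/-- The tensor product of `L` with `T` is the sum of two copies of `L`, with generators `1 ⊗ 1` and
`y ⊗ 1 - 1 ⊗ x` of `B`, and of `p - 1` further copies. -/
noncomputable def equiv : (L.tensor T).carrier ≃ₗ[k] (L.carrier × L.carrier) × (Fin (p - 1) → L.carrier) :=
  { c.coords h S with
    invFun := c.expand L
    left_inv := c.expand_coords h S
    right_inv := c.coords_expand h S }

lemma equiv_eq (x : (L.tensor T).carrier) (v) (hx : x = c.expand L v) : c.equiv h S x = v := by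
  rw [hx]
  exact (c.equiv h S).apply_symm_apply v

lemma expand_equiv (x : (L.tensor T).carrier) : c.expand L (c.equiv h S x) = x :=
  (c.equiv h S).symm_apply_apply x

lemma equiv_left (i : Fin (m + 2)) (x : (L.tensor T).carrier) : c.equiv h S ((L.tensor T).left (X i) x)
    = ((L.left (X i) (c.equiv h S x).1.1, L.left (X i) (c.equiv h S x).1.2),
      fun s => L.left (X i) ((c.equiv h S x).2 s)) :=
  c.equiv_eq h S _ _ (by rw [← expand_left, expand_equiv])

lemma equiv_right (i : Fin (m + 2)) (x : (L.tensor T).carrier) : c.equiv h S ((L.tensor T).right (X i) x)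
    = ((Strand.bsMod h.toKMod 0 0).r i (c.equiv h S x).1, fun s => L.right (X i) ((c.equiv h S x).2 s)) :=
  c.equiv_eq h S _ _ (by rw [← expand_right, expand_equiv])

lemma equiv_dq (c1 c2 : ℤ) (h1 : T.dq c.one = T.left (c1 • (X (vx m) + X (vy m))) c.one)
    (h2 : T.dq c.eta = T.left (c2 • (X (vx m) + X (vy m))) c.eta) (h3 : ∀ s, T.dq (c.gen s) = 0)
    (x : (L.tensor T).carrier) : c.equiv h S ((L.tensor T).dq x)
    = ((L.dq (c.equiv h S x).1.1 + h.toKMod.form (Strand.xy m c1 c1) (c.equiv h S x).1.1,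
      L.dq (c.equiv h S x).1.2 + h.toKMod.form (Strand.xy m c2 c2) (c.equiv h S x).1.2),
      fun s => L.dq ((c.equiv h S x).2 s)) := by
  refine c.equiv_eq h S _ _ ?_
  conv_lhs => rw [← c.expand_equiv h S x]
  generalize c.equiv h S x = v
  rw [expand_apply, expand_apply, map_add, map_add, map_sum, dq_tens, dq_tens, h1, h2, ← tens_bal, ← tens_bal,
    Finset.sum_congr rfl fun s _ => (dq_tens (v.2 s) (c.gen s)).trans
      (by rw [h3, map_zero, add_zero] : _ = tens L T (L.dq (v.2 s)) (c.gen s)), Strand.form_xy, Strand.form_xy]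
  simp only [map_add, map_zsmul, LinearMap.add_apply, smul_add, LinearMap.smul_apply]

lemma equiv_dt (x : (L.tensor T).carrier)
    (w : (L.carrier × L.carrier) × (Fin (p - 1) → L.carrier))
    (hw : tens L T (c.equiv h S x).1.1 (T.dt c.one) + tens L T (c.equiv h S x).1.2 (T.dt c.eta)
      + ∑ s, tens L T ((c.equiv h S x).2 s) (T.dt (c.gen s)) = c.expand L w) :
    c.equiv h S ((L.tensor T).dt x)
    = ((L.dt (c.equiv h S x).1.1 + w.1.1, L.dt (c.equiv h S x).1.2 + w.1.2),
      fun s => L.dt ((c.equiv h S x).2 s) + w.2 s) := by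
  refine c.equiv_eq h S _ _ ?_
  have e : ∀ v v', c.expand L ((v.1.1 + v'.1.1, v.1.2 + v'.1.2), fun s => v.2 s + v'.2 s)
    = c.expand L v + c.expand L v' := fun v v' => map_add (c.expand L) v v'
  refine Eq.trans ?_ (e ((L.dt (c.equiv h S x).1.1, L.dt (c.equiv h S x).1.2), fun s => L.dt ((c.equiv h S x).2 s)) w).symm
  rw [← hw]
  conv_lhs => rw [← c.expand_equiv h S x]
  generalize c.equiv h S x = v
  rw [expand_apply, expand_apply, map_add, map_add, map_sum, dt_tens, dt_tens,
    Finset.sum_congr rfl fun s _ => dt_tens (v.2 s) (c.gen s), Finset.sum_add_distrib]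
  abel

lemma equiv_grq (u w : ℤ) (hT : ∀ j z, z ∈ T.grq j ↔ (c.e z).1 ∈ tensorGr (polGr k _) (polGr k _) (j + u) ∧
      ∀ s, (c.e z).2 s ∈ polGr k _ (j + w)) (j : ℤ) (x : (L.tensor T).carrier) :
    x ∈ (L.tensor T).grq j ↔ ((c.equiv h S x).1.1 ∈ L.grq (j + u) ∧ (c.equiv h S x).1.2 ∈ L.grq (j + u - 2))
      ∧ ∀ s, (c.equiv h S x).2 s ∈ L.grq (j + w) := by
  constructor
  · intro hx
    have hs : c.cSwap L x ∈ L.grq (j + u) := tens_grq_ind _ (fun a b hab l hl z hz => by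
      rw [cSwap_tens]
      exact mem_of_eq (G := L.grq) (PBimod.Homog.act_polGr_mem L.right h.rq
        (brSwap_mem _ _ _ _ ((hT b z).mp hz).1) hl) (by omega)) hx
    have hm : c.cMul L x ∈ L.grq (j + u) := tens_grq_ind _ (fun a b hab l hl z hz => by
      rw [cMul_tens]
      exact mem_of_eq (G := L.grq) (PBimod.Homog.act_polGr_mem L.right h.rq
        (PBimod.Homog.brLin_mem _ _ _ _ ((hT b z).mp hz).1) hl) (by omega)) hx
    refine ⟨⟨hs, S.divG false _ _ (Submodule.sub_mem _ hm hs)⟩, fun s => ?_⟩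
    exact tens_grq_ind (c.cProj L s) (fun a b hab l hl z hz => by
      rw [cProj_tens]
      exact mem_of_eq (G := L.grq) (PBimod.Homog.act_polGr_mem L.right h.rq
        (((hT b z).mp hz).2 s) hl) (by omega)) hx
  · rintro ⟨⟨h1, h2⟩, h3⟩
    rw [← c.expand_equiv h S x, expand_apply]
    refine Submodule.add_mem _ (Submodule.add_mem _ (tens_grq (b := -u) h1 ((hT _ _).mpr ?_) (by ring))
      (tens_grq (b := 2 - u) h2 ((hT _ _).mpr ?_) (by ring)))
      (Submodule.sum_mem _ fun s _ => tens_grq (b := -w) (h3 s) ((hT _ _).mpr ?_) (by ring))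
    · rw [e_one]
      exact ⟨tmul_mem_tensorGr one_mem_polGr one_mem_polGr (by ring), fun s => Submodule.zero_mem _⟩
    · rw [e_eta]
      exact ⟨mem_of_eq (G := tensorGr (polGr k _) (polGr k _)) (PBimod.Homog.rbElt_mem _ _) (by ring),
        fun s => Submodule.zero_mem _⟩
    · rw [e_gen]
      refine ⟨Submodule.zero_mem _, fun t => ?_⟩
      by_cases ht : t = s
      · subst ht
        change (Pi.single t 1 : Fin (p - 1) → Pol k (m + 2)) t ∈ _
        rw [Pi.single_eq_same, neg_add_cancel]
        exact one_mem_polGr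
      · change (Pi.single s 1 : Fin (p - 1) → Pol k (m + 2)) t ∈ _
        rw [Pi.single_eq_of_ne ht]
        exact Submodule.zero_mem _

lemma equiv_grt (v : Fin (p - 1) → ℤ) (hT : ∀ j z, z ∈ T.grt j ↔ (c.e z).1 ∈ (if j = 0 then ⊤ else ⊥ :
      Submodule k (BS k (vx m) (vy m))) ∧ ∀ s, (c.e z).2 s ∈ (if j = v s then ⊤ else ⊥ : Submodule k (Pol k _)))
    (j : ℤ) (x : (L.tensor T).carrier) :
    x ∈ (L.tensor T).grt j ↔ ((c.equiv h S x).1.1 ∈ L.grt j ∧ (c.equiv h S x).1.2 ∈ L.grt j)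
      ∧ ∀ s, (c.equiv h S x).2 s ∈ L.grt (j - v s) := by
  have ha : ∀ (a b d : ℤ) (f : Pol k (m + 2)), f ∈ (if b = d then ⊤ else ⊥ : Submodule k (Pol k _)) →
      ∀ l ∈ L.grt a, L.right f l ∈ L.grt (a + b - d) := by
    intro a b d f hf l hl
    by_cases hb : b = d
    · exact mem_of_eq (G := L.grt) (PBimod.Homog.act_mem L.right (fun i x hx => h.rt i a x hx) f l hl) (by omega)
    · rw [if_neg hb, Submodule.mem_bot] at hf
      rw [hf, map_zero]
      exact Submodule.zero_mem _
  constructor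
  · intro hx
    have hs : c.cSwap L x ∈ L.grt j := tens_grt_ind _ (fun a b hab l hl z hz => by
      rw [cSwap_tens]
      exact mem_of_eq (G := L.grt) (ha a b 0 _ (PBimod.Homog.map_ite _ id ((hT b z).mp hz).1) l hl) (by omega)) hx
    have hm : c.cMul L x ∈ L.grt j := tens_grt_ind _ (fun a b hab l hl z hz => by
      rw [cMul_tens]
      exact mem_of_eq (G := L.grt) (ha a b 0 _ (PBimod.Homog.map_ite _ id ((hT b z).mp hz).1) l hl) (by omega)) hx
    refine ⟨⟨hs, mem_of_eq (G := L.grt) (S.divG true _ _ (Submodule.sub_mem _ hm hs)) (sub_zero j)⟩, fun s => ?_⟩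
    exact tens_grt_ind (c.cProj L s) (fun a b hab l hl z hz => by
      rw [cProj_tens]
      exact mem_of_eq (G := L.grt) (ha a b (v s) _ (((hT b z).mp hz).2 s) l hl) (by omega)) hx
  · rintro ⟨⟨h1, h2⟩, h3⟩
    rw [← c.expand_equiv h S x, expand_apply]
    refine Submodule.add_mem _ (Submodule.add_mem _ (tens_grt (b := 0) h1 ((hT _ _).mpr ?_) (add_zero j))
      (tens_grt (b := 0) h2 ((hT _ _).mpr ?_) (add_zero j)))
      (Submodule.sum_mem _ fun s _ => tens_grt (b := v s) (h3 s) ((hT _ _).mpr ?_) (by ring))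
    · rw [e_one, if_pos rfl]
      exact ⟨trivial, fun s => Submodule.zero_mem _⟩
    · rw [e_eta, if_pos rfl]
      exact ⟨trivial, fun s => Submodule.zero_mem _⟩
    · rw [e_gen]
      refine ⟨Submodule.zero_mem _, fun t => ?_⟩
      by_cases ht : t = s
      · subst ht
        rw [if_pos rfl]; trivial
      · change (Pi.single s 1 : Fin (p - 1) → Pol k (m + 2)) t ∈ _
        rw [Pi.single_eq_of_ne ht]
        exact Submodule.zero_mem _

end Cross

end Cross

end PHHH

/-! ### The positive and the negative crossing -/

namespace PHHH
open MvPolynomial (X)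
variable {k : Type u} [Field k]

/-- Reindexing of a sum over consecutive pairs. -/
lemma sum_shift {A : Type*} [AddCommMonoid A] {q : ℕ} (f : Fin q → Fin q → A) :
    ∑ s : Fin q, (if h : (s : ℕ) + 1 < q then f s ⟨(s : ℕ) + 1, h⟩ else 0)
      = ∑ s : Fin q, (if (s : ℕ) = 0 then 0 else f ⟨(s : ℕ) - 1, by omega⟩ s) := by
  cases q with
  | zero => rfl
  | succ q =>
    rw [Fin.sum_univ_castSucc, Fin.sum_univ_succ, dif_neg (by simp), add_zero]
    refine Eq.trans ?_ (zero_add _).symm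
    refine Finset.sum_congr rfl fun s _ => ?_
    rw [dif_pos (by simp), if_neg (by simp)]
    rfl

lemma mem_iff_of_eq {V : Type*} [AddCommGroup V] [Module k V] {G : ℤ → Submodule k V} {i j : ℤ} {x : V}
    (h : i = j) : x ∈ G i ↔ x ∈ G j := by rw [h]

namespace Cross

variable {p m : ℕ} [Fact p.Prime] [CharP k p]

section Expand

variable {T : PBimod k p (m + 2)} (c : Cross T) (L : PBimod k p (m + 2))

lemma expand_single (s : Fin (p - 1)) (z : L.carrier) :
    c.expand L ((0, 0), Pi.single s z) = tens L T z (c.gen s) := by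
  rw [expand_apply, Finset.sum_eq_single s]
  · change tens L T 0 c.one + tens L T 0 c.eta + tens L T ((Pi.single s z : Fin (p - 1) → L.carrier) s) (c.gen s) = _
    rw [Pi.single_eq_same, map_zero, LinearMap.zero_apply, LinearMap.zero_apply, zero_add, zero_add]
  · intro t _ ht
    change tens L T ((Pi.single s z : Fin (p - 1) → L.carrier) t) (c.gen t) = 0
    rw [Pi.single_eq_of_ne ht, map_zero, LinearMap.zero_apply]
  · exact fun hs => absurd (Finset.mem_univ s) hs

lemma expand_inr (f : Fin (p - 1) → L.carrier) :
    c.expand L ((0, 0), f) = ∑ s, tens L T (f s) (c.gen s) := by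
  rw [expand_apply, map_zero, LinearMap.zero_apply, LinearMap.zero_apply, zero_add, zero_add]

lemma expand_inl (z : L.carrier) : c.expand L ((0, z), 0) = tens L T z c.eta := by
  rw [expand_apply, map_zero, LinearMap.zero_apply, zero_add, Finset.sum_eq_zero, add_zero]
  intro s _
  change tens L T 0 (c.gen s) = 0
  rw [map_zero, LinearMap.zero_apply]

end Expand

section Positive

variable (k p m) in
/-- The decomposition of the complex of a positive crossing. -/
noncomputable def pos : Cross (pTpos k p (Fin.last m)) where
  e := LinearEquiv.refl k _
  eL _ _ := rfl
  eR _ _ := rfl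

lemma zero_lt : 0 < p - 1 := Nat.sub_pos_of_lt (Fact.out : p.Prime).one_lt

lemma pos_dt (v : BS k (vx m) (vy m)) (f : Fin (p - 1) → Pol k (m + 2)) :
    (pTpos k p (Fin.last m)).dt ((pos k p m).e.symm (v, f)) = (pos k p m).e.symm (0, fun s : Fin (p - 1) =>
      if (s : ℕ) = 0 then brLin k (vx m) (vy m) v else f ⟨(s : ℕ) - 1, by omega⟩) := rfl

lemma pos_dt_inl (v : BS k (vx m) (vy m)) : (pTpos k p (Fin.last m)).dt ((pos k p m).e.symm (v, 0))
    = (pTpos k p (Fin.last m)).left (brLin k (vx m) (vy m) v) ((pos k p m).gen ⟨0, zero_lt⟩) := by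
  rw [pos_dt]
  refine (pos k p m).e.injective ?_
  rw [(pos k p m).eL, e_gen, LinearEquiv.apply_symm_apply]
  refine Prod.ext (map_zero (bsLeft k (vx m) (vy m) _)).symm (funext fun s => ?_)
  change (if (s : ℕ) = 0 then brLin k (vx m) (vy m) v else 0)
    = brLin k (vx m) (vy m) v * (Pi.single ⟨0, zero_lt⟩ 1 : Fin (p - 1) → Pol k (m + 2)) s
  by_cases hs : (s : ℕ) = 0
  · obtain rfl : s = ⟨0, zero_lt⟩ := Fin.ext hs
    rw [if_pos rfl, Pi.single_eq_same, mul_one]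
  · rw [if_neg hs, Pi.single_eq_of_ne (fun h => hs (congrArg Fin.val h)), mul_zero]

lemma pos_dt_gen (s : Fin (p - 1)) : (pTpos k p (Fin.last m)).dt ((pos k p m).gen s)
    = if h : (s : ℕ) + 1 < p - 1 then (pos k p m).gen ⟨(s : ℕ) + 1, h⟩ else 0 := by
  rw [gen, pos_dt]
  have h0 : brLin k (vx m) (vy m) 0 = 0 := map_zero _
  split_ifs with h
  · refine congrArg (pos k p m).e.symm (Prod.ext rfl (funext fun t => ?_))
    change (if (t : ℕ) = 0 then brLin k (vx m) (vy m) 0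
      else (Pi.single s 1 : Fin (p - 1) → Pol k (m + 2)) ⟨(t : ℕ) - 1, by omega⟩)
      = (Pi.single ⟨(s : ℕ) + 1, h⟩ 1 : Fin (p - 1) → Pol k (m + 2)) t
    simp only [Pi.single_apply, Fin.ext_iff, h0]
    split_ifs <;> first | rfl | omega
  · refine (congrArg (pos k p m).e.symm (a₂ := (0 : BS k (vx m) (vy m) × (Fin (p - 1) → Pol k (m + 2)))) ?_).trans
      (map_zero (pos k p m).e.symm)
    refine Prod.ext rfl (funext fun t => ?_)
    change (if (t : ℕ) = 0 then brLin k (vx m) (vy m) 0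
      else (Pi.single s 1 : Fin (p - 1) → Pol k (m + 2)) ⟨(t : ℕ) - 1, by omega⟩) = 0
    have := t.2
    simp only [Pi.single_apply, Fin.ext_iff, h0]
    split_ifs <;> first | rfl | omega

lemma bsDq_unit : bsDq k (vx m) (vy m) (bsUnit k m) = 0 := by
  rw [bsDq_tmul, Derivation.map_one_eq_zero, TensorProduct.zero_tmul, TensorProduct.tmul_zero, add_zero]

/-- The element `y ⊗ 1 - 1 ⊗ x` is an eigenvector of `∂_q` with eigenvalue `x + y`. -/
lemma bsDq_eta : bsDq k (vx m) (vy m) (rbElt k (vx m) (vy m))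
    = bsLeft k (vx m) (vy m) (X (vx m) + X (vy m)) (rbElt k (vx m) (vy m)) := by
  have h := dq_rbElt k (vx m) (vy m)
  rw [linForm_rbTwist, map_neg, LinearMap.neg_apply, ← sub_eq_add_neg, sub_eq_zero] at h
  rw [h, left_rbElt]

lemma pos_dq (v : BS k (vx m) (vy m)) (f : Fin (p - 1) → Pol k (m + 2)) :
    (pTpos k p (Fin.last m)).dq ((pos k p m).e.symm (v, f)) = (pos k p m).e.symm
      (bsDq k (vx m) (vy m) v, fun s => dPol k (m + 2) (f s)) := rfl

lemma dPol_single (s : Fin (p - 1)) :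
    (fun t => dPol k (m + 2) ((Pi.single s 1 : Fin (p - 1) → Pol k (m + 2)) t)) = 0 := by
  refine funext fun t => ?_
  by_cases ht : t = s
  · subst ht
    rw [Pi.single_eq_same, Derivation.map_one_eq_zero]; rfl
  · rw [Pi.single_eq_of_ne ht, map_zero]; rfl

variable {L : PBimod k p (m + 2)} (h : L.Homog) {M : KMod k (m + 1)} (S : Strand M h.toKMod)
  (hT : (L.tensor (pTpos k p (Fin.last m))).Homog)

lemma pos_equiv_dt (x : (L.tensor (pTpos k p (Fin.last m))).carrier) :
    (pos k p m).equiv h S ((L.tensor (pTpos k p (Fin.last m))).dt x)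
    = ((L.dt ((pos k p m).equiv h S x).1.1, L.dt ((pos k p m).equiv h S x).1.2),
      fun s => L.dt (((pos k p m).equiv h S x).2 s) + if (s : ℕ) = 0 then
        ((pos k p m).equiv h S x).1.1 + Strand.τ h.toKMod ((pos k p m).equiv h S x).1.2
        else ((pos k p m).equiv h S x).2 ⟨(s : ℕ) - 1, by omega⟩) := by
  refine ((pos k p m).equiv_dt h S x ((0, 0), fun s => if (s : ℕ) = 0 then
        ((pos k p m).equiv h S x).1.1 + Strand.τ h.toKMod ((pos k p m).equiv h S x).1.2
        else ((pos k p m).equiv h S x).2 ⟨(s : ℕ) - 1, lt_of_le_of_lt (Nat.sub_le _ _) s.2⟩) ?_).trans (by rw [add_zero, add_zero])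
  generalize (pos k p m).equiv h S x = v
  have h1 : (pTpos k p (Fin.last m)).dt (pos k p m).one = (pos k p m).gen ⟨0, zero_lt⟩ := by
    rw [one, pos_dt_inl, brLin_tmul, mul_one, map_one]; rfl
  have h2 : (pTpos k p (Fin.last m)).dt (pos k p m).eta
      = (pTpos k p (Fin.last m)).left (X (vy m) - X (vx m)) ((pos k p m).gen ⟨0, zero_lt⟩) := by
    rw [eta, pos_dt_inl, brLin_rbElt]
  have h3 : ∑ s, tens L (pTpos k p (Fin.last m)) (v.2 s) ((pTpos k p (Fin.last m)).dt ((pos k p m).gen s))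
      = (pos k p m).expand L ((0, 0), fun s => if (s : ℕ) = 0 then 0 else v.2 ⟨(s : ℕ) - 1, by omega⟩) := by
    rw [expand_inr]
    refine Eq.trans (Finset.sum_congr rfl fun s _ => ?_) ((sum_shift fun a b =>
      tens L (pTpos k p (Fin.last m)) (v.2 a) ((pos k p m).gen b)).trans (Finset.sum_congr rfl fun s _ => ?_))
    · rw [pos_dt_gen]
      split_ifs
      · rfl
      · rw [map_zero]
    · split_ifs
      · rw [map_zero, LinearMap.zero_apply]
      · rfl
  rw [h1, h2, h3, ← tens_bal, ← LinearMap.add_apply, ← map_add, map_sub, ← expand_single, ← map_add]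
  refine congrArg _ (Prod.ext (Prod.ext (zero_add _) (zero_add _)) (funext fun s => ?_))
  change (Pi.single ⟨0, zero_lt⟩ (v.1.1 + Strand.τ h.toKMod v.1.2) : Fin (p - 1) → L.carrier) s
    + (if (s : ℕ) = 0 then 0 else v.2 ⟨(s : ℕ) - 1, by omega⟩)
    = if (s : ℕ) = 0 then v.1.1 + Strand.τ h.toKMod v.1.2 else v.2 ⟨(s : ℕ) - 1, by omega⟩
  by_cases hs : (s : ℕ) = 0
  · obtain rfl : s = ⟨0, zero_lt⟩ := Fin.ext hs
    rw [if_pos rfl, if_pos rfl, Pi.single_eq_same, add_zero]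
  · rw [if_neg hs, if_neg hs, Pi.single_eq_of_ne (fun h => hs (congrArg Fin.val h)), zero_add]

lemma form_zero (N : KMod k (m + 2)) (v : N.V) : N.form (Strand.xy m 0 0) v = 0 := by
  rw [Strand.form_xy, zero_smul, zero_smul, add_zero]

/-- The tensor product with the complex of a positive crossing, where the indices of the copies of
the polynomial ring are reversed. -/
noncomputable def posModel : KMod.LoModel p hT.toKMod (Strand.bsMod h.toKMod 0 (L1.qsh 3))
    (h.toKMod.twisted (Strand.xy m 0 0) (L1.qsh 3)) (Strand.brHom h.toKMod (L1.qsh 3)) where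
  e := ((pos k p m).equiv h S).trans ((LinearEquiv.refl k (L.carrier × L.carrier)).prodCongr
    (LinearEquiv.funCongrLeft k L.carrier Fin.revPerm))
  el i x := by
    change (((pos k p m).equiv h S _).1, fun s => ((pos k p m).equiv h S _).2 (Fin.rev s)) = _
    rw [equiv_left]
    rfl
  er i x := by
    change (((pos k p m).equiv h S _).1, fun s => ((pos k p m).equiv h S _).2 (Fin.rev s)) = _
    rw [equiv_right]
    rfl
  eq x := by
    change (((pos k p m).equiv h S _).1, fun s => ((pos k p m).equiv h S _).2 (Fin.rev s)) = _
    rw [(pos k p m).equiv_dq h S 0 1]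
    · refine Prod.ext rfl (funext fun s => ?_)
      exact ((congrArg (L.dq (((pos k p m).equiv h S x).2 (Fin.rev s)) + ·) (form_zero h.toKMod _)).trans
        (add_zero _)).symm
    · rw [zero_smul, map_zero, one, pos_dq, bsDq_unit]
      exact congrArg (pos k p m).e.symm (Prod.ext rfl (funext fun s => map_zero _))
    · rw [one_smul]
      refine (pos k p m).e.injective ?_
      rw [(pos k p m).eL, e_eta, eta, pos_dq, LinearEquiv.apply_symm_apply, bsDq_eta]
      refine Prod.ext rfl (funext fun s => ?_)
      change dPol k (m + 2) 0 = _ * 0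
      rw [map_zero, mul_zero]
    · intro s
      rw [gen, pos_dq, dPol_single, map_zero (bsDq k (vx m) (vy m))]
      exact map_zero _
  et x := by
    change (((pos k p m).equiv h S _).1, fun s => ((pos k p m).equiv h S _).2 (Fin.rev s)) = _
    rw [pos_equiv_dt]
    refine Prod.ext rfl (funext fun s => ?_)
    change _ = L.dt (((pos k p m).equiv h S x).2 (Fin.rev s))
      + shDown k (p - 1) L.carrier (fun s => ((pos k p m).equiv h S x).2 (Fin.rev s)) s
      + L1.last k (p - 1) L.carrier
        (((pos k p m).equiv h S x).1.1 + Strand.τ h.toKMod ((pos k p m).equiv h S x).1.2) s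
    rw [shDown_apply, L1.last_apply, add_assoc]
    refine congrArg (L.dt (((pos k p m).equiv h S x).2 (Fin.rev s)) + ·) ?_
    have hr : (Fin.rev s : ℕ) = p - 1 - (s + 1) := Fin.val_rev s
    have hs := s.2
    by_cases hs0 : (s : ℕ) + 1 < p - 1
    · rw [if_neg (by omega), dif_pos hs0, if_neg (by omega), add_zero]
      refine congrArg ((pos k p m).equiv h S x).2 (Fin.ext ?_)
      change (Fin.rev s : ℕ) - 1 = (Fin.rev ⟨(s : ℕ) + 1, hs0⟩ : ℕ)
      rw [hr, Fin.val_rev]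
      change p - 1 - ((s : ℕ) + 1) - 1 = p - 1 - ((s : ℕ) + 1 + 1)
      omega
    · rw [if_pos (by omega), dif_neg hs0, if_pos (by omega), zero_add]
  eG b j x := by
    cases b
    · refine ((pos k p m).equiv_grq h S 3 3 (fun j z => ?_) j x).trans ?_
      · change (z.1 ∈ tensorGr _ _ (j - -3) ∧ z.2 ∈ Submodule.pi Set.univ fun _ => polGr k (m + 2) (j - -3)) ↔ _
        rw [sub_neg_eq_add]
        exact and_congr Iff.rfl ⟨fun hz s => hz s trivial, fun hz s _ => hz s⟩
      · refine and_congr Iff.rfl ⟨fun hx s => ?_, fun hx s => ?_⟩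
        · exact mem_of_eq (G := L.grq) (hx (Fin.rev s)) (by simp [tau, L1.qsh])
        · have := hx (Fin.rev s)
          exact PBimod.Homog.mem_of_val_eq (congrArg ((pos k p m).equiv h S x).2 (Fin.rev_rev s).symm) (mem_of_eq (G := L.grq) this (by simp [tau, L1.qsh]))
    · refine ((pos k p m).equiv_grt h S (fun s => -((s : ℤ) + 1)) (fun j z => ?_) j x).trans ?_
      · change (z.1 ∈ (if j = 0 then ⊤ else ⊥ : Submodule k _) ∧ z.2 ∈ Submodule.pi Set.univ fun s : Fin (p - 1) => _) ↔ _
        exact and_congr Iff.rfl ⟨fun hz s => hz s trivial, fun hz s _ => hz s⟩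
      · have hj : ∀ s : Fin (p - 1), j - -(((Fin.rev s : Fin (p - 1)) : ℤ) + 1)
            = j - tau true * (s : ℕ) + tau true * (p - 1) + L1.qsh 3 true := by
          intro s
          have hr : (Fin.rev s : ℕ) = p - 1 - (s + 1) := Fin.val_rev s
          have hs := s.2
          simp only [tau, L1.qsh, if_true]
          omega
        refine and_congr (and_congr (mem_iff_of_eq (G := L.grt) (by simp [L1.qsh]))
          (mem_iff_of_eq (G := L.grt) (by simp [L1.qsh]))) ⟨fun hx s => ?_, fun hx s => ?_⟩
        · exact mem_of_eq (G := L.grt) (hx (Fin.rev s)) (hj s)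
        · exact PBimod.Homog.mem_of_val_eq (congrArg ((pos k p m).equiv h S x).2 (Fin.rev_rev s).symm)
            (mem_of_eq (G := L.grt) (hx (Fin.rev s)) (by rw [← hj, Fin.rev_rev]))

end Positive

section Negative

variable (k p m) in
/-- The decomposition of the complex of a negative crossing. -/
noncomputable def neg : Cross (pTneg k p (Fin.last m)) where
  e := LinearEquiv.refl k _
  eL _ _ := rfl
  eR _ _ := rfl

lemma neg_dt (v : BS k (vx m) (vy m)) (f : Fin (p - 1) → Pol k (m + 2)) :
    (pTneg k p (Fin.last m)).dt ((neg k p m).e.symm (v, f)) = (neg k p m).e.symm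
      (bsLeft k (vx m) (vy m) (f ⟨0, zero_lt⟩) (rbElt k (vx m) (vy m)),
      fun s : Fin (p - 1) => if h : (s : ℕ) + 1 < p - 1 then f ⟨(s : ℕ) + 1, h⟩ else 0) := rfl

lemma neg_dt_inl (v : BS k (vx m) (vy m)) :
    (pTneg k p (Fin.last m)).dt ((neg k p m).e.symm (v, 0)) = 0 := by
  rw [neg_dt]
  refine (congrArg (neg k p m).e.symm (a₂ := (0 : BS k (vx m) (vy m) × (Fin (p - 1) → Pol k (m + 2)))) ?_).trans
    (map_zero (neg k p m).e.symm)
  refine Prod.ext ?_ (funext fun t => ?_)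
  · change bsLeft k (vx m) (vy m) 0 _ = 0
    rw [map_zero, LinearMap.zero_apply]
  · exact dite_eq_right_iff.mpr fun _ => rfl

lemma neg_dt_gen (s : Fin (p - 1)) : (pTneg k p (Fin.last m)).dt ((neg k p m).gen s)
    = if (s : ℕ) = 0 then (neg k p m).eta else (neg k p m).gen ⟨(s : ℕ) - 1, by omega⟩ := by
  rw [gen, neg_dt]
  have h1 : (neg k p m).eta = (neg k p m).e.symm (rbElt k (vx m) (vy m), 0) := rfl
  have h2 : ∀ t, (neg k p m).gen t = (neg k p m).e.symm (0, Pi.single t 1) := fun t => rfl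
  have hs := s.2
  by_cases h : (s : ℕ) = 0
  · rw [if_pos h, h1]
    obtain rfl : s = ⟨0, zero_lt⟩ := Fin.ext h
    refine congrArg (neg k p m).e.symm (Prod.ext ?_ (funext fun t => ?_))
    · change bsLeft k (vx m) (vy m) ((Pi.single _ 1 : Fin (p - 1) → Pol k (m + 2)) _) _ = _
      rw [Pi.single_eq_same, map_one]; rfl
    · change (if h : (t : ℕ) + 1 < p - 1 then (Pi.single ⟨0, zero_lt⟩ 1 : Fin (p - 1) → Pol k (m + 2)) ⟨(t : ℕ) + 1, h⟩
        else 0) = 0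
      exact dite_eq_right_iff.mpr fun h => Pi.single_eq_of_ne (fun e => absurd (congrArg Fin.val e) (Nat.succ_ne_zero _)) _
  · rw [if_neg h, h2]
    refine congrArg (neg k p m).e.symm (Prod.ext ?_ (funext fun t => ?_))
    · change bsLeft k (vx m) (vy m) ((Pi.single s 1 : Fin (p - 1) → Pol k (m + 2)) ⟨0, zero_lt⟩) _ = 0
      rw [Pi.single_eq_of_ne (fun e => h (congrArg Fin.val e).symm), map_zero]; rfl
    · change (if h : (t : ℕ) + 1 < p - 1 then (Pi.single s 1 : Fin (p - 1) → Pol k (m + 2)) ⟨(t : ℕ) + 1, h⟩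
        else 0) = (Pi.single ⟨(s : ℕ) - 1, by omega⟩ 1 : Fin (p - 1) → Pol k (m + 2)) t
      have ht := t.2
      simp only [Pi.single_apply, Fin.ext_iff]
      split_ifs <;> first | rfl | omega

lemma neg_dq (v : BS k (vx m) (vy m)) (f : Fin (p - 1) → Pol k (m + 2)) :
    (pTneg k p (Fin.last m)).dq ((neg k p m).e.symm (v, f)) = (neg k p m).e.symm
      (bsDq k (vx m) (vy m) v + bsRight k (vx m) (vy m) (linForm k (rbTwist (vx m) (vy m))) v,
      fun s => dPol k (m + 2) (f s)) := rfl

variable {L : PBimod k p (m + 2)} (h : L.Homog) {M : KMod k (m + 1)} (S : Strand M h.toKMod)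
  (hT : (L.tensor (pTneg k p (Fin.last m))).Homog)

lemma neg_equiv_dt (x : (L.tensor (pTneg k p (Fin.last m))).carrier) :
    (neg k p m).equiv h S ((L.tensor (pTneg k p (Fin.last m))).dt x)
    = ((L.dt ((neg k p m).equiv h S x).1.1, L.dt ((neg k p m).equiv h S x).1.2
        + ((neg k p m).equiv h S x).2 ⟨0, zero_lt⟩),
      fun s => L.dt (((neg k p m).equiv h S x).2 s)
        + shDown k (p - 1) L.carrier ((neg k p m).equiv h S x).2 s) := by
  refine ((neg k p m).equiv_dt h S x ((0, ((neg k p m).equiv h S x).2 ⟨0, zero_lt⟩),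
    shDown k (p - 1) L.carrier ((neg k p m).equiv h S x).2) ?_).trans (by rw [add_zero])
  generalize (neg k p m).equiv h S x = v
  have h1 : (pTneg k p (Fin.last m)).dt (neg k p m).one = 0 := neg_dt_inl _
  have h2 : (pTneg k p (Fin.last m)).dt (neg k p m).eta = 0 := neg_dt_inl _
  have h3 : ((neg k p m).expand L) ((0, v.2 ⟨0, zero_lt⟩), shDown k (p - 1) L.carrier v.2)
      = tens L (pTneg k p (Fin.last m)) (v.2 ⟨0, zero_lt⟩) (neg k p m).eta
        + ∑ s, tens L (pTneg k p (Fin.last m)) (shDown k (p - 1) L.carrier v.2 s) ((neg k p m).gen s) := by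
    rw [← expand_inl, ← expand_inr, ← map_add]
    exact congrArg _ (Prod.ext (Prod.ext (zero_add _).symm (add_zero _).symm) (zero_add _).symm)
  have h4 : ∑ s, tens L (pTneg k p (Fin.last m)) (shDown k (p - 1) L.carrier v.2 s) ((neg k p m).gen s)
      = ∑ s : Fin (p - 1), if (s : ℕ) = 0 then 0 else
        tens L (pTneg k p (Fin.last m)) (v.2 s) ((neg k p m).gen ⟨(s : ℕ) - 1, by omega⟩) := by
    refine Eq.trans (Finset.sum_congr rfl fun s _ => ?_) (sum_shift fun a b =>
      tens L (pTneg k p (Fin.last m)) (v.2 b) ((neg k p m).gen a))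
    rw [shDown_apply]
    split_ifs
    · rfl
    · rw [map_zero, LinearMap.zero_apply]
  have h5 : tens L (pTneg k p (Fin.last m)) (v.2 ⟨0, zero_lt⟩) (neg k p m).eta
      = ∑ s : Fin (p - 1), if (s : ℕ) = 0 then tens L (pTneg k p (Fin.last m)) (v.2 s) (neg k p m).eta else 0 := by
    rw [Finset.sum_eq_single ⟨0, zero_lt⟩]
    · rfl
    · exact fun t _ ht => if_neg fun e => ht (Fin.ext e)
    · exact fun hs => absurd (Finset.mem_univ _) hs
  rw [h1, h2, h3, h4, h5, map_zero, map_zero, zero_add, zero_add, ← Finset.sum_add_distrib]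
  refine Finset.sum_congr rfl fun s _ => ?_
  rw [neg_dt_gen]
  split_ifs
  · rw [add_zero]
  · rw [zero_add]

/-- The tensor product with the complex of a negative crossing. -/
noncomputable def negModel : KMod.HiModel p hT.toKMod (Strand.bsMod h.toKMod (-1) (L1.qsh (-1)))
    (h.toKMod.twisted (Strand.xy m 0 0) (Strand.lower (L1.qsh (-1)))) (Strand.rbHom h.toKMod (L1.qsh (-1))) where
  e := (neg k p m).equiv h S
  el i x := (neg k p m).equiv_left h S i x
  er i x := (neg k p m).equiv_right h S i x
  eq x := by
    refine ((neg k p m).equiv_dq h S (-1) 0 ?_ ?_ ?_ x).trans ?_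
    · refine (neg k p m).e.injective ?_
      rw [(neg k p m).eL, e_one, one, neg_dq, LinearEquiv.apply_symm_apply, bsDq_unit, linForm_rbTwist, zero_add,
        neg_one_smul]
      refine Prod.ext ?_ (funext fun s => ?_)
      · change bsRight k (vx m) (vy m) _ (bsUnit k m) = bsLeft k (vx m) (vy m) _ (bsUnit k m)
        have hs := tmul_sym k (Subalgebra.neg_mem _ (add_mem_symSub k (vx m) (vy m))) 1 1
        rw [mul_one] at hs
        rw [bsRight_tmul, bsLeft_tmul, mul_one, hs]
      · change dPol k (m + 2) 0 = _ * 0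
        rw [map_zero, mul_zero]
    · rw [zero_smul, map_zero, eta, neg_dq, dq_rbElt]
      exact (congrArg (neg k p m).e.symm (Prod.ext rfl (funext fun s => map_zero _))).trans
        (map_zero (neg k p m).e.symm)
    · intro s
      rw [gen, neg_dq, dPol_single, map_zero (bsDq k (vx m) (vy m)), map_zero (bsRight k (vx m) (vy m) _), add_zero]
      exact map_zero _
    · refine Prod.ext rfl (funext fun s => ?_)
      exact ((congrArg (L.dq (((neg k p m).equiv h S x).2 s) + ·) (form_zero h.toKMod _)).trans
        (add_zero _)).symm
  et x := by
    rw [L1.first_apply, dif_pos zero_lt]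
    refine (neg_equiv_dt h S x).trans (Prod.ext (Prod.ext (add_zero _).symm rfl) rfl)
  eG b j x := by
    cases b
    · refine ((neg k p m).equiv_grq h S (-1) (-3) (fun j z => ?_) j x).trans ?_
      · change (z.1 ∈ tensorGr _ _ (j - 3 - -2) ∧ z.2 ∈ Submodule.pi Set.univ fun _ => polGr k (m + 2) (j - 3)) ↔ _
        rw [show j - 3 - -2 = j + -1 by ring, sub_eq_add_neg]
        exact and_congr Iff.rfl ⟨fun hz s => hz s trivial, fun hz s _ => hz s⟩
      · refine and_congr Iff.rfl (forall_congr' fun s => mem_iff_of_eq (G := L.grq) ?_)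
        simp [tau, L1.qsh, Strand.lower]
    · refine ((neg k p m).equiv_grt h S (fun s => (s : ℤ) + 1) (fun j z => ?_) j x).trans ?_
      · change (z.1 ∈ (if j = 0 then ⊤ else ⊥ : Submodule k _) ∧ z.2 ∈ Submodule.pi Set.univ fun s : Fin (p - 1) => _) ↔ _
        exact and_congr Iff.rfl ⟨fun hz s => hz s trivial, fun hz s _ => hz s⟩
      · refine and_congr (and_congr (mem_iff_of_eq (G := L.grt) (by simp [L1.qsh]))
          (mem_iff_of_eq (G := L.grt) (by simp [L1.qsh]))) (forall_congr' fun s => mem_iff_of_eq (G := L.grt) ?_)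
        simp only [tau, L1.qsh, Strand.lower]
        simp
        ring

end Negative

end Cross
end PHHH

/-! ### Comparison with the invariant -/

namespace PHHH
open MvPolynomial (X)
variable {k : Type u} [Field k]

lemma slashGr_mono {V : Type u} [AddCommGroup V] [Module k V] {p : ℕ} {D : Module.End k V}
    {S S' : Submodule k V} (h : S ≤ S') : Slash.gr p D S ≤ Slash.gr p D S' := fun x hx =>
  mem_slashGr.mpr fun j => by
    obtain ⟨v, hv, hS, e⟩ := mem_slashGr.mp hx j
    exact ⟨v, hv, h hS, e⟩

/-- Classes in slash homology with representatives in `S` are sums of classes with representatives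
that are homogeneous for the Hochschild degree. -/
lemma L1.Decomp.slashGr_le {X : L1 k} (P : L1.Decomp X) (p : ℕ) [Fact p.Prime] {S : Submodule k X.V}
    (hS : ∀ d, ∀ v ∈ S, P.π d v ∈ S) :
    Slash.gr p X.D S ≤ ⨆ d : ℤ, Slash.gr p X.D (X.A d ⊓ S) := by
  intro x hx
  have hs : x = ∑ i : Fin (p - 1),
      LinearMap.single k (fun j : Fin (p - 1) => SlashPiece p X.D j) i (x i) :=
    (Finset.univ_sum_single _).symm
  rw [hs]
  refine Submodule.sum_mem _ fun i _ => ?_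
  obtain ⟨v, hv, hvS, e⟩ := mem_slashGr.mp hx i
  have hd : ∀ d, P.π d v ∈ LinearMap.ker (X.D ^ ((i : ℕ) + 1)) := fun d => by
    rw [LinearMap.mem_ker] at hv ⊢
    rw [← P.π_D, hv, map_zero]
  have hsum : x i = ∑ d ∈ P.F, slashCls p X.D i (P.π d v) (hd d) := by
    have h : (⟨v, hv⟩ : LinearMap.ker (X.D ^ ((i : ℕ) + 1))) = ∑ d ∈ P.F, ⟨P.π d v, hd d⟩ :=
      Subtype.ext (by rw [AddSubmonoidClass.coe_finsetSum]; exact (P.sum v).symm)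
    exact e.trans ((congrArg (slashDenom p X.D i).mkQ h).trans (map_sum _ _ _))
  rw [hsum, map_sum]
  exact Submodule.sum_mem _ fun d _ => Submodule.mem_iSup_of_mem d
    (L1.single_mem_slashGr p (hd d) ⟨P.πA d v, hS d v hvS⟩)

lemma KMod.slashHH_twisted_G {n : ℕ} (N : KMod k n) (p : ℕ) (c : Fin n → ℤ) (e : Bool → ℤ) (b : Bool)
    (j : ℤ) : (L1.slashHH p ((N.twisted c e).kosL p)).G b j = (L1.slashHH p (N.kosL p)).G b (j + e b) := by
  change (⨆ d : ℤ, _) = ⨆ d : ℤ, _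
  refine iSup_congr fun d => congrArg (Slash.gr p (N.kosL p).D) (congrArg (kosA N.V n p d ⊓ ·) ?_)
  refine Submodule.ext fun w => mem_kosG.trans (Iff.trans (forall_congr' fun a => ?_) mem_kosG.symm)
  exact mem_iff_of_eq (G := N.Gr b) (by ring)

namespace PBimod.Homog

variable {p n : ℕ} [Fact p.Prime] [CharP k p] {M : PBimod k p n} (h : M.Homog)

lemma kosQL_eq : h.toKMod.kosQL p = kosQ M := by
  refine LinearMap.ext fun w => funext fun a => ?_
  rw [KMod.kosQL_apply]
  change M.dq (w a) + h.toKMod.tw p a (w a)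
    = M.dq (w a) + M.left (kosForm k a) (w a) + M.right (kosForm k a) (w a)
  rw [add_assoc, KMod.tw_apply, kosForm, linForm, map_sum, map_sum, LinearMap.sum_apply, LinearMap.sum_apply,
    ← Finset.sum_add_distrib]
  refine congrArg _ (Finset.sum_congr rfl fun i _ => ?_)
  split_ifs
  · rw [zero_smul, map_zero, map_zero]
    exact (add_zero _).symm
  · rw [one_smul]

lemma form_eq (c : Fin n → ℤ) : h.toKMod.form c = M.right (linForm k c) := by
  rw [linForm, map_sum]
  exact Finset.sum_congr rfl fun i _ => (map_zsmul M.right _ _).symm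

lemma kosQL_twisted (c : Fin n → ℤ) (e : Bool → ℤ) :
    (h.toKMod.twisted c e).kosQL p = kosQ M + kosAct M (linForm k c) := by
  rw [← h.kosQL_eq]
  refine LinearMap.ext fun w => funext fun a => ?_
  change M.dq (w a) + h.toKMod.form c (w a) + h.toKMod.tw p a (w a)
    = M.dq (w a) + h.toKMod.tw p a (w a) + M.right (linForm k c) (w a)
  rw [form_eq]
  abel

lemma slashHH_Q : (L1.slashHH p (h.toKMod.kosL p)).Q = pHHQ M :=
  Slash.map_congr h.kosQL_eq _ _

lemma slashHH_twisted_Q (c : Fin n → ℤ) (e : Bool → ℤ) :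
    (L1.slashHH p ((h.toKMod.twisted c e).kosL p)).Q = pHHQ M + pHHAct M (linForm k c) := by
  have hc : (kosQ M + kosAct M (linForm k c)) * kosH M = kosH M * (kosQ M + kosAct M (linForm k c)) := by
    rw [add_mul, mul_add, kosQ_kosH, kosAct_kosH]
  exact (Slash.map_congr (h.kosQL_twisted c e) _ hc).trans (Slash.map_add' (kosQ_kosH M) (kosAct_kosH M _) hc)

lemma kosA_natCast (d : ℕ) : kosA (k := k) M.carrier n p d = kosGrA M d := by
  refine Submodule.ext fun w => forall_congr' fun a => forall_congr' fun _ => ?_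
  have : (∑ s, ((a s : ℕ) : ℤ) = d) = (∑ s, (a s : ℕ) = d) := by
    rw [← Nat.cast_sum, Nat.cast_inj]
  change w a ∈ (if ∑ s, ((a s : ℕ) : ℤ) = d then ⊤ else ⊥ : Submodule k M.carrier)
    ↔ w a ∈ (if ∑ s, (a s : ℕ) = d then ⊤ else ⊥ : Submodule k M.carrier)
  simp only [this]

lemma kosA_neg {d : ℤ} (hd : d < 0) : kosA (k := k) M.carrier n p d = ⊥ :=
  (Submodule.eq_bot_iff _).mpr fun w hw => funext fun a => mem_kosA.mp hw a fun e =>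
    absurd (e ▸ Finset.sum_nonneg fun s _ => Int.natCast_nonneg _) (not_le.mpr hd)

lemma slashHH_GrQ (j : ℤ) : (L1.slashHH p (h.toKMod.kosL p)).G false j = pHHGrQ M j := by
  have hd : ∀ d : ℕ, L1.hochShift p false d = 2 * (hochDeg p d : ℤ) := fun d => by
    rw [L1.hochShift, if_neg Bool.false_ne_true, hochDeg]
    have : ((p : ℤ) ∣ d) = (d % p = 0) := by rw [Int.natCast_dvd_natCast, Nat.dvd_iff_mod_eq_zero]
    simp only [this]
    push_cast
    rfl
  refine le_antisymm (iSup_le fun d => ?_) (iSup_le fun d => ?_)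
  · rcases lt_or_ge d 0 with h0 | h0
    · refine (slashGr_mono (S' := kosGrA M 0 ⊓ kosGrQ M (j - 2 * (hochDeg p 0 : ℤ))) ?_).trans
        (le_iSup (fun d : ℕ => Slash.gr p (kosH M) (kosGrA M d ⊓ kosGrQ M (j - 2 * (hochDeg p d : ℤ)))) 0)
      change kosA M.carrier n p d ⊓ _ ≤ _
      rw [kosA_neg h0, bot_inf_eq]
      exact bot_le
    · lift d to ℕ using h0
      refine le_trans ?_ (le_iSup (fun d : ℕ => Slash.gr p (kosH M)
        (kosGrA M d ⊓ kosGrQ M (j - 2 * (hochDeg p d : ℤ)))) d)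
      rw [← hd, ← kosA_natCast]
      exact le_rfl
  · refine le_trans ?_ (le_iSup (fun d : ℤ => Slash.gr p (kosH M) (kosA M.carrier n p d ⊓
      kosGrQ M (j - L1.hochShift p false d))) (d : ℤ))
    rw [hd, kosA_natCast]
    exact le_rfl

lemma slashHH_GrT (i : ℤ) : (L1.slashHH p (h.toKMod.kosL p)).G true i = pHHGrT M i := by
  have key : ∀ d w, w ∈ kosA (k := k) M.carrier n p d →
      (w ∈ kosG p M.grt 0 (i - d) ↔ w ∈ kosGrT M i) := by
    intro d w hw
    refine mem_kosG.trans ⟨fun hG a _ => ?_, fun hG a => ?_⟩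
    · by_cases ha : ∑ s, ((a s : ℕ) : ℤ) = d
      · exact mem_of_eq (G := M.grt) (hG a) (by rw [ha]; simp)
      · rw [mem_kosA.mp hw a ha]; exact Submodule.zero_mem _
    · by_cases ha : ∑ s, ((a s : ℕ) : ℤ) = d
      · exact mem_of_eq (G := M.grt) (hG a trivial) (by rw [ha]; simp)
      · rw [mem_kosA.mp hw a ha]; exact Submodule.zero_mem _
  refine le_antisymm (iSup_le fun d => slashGr_mono fun w hw => (key d w hw.1).mp hw.2) ?_
  refine ((h.toKMod.kosDecomp p).slashGr_le p (S := kosGrT M i) fun d v hv a _ => ?_).trans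
    (iSup_mono fun d => slashGr_mono fun w hw => ⟨hw.1, (key d w hw.1).mpr hw.2⟩)
  change (LinearMap.pi fun a => if ∑ s, ((a s : ℕ) : ℤ) = d then LinearMap.proj a else 0 :
    Module.End k ((Fin n → Fin p) → M.carrier)) v a ∈ _
  rw [LinearMap.pi_apply]
  split_ifs
  · exact hv a trivial
  · exact Submodule.zero_mem _


/-- The `p`-Hochschild homology with its total `p`-differential, its collapsed gradings, the
`q`-grading being translated by `a`, and an operator `Q`. -/
noncomputable abbrev pHH (M : PBimod k p n) (Q : Module.End k (Slash p (kosH M)))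
    (hQ : Q * totalD M = totalD M * Q) (a : ℤ) : L2 k where
  V := Slash p (kosH M)
  D := totalD M
  Q := Q
  DQ x := (LinearMap.congr_fun hQ x).symm
  G b j := if b then pHHGrT M j else pHHGrQ M (j + a)

/-- The slash homology of the Koszul complex is the `p`-Hochschild homology. -/
noncomputable def pHHIso :
    L2Iso (L1.slashHH p (h.toKMod.kosL p)) (pHH M (pHHQ M) (pHHQ_totalD M) 0) where
  e := LinearEquiv.refl k (Slash p (kosH M))
  eD x := rfl
  eQ x := LinearMap.congr_fun h.slashHH_Q x
  eG b j x hx := by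
    cases b
    · change x ∈ pHHGrQ M (j + 0)
      rw [add_zero, ← h.slashHH_GrQ]
      exact hx
    · change x ∈ pHHGrT M j
      rw [← h.slashHH_GrT]
      exact hx
  eG' b j x hx := by
    cases b
    · rw [h.slashHH_GrQ]
      exact mem_of_eq (G := pHHGrQ M) hx (add_zero j)
    · rw [h.slashHH_GrT]
      exact hx

lemma twist_totalD (c : Fin n → ℤ) : (pHHQ M + pHHAct M (linForm k c)) * totalD M
    = totalD M * (pHHQ M + pHHAct M (linForm k c)) := by
  rw [add_mul, mul_add, pHHQ_totalD, pHHAct_totalD]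

/-- The slash homology of the Koszul complex of a twist, as a twist of the `p`-Hochschild homology. -/
noncomputable def pHHTwistIso (c : Fin n → ℤ) (a : ℤ) :
    L2Iso (L1.slashHH p ((h.toKMod.twisted c (L1.qsh a)).kosL p)) (pHH M (pHHQ M + pHHAct M (linForm k c))
      (twist_totalD c) a) where
  e := LinearEquiv.refl k (Slash p (kosH M))
  eD x := rfl
  eQ x := LinearMap.congr_fun (h.slashHH_twisted_Q c _) x
  eG b j x hx := by
    rw [KMod.slashHH_twisted_G] at hx
    cases b
    · rw [h.slashHH_GrQ] at hx
      exact hx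
    · rw [h.slashHH_GrT] at hx
      exact mem_of_eq (G := pHHGrT M) hx (add_zero j)
  eG' b j x hx := by
    rw [KMod.slashHH_twisted_G]
    cases b
    · rw [h.slashHH_GrQ]
      exact hx
    · rw [h.slashHH_GrT]
      exact mem_of_eq (G := pHHGrT M) hx (add_zero j).symm

lemma twist_dq (c : Fin n → ℤ) : Slash.map p (totalD M) (pHHQ M + pHHAct M (linForm k c)) (twist_totalD c)
    = ((pHHH M).twist c).dq :=
  Slash.map_add' (pHHQ_totalD M) (pHHAct_totalD M _) (twist_totalD c)

/-- An isomorphism of the `p`-Hochschild homologies up to homotopy yields one of the invariants, the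
normalizing shifts `q^{-n}` being taken into account. -/
noncomputable def hqIso {n' : ℕ} {T : PBimod k p n'} (c : Fin n → ℤ) (a : ℤ) (ha : (n' : ℤ) + a = n)
    (e : SlashIso p (pHH T (pHHQ T) (pHHQ_totalD T) 0) (pHH M (pHHQ M + pHHAct M (linForm k c)) (twist_totalD c) a)) :
    HqIso (pHHH T) ((pHHH M).twist c) where
  toEquiv := e.e
  map_dq x := (e.map_Q x).trans (LinearMap.congr_fun (twist_dq c) (e.e x))
  map_dt x := by
    have h1 : e.e (Slash.res p (totalD T) x) = Slash.res p (totalD M) (e.e x) := e.map_res x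
    exact h1
  map_grq j := by
    have h1 : (Slash.gr p (totalD T) (pHHGrQ T (j + n' + 0))).map e.e.toLinearMap
        = Slash.gr p (totalD M) (pHHGrQ M (j + n' + a)) := e.map_G false (j + n')
    exact (congrArg (fun i => (Slash.gr p (totalD T) (pHHGrQ T i)).map e.e.toLinearMap)
      (add_zero (j + n')).symm).trans (h1.trans (congrArg (fun i => Slash.gr p (totalD M) (pHHGrQ M i))
      ((add_assoc j _ a).trans (congrArg (j + ·) ha))))
  map_grt i := e.map_G true i

end PBimod.Homog

namespace Strand

variable {p m : ℕ} [Fact p.Prime] [CharP k p] (M : KMod k (m + 1))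

/-- The two translations after a positive crossing combine to one by `-1`. -/
def closedShift (c : ℤ) : L1Iso (((closed M c (L1.qsh 3)).kosL p).shift (L1.qsh 4))
    ((closed M c (L1.qsh (-1))).kosL p) where
  e := LinearEquiv.refl k _
  eD _ := rfl
  eT _ := rfl
  eQ _ := rfl
  eA _ _ := Iff.rfl
  eG b j x := by
    have h : ∀ i : ℤ, j - L1.qsh 4 b - i + L1.qsh 3 b = j - i + L1.qsh (-1) b := fun i => by
      cases b <;> simp [L1.qsh]
      ring
    exact (mem_kosG (Gr := fun j => M.Gr b (j + L1.qsh 3 b)) (σ := L1.qsh 2 b) (w := x)).trans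
      (Iff.trans (forall_congr' fun a => mem_iff_of_eq (G := M.Gr b) (h _))
        (mem_kosG (Gr := fun j => M.Gr b (j + L1.qsh (-1) b)) (σ := L1.qsh 2 b) (w := x)).symm)

end Strand

namespace PBimod.Homog

variable {p m : ℕ} [Fact p.Prime] [CharP k p] {M : PBimod k p (m + 1)} (h : M.Homog)

/-- Adding a strand and a positive crossing. The normalization of the crossing and the suspensions
shift the `q`-degree by `4 - 3 = 1`, which the additional `q^{-1}` of the extra strand absorbs. -/
noncomputable def positive (hp : 2 < p) :
    HqIso (pHHH (M.adjoin.tensor (PHHH.pTpos k p (Fin.last m)))) ((pHHH M).twist (Pi.single (Fin.last m) 2)) :=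
  have hodd : Odd p := (Fact.out : p.Prime).odd_of_ne_two hp.ne'
  have hT : (M.adjoin.tensor (PHHH.pTpos k p (Fin.last m))).Homog := h.adjoin.tensor (pTpos _)
  hqIso _ (-1) (by push_cast; ring)
    ((hT.pHHIso.hEquiv p).slashIso.symm.trans (((hT.toKMod.kosExtIso p hp hodd).hEquiv p).slashIso.symm.trans
      ((h.strand.loIso hodd (L1.qsh 3) (Cross.posModel h.adjoin h.strand hT)
        (KMod.kosL_T_pow (PBimod.dt_pow _)) M.dt_pow).trans
      ((((Strand.closedShift h.toKMod 2).ext p).hEquiv p).slashIso.trans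
      ((((Strand.closed h.toKMod 2 (L1.qsh (-1))).kosExtIso p hp hodd).hEquiv p).slashIso.trans
      ((h.pHHTwistIso (Pi.single (Fin.last m) 2) (-1)).hEquiv p).slashIso)))))

/-- Adding a strand and a negative crossing. Its normalization and the grading of `B_i` shift the
`q`-degree by `3 - 2 = 1`, which the additional `q^{-1}` of the extra strand absorbs. -/
noncomputable def negative (hp : 2 < p) :
    HqIso (pHHH (M.adjoin.tensor (PHHH.pTneg k p (Fin.last m)))) ((pHHH M).twist (Pi.single (Fin.last m) (-2))) :=
  have hodd : Odd p := (Fact.out : p.Prime).odd_of_ne_two hp.ne'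
  have hT : (M.adjoin.tensor (PHHH.pTneg k p (Fin.last m))).Homog := h.adjoin.tensor (pTneg _)
  hqIso _ (-1) (by push_cast; ring)
    ((hT.pHHIso.hEquiv p).slashIso.symm.trans (((hT.toKMod.kosExtIso p hp hodd).hEquiv p).slashIso.symm.trans
      ((h.strand.hiIso hodd (L1.qsh (-1)) (Cross.negModel h.adjoin h.strand hT)
        (KMod.kosL_T_pow (PBimod.dt_pow _))).trans
      ((((Strand.closed h.toKMod (-2) (L1.qsh (-1))).kosExtIso p hp hodd).hEquiv p).slashIso.trans
      ((h.pHHTwistIso (Pi.single (Fin.last m) (-2)) (-1)).hEquiv p).slashIso))))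

end PBimod.Homog

end PHHH

theorem mainTheorem8 {k : Type*} [Field k] (p : ℕ) [Fact p.Prime] [CharP k p] (hp : 2 < p)
    (m : ℕ) (β : List (Fin m × Bool)) :
    Nonempty (PHHH.HqIso
      (PHHH.pHHH ((PHHH.pT k p β).adjoin.tensor (PHHH.pTpos k p (Fin.last m))))
      ((PHHH.pHHH (PHHH.pT k p β)).twist (Pi.single (Fin.last m) 2))) ∧
    Nonempty (PHHH.HqIso
      (PHHH.pHHH ((PHHH.pT k p β).adjoin.tensor (PHHH.pTneg k p (Fin.last m))))
      ((PHHH.pHHH (PHHH.pT k p β)).twist (Pi.single (Fin.last m) (-2)))) :=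
  ⟨⟨(PHHH.PBimod.Homog.pT β).positive hp⟩, ⟨(PHHH.PBimod.Homog.pT β).negative hp⟩⟩
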